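/- **Conventions.** Let $k$ be a field and let $H=(H,\Delta,\varepsilon,\Phi,S,\alpha,\beta)$ be a quasi-Hopf algebra over $k$: $H$ is an associative unital $k$-algebra, $\Delta:H\to H\otimes H$ and $\varepsilon:H\to k$ are algebra maps, $\Phi=X^1\otimes X^2\otimes X^3=Y^1\otimes Y^2\otimes Y^3\in H^{\otimes 3}$ is invertible with inverse $\Phi^{-1}=x^1\otimes x^2\otimes x^3=y^1\otimes y^2\otimes y^3$ (different letters denote different copies, summation understood, $\Delta(h)=h_1\otimes h_2$), $S$ is an algebra anti-automorphism (so bijective), $\alpha,\beta\in H$, and $$(\mathrm{id}\otimes\Delta)\Delta(h)=\Phi(\Delta\otimes \mathrm{id})\Delta(h)\Phi^{-1},\quad (\mathrm{id}\otimes\varepsilon)\Delta(h)=h=(\varepsilon\otimes \mathrm{id})\Delta(h),$$ $$(1\otimes\Phi)(\mathrm{id}\otimes\Delta\otimes \mathrm{id})(\Phi)(\Phi\otimes1)=(\mathrm{id}\otimes \mathrm{id}\otimes\Delta)(\Phi)(\Delta\otimes \mathrm{id}\otimes \mathrm{id})(\Phi),\quad (\mathrm{id}\otimes\varepsilon\otimes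 \mathrm{id})(\Phi)=1\otimes1,$$ $$S(h_1)\alpha h_2=\varepsilon(h)\alpha,\quad h_1\beta S(h_2)=\varepsilon(h)\beta,\quad X^1\beta S(X^2)\alpha X^3=1=S(x^1)\alpha x^2\beta S(x^3),$$ normalised by $\varepsilon(\alpha)=\varepsilon(\beta)=1$. Put $$p_R=p^1\otimes p^2=x^1\otimes x^2\beta S(x^3),\qquad q_R=q^1\otimes q^2=X^1\otimes S^{-1}(\alpha X^3)X^2,$$ $$p_L=\tilde p^1\otimes\tilde p^2=X^2S^{-1}(X^1\beta)\otimes X^3,\qquad q_L=\tilde q^1\otimes\tilde q^2=S(x^1)\alpha x^2\otimes x^3.$$ With $A=(\Phi\otimes1)(\Delta\otimes \mathrm{id}\otimes \mathrm{id})(\Phi^{-1})$, $C=(\Delta\otimes \mathrm{id}\otimes \mathrm{id})(\Phi)(\Phi^{-1}\otimes1)$, $\gamma=S(A^2)\alpha A^3\otimes S(A^1)\alpha A^4$, $\delta=C^1\beta S(C^4)\otimes C^2\beta S(C^3)$, let $$f=f^1\otimes f^2=(S\otimes S)(\Delta^{\rm op}(x^1))\,\gamma\,\Delta(x^2\beta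 S(x^3)),\qquad f^{-1}=g^1\otimes g^2=\Delta(S(x^1)\alpha x^2)\,\delta\,(S\otimes S)(\Delta^{\rm op}(x^3)).$$ A *left Yetter–Drinfeld module* is a left $H$-module $M$ with a linear map $\lambda:M\to H\otimes M$, $m\mapsto m_{(-1)}\otimes m_{(0)}$, such that $$X^1m_{(-1)}\otimes(X^2\cdot m_{(0)})_{(-1)}X^3\otimes(X^2\cdot m_{(0)})_{(0)}=X^1(Y^1\cdot m)_{(-1)_1}Y^2\otimes X^2(Y^1\cdot m)_{(-1)_2}Y^3\otimes X^3\cdot(Y^1\cdot m)_{(0)},$$ $$\varepsilon(m_{(-1)})m_{(0)}=m,\qquad h_1m_{(-1)}\otimes h_2\cdot m_{(0)}=(h_1\cdot m)_{(-1)}h_2\otimes(h_1\cdot m)_{(0)}.$$ Morphisms are the linear maps preserving action and coaction. These form a braided monoidal category ${}^H_H\mathcal{YD}$ with unit $k$ (action $\varepsilon$, coaction $1_k\mapsto 1_H\otimes 1_k$), tensor product $M\otimes N$ with action via $\Delta$ and coaction $$\lambda(m\otimes n)=X^1(x^1Y^1\cdot m)_{(-1)}x^2(Y^2\cdot n)_{(-1)}Y^3\otimes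 X^2\cdot(x^1Y^1\cdot m)_{(0)}\otimes X^3x^3\cdot(Y^2\cdot n)_{(0)},$$ associativity constraint $a((u\otimes v)\otimes w)=X^1\cdot u\otimes(X^2\cdot v\otimes X^3\cdot w)$ and braiding $c_{M,N}(m\otimes n)=m_{(-1)}\cdot n\otimes m_{(0)}$. A *Hopf algebra in* ${}^H_H\mathcal{YD}$ is an object $B$ with morphisms $m_B$ (multiplication), $k\to B$ (unit $1_B$), $\Delta_B(b)=b_{\underline 1}\otimes b_{\underline 2}$, $\underline\varepsilon_B$ and $\underline S$ (antipode) in this category, which is an algebra and a coalgebra there, such that $\Delta_B$ and $\underline\varepsilon_B$ are algebra morphisms and $\underline S(b_{\underline1})b_{\underline2}=b_{\underline1}\underline S(b_{\underline2})=\underline\varepsilon_B(b)1_B$. Let $M$ be finite dimensional with basis $({}_im)$ and dual basis $({}^im)$. Its duals $M^*$ and ${}^*M$ are the space $\mathrm{Hom}(M,k)$ with, for $M^*$, $$(h\cdot m^*)(m)=m^*(S(h)\cdot m),\quad \lambda(m^*)=\langle m^*,f^2\cdot(g^1\cdot{}_im)_{(0)}\rangle S^{-1}\big(f^1(g^1\cdot{}_im)_{(-1)}g^2\big)\otimes{}^im,$$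 and, for ${}^*M$, $$(h\cdot{}^*m)(m)={}^*m(S^{-1}(h)\cdot m),\quad \lambda({}^*m)=\langle{}^*m,S^{-1}(f^1)\cdot(S^{-1}(g^2)\cdot{}_im)_{(0)}\rangle\, g^1S\big((S^{-1}(g^2)\cdot{}_im)_{(-1)}\big)f^2\otimes{}^im .$$ Put ${\rm ev}_M(m^*\otimes m)=m^*(\alpha\cdot m)$, ${\rm coev}_M(1)=\beta\cdot{}_im\otimes{}^im$ on $M^*$, and ${\rm ev}'_M(m\otimes{}^*m)={}^*m(S^{-1}(\alpha)\cdot m)$, ${\rm coev}'_M(1)={}^im\otimes S^{-1}(\beta)\cdot{}_im$ on ${}^*M$. Let $\phi^*_{N,M}:N^*\otimes M^*\to(M\otimes N)^*$ be the composition $$N^*\otimes M^*\to(N^*\otimes M^*)\otimes((M\otimes N)\otimes(M\otimes N)^*)\to((N^*\otimes M^*)\otimes(M\otimes N))\otimes(M\otimes N)^*\to(N^*\otimes((M^*\otimes M)\otimes N))\otimes(M\otimes N)^*\to(M\otimes N)^*$$ of ${\rm coev}_{M\otimes N}$, associativity constraints, ${\rm ev}_M$ and ${\rm ev}_N$, and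 let ${}^*\phi_{N,M}:{}^*N\otimes{}^*M\to{}^*(M\otimes N)$ be the analogous composition $${}^*N\otimes{}^*M\to({}^*(M\otimes N)\otimes(M\otimes N))\otimes({}^*N\otimes{}^*M)\to{}^*(M\otimes N)\otimes(M\otimes((N\otimes{}^*N)\otimes{}^*M))\to{}^*(M\otimes N)$$ of ${\rm coev}'_{M\otimes N}$, associativity constraints, ${\rm ev}'_N$ and ${\rm ev}'_M$. Put $\sigma^*_{M,N}=\phi^*_{N,M}\circ c^{-1}_{N^*,M^*}$ and ${}^*\sigma_{M,N}={}^*\phi_{N,M}\circ c^{-1}_{{}^*N,{}^*M}$. **Proposition.** Let $B$ be a finite dimensional Hopf algebra in ${}^H_H\mathcal{YD}$, with basis $({}_ib)$ and dual basis $({}^ib)$. (1) $B^*$ is a Hopf algebra in ${}^H_H\mathcal{YD}$ with the following structure maps, for $a^*,b^*\in B^*$ and $b\in B$: $$(a^*\underline\circ\, b^*)(b)=\langle a^*,f^2\tilde q^2_2X^3S^{-1}\big(\tilde q^1X^1(p^1\cdot b_{\underline2})_{(-1)}p^2\big)\cdot b_{\underline1}\rangle\langle b^*,f^1\tilde q^2_1X^2\cdot(p^1\cdot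 b_{\underline2})_{(0)}\rangle,$$ $$\Delta_{B^*}(b^*)=\langle b^*,[(g^1\cdot{}_jb)_{(-1)}g^2\cdot{}_ib](g^1\cdot{}_jb)_{(0)}\rangle\,{}^ib\otimes{}^jb,$$ $$S_{B^*}(b^*)=b^*\circ\underline S,\qquad u_{B^*}(1)=\underline\varepsilon_B,\qquad \varepsilon_{B^*}(b^*)=b^*(1_B).$$ Moreover $c_{B^*,B^*}$ and $\sigma^*_{B,B}$ are bijective, and the multiplication and comultiplication of $B^*$ are $\Delta_B^*\circ\sigma^*_{B,B}$ and $(\sigma^*_{B,B})^{-1}\circ m_B^*$, where $\Delta_B^*$ and $m_B^*$ are the transposes of $\Delta_B$ and $m_B$. (2) ${}^*B$ is a Hopf algebra in ${}^H_H\mathcal{YD}$ with the following structure maps, for ${}^*a,{}^*b\in{}^*B$ and $b\in B$: $$({}^*a\,\overline\circ\,{}^*b)(b)=\langle{}^*a,S^{-1}\big(f^2q^1(x^1\tilde p^1S^{-1}(f^1)\cdot b_{\underline2})_{(-1)}x^2\tilde p^2_1\big)\cdot b_{\underline1}\rangle\langle{}^*b,S^{-1}(x^3\tilde p^2_2)q^2\cdot(x^1\tilde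 p^1S^{-1}(f^1)\cdot b_{\underline2})_{(0)}\rangle,$$ $$\Delta_{{}^*B}({}^*b)=\langle{}^*b,[(S^{-1}(g^2)\cdot{}_jb)_{(-1)}S^{-1}(g^1)\cdot{}_ib](S^{-1}(g^2)\cdot{}_jb)_{(0)}\rangle\,{}^ib\otimes{}^jb,$$ $$S_{{}^*B}({}^*b)={}^*b\circ\underline S,\qquad u_{{}^*B}(1)=\underline\varepsilon_B,\qquad \varepsilon_{{}^*B}({}^*b)={}^*b(1_B).$$ Moreover $c_{{}^*B,{}^*B}$ and ${}^*\sigma_{B,B}$ are bijective, and the multiplication and comultiplication of ${}^*B$ are ${}^*\Delta_B\circ{}^*\sigma_{B,B}$ and $({}^*\sigma_{B,B})^{-1}\circ{}^*m_B$, where ${}^*\Delta_B$ and ${}^*m_B$ are the transposes of $\Delta_B$ and $m_B$. -/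

import Mathlib

open scoped TensorProduct

namespace QuasiHopf

set_option linter.unusedSimpArgs false

/-! ### Sweedler notation

For a bilinear expression `F`, the map `sw2 F` sends `∑ a ⊗ b` to `∑ F a b`; similarly for three
and four tensor factors (tensor powers are bracketed to the right). -/

section Sweedler

variable {k A B C D V X : Type*} [Field k]
  [AddCommGroup A] [Module k A] [AddCommGroup B] [Module k B] [AddCommGroup C] [Module k C]
  [AddCommGroup D] [Module k D] [AddCommGroup V] [Module k V] [AddCommGroup X] [Module k X]

structure IsBilin (k : Type*) {A B V : Type*} [Field k] [AddCommGroup A] [Module k A]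
    [AddCommGroup B] [Module k B] [AddCommGroup V] [Module k V] (F : A → B → V) : Prop where
  fst : ∀ b, IsLinearMap k fun a => F a b
  snd : ∀ a, IsLinearMap k fun b => F a b

structure IsTrilin (k : Type*) {A B C V : Type*} [Field k] [AddCommGroup A] [Module k A]
    [AddCommGroup B] [Module k B] [AddCommGroup C] [Module k C] [AddCommGroup V] [Module k V]
    (F : A → B → C → V) : Prop where
  fst : ∀ b c, IsLinearMap k fun a => F a b c
  snd : ∀ a c, IsLinearMap k fun b => F a b c
  trd : ∀ a b, IsLinearMap k fun c => F a b c

structure IsQuadrilin (k : Type*) {A B C D V : Type*} [Field k] [AddCommGroup A] [Module k A]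
    [AddCommGroup B] [Module k B] [AddCommGroup C] [Module k C] [AddCommGroup D] [Module k D]
    [AddCommGroup V] [Module k V] (F : A → B → C → D → V) : Prop where
  fst : ∀ b c d, IsLinearMap k fun a => F a b c d
  snd : ∀ a c d, IsLinearMap k fun b => F a b c d
  trd : ∀ a b d, IsLinearMap k fun c => F a b c d
  fth : ∀ a b c, IsLinearMap k fun d => F a b c d

noncomputable def sw2 (F : A → B → V) (hF : IsBilin k F) : A ⊗[k] B →ₗ[k] V :=
  TensorProduct.lift (LinearMap.mk₂ k F (fun a a' b => (hF.fst b).map_add a a')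
    (fun c a b => (hF.fst b).map_smul c a) (fun a b b' => (hF.snd a).map_add b b')
    (fun c a b => (hF.snd a).map_smul c b))

theorem sw2_tmul (F : A → B → V) (hF : IsBilin k F) (a : A) (b : B) :
    sw2 F hF (a ⊗ₜ b) = F a b := rfl

theorem sw2_isLinear {F : X → A → B → V} (hF : ∀ x, IsBilin k (F x))
    (h : ∀ a b, IsLinearMap k fun x => F x a b) (t : A ⊗[k] B) :
    IsLinearMap k fun x => sw2 (F x) (hF x) t := by
  induction t with
  | zero => exact ⟨by simp, by simp⟩
  | tmul a b => exact h a b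
  | add s t hs ht =>
    refine ⟨fun x y => ?_, fun c x => ?_⟩
    · have h1 := hs.map_add x y
      have h2 := ht.map_add x y
      simp only [map_add] at *
      rw [h1, h2]; abel
    · have h1 := hs.map_smul c x
      have h2 := ht.map_smul c x
      simp only [map_add, smul_add] at *
      rw [h1, h2]

noncomputable def sw3 (F : A → B → C → V) (hF : IsTrilin k F) : A ⊗[k] (B ⊗[k] C) →ₗ[k] V :=
  sw2 (fun a t => sw2 (F a) ⟨fun c => hF.snd a c, fun b => hF.trd a b⟩ t)
    ⟨fun t => sw2_isLinear _ (fun b c => hF.fst b c) t, fun a => (sw2 (F a) _).isLinear⟩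

theorem sw3_tmul (F : A → B → C → V) (hF : IsTrilin k F) (a : A) (b : B) (c : C) :
    sw3 F hF (a ⊗ₜ (b ⊗ₜ c)) = F a b c := rfl

theorem sw3_isLinear {F : X → A → B → C → V} (hF : ∀ x, IsTrilin k (F x))
    (h : ∀ a b c, IsLinearMap k fun x => F x a b c) (t : A ⊗[k] (B ⊗[k] C)) :
    IsLinearMap k fun x => sw3 (F x) (hF x) t :=
  sw2_isLinear _ (fun a t => sw2_isLinear _ (fun b c => h a b c) t) t

noncomputable def sw4 (F : A → B → C → D → V) (hF : IsQuadrilin k F) :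
    A ⊗[k] (B ⊗[k] (C ⊗[k] D)) →ₗ[k] V :=
  sw2 (fun a t => sw3 (F a)
      ⟨fun c d => hF.snd a c d, fun b d => hF.trd a b d, fun b c => hF.fth a b c⟩ t)
    ⟨fun t => sw3_isLinear _ (fun b c d => hF.fst b c d) t, fun a => (sw3 (F a) _).isLinear⟩

theorem sw4_tmul (F : A → B → C → D → V) (hF : IsQuadrilin k F) (a : A) (b : B) (c : C) (d : D) :
    sw4 F hF (a ⊗ₜ (b ⊗ₜ (c ⊗ₜ d))) = F a b c d := rfl

end Sweedler

section MulLemmas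

variable {k H : Type*} [Field k] [Ring H] [Algebra k H]

theorem isBilin_left (S : H →ₗ[k] H) (u : H) : IsBilin k fun a b : H => S a * u * b := by
  constructor <;> intros <;> constructor <;> intros <;> simp [add_mul, mul_add]

theorem isBilin_right (S : H →ₗ[k] H) (u : H) : IsBilin k fun a b : H => a * u * S b := by
  constructor <;> intros <;> constructor <;> intros <;> simp [add_mul, mul_add]

theorem isTrilin_mid (S : H →ₗ[k] H) (u v : H) :
    IsTrilin k fun a b c : H => a * u * S b * v * c := by
  constructor <;> intros <;> constructor <;> intros <;> simp [add_mul, mul_add]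

theorem isTrilin_out (S : H →ₗ[k] H) (u v : H) :
    IsTrilin k fun a b c : H => S a * u * b * v * S c := by
  constructor <;> intros <;> constructor <;> intros <;> simp [add_mul, mul_add]

end MulLemmas

/-! ### Quasi-Hopf algebras -/

/-- A quasi-Hopf algebra structure on the `k`-algebra `H`: comultiplication `Δ`, counit `ε`,
invertible reassociator `Φ ∈ H ⊗ (H ⊗ H)`, an algebra anti-automorphism `S`, and elements
`α`, `β`, normalised by `ε(α) = ε(β) = 1`. -/
structure QuasiHopfAlgebra (k H : Type*) [Field k] [Ring H] [Algebra k H] where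
  comul : H →ₐ[k] H ⊗[k] H
  counit : H →ₐ[k] k
  reassoc : (H ⊗[k] (H ⊗[k] H))ˣ
  antipode : H ≃ₗ[k] H
  alpha : H
  beta : H
  /-- `(id ⊗ Δ)(Δ h) = Φ (Δ ⊗ id)(Δ h) Φ⁻¹` -/
  quasi_coassoc : ∀ h, Algebra.TensorProduct.map (AlgHom.id k H) comul (comul h) =
    (reassoc : H ⊗[k] (H ⊗[k] H)) *
      Algebra.TensorProduct.assoc k k k H H H
        (Algebra.TensorProduct.map comul (AlgHom.id k H) (comul h)) *
      ((reassoc⁻¹ : (H ⊗[k] (H ⊗[k] H))ˣ) : H ⊗[k] (H ⊗[k] H))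
  /-- `(id ⊗ ε)(Δ h) = h` -/
  counit_right : ∀ h, Algebra.TensorProduct.rid k k H
    (Algebra.TensorProduct.map (AlgHom.id k H) counit (comul h)) = h
  /-- `(ε ⊗ id)(Δ h) = h` -/
  counit_left : ∀ h, Algebra.TensorProduct.lid k H
    (Algebra.TensorProduct.map counit (AlgHom.id k H) (comul h)) = h
  /-- `(1 ⊗ Φ) (id ⊗ Δ ⊗ id)(Φ) (Φ ⊗ 1) = (id ⊗ id ⊗ Δ)(Φ) (Δ ⊗ id ⊗ id)(Φ)` -/
  cocycle :
    ((1 : H) ⊗ₜ[k] (reassoc : H ⊗[k] (H ⊗[k] H))) *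
      Algebra.TensorProduct.map (AlgHom.id k H)
        ((Algebra.TensorProduct.assoc k k k H H H).toAlgHom.comp
          (Algebra.TensorProduct.map comul (AlgHom.id k H))) (reassoc : H ⊗[k] (H ⊗[k] H)) *
      Algebra.TensorProduct.map (AlgHom.id k H)
        (Algebra.TensorProduct.map (AlgHom.id k H) Algebra.TensorProduct.includeLeft)
        (reassoc : H ⊗[k] (H ⊗[k] H)) =
    Algebra.TensorProduct.map (AlgHom.id k H) (Algebra.TensorProduct.map (AlgHom.id k H) comul)
        (reassoc : H ⊗[k] (H ⊗[k] H)) *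
      Algebra.TensorProduct.assoc k k k H H (H ⊗[k] H)
        (Algebra.TensorProduct.map comul (AlgHom.id k (H ⊗[k] H))
          (reassoc : H ⊗[k] (H ⊗[k] H)))
  /-- `(id ⊗ ε ⊗ id)(Φ) = 1 ⊗ 1` -/
  reassoc_normalized :
    Algebra.TensorProduct.map (AlgHom.id k H)
      ((Algebra.TensorProduct.lid k H).toAlgHom.comp
        (Algebra.TensorProduct.map counit (AlgHom.id k H)))
      (reassoc : H ⊗[k] (H ⊗[k] H)) = 1
  antipode_one : antipode 1 = 1
  antipode_mul : ∀ a b, antipode (a * b) = antipode b * antipode a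
  /-- `S(h₁) α h₂ = ε(h) α` -/
  antipode_alpha : ∀ h, sw2 (fun a b => antipode.toLinearMap a * alpha * b)
    (isBilin_left _ _) (comul h) = counit h • alpha
  /-- `h₁ β S(h₂) = ε(h) β` -/
  antipode_beta : ∀ h, sw2 (fun a b => a * beta * antipode.toLinearMap b)
    (isBilin_right _ _) (comul h) = counit h • beta
  /-- `X¹ β S(X²) α X³ = 1` -/
  reassoc_antipode : sw3 (fun a b c => a * beta * antipode.toLinearMap b * alpha * c)
    (isTrilin_mid _ _ _) (reassoc : H ⊗[k] (H ⊗[k] H)) = 1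
  /-- `S(x¹) α x² β S(x³) = 1` -/
  reassoc_inv_antipode :
    sw3 (fun a b c => antipode.toLinearMap a * alpha * b * beta * antipode.toLinearMap c)
      (isTrilin_out _ _ _)
      ((reassoc⁻¹ : (H ⊗[k] (H ⊗[k] H))ˣ) : H ⊗[k] (H ⊗[k] H)) = 1
  counit_alpha : counit alpha = 1
  counit_beta : counit beta = 1

namespace QuasiHopfAlgebra

variable {k H : Type*} [Field k] [Ring H] [Algebra k H] (Q : QuasiHopfAlgebra k H)

/-- The antipode `S`. -/
def S : H →ₗ[k] H := Q.antipode.toLinearMap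

/-- The inverse `S⁻¹` of the antipode. -/
def Sinv : H →ₗ[k] H := Q.antipode.symm.toLinearMap

theorem S_one : Q.S 1 = 1 := Q.antipode_one

theorem S_mul (a b : H) : Q.S (a * b) = Q.S b * Q.S a := Q.antipode_mul a b

theorem Sinv_one : Q.Sinv 1 = 1 := by
  change Q.antipode.symm 1 = 1
  rw [LinearEquiv.symm_apply_eq, Q.antipode_one]

theorem Sinv_mul (a b : H) : Q.Sinv (a * b) = Q.Sinv b * Q.Sinv a := by
  change Q.antipode.symm (a * b) = Q.antipode.symm b * Q.antipode.symm a
  rw [LinearEquiv.symm_apply_eq, Q.antipode_mul, LinearEquiv.apply_symm_apply,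
    LinearEquiv.apply_symm_apply]

/-- The reassociator `Φ = X¹ ⊗ X² ⊗ X³`. -/
def Phi : H ⊗[k] (H ⊗[k] H) := Q.reassoc

/-- Its inverse `Φ⁻¹ = x¹ ⊗ x² ⊗ x³`. -/
def PhiInv : H ⊗[k] (H ⊗[k] H) := (Q.reassoc⁻¹ : (H ⊗[k] (H ⊗[k] H))ˣ)

/-- `id ⊗ Δ : H ⊗ H → H ⊗ (H ⊗ H)`. -/
noncomputable def idComul : H ⊗[k] H →ₐ[k] H ⊗[k] (H ⊗[k] H) :=
  Algebra.TensorProduct.map (AlgHom.id k H) Q.comul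

/-- `Δ ⊗ id ⊗ id : H ⊗ (H ⊗ H) → H ⊗ (H ⊗ (H ⊗ H))`. -/
noncomputable def comulIdId : H ⊗[k] (H ⊗[k] H) →ₐ[k] H ⊗[k] (H ⊗[k] (H ⊗[k] H)) :=
  (Algebra.TensorProduct.assoc k k k H H (H ⊗[k] H)).toAlgHom.comp
    (Algebra.TensorProduct.map Q.comul (AlgHom.id k (H ⊗[k] H)))

/-- `t ↦ t ⊗ 1 : H ⊗ (H ⊗ H) → H ⊗ (H ⊗ (H ⊗ H))`. -/
noncomputable def tensorOne (k H : Type*) [Field k] [Ring H] [Algebra k H] :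
    H ⊗[k] (H ⊗[k] H) →ₐ[k] H ⊗[k] (H ⊗[k] (H ⊗[k] H)) :=
  Algebra.TensorProduct.map (AlgHom.id k H)
    (Algebra.TensorProduct.map (AlgHom.id k H) Algebra.TensorProduct.includeLeft)

/-- `p_R = p¹ ⊗ p² = x¹ ⊗ x² β S(x³)`. -/
noncomputable def pR : H ⊗[k] H :=
  sw3 (fun a b c => a ⊗ₜ[k] (b * Q.beta * Q.S c))
    (by constructor <;> intros <;> constructor <;> intros <;>
      simp [add_mul, mul_add, TensorProduct.add_tmul, TensorProduct.tmul_add,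
        TensorProduct.smul_tmul'])
    Q.PhiInv

/-- `q_R = q¹ ⊗ q² = X¹ ⊗ S⁻¹(α X³) X²`. -/
noncomputable def qR : H ⊗[k] H :=
  sw3 (fun a b c => a ⊗ₜ[k] (Q.Sinv (Q.alpha * c) * b))
    (by constructor <;> intros <;> constructor <;> intros <;>
      simp [add_mul, mul_add, TensorProduct.add_tmul, TensorProduct.tmul_add,
        TensorProduct.smul_tmul'])
    Q.Phi

/-- `p_L = p̃¹ ⊗ p̃² = X² S⁻¹(X¹ β) ⊗ X³`. -/
noncomputable def pL : H ⊗[k] H :=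
  sw3 (fun a b c => (b * Q.Sinv (a * Q.beta)) ⊗ₜ[k] c)
    (by constructor <;> intros <;> constructor <;> intros <;>
      simp [add_mul, mul_add, TensorProduct.add_tmul, TensorProduct.tmul_add,
        TensorProduct.smul_tmul'])
    Q.Phi

/-- `q_L = q̃¹ ⊗ q̃² = S(x¹) α x² ⊗ x³`. -/
noncomputable def qL : H ⊗[k] H :=
  sw3 (fun a b c => (Q.S a * Q.alpha * b) ⊗ₜ[k] c)
    (by constructor <;> intros <;> constructor <;> intros <;>
      simp [add_mul, mul_add, TensorProduct.add_tmul, TensorProduct.tmul_add,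
        TensorProduct.smul_tmul'])
    Q.PhiInv

/-- `γ = S(A²) α A³ ⊗ S(A¹) α A⁴`, where `A = (Φ ⊗ 1) (Δ ⊗ id ⊗ id)(Φ⁻¹)`. -/
noncomputable def gamma : H ⊗[k] H :=
  sw4 (fun a b c d => (Q.S b * Q.alpha * c) ⊗ₜ[k] (Q.S a * Q.alpha * d))
    (by constructor <;> intros <;> constructor <;> intros <;>
      simp [add_mul, mul_add, TensorProduct.add_tmul, TensorProduct.tmul_add,
        TensorProduct.smul_tmul'])
    (tensorOne k H Q.Phi * Q.comulIdId Q.PhiInv)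

/-- `δ = B¹ β S(B⁴) ⊗ B² β S(B³)`, where `B = (Δ ⊗ id ⊗ id)(Φ) (Φ⁻¹ ⊗ 1)`. -/
noncomputable def delta : H ⊗[k] H :=
  sw4 (fun a b c d => (a * Q.beta * Q.S d) ⊗ₜ[k] (b * Q.beta * Q.S c))
    (by constructor <;> intros <;> constructor <;> intros <;>
      simp [add_mul, mul_add, TensorProduct.add_tmul, TensorProduct.tmul_add,
        TensorProduct.smul_tmul'])
    (Q.comulIdId Q.Phi * tensorOne k H Q.PhiInv)

/-- `h ↦ (S ⊗ S)(Δᵒᵖ(h)) = S(h₂) ⊗ S(h₁)`. -/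
noncomputable def SSop : H →ₗ[k] H ⊗[k] H :=
  TensorProduct.map Q.S Q.S ∘ₗ (TensorProduct.comm k H H).toLinearMap ∘ₗ Q.comul.toLinearMap

/-- The Drinfeld twist `f = f¹ ⊗ f² = (S ⊗ S)(Δᵒᵖ(x¹)) γ Δ(x² β S(x³))`. -/
noncomputable def f : H ⊗[k] H :=
  sw3 (fun a b c => Q.SSop a * Q.gamma * Q.comul (b * Q.beta * Q.S c))
    (by constructor <;> intros <;> constructor <;> intros <;> simp [add_mul, mul_add])
    Q.PhiInv

/-- Its inverse `f⁻¹ = g¹ ⊗ g² = Δ(S(x¹) α x²) δ (S ⊗ S)(Δᵒᵖ(x³))`. -/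
noncomputable def g : H ⊗[k] H :=
  sw3 (fun a b c => Q.comul (Q.S a * Q.alpha * b) * Q.delta * Q.SSop c)
    (by constructor <;> intros <;> constructor <;> intros <;> simp [add_mul, mul_add])
    Q.PhiInv

/-- `S⁻¹(f²) ⊗ S⁻¹(f¹)`. -/
noncomputable def fOpInv : H ⊗[k] H :=
  TensorProduct.map Q.Sinv Q.Sinv (TensorProduct.comm k H H Q.f)

/-- `S⁻¹(g²) ⊗ S⁻¹(g¹)`. -/
noncomputable def gOpInv : H ⊗[k] H :=
  TensorProduct.map Q.Sinv Q.Sinv (TensorProduct.comm k H H Q.g)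

end QuasiHopfAlgebra

/-! ### The monoidal category of left modules -/

section Modules

variable {k H M N U : Type*} [Field k] [Ring H] [Algebra k H]
  [AddCommGroup M] [Module k M] [AddCommGroup N] [Module k N] [AddCommGroup U] [Module k U]

/-- For an `A`-module `M` and an `A'`-module `N`, the action of `A ⊗ A'` on `M ⊗ N`. -/
noncomputable def tensAct {A A' : Type*} [Ring A] [Algebra k A] [Ring A'] [Algebra k A']
    (ρ : A →ₐ[k] Module.End k M) (τ : A' →ₐ[k] Module.End k N) :
    A ⊗[k] A' →ₐ[k] Module.End k (M ⊗[k] N) :=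
  (Module.endTensorEndAlgHom (R := k) (S := k) (A := k) (M := M) (N := N)).comp
    (Algebra.TensorProduct.map ρ τ)

theorem tensAct_tmul {A A' : Type*} [Ring A] [Algebra k A] [Ring A'] [Algebra k A']
    (ρ : A →ₐ[k] Module.End k M) (τ : A' →ₐ[k] Module.End k N) (a : A) (b : A') (m : M) (n : N) :
    tensAct ρ τ (a ⊗ₜ b) (m ⊗ₜ n) = ρ a m ⊗ₜ τ b n := rfl

/-- The tensor product of two `H`-modules: `h · (m ⊗ n) = h₁ · m ⊗ h₂ · n`. -/
noncomputable def prodAct (Q : QuasiHopfAlgebra k H) (ρ : H →ₐ[k] Module.End k M)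
    (τ : H →ₐ[k] Module.End k N) : H →ₐ[k] Module.End k (M ⊗[k] N) :=
  (tensAct ρ τ).comp Q.comul

/-- The associativity constraint
`(m ⊗ n) ⊗ u ↦ X¹ · m ⊗ (X² · n ⊗ X³ · u)`. -/
noncomputable def assocMap (Q : QuasiHopfAlgebra k H) (ρ : H →ₐ[k] Module.End k M)
    (τ : H →ₐ[k] Module.End k N) (υ : H →ₐ[k] Module.End k U) :
    (M ⊗[k] N) ⊗[k] U →ₗ[k] M ⊗[k] (N ⊗[k] U) :=
  tensAct ρ (tensAct τ υ) Q.Phi ∘ₗ (TensorProduct.assoc k M N U).toLinearMap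

/-- The inverse associativity constraint
`m ⊗ (n ⊗ u) ↦ (x¹ · m ⊗ x² · n) ⊗ x³ · u`. -/
noncomputable def assocInv (Q : QuasiHopfAlgebra k H) (ρ : H →ₐ[k] Module.End k M)
    (τ : H →ₐ[k] Module.End k N) (υ : H →ₐ[k] Module.End k U) :
    M ⊗[k] (N ⊗[k] U) →ₗ[k] (M ⊗[k] N) ⊗[k] U :=
  (TensorProduct.assoc k M N U).symm.toLinearMap ∘ₗ tensAct ρ (tensAct τ υ) Q.PhiInv

/-- The action `(h · φ)(m) = φ(T(h) · m)` on the dual space, for an anti-endomorphism `T` of `H`. -/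
noncomputable def dualAct (T : H →ₗ[k] H) (h1 : T 1 = 1) (hmul : ∀ a b, T (a * b) = T b * T a)
    (ρ : H →ₐ[k] Module.End k M) : H →ₐ[k] Module.End k (Module.Dual k M) :=
  AlgHom.ofLinearMap (Module.Dual.transpose ∘ₗ ρ.toLinearMap ∘ₗ T)
    (by ext φ m; simp [h1, Module.Dual.transpose_apply])
    (by intro a b; ext φ m; simp [hmul, Module.Dual.transpose_apply])

/-- The left dual `M*` of an `H`-module: `(h · φ)(m) = φ(S(h) · m)`. -/
noncomputable def leftDualAct (Q : QuasiHopfAlgebra k H) (ρ : H →ₐ[k] Module.End k M) :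
    H →ₐ[k] Module.End k (Module.Dual k M) :=
  dualAct Q.S Q.S_one Q.S_mul ρ

/-- The right dual `*M` of an `H`-module: `(h · φ)(m) = φ(S⁻¹(h) · m)`. -/
noncomputable def rightDualAct (Q : QuasiHopfAlgebra k H) (ρ : H →ₐ[k] Module.End k M) :
    H →ₐ[k] Module.End k (Module.Dual k M) :=
  dualAct Q.Sinv Q.Sinv_one Q.Sinv_mul ρ

variable {ι κ : Type*} [Fintype ι] [Fintype κ]

/-- `ev : M* ⊗ M → k`, `φ ⊗ m ↦ φ(α · m)`. -/
noncomputable def ev (Q : QuasiHopfAlgebra k H) (ρ : H →ₐ[k] Module.End k M) :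
    Module.Dual k M ⊗[k] M →ₗ[k] k :=
  contractLeft k M ∘ₗ (ρ Q.alpha).lTensor (Module.Dual k M)

/-- `coev(1) = ∑ᵢ β · eᵢ ⊗ eⁱ ∈ M ⊗ M*`. -/
noncomputable def coev (Q : QuasiHopfAlgebra k H) (ρ : H →ₐ[k] Module.End k M)
    (e : Module.Basis ι k M) : M ⊗[k] Module.Dual k M :=
  ∑ i, ρ Q.beta (e i) ⊗ₜ[k] e.coord i

/-- `ev' : M ⊗ *M → k`, `m ⊗ φ ↦ φ(S⁻¹(α) · m)`. -/
noncomputable def ev' (Q : QuasiHopfAlgebra k H) (ρ : H →ₐ[k] Module.End k M) :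
    M ⊗[k] Module.Dual k M →ₗ[k] k :=
  contractRight k M ∘ₗ (ρ (Q.Sinv Q.alpha)).rTensor (Module.Dual k M)

/-- `coev'(1) = ∑ᵢ eⁱ ⊗ S⁻¹(β) · eᵢ ∈ *M ⊗ M`. -/
noncomputable def coev' (Q : QuasiHopfAlgebra k H) (ρ : H →ₐ[k] Module.End k M)
    (e : Module.Basis ι k M) : Module.Dual k M ⊗[k] M :=
  ∑ i, e.coord i ⊗ₜ[k] ρ (Q.Sinv Q.beta) (e i)

/-- The canonical map `φ*_{N,M} : N* ⊗ M* → (M ⊗ N)*`, the composition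
`N*⊗M* → (N*⊗M*)⊗((M⊗N)⊗(M⊗N)*) → ((N*⊗M*)⊗(M⊗N))⊗(M⊗N)* → (N*⊗(M*⊗(M⊗N)))⊗(M⊗N)*
→ (N*⊗((M*⊗M)⊗N))⊗(M⊗N)* → (N*⊗N)⊗(M⊗N)* → (M⊗N)*`. -/
noncomputable def phiLeft (Q : QuasiHopfAlgebra k H) (ρ : H →ₐ[k] Module.End k M)
    (τ : H →ₐ[k] Module.End k N) (e : Module.Basis ι k M) (e' : Module.Basis κ k N) :
    Module.Dual k N ⊗[k] Module.Dual k M →ₗ[k] Module.Dual k (M ⊗[k] N) :=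
  let ρd := leftDualAct Q ρ
  let τd := leftDualAct Q τ
  let ρτ := prodAct Q ρ τ
  let W := Module.Dual k (M ⊗[k] N)
  (TensorProduct.lid k W).toLinearMap ∘ₗ
  (ev Q τ).rTensor W ∘ₗ
  (((TensorProduct.lid k N).toLinearMap ∘ₗ (ev Q ρ).rTensor N).lTensor
    (Module.Dual k N)).rTensor W ∘ₗ
  ((assocInv Q ρd ρ τ).lTensor (Module.Dual k N)).rTensor W ∘ₗ
  (assocMap Q τd ρd ρτ).rTensor W ∘ₗ
  assocInv Q (prodAct Q τd ρd) ρτ (leftDualAct Q ρτ) ∘ₗ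
  (TensorProduct.mk k _ _).flip (coev Q ρτ (e.tensorProduct e'))

/-- The canonical map `*φ_{N,M} : *N ⊗ *M → *(M ⊗ N)`, the composition
`*N⊗*M → (*(M⊗N)⊗(M⊗N))⊗(*N⊗*M) → *(M⊗N)⊗((M⊗N)⊗(*N⊗*M)) → *(M⊗N)⊗(M⊗(N⊗(*N⊗*M)))
→ *(M⊗N)⊗(M⊗((N⊗*N)⊗*M)) → *(M⊗N)⊗(M⊗*M) → *(M⊗N)`. -/
noncomputable def phiRight (Q : QuasiHopfAlgebra k H) (ρ : H →ₐ[k] Module.End k M)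
    (τ : H →ₐ[k] Module.End k N) (e : Module.Basis ι k M) (e' : Module.Basis κ k N) :
    Module.Dual k N ⊗[k] Module.Dual k M →ₗ[k] Module.Dual k (M ⊗[k] N) :=
  let ρd := rightDualAct Q ρ
  let τd := rightDualAct Q τ
  let ρτ := prodAct Q ρ τ
  let W := Module.Dual k (M ⊗[k] N)
  (TensorProduct.rid k W).toLinearMap ∘ₗ
  (ev' Q ρ).lTensor W ∘ₗ
  (((TensorProduct.lid k (Module.Dual k M)).toLinearMap ∘ₗ
    (ev' Q τ).rTensor (Module.Dual k M)).lTensor M).lTensor W ∘ₗ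
  ((assocInv Q τ τd ρd).lTensor M).lTensor W ∘ₗ
  (assocMap Q ρ τ (prodAct Q τd ρd)).lTensor W ∘ₗ
  assocMap Q (rightDualAct Q ρτ) ρτ (prodAct Q τd ρd) ∘ₗ
  TensorProduct.mk k _ _ (coev' Q ρτ (e.tensorProduct e'))

end Modules

/-! ### Yetter-Drinfeld modules -/

/-- The data of a left Yetter-Drinfeld module: an action of `H` and a linear map
`λ : M → H ⊗ M`, `m ↦ m₍₋₁₎ ⊗ m₍₀₎`. The axioms are in `IsYD`. -/
structure YDData (k H M : Type*) [Field k] [Ring H] [Algebra k H]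
    [AddCommGroup M] [Module k M] where
  act : H →ₐ[k] Module.End k M
  coact : M →ₗ[k] H ⊗[k] M

section YD

variable {k H M N : Type*} [Field k] [Ring H] [Algebra k H]
  [AddCommGroup M] [Module k M] [AddCommGroup N] [Module k N]

/-- For `t = t¹ ⊗ t²`, the map `m ↦ (t¹ · m)₍₋₁₎ t² ⊗ (t¹ · m)₍₀₎`. -/
noncomputable def YDData.twistCoact (D : YDData k H M) :
    H ⊗[k] H →ₗ[k] (M →ₗ[k] H ⊗[k] M) :=
  sw2 (fun a b => ((LinearMap.mul k H).flip b).rTensor M ∘ₗ D.coact ∘ₗ D.act a)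
    (by
      constructor <;> intros <;> constructor <;> intros <;> ext <;>
        simp [LinearMap.rTensor_add, LinearMap.rTensor_smul])

/-- The map `m ⊗ n ↦ T((u · n)₍₋₁₎) · m ⊗ v · (u · n)₍₀₎`. -/
noncomputable def crossMap (ρ : H →ₐ[k] Module.End k M) (D : YDData k H N)
    (T : H →ₗ[k] H) (u v : H) : M ⊗[k] N →ₗ[k] M ⊗[k] N :=
  TensorProduct.map (TensorProduct.lift ρ.toLinearMap) (D.act v) ∘ₗ
    (TensorProduct.assoc k H M N).symm.toLinearMap ∘ₗ
    (TensorProduct.leftComm k M H N).toLinearMap ∘ₗ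
    (T.rTensor N ∘ₗ D.coact ∘ₗ D.act u).lTensor M

theorem crossMap_linear₁ (ρ : H →ₐ[k] Module.End k M) (D : YDData k H N) (u v : H)
    {X : Type*} [AddCommGroup X] [Module k X] {T : X → H →ₗ[k] H} (hT : IsLinearMap k T) :
    IsLinearMap k fun x => crossMap ρ D (T x) u v := by
  constructor <;> intros <;>
    simp [crossMap, hT.map_add, hT.map_smul, LinearMap.rTensor_add, LinearMap.rTensor_smul,
      LinearMap.lTensor_add, LinearMap.lTensor_smul, LinearMap.add_comp, LinearMap.comp_add,
      LinearMap.smul_comp, LinearMap.comp_smul]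

theorem crossMap_linear₂ (ρ : H →ₐ[k] Module.End k M) (D : YDData k H N) (T : H →ₗ[k] H)
    (v : H) {X : Type*} [AddCommGroup X] [Module k X] {u : X → H} (hu : IsLinearMap k u) :
    IsLinearMap k fun x => crossMap ρ D T (u x) v := by
  constructor <;> intros <;>
    simp [crossMap, hu.map_add, hu.map_smul, LinearMap.lTensor_add, LinearMap.lTensor_smul,
      LinearMap.comp_add, LinearMap.comp_smul]

theorem crossMap_linear₃ (ρ : H →ₐ[k] Module.End k M) (D : YDData k H N) (T : H →ₗ[k] H)
    (u : H) {X : Type*} [AddCommGroup X] [Module k X] {v : X → H} (hv : IsLinearMap k v) :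
    IsLinearMap k fun x => crossMap ρ D T u (v x) := by
  constructor <;> intros <;>
    simp [crossMap, hv.map_add, hv.map_smul, TensorProduct.map_add_right,
      TensorProduct.map_smul_right, LinearMap.add_comp, LinearMap.smul_comp]

/-- The axioms of a left Yetter-Drinfeld module. -/
structure IsYD (Q : QuasiHopfAlgebra k H) (D : YDData k H M) : Prop where
  /-- `X¹m₍₋₁₎ ⊗ (X²·m₍₀₎)₍₋₁₎X³ ⊗ (X²·m₍₀₎)₍₀₎ =
  X¹(Y¹·m)₍₋₁₎₁Y² ⊗ X²(Y¹·m)₍₋₁₎₂Y³ ⊗ X³·(Y¹·m)₍₀₎` -/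
  coact_coassoc : ∀ m,
    sw3 (fun a b c => TensorProduct.map (LinearMap.mul k H a) (D.twistCoact (b ⊗ₜ c)) (D.coact m))
      (by
        constructor <;> intros <;> constructor <;> intros <;>
          simp [TensorProduct.add_tmul, TensorProduct.tmul_add, TensorProduct.map_add_left,
            TensorProduct.map_add_right, TensorProduct.map_smul_left,
            TensorProduct.map_smul_right, ← TensorProduct.smul_tmul'])
      Q.Phi =
    tensAct (Algebra.lmul k H) (tensAct (Algebra.lmul k H) D.act) Q.Phi
      (sw3 (fun a b c => TensorProduct.assoc k H H M
          (((LinearMap.mul k (H ⊗[k] H)).flip (b ⊗ₜ c) ∘ₗ Q.comul.toLinearMap).rTensor M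
            (D.coact (D.act a m))))
        (by
          constructor <;> intros <;> constructor <;> intros <;>
            simp [TensorProduct.add_tmul, TensorProduct.tmul_add, LinearMap.rTensor_add,
              LinearMap.rTensor_smul, LinearMap.add_comp, LinearMap.smul_comp,
              ← TensorProduct.smul_tmul'])
        Q.Phi)
  /-- `ε(m₍₋₁₎) m₍₀₎ = m` -/
  counit_coact : ∀ m, TensorProduct.lid k M (Q.counit.toLinearMap.rTensor M (D.coact m)) = m
  /-- `h₁m₍₋₁₎ ⊗ h₂·m₍₀₎ = (h₁·m)₍₋₁₎h₂ ⊗ (h₁·m)₍₀₎` -/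
  compat : ∀ h m, tensAct (Algebra.lmul k H) D.act (Q.comul h) (D.coact m) =
    D.twistCoact (Q.comul h) m

/-- Morphisms of Yetter-Drinfeld modules: linear maps preserving action and coaction. -/
structure IsYDHom (D : YDData k H M) (E : YDData k H N) (φ : M →ₗ[k] N) : Prop where
  map_act : ∀ h m, φ (D.act h m) = E.act h (φ m)
  map_coact : ∀ m, E.coact (φ m) = φ.lTensor H (D.coact m)

/-- The unit object `k`: `h · c = ε(h) c`, `c ↦ 1 ⊗ c`. -/
noncomputable def unitYD (Q : QuasiHopfAlgebra k H) : YDData k H k where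
  act := (Algebra.lmul k k).comp Q.counit
  coact := TensorProduct.mk k H k 1

/-- `m ⊗ (h ⊗ n) ↦ (x¹ · m)₍₋₁₎ x² h ⊗ ((x¹ · m)₍₀₎ ⊗ x³ · n)`. -/
noncomputable def prodCoactAux (Q : QuasiHopfAlgebra k H) (D : YDData k H M) (E : YDData k H N) :
    M ⊗[k] (H ⊗[k] N) →ₗ[k] H ⊗[k] (M ⊗[k] N) :=
  sw3 (fun a b c => (LinearMap.mul' k H).rTensor (M ⊗[k] N) ∘ₗ
      (TensorProduct.tensorTensorTensorComm k H M H N).toLinearMap ∘ₗ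
      TensorProduct.map (D.twistCoact (a ⊗ₜ b)) ((E.act c).lTensor H))
    (by
      constructor <;> intros <;> constructor <;> intros <;>
        simp [TensorProduct.add_tmul, TensorProduct.tmul_add, TensorProduct.map_add_left,
          TensorProduct.map_add_right, TensorProduct.map_smul_left, LinearMap.lTensor_add,
          LinearMap.lTensor_smul, TensorProduct.map_smul_right, LinearMap.comp_add,
          LinearMap.comp_smul, ← TensorProduct.smul_tmul'])
    Q.PhiInv

/-- The coaction on a tensor product:
`m ⊗ n ↦ X¹(x¹Y¹·m)₍₋₁₎x²(Y²·n)₍₋₁₎Y³ ⊗ (X²·(x¹Y¹·m)₍₀₎ ⊗ X³x³·(Y²·n)₍₀₎)`. -/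
noncomputable def prodCoact (Q : QuasiHopfAlgebra k H) (D : YDData k H M) (E : YDData k H N) :
    M ⊗[k] N →ₗ[k] H ⊗[k] (M ⊗[k] N) :=
  tensAct (Algebra.lmul k H) (tensAct D.act E.act) Q.Phi ∘ₗ
    prodCoactAux Q D E ∘ₗ
    sw3 (fun a b c => TensorProduct.map (D.act a) (E.twistCoact (b ⊗ₜ c)))
      (by
        constructor <;> intros <;> constructor <;> intros <;>
          simp [TensorProduct.add_tmul, TensorProduct.tmul_add, TensorProduct.map_add_left,
            TensorProduct.map_add_right, TensorProduct.map_smul_left,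
            TensorProduct.map_smul_right, ← TensorProduct.smul_tmul'])
      Q.Phi

/-- The tensor product of Yetter-Drinfeld modules. -/
noncomputable def prodYD (Q : QuasiHopfAlgebra k H) (D : YDData k H M) (E : YDData k H N) :
    YDData k H (M ⊗[k] N) where
  act := prodAct Q D.act E.act
  coact := prodCoact Q D E

/-- The braiding `c_{M,N}(m ⊗ n) = m₍₋₁₎ · n ⊗ m₍₀₎`. -/
noncomputable def braiding (D : YDData k H M) (E : YDData k H N) :
    M ⊗[k] N →ₗ[k] N ⊗[k] M :=
  (TensorProduct.lift E.act.toLinearMap).rTensor M ∘ₗ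
    (TensorProduct.assoc k H N M).symm.toLinearMap ∘ₗ
    (TensorProduct.comm k M N).toLinearMap.lTensor H ∘ₗ
    (TensorProduct.assoc k H M N).toLinearMap ∘ₗ
    D.coact.rTensor N

variable {ι : Type*} [Fintype ι]

/-- For `w(m) = m₍₋₁₎ ⊗ m₍₀₎`, the map
`M* → H ⊗ M*`, `φ ↦ ∑ᵢ ⟨φ, (eᵢ)₍₀₎⟩ T((eᵢ)₍₋₁₎) ⊗ eⁱ`. -/
noncomputable def dualCoact (e : Module.Basis ι k M) (T : H →ₗ[k] H) (w : M →ₗ[k] H ⊗[k] M) :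
    Module.Dual k M →ₗ[k] H ⊗[k] Module.Dual k M where
  toFun φ := ∑ i, T (TensorProduct.rid k H (φ.lTensor H (w (e i)))) ⊗ₜ[k] e.coord i
  map_add' φ ψ := by
    simp [LinearMap.lTensor_add, TensorProduct.add_tmul, Finset.sum_add_distrib]
  map_smul' c φ := by
    simp [LinearMap.lTensor_smul, TensorProduct.smul_tmul', Finset.smul_sum]

/-- The left dual `M*` of a Yetter-Drinfeld module with finite basis `eᵢ`:
`(h · φ)(m) = φ(S(h) · m)` and
`φ ↦ ⟨φ, f² · (g¹ · eᵢ)₍₀₎⟩ S⁻¹(f¹ (g¹ · eᵢ)₍₋₁₎ g²) ⊗ eⁱ`. -/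
noncomputable def leftDualYD (Q : QuasiHopfAlgebra k H) (e : Module.Basis ι k M)
    (D : YDData k H M) : YDData k H (Module.Dual k M) where
  act := leftDualAct Q D.act
  coact := dualCoact e Q.Sinv (tensAct (Algebra.lmul k H) D.act Q.f ∘ₗ D.twistCoact Q.g)

/-- The right dual `*M` of a Yetter-Drinfeld module with finite basis `eᵢ`:
`(h · φ)(m) = φ(S⁻¹(h) · m)` and
`φ ↦ ⟨φ, S⁻¹(f¹) · (S⁻¹(g²) · eᵢ)₍₀₎⟩ g¹ S((S⁻¹(g²) · eᵢ)₍₋₁₎) f² ⊗ eⁱ`, where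
`g¹ S(h) f² = S(S⁻¹(f²) h S⁻¹(g¹))`. -/
noncomputable def rightDualYD (Q : QuasiHopfAlgebra k H) (e : Module.Basis ι k M)
    (D : YDData k H M) : YDData k H (Module.Dual k M) where
  act := rightDualAct Q D.act
  coact := dualCoact e Q.S (tensAct (Algebra.lmul k H) D.act Q.fOpInv ∘ₗ D.twistCoact Q.gOpInv)

end YD

/-! ### Hopf algebras in the category of Yetter-Drinfeld modules -/

/-- The data of a Hopf algebra in the category of Yetter-Drinfeld modules; the axioms are in
`IsBraidedHopf`. -/
structure BraidedHopfData (k H B : Type*) [Field k] [Ring H] [Algebra k H]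
    [AddCommGroup B] [Module k B] extends YDData k H B where
  mul : B ⊗[k] B →ₗ[k] B
  one : B
  comul : B →ₗ[k] B ⊗[k] B
  counit : B →ₗ[k] k
  antipode : B →ₗ[k] B

section Hopf

variable {k H B : Type*} [Field k] [Ring H] [Algebra k H] [AddCommGroup B] [Module k B]

/-- The multiplication of `B ⊗ B`: the composition
`(B⊗B)⊗(B⊗B) → B⊗(B⊗(B⊗B)) → B⊗((B⊗B)⊗B) → B⊗((B⊗B)⊗B) → B⊗(B⊗(B⊗B)) → (B⊗B)⊗(B⊗B) → B⊗B`
of `a`, `B ⊗ a⁻¹`, `B ⊗ (c ⊗ B)`, `B ⊗ a`, `a⁻¹` and `m ⊗ m`. -/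
noncomputable def mulProd (Q : QuasiHopfAlgebra k H) (D : BraidedHopfData k H B) :
    (B ⊗[k] B) ⊗[k] (B ⊗[k] B) →ₗ[k] B ⊗[k] B :=
  TensorProduct.map D.mul D.mul ∘ₗ
  assocInv Q D.act D.act (prodAct Q D.act D.act) ∘ₗ
  (assocMap Q D.act D.act D.act).lTensor B ∘ₗ
  ((braiding D.toYDData D.toYDData).rTensor B).lTensor B ∘ₗ
  (assocInv Q D.act D.act D.act).lTensor B ∘ₗ
  assocMap Q D.act D.act (prodAct Q D.act D.act)

/-- `B` is a Hopf algebra in the braided category of left Yetter-Drinfeld modules: an algebra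
and a coalgebra in the category such that the comultiplication and the counit are algebra
morphisms, together with an antipode. -/
structure IsBraidedHopf (Q : QuasiHopfAlgebra k H) (D : BraidedHopfData k H B) : Prop where
  isYD : IsYD Q D.toYDData
  mul_hom : IsYDHom (prodYD Q D.toYDData D.toYDData) D.toYDData D.mul
  /-- `(ab)c = (X¹·a)[(X²·b)(X³·c)]` -/
  mul_assoc : D.mul ∘ₗ D.mul.rTensor B =
    D.mul ∘ₗ D.mul.lTensor B ∘ₗ assocMap Q D.act D.act D.act
  one_hom : IsYDHom (unitYD Q) D.toYDData (LinearMap.toSpanSingleton k B D.one)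
  one_mul : ∀ b, D.mul (D.one ⊗ₜ b) = b
  mul_one : ∀ b, D.mul (b ⊗ₜ D.one) = b
  comul_hom : IsYDHom D.toYDData (prodYD Q D.toYDData D.toYDData) D.comul
  coassoc : assocMap Q D.act D.act D.act ∘ₗ D.comul.rTensor B ∘ₗ D.comul =
    D.comul.lTensor B ∘ₗ D.comul
  counit_hom : IsYDHom D.toYDData (unitYD Q) D.counit
  counit_comul : ∀ b, TensorProduct.lid k B (D.counit.rTensor B (D.comul b)) = b
  comul_counit : ∀ b, TensorProduct.rid k B (D.counit.lTensor B (D.comul b)) = b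
  comul_mul : D.comul ∘ₗ D.mul = mulProd Q D ∘ₗ TensorProduct.map D.comul D.comul
  comul_one : D.comul D.one = D.one ⊗ₜ D.one
  counit_mul : ∀ a b, D.counit (D.mul (a ⊗ₜ b)) = D.counit a * D.counit b
  counit_one : D.counit D.one = 1
  antipode_hom : IsYDHom D.toYDData D.toYDData D.antipode
  antipode_left : ∀ b, D.mul (D.antipode.rTensor B (D.comul b)) = D.counit b • D.one
  antipode_right : ∀ b, D.mul (D.antipode.lTensor B (D.comul b)) = D.counit b • D.one

/-- The endomorphism of `B ⊗ B`
`m ⊗ n ↦ f² q̃²₂ X³ S⁻¹(q̃¹ X¹ (p¹ · n)₍₋₁₎ p²) · m ⊗ f¹ q̃²₁ X² · (p¹ · n)₍₀₎`. -/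
noncomputable def kappaLeft (Q : QuasiHopfAlgebra k H) (D : YDData k H B) :
    B ⊗[k] B →ₗ[k] B ⊗[k] B :=
  sw2 (fun f₁ f₂ => sw2 (fun p₁ p₂ => sw3 (fun a b c =>
      crossMap D.act D
        (LinearMap.mul k H (f₂ * c) ∘ₗ Q.Sinv ∘ₗ LinearMap.mul k H a ∘ₗ (LinearMap.mul k H).flip p₂)
        p₁ (f₁ * b))
      ⟨fun _ _ => crossMap_linear₁ _ _ _ _ ⟨by intros; simp [mul_add, add_mul, LinearMap.add_comp, LinearMap.comp_add], by
          intros; simp [LinearMap.smul_comp, LinearMap.comp_smul]⟩,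
        fun _ _ => crossMap_linear₃ _ _ _ _ ⟨by intros; simp [mul_add, add_mul, LinearMap.add_comp, LinearMap.comp_add], by
          intros; simp [LinearMap.smul_comp, LinearMap.comp_smul]⟩,
        fun _ _ => crossMap_linear₁ _ _ _ _ ⟨by intros; simp [mul_add, add_mul, LinearMap.add_comp, LinearMap.comp_add], by
          intros; simp [LinearMap.smul_comp, LinearMap.comp_smul]⟩⟩
      (Q.idComul Q.qL * Q.Phi))
      ⟨fun _ => sw3_isLinear _ (fun _ _ _ => crossMap_linear₂ _ _ _ _ ⟨by intros; simp [mul_add, add_mul, LinearMap.add_comp, LinearMap.comp_add], by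
          intros; simp [LinearMap.smul_comp, LinearMap.comp_smul]⟩) _,
        fun _ => sw3_isLinear _ (fun _ _ _ => crossMap_linear₁ _ _ _ _ ⟨by intros; simp [mul_add, add_mul, LinearMap.add_comp, LinearMap.comp_add], by
          intros; simp [LinearMap.smul_comp, LinearMap.comp_smul]⟩) _⟩
      Q.pR)
      ⟨fun _ => sw2_isLinear _ (fun _ _ => sw3_isLinear _ (fun _ _ _ =>
          crossMap_linear₃ _ _ _ _ ⟨by intros; simp [mul_add, add_mul, LinearMap.add_comp, LinearMap.comp_add], by
          intros; simp [LinearMap.smul_comp, LinearMap.comp_smul]⟩) _) _,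
        fun _ => sw2_isLinear _ (fun _ _ => sw3_isLinear _ (fun _ _ _ =>
          crossMap_linear₁ _ _ _ _ ⟨by intros; simp [mul_add, add_mul, LinearMap.add_comp, LinearMap.comp_add], by
          intros; simp [LinearMap.smul_comp, LinearMap.comp_smul]⟩) _) _⟩
      Q.f

/-- The endomorphism of `B ⊗ B`
`m ⊗ n ↦ S⁻¹(f² q¹ (x¹ p̃¹ S⁻¹(f¹) · n)₍₋₁₎ x² p̃²₁) · m ⊗
S⁻¹(x³ p̃²₂) q² · (x¹ p̃¹ S⁻¹(f¹) · n)₍₀₎`. -/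
noncomputable def kappaRight (Q : QuasiHopfAlgebra k H) (D : YDData k H B) :
    B ⊗[k] B →ₗ[k] B ⊗[k] B :=
  sw2 (fun f₁ f₂ => sw2 (fun q₁ q₂ => sw3 (fun a b c =>
      crossMap D.act D
        (Q.Sinv ∘ₗ LinearMap.mul k H (f₂ * q₁) ∘ₗ (LinearMap.mul k H).flip b)
        (a * Q.Sinv f₁) (Q.Sinv c * q₂))
      ⟨fun _ _ => crossMap_linear₂ _ _ _ _ ⟨by intros; simp [mul_add, add_mul, LinearMap.add_comp, LinearMap.comp_add], by
          intros; simp [LinearMap.smul_comp, LinearMap.comp_smul]⟩,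
        fun _ _ => crossMap_linear₁ _ _ _ _ ⟨by intros; simp [mul_add, add_mul, LinearMap.add_comp, LinearMap.comp_add], by
          intros; simp [LinearMap.smul_comp, LinearMap.comp_smul]⟩,
        fun _ _ => crossMap_linear₃ _ _ _ _ ⟨by intros; simp [mul_add, add_mul, LinearMap.add_comp, LinearMap.comp_add], by
          intros; simp [LinearMap.smul_comp, LinearMap.comp_smul]⟩⟩
      (Q.PhiInv * Q.idComul Q.pL))
      ⟨fun _ => sw3_isLinear _ (fun _ _ _ => crossMap_linear₁ _ _ _ _ ⟨by intros; simp [mul_add, add_mul, LinearMap.add_comp, LinearMap.comp_add], by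
          intros; simp [LinearMap.smul_comp, LinearMap.comp_smul]⟩) _,
        fun _ => sw3_isLinear _ (fun _ _ _ => crossMap_linear₃ _ _ _ _ ⟨by intros; simp [mul_add, add_mul, LinearMap.add_comp, LinearMap.comp_add], by
          intros; simp [LinearMap.smul_comp, LinearMap.comp_smul]⟩) _⟩
      Q.qR)
      ⟨fun _ => sw2_isLinear _ (fun _ _ => sw3_isLinear _ (fun _ _ _ =>
          crossMap_linear₂ _ _ _ _ ⟨by intros; simp [mul_add, add_mul, LinearMap.add_comp, LinearMap.comp_add], by
          intros; simp [LinearMap.smul_comp, LinearMap.comp_smul]⟩) _) _,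
        fun _ => sw2_isLinear _ (fun _ _ => sw3_isLinear _ (fun _ _ _ =>
          crossMap_linear₁ _ _ _ _ ⟨by intros; simp [mul_add, add_mul, LinearMap.add_comp, LinearMap.comp_add], by
          intros; simp [LinearMap.smul_comp, LinearMap.comp_smul]⟩) _) _⟩
      Q.f

variable {ι : Type*} [Fintype ι]

/-- For `t = t¹ ⊗ t²`, the map `B* → B* ⊗ B*`,
`φ ↦ ∑ᵢⱼ ⟨φ, [(t¹ · eⱼ)₍₋₁₎ t² · eᵢ] (t¹ · eⱼ)₍₀₎⟩ eⁱ ⊗ eʲ`. -/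
noncomputable def dualComul (D : BraidedHopfData k H B) (e : Module.Basis ι k B) (t : H ⊗[k] H) :
    Module.Dual k B →ₗ[k] Module.Dual k B ⊗[k] Module.Dual k B :=
  ∑ i, ∑ j, (Module.Dual.eval k B
    (D.mul ((D.act.toLinearMap.flip (e i)).rTensor B (D.twistCoact t (e j))))).smulRight
      (e.coord i ⊗ₜ[k] e.coord j)

/-- The structure maps on the left dual `B*`, where `eᵢ` is a basis of `B`:
* `(a* b*)(b) = ⟨a*, f² q̃²₂ X³ S⁻¹(q̃¹ X¹ (p¹ · b₂)₍₋₁₎ p²) · b₁⟩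
  ⟨b*, f¹ q̃²₁ X² · (p¹ · b₂)₍₀₎⟩`,
* `Δ(b*) = ⟨b*, [(g¹ · eⱼ)₍₋₁₎ g² · eᵢ] (g¹ · eⱼ)₍₀₎⟩ eⁱ ⊗ eʲ`,
* antipode `b* ↦ b* ∘ S_B`, unit `ε_B`, counit `b* ↦ b*(1_B)`. -/
noncomputable def leftDualHopf (Q : QuasiHopfAlgebra k H) (e : Module.Basis ι k B)
    (D : BraidedHopfData k H B) : BraidedHopfData k H (Module.Dual k B) where
  toYDData := leftDualYD Q e D.toYDData
  mul := (kappaLeft Q D.toYDData ∘ₗ D.comul).dualMap ∘ₗ TensorProduct.dualDistrib k B B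
  one := D.counit
  comul := dualComul D e Q.g
  counit := Module.Dual.eval k B D.one
  antipode := D.antipode.dualMap

/-- The structure maps on the right dual `*B`, where `eᵢ` is a basis of `B`:
* `(*a *b)(b) = ⟨*a, S⁻¹(f² q¹ (x¹ p̃¹ S⁻¹(f¹) · b₂)₍₋₁₎ x² p̃²₁) · b₁⟩
  ⟨*b, S⁻¹(x³ p̃²₂) q² · (x¹ p̃¹ S⁻¹(f¹) · b₂)₍₀₎⟩`,
* `Δ(*b) = ⟨*b, [(S⁻¹(g²) · eⱼ)₍₋₁₎ S⁻¹(g¹) · eᵢ] (S⁻¹(g²) · eⱼ)₍₀₎⟩ eⁱ ⊗ eʲ`,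
* antipode `*b ↦ *b ∘ S_B`, unit `ε_B`, counit `*b ↦ *b(1_B)`. -/
noncomputable def rightDualHopf (Q : QuasiHopfAlgebra k H) (e : Module.Basis ι k B)
    (D : BraidedHopfData k H B) : BraidedHopfData k H (Module.Dual k B) where
  toYDData := rightDualYD Q e D.toYDData
  mul := (kappaRight Q D.toYDData ∘ₗ D.comul).dualMap ∘ₗ TensorProduct.dualDistrib k B B
  one := D.counit
  comul := dualComul D e Q.gOpInv
  counit := Module.Dual.eval k B D.one
  antipode := D.antipode.dualMap

end Hopf

end QuasiHopf

namespace QuasiHopf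

set_option linter.unusedSimpArgs false
set_option linter.unusedSectionVars false
set_option maxSynthPendingDepth 8

/-! Instances that never apply to the objects below are removed, to keep instance search short. -/

attribute [-instance]
  IdemSemiring.toSemiring BooleanRing.toRing SeminormedRing.toRing NormedRing.toRing
  IdemCommSemiring.toCommSemiring EuclideanDomain.toCommRing BooleanRing.toCommRing
  SeminormedCommRing.toCommRing NormedCommRing.toCommRing
  LinearOrderedAddCommMonoidWithTop.toAddCommMonoid
  LinearOrderedAddCommGroupWithTop.toAddCommMonoid ESeminormedAddCommMonoid.toAddCommMonoid
  AddCancelCommMonoid.toAddCommMonoid LieRing.toAddCommGroup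
  SeminormedAddCommGroup.toAddCommGroup NormedAddCommGroup.toAddCommGroup NormedField.toField
  littleWedderburn NormedDivisionRing.toDivisionRing LeftPreLieRing.toNonUnitalNonAssocRing
  RightPreLieRing.toNonUnitalNonAssocRing LieAdmissibleRing.toNonUnitalNonAssocRing
  NonUnitalSeminormedRing.toNonUnitalRing NonUnitalNormedRing.toNonUnitalRing RKHS.instFunLike
  Bialgebra.toAlgebra ESeminormedAddMonoid.toAddMonoid MonTypeEquivalenceMon.monMonoid
  ESeminormedMonoid.toMonoid SemiRingCat.instSemiringObjForgetRingHomCarrier Action.instMulAction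
  Action.FintypeCat.instMulActionObjFiniteOf GradedMonoid.GradeZero.mulAction Torsor.toMulAction
  AddCommMonCat.FilteredColimits.colimitAddCommMonoid RCLike.toDenselyNormedField
  NonUnitalNormedCommRing.toNonUnitalCommRing NonUnitalSeminormedCommRing.toNonUnitalCommRing
  CategoryTheory.Limits.Concrete.instUniqueToTypeTerminal
  CommSemiRingCat.FilteredColimits.colimitCommSemiring LieAdmissibleAlgebra.toSMulCommClass
  RightPreLieAlgebra.toSMulCommClass LeftPreLieAlgebra.toSMulCommClass
  LieAdmissibleAlgebra.toIsScalarTower RightPreLieAlgebra.toIsScalarTower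
  LeftPreLieAlgebra.toIsScalarTower LieRinehartAlgebra.toIsScalarTower
  GrpTypeEquivalenceGrp.grpGroup SemiRingCat.semiring SemimoduleCat.isAddCommMonoid
  CommSemiRingCat.instCommSemiringObjForgetRingHomCarrier Pi.nonUnitalNonAssocSemiring
  Pi.nonAssocSemiring CategoryTheory.CommGrpObj.toGrpObj CategoryTheory.Preadditive.instGrpObj
  CommMonTypeEquivalenceCommMon.commMonCommMonoid AddOpposite.instAddZero
  LieAdmissibleAlgebra.toModule RightPreLieAlgebra.toModule LeftPreLieAlgebra.toModule
  NormedSpace.toModule LieAlgebra.toModule NormedCommGroup.toCommGroup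
  CommGrpTypeEquivalenceCommGrp.commGrpCommGroup instCommGroupOfIsSimpleGroupOfIsNilpotent

open LinearMap (mulLeft mulRight)

section Strands

variable {k A A' P P' P'' X : Type*} [Field k] [Ring A] [Algebra k A] [Ring A'] [Algebra k A']

section Linear
variable [AddCommGroup P] [Module k P] [AddCommGroup P'] [Module k P']
  [AddCommGroup P''] [Module k P''] [AddCommGroup X] [Module k X]

/-- The map `a ⊗ b ↦ u a * v b`. -/
noncomputable def m2 (u : P →ₗ[k] A) (v : P' →ₗ[k] A) : P ⊗[k] P' →ₗ[k] A :=
  LinearMap.mul' k A ∘ₗ TensorProduct.map u v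

@[simp] theorem m2_tmul (u : P →ₗ[k] A) (v : P' →ₗ[k] A) (a : P) (b : P') :
    m2 u v (a ⊗ₜ b) = u a * v b := rfl

theorem m2_assoc (u : P →ₗ[k] A) (v : P' →ₗ[k] A) (w : P'' →ₗ[k] A) (s : (P ⊗[k] P') ⊗[k] P'') :
    m2 u (m2 v w) (TensorProduct.assoc k P P' P'' s) = m2 (m2 u v) w s := by
  induction s with
  | zero => simp only [LinearMap.map_zero, LinearEquiv.map_zero, LinearMap.zero_apply, mul_zero, zero_mul,
        TensorProduct.zero_tmul, TensorProduct.tmul_zero]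
  | add s t hs ht => simp only [LinearMap.map_add, LinearEquiv.map_add, hs, ht]
  | tmul s c =>
    induction s with
    | zero => simp only [LinearMap.map_zero, LinearEquiv.map_zero, LinearMap.zero_apply, mul_zero, zero_mul,
          TensorProduct.zero_tmul, TensorProduct.tmul_zero]
    | add s t hs ht => simp only [LinearMap.map_add, LinearEquiv.map_add, TensorProduct.add_tmul, hs, ht]
    | tmul a b => simp [mul_assoc]

/-- The images of `u` and `v` commute. -/
class Cm (u : P →ₗ[k] A) (v : P' →ₗ[k] A) : Prop where
  comm : ∀ a b, u a * v b = v b * u a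

theorem Cm.symm (u : P →ₗ[k] A) (v : P' →ₗ[k] A) [h : Cm u v] : Cm v u :=
  ⟨fun a b => (h.comm b a).symm⟩

instance (u : P →ₗ[k] A) (v : P' →ₗ[k] A) (w : P'' →ₗ[k] A) [Cm u w] [Cm v w] :
    Cm (m2 u v) w where
  comm s c := by
    induction s with
    | zero => simp only [LinearMap.map_zero, LinearMap.zero_apply, mul_zero, zero_mul,
          TensorProduct.zero_tmul, TensorProduct.tmul_zero]
    | add s t hs ht => simp only [LinearMap.map_add, add_mul, mul_add, hs, ht]
    | tmul a b => rw [m2_tmul, mul_assoc, Cm.comm b c, ← mul_assoc, Cm.comm a c, mul_assoc]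

instance (u : P →ₗ[k] A) (v : P' →ₗ[k] A) (w : P'' →ₗ[k] A) [Cm w u] [Cm w v] :
    Cm w (m2 u v) where
  comm c s := by
    have := Cm.symm w u
    have := Cm.symm w v
    exact (Cm.comm s c).symm

/-- `F (u a * t) = F (u' a * t)` for all `a` and `t`. -/
def LCol (F : A →ₗ[k] X) (u u' : P →ₗ[k] A) : Prop := ∀ a t, F (u a * t) = F (u' a * t)

/-- `F (t * u a) = F (t * u' a)` for all `a` and `t`. -/
def RCol (F : A →ₗ[k] X) (u u' : P →ₗ[k] A) : Prop := ∀ a t, F (t * u a) = F (t * u' a)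

theorem LCol.m2_left {F : A →ₗ[k] X} {u u' : P →ₗ[k] A} (h : LCol F u u') (v : P' →ₗ[k] A) :
    LCol F (m2 u v) (m2 u' v) := by
  intro s t
  induction s with
  | zero => simp only [LinearMap.map_zero, LinearMap.zero_apply, mul_zero, zero_mul,
        TensorProduct.zero_tmul, TensorProduct.tmul_zero]
  | add s t hs ht => simp only [LinearMap.map_add, add_mul, hs, ht]
  | tmul a b => simp only [m2_tmul, mul_assoc]; exact h a _

theorem LCol.m2_right {F : A →ₗ[k] X} {v v' : P' →ₗ[k] A} (h : LCol F v v') (u : P →ₗ[k] A)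
    [Cm u v] [Cm u v'] : LCol F (m2 u v) (m2 u v') := by
  intro s t
  induction s with
  | zero => simp only [LinearMap.map_zero, LinearMap.zero_apply, mul_zero, zero_mul,
        TensorProduct.zero_tmul, TensorProduct.tmul_zero]
  | add s t hs ht => simp only [LinearMap.map_add, add_mul, hs, ht]
  | tmul a b =>
    rw [m2_tmul, m2_tmul, Cm.comm (u := u) (v := v), Cm.comm (u := u) (v := v'), mul_assoc,
      mul_assoc]
    exact h b _

theorem RCol.m2_right {F : A →ₗ[k] X} {v v' : P' →ₗ[k] A} (h : RCol F v v') (u : P →ₗ[k] A) :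
    RCol F (m2 u v) (m2 u v') := by
  intro s t
  induction s with
  | zero => simp only [LinearMap.map_zero, LinearMap.zero_apply, mul_zero, zero_mul,
        TensorProduct.zero_tmul, TensorProduct.tmul_zero]
  | add s t hs ht => simp only [LinearMap.map_add, mul_add, hs, ht]
  | tmul a b => simp only [m2_tmul, ← mul_assoc]; exact h b _

theorem RCol.m2_left {F : A →ₗ[k] X} {u u' : P →ₗ[k] A} (h : RCol F u u') (v : P' →ₗ[k] A)
    [Cm u v] [Cm u' v] : RCol F (m2 u v) (m2 u' v) := by
  intro s t
  induction s with
  | zero => simp only [LinearMap.map_zero, LinearMap.zero_apply, mul_zero, zero_mul,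
        TensorProduct.zero_tmul, TensorProduct.tmul_zero]
  | add s t hs ht => simp only [LinearMap.map_add, mul_add, hs, ht]
  | tmul a b =>
    rw [m2_tmul, m2_tmul, Cm.comm (u := u) (v := v), Cm.comm (u := u') (v := v), ← mul_assoc,
      ← mul_assoc]
    exact h a _

theorem LCol.comp {F : A →ₗ[k] X} {u u' : P →ₗ[k] A} (h : LCol F u u') (φ : P' →ₗ[k] P) :
    LCol F (u ∘ₗ φ) (u' ∘ₗ φ) := fun a t => h (φ a) t

theorem RCol.comp {F : A →ₗ[k] X} {u u' : P →ₗ[k] A} (h : RCol F u u') (φ : P' →ₗ[k] P) :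
    RCol F (u ∘ₗ φ) (u' ∘ₗ φ) := fun a t => h (φ a) t

/-- Left collapsing behind a factor `p` that commutes with both strands. -/
theorem LCol.behind {F : A →ₗ[k] X} {u u' : P →ₗ[k] A} (h : LCol F u u') (p : A)
    (h1 : ∀ a, p * u a = u a * p) (h2 : ∀ a, p * u' a = u' a * p) (a : P) (t : A) :
    F (p * (u a * t)) = F (p * (u' a * t)) := by
  rw [← mul_assoc, h1, mul_assoc, h a, ← mul_assoc, ← h2, mul_assoc]

theorem RCol.behind {F : A →ₗ[k] X} {u u' : P →ₗ[k] A} (h : RCol F u u') (p : A)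
    (h1 : ∀ a, p * u a = u a * p) (h2 : ∀ a, p * u' a = u' a * p) (a : P) (t : A) :
    F (t * (u a * p)) = F (t * (u' a * p)) := by
  rw [← h1, ← mul_assoc, h a, mul_assoc, h2]

end Linear

section Algebras
variable [Ring P] [Algebra k P] [Ring P'] [Algebra k P'] [Ring P''] [Algebra k P'']

/-- The linear map `u` is a homomorphism of unital algebras. -/
class Str (u : P →ₗ[k] A) : Prop where
  map_one : u 1 = 1
  map_mul : ∀ a b, u (a * b) = u a * u b

instance (φ : P →ₐ[k] A) : Str φ.toLinearMap := ⟨map_one φ, map_mul φ⟩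

instance : Str (LinearMap.id : P →ₗ[k] P) := ⟨rfl, fun _ _ => rfl⟩

instance (φ : P →ₗ[k] P') (u : P' →ₗ[k] A) [Str φ] [Str u] : Str (u ∘ₗ φ) :=
  ⟨by simp [Str.map_one], by simp [Str.map_mul]⟩

instance (φ : P →ₗ[k] P') (u : P' →ₗ[k] A) (v : P'' →ₗ[k] A) [Cm u v] : Cm (u ∘ₗ φ) v :=
  ⟨fun a b => Cm.comm (φ a) b⟩

instance (φ : P →ₗ[k] P') (u : P' →ₗ[k] A) (v : P'' →ₗ[k] A) [Cm v u] : Cm v (u ∘ₗ φ) :=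
  ⟨fun a b => Cm.comm a (φ b)⟩

instance (u : P →ₗ[k] A) (v : P' →ₗ[k] A) [Str u] [Str v] [Cm u v] : Str (m2 u v) where
  map_one := by simp [Algebra.TensorProduct.one_def, Str.map_one]
  map_mul s t := by
    induction s with
    | zero => simp only [LinearMap.map_zero, LinearMap.zero_apply, mul_zero, zero_mul,
          TensorProduct.zero_tmul, TensorProduct.tmul_zero]
    | add s t hs ht => simp only [LinearMap.map_add, add_mul, hs, ht]
    | tmul a b =>
      induction t with
      | zero => simp only [LinearMap.map_zero, LinearMap.zero_apply, mul_zero, zero_mul,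
            TensorProduct.zero_tmul, TensorProduct.tmul_zero]
      | add s t hs ht => simp only [LinearMap.map_add, mul_add, hs, ht]
      | tmul c d =>
        rw [Algebra.TensorProduct.tmul_mul_tmul, m2_tmul, m2_tmul, m2_tmul, Str.map_mul,
          Str.map_mul, mul_assoc, mul_assoc, ← mul_assoc (u c), Cm.comm c b, mul_assoc]

theorem map_m2 (χ : A →ₗ[k] A') [Str χ] (u : P →ₗ[k] A) (v : P' →ₗ[k] A) (s : P ⊗[k] P') :
    χ (m2 u v s) = m2 (χ ∘ₗ u) (χ ∘ₗ v) s := by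
  induction s with
  | zero => simp only [LinearMap.map_zero, LinearMap.zero_apply, mul_zero, zero_mul,
        TensorProduct.zero_tmul, TensorProduct.tmul_zero]
  | add s t hs ht => simp only [LinearMap.map_add, hs, ht]
  | tmul a b => simp [Str.map_mul]

theorem comp_m2 (χ : A →ₗ[k] A') [Str χ] (u : P →ₗ[k] A) (v : P' →ₗ[k] A) :
    χ ∘ₗ m2 u v = m2 (χ ∘ₗ u) (χ ∘ₗ v) := LinearMap.ext (map_m2 χ u v)

/-- The strand `a ↦ a ⊗ 1`. -/
noncomputable def sL (k P P' : Type*) [Field k] [Ring P] [Algebra k P] [Ring P'] [Algebra k P'] :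
    P →ₗ[k] P ⊗[k] P' := Algebra.TensorProduct.includeLeft.toLinearMap

/-- The strand `a ↦ 1 ⊗ s a`. -/
noncomputable def sR (P' : Type*) [Ring P'] [Algebra k P'] (s : P →ₗ[k] A) : P →ₗ[k] P' ⊗[k] A :=
  Algebra.TensorProduct.includeRight.toLinearMap ∘ₗ s

@[simp] theorem sL_apply (a : P) : sL k P P' a = a ⊗ₜ 1 := rfl
@[simp] theorem sR_apply (s : P →ₗ[k] A) (a : P) : sR P' s a = 1 ⊗ₜ s a := rfl

instance : Str (sL k P P') := inferInstanceAs (Str (AlgHom.toLinearMap _))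
instance (s : P →ₗ[k] A) [Str s] : Str (sR P' s) :=
  ⟨by simp [Str.map_one, Algebra.TensorProduct.one_def], by simp [Str.map_mul]⟩
instance (s : P'' →ₗ[k] P') : Cm (sL k P P') (sR P s) := ⟨by simp⟩
instance (s : P'' →ₗ[k] P') : Cm (sR P s) (sL k P P') := ⟨by simp⟩
instance (s : P →ₗ[k] A) (t : P' →ₗ[k] A) [Cm s t] : Cm (sR P'' s) (sR P'' t) :=
  ⟨by simp [Cm.comm (u := s) (v := t)]⟩

theorem m2_comp_sL (u : P →ₗ[k] A) (v : P' →ₗ[k] A) [Str v] : m2 u v ∘ₗ sL k P P' = u := by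
  ext a; simp [Str.map_one]

theorem m2_comp_sR (u : P →ₗ[k] A) (v : P' →ₗ[k] A) (s : P'' →ₗ[k] P') [Str u] :
    m2 u v ∘ₗ sR P s = v ∘ₗ s := by
  ext a; simp [Str.map_one]

theorem sR_m2 {A : Type*} [Ring A] [Algebra k A] {U V : Type*} [AddCommGroup U] [Module k U]
    [AddCommGroup V] [Module k V] (u : U →ₗ[k] A) (v : V →ₗ[k] A) (s : U ⊗[k] V) :
    (1 : P) ⊗ₜ[k] m2 u v s = m2 ((Algebra.TensorProduct.includeRight (R := k) (A := P)).toLinearMap ∘ₗ u)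
      ((Algebra.TensorProduct.includeRight (R := k) (A := P)).toLinearMap ∘ₗ v) s := by
  induction s with
  | zero => simp only [LinearMap.map_zero, LinearMap.zero_apply, mul_zero, zero_mul,
        TensorProduct.zero_tmul, TensorProduct.tmul_zero]
  | add s t hs ht => simp only [LinearMap.map_add, TensorProduct.tmul_add, hs, ht]
  | tmul a b => simp

end Algebras

end Strands

section Calculus

variable {k H A A' X P E : Type*} [Field k] [Ring H] [Algebra k H] [Ring A] [Algebra k A]
  [Ring A'] [Algebra k A'] [AddCommGroup X] [Module k X] [Ring P] [Algebra k P]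
  (Q : QuasiHopfAlgebra k H)

/-- The product strand `h ↦ u h₁ * v h₂`. -/
noncomputable def conv (u v : H →ₗ[k] A) : H →ₗ[k] A := m2 u v ∘ₗ Q.comul.toLinearMap

/-- The trivial strand `h ↦ ε(h)`. -/
noncomputable def triv (A : Type*) [Ring A] [Algebra k A] : H →ₗ[k] A :=
  Algebra.linearMap k A ∘ₗ Q.counit.toLinearMap

@[simp] theorem triv_apply (h : H) : triv Q A h = algebraMap k A (Q.counit h) := rfl

instance : Str (triv Q A) := ⟨by simp, by simp⟩
instance (u : P →ₗ[k] A) : Cm (triv Q A) u := ⟨fun _ _ => Algebra.commutes _ _⟩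
instance (u : P →ₗ[k] A) : Cm u (triv Q A) := ⟨fun _ _ => (Algebra.commutes _ _).symm⟩

instance (u v : H →ₗ[k] A) [Str u] [Str v] [Cm u v] : Str (conv Q u v) :=
  inferInstanceAs (Str (m2 u v ∘ₗ Q.comul.toLinearMap))
instance (u v : H →ₗ[k] A) (w : P →ₗ[k] A) [Cm u w] [Cm v w] : Cm (conv Q u v) w :=
  ⟨fun _ _ => Cm.comm (u := m2 u v) (v := w) _ _⟩
instance (u v : H →ₗ[k] A) (w : P →ₗ[k] A) [Cm w u] [Cm w v] : Cm w (conv Q u v) :=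
  ⟨fun _ _ => Cm.comm (u := w) (v := m2 u v) _ _⟩

/-- `Φ` placed on three strands. -/
noncomputable def ph (u v w : H →ₗ[k] A) : A := m2 u (m2 v w) Q.Phi

/-- `Φ⁻¹` placed on three strands. -/
noncomputable def phi (u v w : H →ₗ[k] A) : A := m2 u (m2 v w) Q.PhiInv

theorem Phi_mul_PhiInv : Q.Phi * Q.PhiInv = 1 := Q.reassoc.mul_inv
theorem PhiInv_mul_Phi : Q.PhiInv * Q.Phi = 1 := Q.reassoc.inv_mul

section
variable (u v w : H →ₗ[k] A) [Str u] [Str v] [Str w] [Cm u v] [Cm u w] [Cm v w]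

@[simp] theorem ph_mul_phi : ph Q u v w * phi Q u v w = 1 := by
  rw [ph, phi, ← Str.map_mul, Phi_mul_PhiInv, Str.map_one]

@[simp] theorem phi_mul_ph : phi Q u v w * ph Q u v w = 1 := by
  rw [ph, phi, ← Str.map_mul, PhiInv_mul_Phi, Str.map_one]

@[simp] theorem ph_mul_phi_mul (t : A) : ph Q u v w * (phi Q u v w * t) = t := by
  rw [← mul_assoc, ph_mul_phi, one_mul]

@[simp] theorem phi_mul_ph_mul (t : A) : phi Q u v w * (ph Q u v w * t) = t := by
  rw [← mul_assoc, phi_mul_ph, one_mul]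

theorem ph_nat (h : H) :
    ph Q u v w * conv Q (conv Q u v) w h = conv Q u (conv Q v w) h * ph Q u v w := by
  have h1 := congrArg (m2 u (m2 v w)) (Q.quasi_coassoc h)
  rw [Str.map_mul, Str.map_mul] at h1
  change _ = ph Q u v w * _ * phi Q u v w at h1
  have h2 : m2 u (m2 v w) (Algebra.TensorProduct.map (AlgHom.id k H) Q.comul (Q.comul h)) =
      conv Q u (conv Q v w) h := by
    change _ = m2 u (conv Q v w) (Q.comul h)
    generalize Q.comul h = s
    induction s with
    | zero => simp
    | add s t hs ht => simp only [map_add, hs, ht]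
    | tmul a b => simp [conv]
  have h3 : m2 u (m2 v w) (Algebra.TensorProduct.assoc k k k H H H
      (Algebra.TensorProduct.map Q.comul (AlgHom.id k H) (Q.comul h))) =
      conv Q (conv Q u v) w h := by
    refine (m2_assoc u v w _).trans ?_
    change _ = m2 (conv Q u v) w (Q.comul h)
    generalize Q.comul h = s
    induction s with
    | zero => simp
    | add s t hs ht => simp only [map_add, hs, ht]
    | tmul a b => simp [conv]
  rw [h2, h3] at h1
  rw [h1, mul_assoc, phi_mul_ph, mul_one]

theorem phi_nat (h : H) :
    phi Q u v w * conv Q u (conv Q v w) h = conv Q (conv Q u v) w h * phi Q u v w := by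
  have := ph_nat Q u v w h
  calc phi Q u v w * conv Q u (conv Q v w) h
      = phi Q u v w * (conv Q u (conv Q v w) h * ph Q u v w) * phi Q u v w := by
        rw [mul_assoc, mul_assoc, ph_mul_phi, mul_one]
    _ = _ := by rw [← this, ← mul_assoc, phi_mul_ph, one_mul]

end

theorem pentagon (u v w z : H →ₗ[k] A) [Str u] [Str v] [Str w] [Str z] [Cm u v] [Cm u w] [Cm u z]
    [Cm v w] [Cm v z] [Cm w z] :
    ph Q v w z * (ph Q u (conv Q v w) z * ph Q u v w) =
      ph Q u v (conv Q w z) * ph Q (conv Q u v) w z := by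
  have h1 := congrArg (m2 u (m2 v (m2 w z))) Q.cocycle
  have hm := Str.map_mul (u := m2 u (m2 v (m2 w z)))
  rw [hm, hm, hm, mul_assoc] at h1
  convert h1 using 2
  · simp [ph, Str.map_one, QuasiHopfAlgebra.Phi]
  · congr 1
    · change m2 u (m2 (conv Q v w) z) _ = _
      rw [QuasiHopfAlgebra.Phi]
      generalize (Q.reassoc : H ⊗[k] (H ⊗[k] H)) = s
      induction s with
      | zero => simp
      | add s t hs ht => simp only [map_add, hs, ht]
      | tmul a s =>
        simp only [Algebra.TensorProduct.map_tmul, m2_tmul, AlgHom.coe_id, id_eq]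
        congr 1
        refine Eq.trans ?_ (m2_assoc v w z _).symm
        induction s with
        | zero => simp
        | add s t hs ht => simp only [map_add, hs, ht]
        | tmul a b => simp [conv]
    · change m2 u (m2 v w) _ = _
      rw [QuasiHopfAlgebra.Phi]
      generalize (Q.reassoc : H ⊗[k] (H ⊗[k] H)) = s
      induction s with
      | zero => simp
      | add s t hs ht => simp only [map_add, hs, ht]
      | tmul a s =>
        induction s with
        | zero => simp
        | add s t hs ht => simp only [map_add, TensorProduct.tmul_add, hs, ht]
        | tmul a b => simp [Str.map_one]
  · change m2 u (m2 v (conv Q w z)) _ = _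
    rw [QuasiHopfAlgebra.Phi]
    generalize (Q.reassoc : H ⊗[k] (H ⊗[k] H)) = s
    induction s with
    | zero => simp
    | add s t hs ht => simp only [map_add, hs, ht]
    | tmul a s =>
      induction s with
      | zero => simp
      | add s t hs ht => simp only [map_add, TensorProduct.tmul_add, hs, ht]
      | tmul a b => simp [conv]
  · change m2 (conv Q u v) (m2 w z) _ = _
    refine Eq.trans ?_ (m2_assoc u v (m2 w z) _).symm
    rw [QuasiHopfAlgebra.Phi]
    generalize (Q.reassoc : H ⊗[k] (H ⊗[k] H)) = s
    induction s with
    | zero => simp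
    | add s t hs ht => simp only [map_add, hs, ht]
    | tmul a s => simp [conv]

@[simp] theorem conv_triv (u : H →ₗ[k] A) : conv Q u (triv Q A) = u := by
  ext h
  conv_rhs => rw [← Q.counit_right h]
  change m2 u (triv Q A) (Q.comul h) = _
  generalize Q.comul h = s
  induction s with
  | zero => simp
  | add s t hs ht => simp only [map_add, hs, ht]
  | tmul a b => simp [Algebra.algebraMap_eq_smul_one]

@[simp] theorem triv_conv (u : H →ₗ[k] A) : conv Q (triv Q A) u = u := by
  ext h
  conv_rhs => rw [← Q.counit_left h]
  change m2 (triv Q A) u (Q.comul h) = _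
  generalize Q.comul h = s
  induction s with
  | zero => simp
  | add s t hs ht => simp only [map_add, hs, ht]
  | tmul a b => simp [Algebra.algebraMap_eq_smul_one]

@[simp] theorem ph_triv_mid (u w : H →ₗ[k] A) [Str u] [Str w] [Cm u w] : ph Q u (triv Q A) w = 1 := by
  have h1 := congrArg (m2 u w) Q.reassoc_normalized
  rw [Str.map_one] at h1
  rw [← h1, ph, QuasiHopfAlgebra.Phi]
  generalize (Q.reassoc : H ⊗[k] (H ⊗[k] H)) = s
  induction s with
  | zero => simp
  | add s t hs ht => simp only [map_add, hs, ht]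
  | tmul a s =>
    induction s with
    | zero => simp
    | add s t hs ht => simp only [map_add, TensorProduct.tmul_add, hs, ht]
    | tmul a b => simp [Algebra.algebraMap_eq_smul_one]

@[simp] theorem ph_triv_left (v w : H →ₗ[k] A) [Str v] [Str w] [Cm v w] :
    ph Q (triv Q A) v w = 1 := by
  have h := pentagon Q (triv Q A) (triv Q A) v w
  simp only [ph_triv_mid, mul_one, one_mul, triv_conv] at h
  calc _ = ph Q (triv Q A) v w * (ph Q (triv Q A) v w * phi Q (triv Q A) v w) := by simp
    _ = _ := by rw [← mul_assoc, h, ph_mul_phi]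

@[simp] theorem ph_triv_right (u v : H →ₗ[k] A) [Str u] [Str v] [Cm u v] :
    ph Q u v (triv Q A) = 1 := by
  have h := pentagon Q u v (triv Q A) (triv Q A)
  simp only [ph_triv_mid, mul_one, one_mul, conv_triv] at h
  calc _ = (ph Q u v (triv Q A) * ph Q u v (triv Q A)) * phi Q u v (triv Q A) := by
        simp [mul_assoc]
    _ = _ := by rw [h, ph_mul_phi]

theorem phi_eq_one (u v w : H →ₗ[k] A) [Str u] [Str v] [Str w] [Cm u v] [Cm u w] [Cm v w]
    (h : ph Q u v w = 1) : phi Q u v w = 1 := by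
  have := ph_mul_phi Q u v w
  rwa [h, one_mul] at this

@[simp] theorem phi_triv_mid (u w : H →ₗ[k] A) [Str u] [Str w] [Cm u w] :
    phi Q u (triv Q A) w = 1 := phi_eq_one Q _ _ _ (by simp)
@[simp] theorem phi_triv_left (v w : H →ₗ[k] A) [Str v] [Str w] [Cm v w] :
    phi Q (triv Q A) v w = 1 := phi_eq_one Q _ _ _ (by simp)
@[simp] theorem phi_triv_right (u v : H →ₗ[k] A) [Str u] [Str v] [Cm u v] :
    phi Q u v (triv Q A) = 1 := phi_eq_one Q _ _ _ (by simp)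

theorem map_ph (χ : A →ₗ[k] A') [Str χ] (u v w : H →ₗ[k] A) :
    χ (ph Q u v w) = ph Q (χ ∘ₗ u) (χ ∘ₗ v) (χ ∘ₗ w) := by
  rw [ph, map_m2, comp_m2, ph]

theorem map_phi (χ : A →ₗ[k] A') [Str χ] (u v w : H →ₗ[k] A) :
    χ (phi Q u v w) = phi Q (χ ∘ₗ u) (χ ∘ₗ v) (χ ∘ₗ w) := by
  rw [phi, map_m2, comp_m2, phi]

theorem comp_conv (χ : A →ₗ[k] A') [Str χ] (u v : H →ₗ[k] A) :
    χ ∘ₗ conv Q u v = conv Q (χ ∘ₗ u) (χ ∘ₗ v) := by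
  rw [conv, ← LinearMap.comp_assoc, comp_m2, conv]

end Calculus

section Contractions

variable {k H A C X Y : Type*} [Field k] [Ring H] [Algebra k H] [Ring A] [Algebra k A]
  [Ring C] [Algebra k C] [AddCommGroup X] [Module k X] [AddCommGroup Y] [Module k Y]
  (Q : QuasiHopfAlgebra k H)

section Induction
variable {M1 M2 M3 M4 M5 M6 : Type*} [AddCommGroup M1] [Module k M1] [AddCommGroup M2] [Module k M2]
  [AddCommGroup M3] [Module k M3] [AddCommGroup M4] [Module k M4] [AddCommGroup M5] [Module k M5]
  [AddCommGroup M6] [Module k M6]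

theorem ind2 {p : M1 ⊗[k] M2 → Prop} (h0 : p 0) (ha : ∀ s t, p s → p t → p (s + t))
    (h : ∀ a b, p (a ⊗ₜ b)) (t : M1 ⊗[k] M2) : p t :=
  TensorProduct.induction_on t h0 h ha

theorem ind3 {p : M1 ⊗[k] (M2 ⊗[k] M3) → Prop} (h0 : p 0) (ha : ∀ s t, p s → p t → p (s + t))
    (h : ∀ a b c, p (a ⊗ₜ (b ⊗ₜ c))) (t : M1 ⊗[k] (M2 ⊗[k] M3)) : p t :=
  ind2 h0 ha (fun a => ind2 (by simpa using h0)
    (fun s t hs ht => by simpa [TensorProduct.tmul_add] using ha _ _ hs ht) (h a)) t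

theorem ind4 {p : M1 ⊗[k] (M2 ⊗[k] (M3 ⊗[k] M4)) → Prop} (h0 : p 0)
    (ha : ∀ s t, p s → p t → p (s + t))
    (h : ∀ a b c d, p (a ⊗ₜ (b ⊗ₜ (c ⊗ₜ d)))) (t : M1 ⊗[k] (M2 ⊗[k] (M3 ⊗[k] M4))) : p t :=
  ind2 h0 ha (fun a => ind3 (by simpa using h0)
    (fun s t hs ht => by simpa [TensorProduct.tmul_add] using ha _ _ hs ht) (h a)) t

end Induction

/-- A linear map `κ` on `H ⊗ H` with `κ (Δ h) = ε(h) κ (1 ⊗ 1)`. -/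
def Contr (κ : H ⊗[k] H →ₗ[k] Y) : Prop :=
  ∀ h, κ (Q.comul h) = Q.counit h • κ (1 ⊗ₜ 1)

/-- The bilinear expression `B` factors through `κ`. -/
def Fac (κ : H ⊗[k] H →ₗ[k] Y) (B : H → H → X) : Prop :=
  ∃ G : Y →ₗ[k] X, ∀ x y, B x y = G (κ (x ⊗ₜ y))

theorem Fac.left {κ : H ⊗[k] H →ₗ[k] Y} (F : A →ₗ[k] X) (u v : H →ₗ[k] A) :
    Fac κ (fun x y => F (u x * (v y * 0))) ∧
    ∀ s t, Fac κ (fun x y => F (u x * (v y * s))) → Fac κ (fun x y => F (u x * (v y * t))) →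
      Fac κ (fun x y => F (u x * (v y * (s + t)))) :=
  ⟨⟨0, by simp⟩, fun s t ⟨G, hG⟩ ⟨G', hG'⟩ => ⟨G + G', fun x y => by simp [mul_add, hG, hG']⟩⟩

theorem Fac.right {κ : H ⊗[k] H →ₗ[k] Y} (F : A →ₗ[k] X) (u v : H →ₗ[k] A) :
    Fac κ (fun x y => F (0 * (u x * v y))) ∧
    ∀ s t, Fac κ (fun x y => F (s * (u x * v y))) → Fac κ (fun x y => F (t * (u x * v y))) →
      Fac κ (fun x y => F ((s + t) * (u x * v y))) :=
  ⟨⟨0, by simp⟩, fun s t ⟨G, hG⟩ ⟨G', hG'⟩ => ⟨G + G', fun x y => by simp [add_mul, hG, hG']⟩⟩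

variable {Q}

theorem LCol.of_contr {κ : H ⊗[k] H →ₗ[k] Y} (hκ : Contr Q κ) {F : A →ₗ[k] X} {u v : H →ₗ[k] A}
    [Str u] [Str v] (hF : ∀ t, Fac κ fun x y => F (u x * (v y * t))) :
    LCol F (conv Q u v) (triv Q A) := by
  intro h t
  obtain ⟨G, hG⟩ := hF t
  have h1 : ∀ w : H ⊗[k] H, F (m2 u v w * t) = G (κ w) := by
    intro w
    induction w with
    | zero => simp only [LinearMap.map_zero, LinearMap.zero_apply, mul_zero, zero_mul,
          TensorProduct.zero_tmul, TensorProduct.tmul_zero]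
    | add s t hs ht => simp only [LinearMap.map_add, add_mul, hs, ht]
    | tmul a b => rw [m2_tmul, mul_assoc]; exact hG a b
  have h2 := h1 (1 ⊗ₜ 1)
  change F (m2 u v (Q.comul h) * t) = _
  rw [h1, hκ, map_smul, ← h2]
  simp [Str.map_one, Algebra.algebraMap_eq_smul_one]

theorem RCol.of_contr {κ : H ⊗[k] H →ₗ[k] Y} (hκ : Contr Q κ) {F : A →ₗ[k] X} {u v : H →ₗ[k] A}
    [Str u] [Str v] (hF : ∀ t, Fac κ fun x y => F (t * (u x * v y))) :
    RCol F (conv Q u v) (triv Q A) := by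
  intro h t
  obtain ⟨G, hG⟩ := hF t
  have h1 : ∀ w : H ⊗[k] H, F (t * m2 u v w) = G (κ w) := by
    intro w
    induction w with
    | zero => simp only [LinearMap.map_zero, LinearMap.zero_apply, mul_zero, zero_mul,
          TensorProduct.zero_tmul, TensorProduct.tmul_zero]
    | add s t hs ht => simp only [LinearMap.map_add, mul_add, hs, ht]
    | tmul a b => rw [m2_tmul]; exact hG a b
  have h2 := h1 (1 ⊗ₜ 1)
  change F (t * m2 u v (Q.comul h)) = _
  rw [h1, hκ, map_smul, ← h2]
  simp [Str.map_one, Algebra.algebraMap_eq_smul_one]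

variable (Q)

/-- `a ⊗ b ↦ u a * γ * v b` -/
noncomputable def sand (u v : H →ₗ[k] C) (γ : C) : H ⊗[k] H →ₗ[k] C := m2 (mulRight k γ ∘ₗ u) v

@[simp] theorem sand_tmul (u v : H →ₗ[k] C) (γ : C) (a b : H) :
    sand u v γ (a ⊗ₜ b) = u a * γ * v b := rfl

@[simp] theorem S_apply_mul (a b : H) : Q.S (a * b) = Q.S b * Q.S a := Q.S_mul a b
@[simp] theorem Sinv_apply_mul (a b : H) : Q.Sinv (a * b) = Q.Sinv b * Q.Sinv a := Q.Sinv_mul a b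
@[simp] theorem S_apply_one : Q.S 1 = 1 := Q.S_one
@[simp] theorem Sinv_apply_one : Q.Sinv 1 = 1 := Q.Sinv_one
@[simp] theorem S_Sinv (a : H) : Q.S (Q.Sinv a) = a := Q.antipode.apply_symm_apply a
@[simp] theorem Sinv_S (a : H) : Q.Sinv (Q.S a) = a := Q.antipode.symm_apply_apply a

theorem contr_alpha : Contr Q (sand Q.S LinearMap.id Q.alpha) := by
  intro h
  have := Q.antipode_alpha h
  rw [show sw2 _ _ = sand Q.S LinearMap.id Q.alpha from TensorProduct.ext' fun _ _ => rfl] at this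
  simpa using this

theorem contr_beta : Contr Q (sand LinearMap.id Q.S Q.beta) := by
  intro h
  have := Q.antipode_beta h
  rw [show sw2 _ _ = sand LinearMap.id Q.S Q.beta from TensorProduct.ext' fun _ _ => rfl] at this
  simpa using this

/-- The linear map `T` is an anti-homomorphism of unital algebras. -/
class Anti (T : H →ₗ[k] C) : Prop where
  map_one : T 1 = 1
  map_mul : ∀ a b, T (a * b) = T b * T a

instance : Anti Q.S := ⟨Q.S_one, Q.S_mul⟩
instance : Anti Q.Sinv := ⟨Q.Sinv_one, Q.Sinv_mul⟩
instance (T : H →ₗ[k] A) (u : A →ₗ[k] C) [Anti T] [Str u] : Anti (u ∘ₗ T) :=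
  ⟨by simp [Anti.map_one, Str.map_one], by simp [Anti.map_mul, Str.map_mul]⟩

section Rigidity
variable (D T : H →ₗ[k] C) [Str D] [Anti T] (γ : C)

/-- `T(x¹) γ D(x² β S(x³))`. -/
noncomputable def mate : C :=
  m2 (mulRight k γ ∘ₗ T) (D ∘ₗ m2 (mulRight k Q.beta) Q.S) Q.PhiInv

/-- `D(S(x¹) α x²) γ T(x³)`. -/
noncomputable def comate : C :=
  m2 (D ∘ₗ mulRight k Q.alpha ∘ₗ Q.S) (m2 (mulRight k γ ∘ₗ D) T) Q.PhiInv

theorem phi_std3 : phi Q (sL k H (H ⊗[k] H)) (sR H (sL k H H)) (sR H (sR H LinearMap.id)) = Q.PhiInv := by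
  rw [phi]
  generalize Q.PhiInv = t
  induction t using ind3 with
  | h0 => simp only [LinearMap.map_zero, LinearMap.zero_apply, mul_zero, zero_mul,
        TensorProduct.zero_tmul, TensorProduct.tmul_zero]
  | ha s t hs ht => rw [map_add, hs, ht]
  | h a b c => simp

theorem ph_std3 : ph Q (sL k H (H ⊗[k] H)) (sR H (sL k H H)) (sR H (sR H LinearMap.id)) = Q.Phi := by
  rw [ph]
  generalize Q.Phi = t
  induction t using ind3 with
  | h0 => simp only [LinearMap.map_zero, LinearMap.zero_apply, mul_zero, zero_mul,
        TensorProduct.zero_tmul, TensorProduct.tmul_zero]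
  | ha s t hs ht => rw [map_add, hs, ht]
  | h a b c => simp

variable {D T γ}

theorem mate_intertwine (hγ : Contr Q (sand T D γ)) (h : H) :
    T h * mate Q D T γ = mate Q D T γ * D (Q.S h) := by
  set F : H ⊗[k] (H ⊗[k] H) →ₗ[k] C :=
    m2 (mulRight k γ ∘ₗ T) (D ∘ₗ m2 (mulRight k Q.beta) Q.S) with hF
  set i1 : H →ₗ[k] H ⊗[k] (H ⊗[k] H) := sL k H (H ⊗[k] H)
  set i2 : H →ₗ[k] H ⊗[k] (H ⊗[k] H) := sR H (sL k H H)
  set i3 : H →ₗ[k] H ⊗[k] (H ⊗[k] H) := sR H (sR H LinearMap.id)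
  have hl : LCol F (conv Q i1 i2) (triv Q _) := LCol.of_contr hγ <|
    ind3 (Fac.left _ _ _).1 (Fac.left _ _ _).2 fun a b c =>
      ⟨mulLeft k (T a) ∘ₗ mulRight k (D (b * Q.beta * Q.S c)), fun x y => by
        simp [hF, i1, i2, Anti.map_mul, Str.map_mul, mul_assoc]⟩
  have hr : RCol F (conv Q i2 i3) (triv Q _) := RCol.of_contr (contr_beta Q) <|
    ind3 (Fac.right _ _ _).1 (Fac.right _ _ _).2 fun a b c =>
      ⟨mulLeft k (T a * γ) ∘ₗ D ∘ₗ mulLeft k b ∘ₗ mulRight k (Q.S c), fun x y => by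
        simp [hF, i3, i2, Anti.map_mul, Str.map_mul, mul_assoc]⟩
  have e1 : ∀ t, F (t * i1 h) = T h * F t := ind3 (by simp)
    (fun s t hs ht => by simp only [add_mul, map_add, mul_add, hs, ht])
    fun a b c => by simp [hF, i1, Anti.map_mul, mul_assoc]
  have e2 : ∀ t, F (i3 h * t) = F t * D (Q.S h) := ind3 (by simp)
    (fun s t hs ht => by simp only [add_mul, map_add, mul_add, hs, ht])
    fun a b c => by simp [hF, i3, Str.map_mul, mul_assoc]
  have h1 := congrArg F (phi_nat Q i1 i2 i3 h)
  rw [show F (phi Q i1 i2 i3 * conv Q i1 (conv Q i2 i3) h) = F (phi Q i1 i2 i3 * i1 h) from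
      ((hr.m2_right i1).comp _ h _).trans (by rw [← conv, conv_triv]),
    show F (conv Q (conv Q i1 i2) i3 h * phi Q i1 i2 i3) = F (i3 h * phi Q i1 i2 i3) from
      ((hl.m2_left i3).comp _ h _).trans (by rw [← conv, triv_conv]), e1, e2, phi_std3] at h1
  exact h1

theorem mate_alpha (hγ : Contr Q (sand T D γ)) : mate Q D T γ * D Q.alpha = γ := by
  set F : H ⊗[k] (H ⊗[k] (H ⊗[k] H)) →ₗ[k] C :=
    m2 (mulRight k γ ∘ₗ T) (D ∘ₗ m2 (mulRight k Q.beta) (m2 Q.S (mulLeft k Q.alpha))) with hF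
  set i1 : H →ₗ[k] H ⊗[k] (H ⊗[k] (H ⊗[k] H)) := sL k H _
  set i2 : H →ₗ[k] H ⊗[k] (H ⊗[k] (H ⊗[k] H)) := sR H (sL k H _)
  set i3 : H →ₗ[k] H ⊗[k] (H ⊗[k] (H ⊗[k] H)) := sR H (sR H (sL k H _))
  set i4 : H →ₗ[k] H ⊗[k] (H ⊗[k] (H ⊗[k] H)) := sR H (sR H (sR H LinearMap.id))
  have hl : LCol F (conv Q i1 i2) (triv Q _) := LCol.of_contr hγ <|
    ind4 (Fac.left _ _ _).1 (Fac.left _ _ _).2 fun a b c d =>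
      ⟨mulLeft k (T a) ∘ₗ mulRight k (D (b * Q.beta * Q.S c * Q.alpha * d)), fun x y => by
        simp [hF, i1, i2, Anti.map_mul, Str.map_mul, mul_assoc]⟩
  have hr : RCol F (conv Q i2 i3) (triv Q _) := RCol.of_contr (contr_beta Q) <|
    ind4 (Fac.right _ _ _).1 (Fac.right _ _ _).2 fun a b c d =>
      ⟨mulLeft k (T a * γ) ∘ₗ D ∘ₗ mulLeft k b ∘ₗ mulRight k (Q.S c * Q.alpha * d), fun x y => by
        simp [hF, i3, i2, Anti.map_mul, Str.map_mul, mul_assoc]⟩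
  have hl' : LCol F (conv Q i3 i4) (triv Q _) := LCol.of_contr (contr_alpha Q) <|
    ind4 (Fac.left _ _ _).1 (Fac.left _ _ _).2 fun a b c d =>
      ⟨mulLeft k (T a * γ) ∘ₗ D ∘ₗ mulLeft k (b * Q.beta * Q.S c) ∘ₗ mulRight k d, fun x y => by
        simp [hF, i3, i4, Anti.map_mul, Str.map_mul, mul_assoc]⟩
  have hp := pentagon Q i1 i2 i3 i4
  have h1 : phi Q i1 i2 (conv Q i3 i4) * (ph Q i2 i3 i4 * ph Q i1 (conv Q i2 i3) i4) =
      ph Q (conv Q i1 i2) i3 i4 * phi Q i1 i2 i3 := by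
    calc _ = phi Q i1 i2 (conv Q i3 i4) *
          (ph Q i2 i3 i4 * (ph Q i1 (conv Q i2 i3) i4 * ph Q i1 i2 i3)) * phi Q i1 i2 i3 := by
          simp only [mul_assoc, ph_mul_phi, mul_one]
      _ = _ := by rw [hp]; simp only [mul_assoc, phi_mul_ph_mul]
  have h2 := congrArg F h1
  have e1 : F (phi Q i1 i2 (conv Q i3 i4) * (ph Q i2 i3 i4 * ph Q i1 (conv Q i2 i3) i4)) = γ := by
    rw [show F (phi Q i1 i2 (conv Q i3 i4) * _) = _ from ((hl'.m2_right i2).m2_right i1) _ _,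
      ← phi, phi_triv_right, one_mul,
      show F (ph Q i2 i3 i4 * ph Q i1 (conv Q i2 i3) i4) = _ from
        ((hr.m2_left i4).m2_right i1) _ _, ← ph, ph_triv_mid, mul_one]
    have e : ∀ t, F (m2 i2 (m2 i3 i4) t) = γ * D (m2 (mulRight k Q.beta)
        (m2 Q.S (mulLeft k Q.alpha)) t) := ind3 (by simp)
      (fun s t hs ht => by simp only [LinearMap.map_add, mul_add, hs, ht])
      (fun a b c => by simp [hF, i2, i3, i4, Anti.map_one])
    rw [ph, e, show m2 (mulRight k Q.beta) (m2 Q.S (mulLeft k Q.alpha)) Q.Phi = 1 from ?_,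
      Str.map_one, mul_one]
    refine Eq.trans ?_ Q.reassoc_antipode
    rw [QuasiHopfAlgebra.Phi]
    generalize (Q.reassoc : H ⊗[k] (H ⊗[k] H)) = t
    induction t using ind3 with
    | h0 => simp only [LinearMap.map_zero, LinearMap.zero_apply, mul_zero, zero_mul,
          TensorProduct.zero_tmul, TensorProduct.tmul_zero]
    | ha s t hs ht => simp only [LinearMap.map_add, hs, ht]
    | h a b c => simp [sw3_tmul, mul_assoc, QuasiHopfAlgebra.S]
  have e2 : F (ph Q (conv Q i1 i2) i3 i4 * phi Q i1 i2 i3) = mate Q D T γ * D Q.alpha := by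
    rw [show F (ph Q (conv Q i1 i2) i3 i4 * _) = _ from (hl.m2_left _) _ _, ← ph, ph_triv_left,
      one_mul, phi, mate]
    generalize Q.PhiInv = t
    induction t using ind3 with
    | h0 => simp only [LinearMap.map_zero, LinearMap.zero_apply, mul_zero, zero_mul,
          TensorProduct.zero_tmul, TensorProduct.tmul_zero]
    | ha s t hs ht => simp only [LinearMap.map_add, add_mul, hs, ht]
    | h a b c => simp [hF, i1, i2, i3, Str.map_mul, mul_assoc]
  rw [← e2, ← h2, e1]

/-- An intertwiner is determined by its product with `D(α)`. -/
theorem mate_of_intertwine {f : C} (hf : ∀ h, T h * f = f * D (Q.S h)) :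
    mate Q D T (f * D Q.alpha) = f := by
  have : mate Q D T (f * D Q.alpha) = f * D (m2 Q.S (mulLeft k Q.alpha ∘ₗ
      m2 (mulRight k Q.beta) Q.S) Q.PhiInv) := by
    rw [mate]
    generalize Q.PhiInv = t
    induction t using ind3 with
    | h0 => simp only [LinearMap.map_zero, LinearMap.zero_apply, mul_zero, zero_mul,
          TensorProduct.zero_tmul, TensorProduct.tmul_zero]
    | ha s t hs ht => simp only [LinearMap.map_add, mul_add, hs, ht]
    | h a b c =>
      simp only [m2_tmul, LinearMap.comp_apply, LinearMap.mulRight_apply, LinearMap.mulLeft_apply,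
        Str.map_mul]
      rw [← mul_assoc (T a), hf]
      simp only [mul_assoc]
  rw [this, show m2 Q.S (mulLeft k Q.alpha ∘ₗ m2 (mulRight k Q.beta) Q.S) Q.PhiInv = 1 from ?_,
    Str.map_one, mul_one]
  refine Eq.trans ?_ Q.reassoc_inv_antipode
  rw [QuasiHopfAlgebra.PhiInv]
  generalize ((Q.reassoc⁻¹ : (H ⊗[k] (H ⊗[k] H))ˣ) : H ⊗[k] (H ⊗[k] H)) = t
  induction t using ind3 with
  | h0 => simp only [LinearMap.map_zero, LinearMap.zero_apply, mul_zero, zero_mul,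
        TensorProduct.zero_tmul, TensorProduct.tmul_zero]
  | ha s t hs ht => simp only [LinearMap.map_add, hs, ht]
  | h a b c => simp [sw3_tmul, mul_assoc, QuasiHopfAlgebra.S]

end Rigidity
end Contractions

section Passing

variable {k H A P P' X : Type*} [Field k] [Ring H] [Algebra k H] [Ring A] [Algebra k A]
  [AddCommGroup X] [Module k X] [AddCommGroup P] [Module k P] [AddCommGroup P'] [Module k P']
  (Q : QuasiHopfAlgebra k H)

/-- Multiplication by `p` carries the strand `u` to the strand `u'`. -/
class Ps (p : A) (u u' : P →ₗ[k] A) : Prop where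
  pass : ∀ a, p * u a = u' a * p

instance (p : A) (u u' : P →ₗ[k] A) (v v' : P' →ₗ[k] A) [Ps p u u'] [Ps p v v'] :
    Ps p (m2 u v) (m2 u' v') where
  pass s := by
    induction s with
    | zero => simp only [LinearMap.map_zero, LinearMap.zero_apply, mul_zero, zero_mul,
          TensorProduct.zero_tmul, TensorProduct.tmul_zero]
    | add s t hs ht => simp only [LinearMap.map_add, add_mul, mul_add, hs, ht]
    | tmul a b => rw [m2_tmul, m2_tmul, ← mul_assoc, Ps.pass (u' := u') a, mul_assoc,
      Ps.pass (u' := v') b, mul_assoc]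

instance (p : A) (u u' v v' : H →ₗ[k] A) [Ps p u u'] [Ps p v v'] :
    Ps p (conv Q u v) (conv Q u' v') := ⟨fun _ => Ps.pass (u := m2 u v) (u' := m2 u' v') _⟩

instance (p : A) : Ps p (triv Q A) (triv Q A) := ⟨fun _ => (Algebra.commutes _ _).symm⟩

instance (p q : A) (u : P →ₗ[k] A) [Ps p u u] [Ps q u u] : Ps (p * q) u u :=
  ⟨fun a => by rw [mul_assoc, Ps.pass (p := q) (u' := u) a, ← mul_assoc,
    Ps.pass (p := p) (u' := u) a, mul_assoc]⟩

variable (u v w : H →ₗ[k] A)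

instance (z : P →ₗ[k] A) [Cm u z] [Cm v z] [Cm w z] : Ps (ph Q u v w) z z :=
  ⟨fun a => Cm.comm (u := m2 u (m2 v w)) _ a⟩

instance (z : P →ₗ[k] A) [Cm u z] [Cm v z] [Cm w z] : Ps (phi Q u v w) z z :=
  ⟨fun a => Cm.comm (u := m2 u (m2 v w)) _ a⟩

instance [Str u] [Str v] [Str w] [Cm u v] [Cm u w] [Cm v w] :
    Ps (ph Q u v w) (conv Q (conv Q u v) w) (conv Q u (conv Q v w)) := ⟨ph_nat Q u v w⟩

instance [Str u] [Str v] [Str w] [Cm u v] [Cm u w] [Cm v w] :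
    Ps (phi Q u v w) (conv Q u (conv Q v w)) (conv Q (conv Q u v) w) := ⟨phi_nat Q u v w⟩

variable {u v w} {u' v' w' : H →ₗ[k] A}

theorem pass_ph (p : A) [Ps p u u'] [Ps p v v'] [Ps p w w'] :
    p * ph Q u v w = ph Q u' v' w' * p := Ps.pass (u := m2 u (m2 v w)) _

theorem pass_phi (p : A) [Ps p u u'] [Ps p v v'] [Ps p w w'] :
    p * phi Q u v w = phi Q u' v' w' * p := Ps.pass (u := m2 u (m2 v w)) _

theorem pass_ph_mul (p t : A) [Ps p u u'] [Ps p v v'] [Ps p w w'] :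
    p * (ph Q u v w * t) = ph Q u' v' w' * (p * t) := by
  rw [← mul_assoc, pass_ph Q (u' := u') (v' := v') (w' := w'), mul_assoc]

theorem pass_phi_mul (p t : A) [Ps p u u'] [Ps p v v'] [Ps p w w'] :
    p * (phi Q u v w * t) = phi Q u' v' w' * (p * t) := by
  rw [← mul_assoc, pass_phi Q (u' := u') (v' := v') (w' := w'), mul_assoc]

variable {F : A →ₗ[k] X}

theorem LCol.rfl {u : P →ₗ[k] A} : LCol F u u := fun _ _ => Eq.refl _
theorem RCol.rfl {u : P →ₗ[k] A} : RCol F u u := fun _ _ => Eq.refl _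

theorem LCol.m2 {u u' : P →ₗ[k] A} {v v' : P' →ₗ[k] A} (h : LCol F u u') (h' : LCol F v v')
    [Cm u' v] [Cm u' v'] : LCol F (m2 u v) (m2 u' v') :=
  fun s t => (h.m2_left v s t).trans (h'.m2_right u' s t)

theorem RCol.m2 {u u' : P →ₗ[k] A} {v v' : P' →ₗ[k] A} (h : RCol F u u') (h' : RCol F v v')
    [Cm u v'] [Cm u' v'] : RCol F (m2 u v) (m2 u' v') :=
  fun s t => (h'.m2_right u s t).trans (h.m2_left v' s t)

theorem LCol.conv (h : LCol F u u') (h' : LCol F v v') [Cm u' v] [Cm u' v'] :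
    LCol F (conv Q u v) (conv Q u' v') := (h.m2 h').comp _

theorem RCol.conv (h : RCol F u u') (h' : RCol F v v') [Cm u v'] [Cm u' v'] :
    RCol F (conv Q u v) (conv Q u' v') := (h.m2 h').comp _

section
variable [Cm u' v] [Cm u' v'] [Cm u' w] [Cm u' w'] [Cm v' w] [Cm v' w']

theorem LCol.ph (h1 : LCol F u u') (h2 : LCol F v v') (h3 : LCol F w w') (t : A) :
    F (ph Q u v w * t) = F (ph Q u' v' w' * t) := h1.m2 (h2.m2 h3) _ t

theorem LCol.phi (h1 : LCol F u u') (h2 : LCol F v v') (h3 : LCol F w w') (t : A) :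
    F (phi Q u v w * t) = F (phi Q u' v' w' * t) := h1.m2 (h2.m2 h3) _ t
end

section
variable [Cm u v'] [Cm u' v'] [Cm u w'] [Cm u' w'] [Cm v w'] [Cm v' w']

theorem RCol.ph (h1 : RCol F u u') (h2 : RCol F v v') (h3 : RCol F w w') (t : A) :
    F (t * ph Q u v w) = F (t * ph Q u' v' w') := h1.m2 (h2.m2 h3) _ t

theorem RCol.phi (h1 : RCol F u u') (h2 : RCol F v v') (h3 : RCol F w w') (t : A) :
    F (t * phi Q u v w) = F (t * phi Q u' v' w') := h1.m2 (h2.m2 h3) _ t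
end

theorem LCol.past {u u' : P →ₗ[k] A} (h : LCol F u u') (p : A) [Ps p u u] [Ps p u' u'] :
    LCol (F ∘ₗ LinearMap.mulLeft k p) u u' :=
  fun a t => h.behind p Ps.pass Ps.pass a t

theorem RCol.past {u u' : P →ₗ[k] A} (h : RCol F u u') (p : A) [Ps p u u] [Ps p u' u'] :
    RCol (F ∘ₗ LinearMap.mulRight k p) u u' := fun a t => by
  simpa [mul_assoc] using h.behind p Ps.pass Ps.pass a t

end Passing

section Zigzag

variable {k H A X : Type*} [Field k] [Ring H] [Algebra k H] [Ring A] [Algebra k A]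
  [AddCommGroup X] [Module k X] (Q : QuasiHopfAlgebra k H) {F : A →ₗ[k] X}
  (u v w z : H →ₗ[k] A) [Str u] [Str v] [Str w] [Str z] [Cm u v] [Cm u w] [Cm u z]
  [Cm v w] [Cm v z] [Cm w z]

theorem pentagon_ph_phi_left : phi Q u v (conv Q w z) * ph Q v w z =
    ph Q (conv Q u v) w z * (phi Q u v w * phi Q u (conv Q v w) z) := by
  have h := congrArg (fun x => phi Q u v (conv Q w z) * x * (phi Q u v w * phi Q u (conv Q v w) z))
    (pentagon Q u v w z)
  simpa [mul_assoc] using h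

theorem pentagon_phi : phi Q u v w * (phi Q u (conv Q v w) z * phi Q v w z) =
    phi Q (conv Q u v) w z * phi Q u v (conv Q w z) := by
  have h := congrArg (fun x => phi Q u v w * (phi Q u (conv Q v w) z * phi Q v w z) * x *
    (phi Q (conv Q u v) w z * phi Q u v (conv Q w z)))
    (pentagon Q u v w z)
  simpa [mul_assoc] using h.symm

theorem pentagon_ph_phi_mid : ph Q u v w * phi Q (conv Q u v) w z =
    phi Q u (conv Q v w) z * (phi Q v w z * ph Q u v (conv Q w z)) := by
  have h := congrArg (fun x => phi Q u (conv Q v w) z * (phi Q v w z * x) * phi Q (conv Q u v) w z)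
    (pentagon Q u v w z)
  simpa [mul_assoc] using h

theorem pentagon_ph_ph : ph Q u (conv Q v w) z * ph Q u v w =
    phi Q v w z * (ph Q u v (conv Q w z) * ph Q (conv Q u v) w z) := by
  have h := congrArg (fun x => phi Q v w z * x) (pentagon Q u v w z)
  simpa [mul_assoc] using h

theorem pentagon_ph_phi_phi : ph Q u v w * (phi Q (conv Q u v) w z * phi Q u v (conv Q w z)) =
    phi Q u (conv Q v w) z * phi Q v w z := by
  rw [← pentagon_phi, ph_mul_phi_mul]

theorem pentagon_ph_phi_right : ph Q (conv Q u v) w z * phi Q u v w =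
    phi Q u v (conv Q w z) * (ph Q v w z * ph Q u (conv Q v w) z) := by
  have h := congrArg (fun x => phi Q u v (conv Q w z) * x * phi Q u v w) (pentagon Q u v w z)
  simpa [mul_assoc] using h.symm

theorem pentagon_phi_ph : phi Q v w z * ph Q u v (conv Q w z) =
    ph Q u (conv Q v w) z * (ph Q u v w * phi Q (conv Q u v) w z) := by
  have h := congrArg (fun x => phi Q v w z * x * phi Q (conv Q u v) w z) (pentagon Q u v w z)
  simpa [mul_assoc] using h.symm

attribute [local instance] Cm.symm

variable (a b c d e f : H →ₗ[k] A) [Str a] [Str b] [Str c] [Str d] [Str e] [Str f]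
  [Cm a b] [Cm a c] [Cm a d] [Cm a e] [Cm a f] [Cm b c] [Cm b d] [Cm b e] [Cm b f]
  [Cm c d] [Cm c e] [Cm c f] [Cm d e] [Cm d f] [Cm e f]

theorem zigzag_left (hbc : LCol F (conv Q b c) (triv Q A)) (had : LCol F (conv Q a d) (triv Q A))
    (hcf : RCol F (conv Q c f) (triv Q A)) (hde : RCol F (conv Q d e) (triv Q A)) :
    F (ph Q a b c * (phi Q (conv Q a b) c d * (phi Q (conv Q a b) (conv Q c d) (conv Q e f) *
      (ph Q (conv Q c d) e f * phi Q c d e)))) = F (phi Q a d e * phi Q b c f) := by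
  have had' : LCol F (conv Q (conv Q a (conv Q b c)) d) (triv Q A) := fun h t => by
    rw [(LCol.rfl.conv Q hbc).conv Q LCol.rfl, conv_triv, had]
  have hbc' : LCol F (conv Q a (conv Q b c)) a := fun h t => by
    rw [LCol.rfl.conv Q hbc, conv_triv]
  calc _ = F (ph Q a b c * (phi Q (conv Q a b) c d * (ph Q (conv Q (conv Q a b) (conv Q c d)) e f *
        (phi Q (conv Q a b) (conv Q c d) e * (phi Q c d e *
          phi Q (conv Q a b) (conv Q c (conv Q d e)) f))))) := by
        rw [pass_phi Q (u' := conv Q a b) (v' := conv Q (conv Q c d) e) (w' := f) (phi Q c d e),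
          ← mul_assoc (phi Q (conv Q a b) (conv Q c d) (conv Q e f)), pentagon_ph_phi_left]
        simp only [mul_assoc]
    _ = F (ph Q (conv Q (conv Q a (conv Q b c)) d) e f * (ph Q a b c * (phi Q (conv Q a b) c d * (
        (phi Q (conv Q a b) (conv Q c d) e * (phi Q c d e *
          phi Q (conv Q a b) c f)))))) := by
        simp only [← mul_assoc]
        rw [RCol.rfl.phi Q (RCol.rfl.conv Q hde) RCol.rfl, conv_triv]
        simp only [mul_assoc]
        rw [pass_ph_mul Q (u' := conv Q (conv Q (conv Q a b) c) d) (v' := e) (w' := f)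
            (phi Q (conv Q a b) c d),
          pass_ph_mul Q (u' := conv Q (conv Q a (conv Q b c)) d) (v' := e) (w' := f) (ph Q a b c)]
    _ = F (ph Q a b c * (phi Q (conv Q (conv Q a b) c) d e * (phi Q (conv Q a b) c (conv Q d e) *
          phi Q (conv Q a b) c f))) := by
        rw [had'.ph Q LCol.rfl LCol.rfl, ph_triv_left, one_mul,
          ← mul_assoc (phi Q (conv Q (conv Q a b) c) d e), ← pentagon_phi]
        simp only [mul_assoc]
    _ = F (phi Q (conv Q a (conv Q b c)) d e * (ph Q a b c * phi Q (conv Q a b) c f)) := by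
        simp only [← mul_assoc]
        refine (RCol.rfl.phi Q RCol.rfl (hde.past (phi Q (conv Q a b) c f)) _).trans ?_
        rw [phi_triv_right, mul_one,
          pass_phi Q (u' := conv Q a (conv Q b c)) (v' := d) (w' := e) (ph Q a b c)]
        rfl
    _ = F (phi Q a d e * phi Q b c f) := by
        rw [hbc'.phi Q LCol.rfl LCol.rfl, pentagon_ph_phi_mid]
        refine (LCol.rfl.phi Q (hbc.past (phi Q a d e)) LCol.rfl _).trans ?_
        rw [phi_triv_mid, one_mul, LinearMap.comp_apply, LinearMap.mulLeft_apply, ← mul_assoc,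
          RCol.rfl.ph Q RCol.rfl hcf, ph_triv_right, mul_one]

theorem zigzag_right (hbc : RCol F (conv Q b c) (triv Q A)) (had : RCol F (conv Q a d) (triv Q A))
    (hcf : LCol F (conv Q c f) (triv Q A)) (hde : LCol F (conv Q d e) (triv Q A)) :
    F (ph Q c d e * (phi Q (conv Q c d) e f * (ph Q (conv Q a b) (conv Q c d) (conv Q e f) *
      (ph Q (conv Q a b) c d * phi Q a b c)))) = F (ph Q b c f * ph Q a d e) := by
  have hde' : LCol F (conv Q (conv Q d e) f) f := fun h t => by
    rw [hde.conv Q LCol.rfl, triv_conv]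
  have hbc' : RCol F (conv Q a (conv Q b c)) a := fun h t => by
    rw [RCol.rfl.conv Q hbc, conv_triv]
  calc _ = F (phi Q c (conv Q d e) f * (phi Q d e f * (ph Q (conv Q a b) c (conv Q d (conv Q e f)) *
        (ph Q (conv Q (conv Q a b) c) d (conv Q e f) * phi Q a b c)))) := by
        rw [← mul_assoc (ph Q (conv Q a b) (conv Q c d) (conv Q e f)), pentagon_ph_ph,
          ← mul_assoc (phi Q c (conv Q d e) f), ← pentagon_ph_phi_phi]
        simp only [mul_assoc]
    _ = F (phi Q c (conv Q d e) f * (ph Q (conv Q a b) c (conv Q (conv Q d e) f) * (phi Q d e f *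
        (phi Q a b c * ph Q (conv Q a (conv Q b c)) d (conv Q e f))))) := by
        rw [pass_ph_mul Q (u' := conv Q a b) (v' := c) (w' := conv Q (conv Q d e) f) (phi Q d e f),
          pass_ph Q (u' := conv Q (conv Q a b) c) (v' := d) (w' := conv Q e f) (phi Q a b c)]
    _ = F ((ph Q (conv Q a b) c f * phi Q a b c) * (phi Q d e f * ph Q a d (conv Q e f))) := by
        rw [LCol.rfl.phi Q hde LCol.rfl, phi_triv_mid, one_mul, LCol.rfl.ph Q LCol.rfl hde']
        simp only [← mul_assoc]
        rw [hbc'.ph Q RCol.rfl RCol.rfl]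
        simp only [mul_assoc]
        rw [pass_phi_mul Q (u' := a) (v' := b) (w' := c) (phi Q d e f)]
    _ = F (ph Q b c f * (ph Q a (conv Q b c) f * (ph Q a (conv Q d e) f * ph Q a d e))) := by
        rw [pentagon_ph_phi_right, pentagon_phi_ph, mul_assoc, LCol.rfl.phi Q LCol.rfl hcf,
          phi_triv_right, one_mul]
        simp only [← mul_assoc]
        rw [had.phi Q RCol.rfl RCol.rfl, phi_triv_left, mul_one]
    _ = F (ph Q b c f * (ph Q a (conv Q d e) f * ph Q a d e)) := by
        rw [← mul_assoc]
        refine (RCol.rfl.ph Q (hbc.past (ph Q a (conv Q d e) f * ph Q a d e)) RCol.rfl _).trans ?_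
        rw [ph_triv_mid, mul_one]
        rfl
    _ = F (ph Q b c f * ph Q a d e) := by
        refine (LCol.rfl.ph Q (hde.past (ph Q b c f)) LCol.rfl _).trans ?_
        rw [ph_triv_mid, one_mul]
        rfl

end Zigzag

section Comate

variable {k H C : Type*} [Field k] [Ring H] [Algebra k H] [Ring C] [Algebra k C]
  (Q : QuasiHopfAlgebra k H) {D T : H →ₗ[k] C} [Str D] [Anti T] {δ : C}

theorem comate_intertwine (hδ : Contr Q (sand D T δ)) (h : H) :
    comate Q D T δ * T h = D (Q.S h) * comate Q D T δ := by
  set F : H ⊗[k] (H ⊗[k] H) →ₗ[k] C :=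
    m2 (D ∘ₗ mulRight k Q.alpha ∘ₗ Q.S) (m2 (mulRight k δ ∘ₗ D) T) with hF
  set i1 : H →ₗ[k] H ⊗[k] (H ⊗[k] H) := sL k H (H ⊗[k] H)
  set i2 : H →ₗ[k] H ⊗[k] (H ⊗[k] H) := sR H (sL k H H)
  set i3 : H →ₗ[k] H ⊗[k] (H ⊗[k] H) := sR H (sR H LinearMap.id)
  have hr : RCol F (conv Q i2 i3) (triv Q _) := RCol.of_contr hδ <|
    ind3 (Fac.right _ _ _).1 (Fac.right _ _ _).2 fun a b c =>
      ⟨mulLeft k (D (Q.S a * Q.alpha * b)) ∘ₗ mulRight k (T c), fun x y => by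
        simp [hF, i3, i2, Anti.map_mul, Str.map_mul, mul_assoc]⟩
  have hl : LCol F (conv Q i1 i2) (triv Q _) := LCol.of_contr (contr_alpha Q) <|
    ind3 (Fac.left _ _ _).1 (Fac.left _ _ _).2 fun a b c =>
      ⟨mulRight k (δ * T c) ∘ₗ D ∘ₗ mulLeft k (Q.S a) ∘ₗ mulRight k b, fun x y => by
        simp [hF, i1, i2, Anti.map_mul, Str.map_mul, mul_assoc]⟩
  have e1 : ∀ t, F (t * i1 h) = D (Q.S h) * F t := ind3 (by simp)
    (fun s t hs ht => by simp only [add_mul, map_add, mul_add, hs, ht])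
    fun a b c => by simp [hF, i1, Str.map_mul, mul_assoc]
  have e2 : ∀ t, F (i3 h * t) = F t * T h := ind3 (by simp)
    (fun s t hs ht => by simp only [add_mul, map_add, mul_add, hs, ht])
    fun a b c => by simp [hF, i3, Anti.map_mul, mul_assoc]
  have h1 := congrArg F (phi_nat Q i1 i2 i3 h)
  rw [show F (phi Q i1 i2 i3 * conv Q i1 (conv Q i2 i3) h) = F (phi Q i1 i2 i3 * i1 h) from
      ((hr.m2_right i1).comp _ h _).trans (by rw [← conv, conv_triv]),
    show F (conv Q (conv Q i1 i2) i3 h * phi Q i1 i2 i3) = F (i3 h * phi Q i1 i2 i3) from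
      ((hl.m2_left i3).comp _ h _).trans (by rw [← conv, triv_conv]), e1, e2, phi_std3] at h1
  exact h1.symm

theorem beta_comate (hδ : Contr Q (sand D T δ)) : D Q.beta * comate Q D T δ = δ := by
  set F : H ⊗[k] (H ⊗[k] (H ⊗[k] H)) →ₗ[k] C :=
    m2 (D ∘ₗ mulRight k Q.beta) (m2 (D ∘ₗ mulRight k Q.alpha ∘ₗ Q.S)
      (m2 (mulRight k δ ∘ₗ D) T)) with hF
  set i1 : H →ₗ[k] H ⊗[k] (H ⊗[k] (H ⊗[k] H)) := sL k H _
  set i2 : H →ₗ[k] H ⊗[k] (H ⊗[k] (H ⊗[k] H)) := sR H (sL k H _)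
  set i3 : H →ₗ[k] H ⊗[k] (H ⊗[k] (H ⊗[k] H)) := sR H (sR H (sL k H _))
  set i4 : H →ₗ[k] H ⊗[k] (H ⊗[k] (H ⊗[k] H)) := sR H (sR H (sR H LinearMap.id))
  have hr : RCol F (conv Q i3 i4) (triv Q _) := RCol.of_contr hδ <|
    ind4 (Fac.right _ _ _).1 (Fac.right _ _ _).2 fun a b c d =>
      ⟨mulLeft k (D (a * Q.beta * Q.S b * Q.alpha * c)) ∘ₗ mulRight k (T d), fun x y => by
        simp [hF, i3, i4, Anti.map_mul, Str.map_mul, mul_assoc]⟩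
  have hl : LCol F (conv Q i2 i3) (triv Q _) := LCol.of_contr (contr_alpha Q) <|
    ind4 (Fac.left _ _ _).1 (Fac.left _ _ _).2 fun a b c d =>
      ⟨mulRight k (δ * T d) ∘ₗ D ∘ₗ mulLeft k (a * Q.beta * Q.S b) ∘ₗ mulRight k c, fun x y => by
        simp [hF, i3, i2, Anti.map_mul, Str.map_mul, mul_assoc]⟩
  have hr' : RCol F (conv Q i1 i2) (triv Q _) := RCol.of_contr (contr_beta Q) <|
    ind4 (Fac.right _ _ _).1 (Fac.right _ _ _).2 fun a b c d =>
      ⟨mulRight k (δ * T d) ∘ₗ D ∘ₗ mulLeft k a ∘ₗ mulRight k (Q.S b * Q.alpha * c),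
        fun x y => by simp [hF, i1, i2, Anti.map_mul, Str.map_mul, mul_assoc]⟩
  have h1 : phi Q i2 i3 i4 * ph Q i1 i2 (conv Q i3 i4) =
      ph Q i1 (conv Q i2 i3) i4 * (ph Q i1 i2 i3 * phi Q (conv Q i1 i2) i3 i4) :=
    pentagon_phi_ph Q i1 i2 i3 i4
  have h2 := congrArg F h1
  rw [RCol.rfl.ph Q RCol.rfl hr, ph_triv_right, mul_one, LCol.rfl.ph Q hl LCol.rfl, ph_triv_mid,
    one_mul, hr'.phi Q RCol.rfl RCol.rfl, phi_triv_left, mul_one] at h2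
  have e1 : F (phi Q i2 i3 i4) = D Q.beta * comate Q D T δ := by
    rw [phi, comate]
    generalize Q.PhiInv = t
    induction t using ind3 with
    | h0 => simp only [LinearMap.map_zero, LinearMap.zero_apply, mul_zero, zero_mul,
          TensorProduct.zero_tmul, TensorProduct.tmul_zero]
    | ha s t hs ht => simp only [LinearMap.map_add, mul_add, hs, ht]
    | h a b c => simp [hF, i2, i3, i4, Str.map_mul, mul_assoc]
  have e : ∀ t, F (m2 i1 (m2 i2 i3) t) = D (m2 (mulRight k Q.beta)
      (m2 Q.S (mulLeft k Q.alpha)) t) * δ := ind3 (by simp)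
    (fun s t hs ht => by simp only [LinearMap.map_add, add_mul, hs, ht])
    (fun a b c => by simp [hF, i2, i3, i1, Anti.map_one, Str.map_mul, mul_assoc])
  rw [← e1, h2, ph, e, show m2 (mulRight k Q.beta) (m2 Q.S (mulLeft k Q.alpha)) Q.Phi = 1 from ?_,
    Str.map_one, one_mul]
  refine Eq.trans ?_ Q.reassoc_antipode
  rw [QuasiHopfAlgebra.Phi]
  generalize (Q.reassoc : H ⊗[k] (H ⊗[k] H)) = t
  induction t using ind3 with
  | h0 => simp only [LinearMap.map_zero, LinearMap.zero_apply, mul_zero, zero_mul,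
        TensorProduct.zero_tmul, TensorProduct.tmul_zero]
  | ha s t hs ht => simp only [LinearMap.map_add, hs, ht]
  | h a b c => simp [sw3_tmul, mul_assoc, QuasiHopfAlgebra.S]

end Comate

section Maps

variable {k H A A' B P X Y : Type*} [Field k] [Ring H] [Algebra k H] [Ring A] [Algebra k A]
  [Ring A'] [Algebra k A'] [Ring B] [Algebra k B]
  [AddCommGroup X] [Module k X] [AddCommGroup Y] [Module k Y] [Ring P] [Algebra k P]
  (Q : QuasiHopfAlgebra k H)

theorem LCol.map_left {F : A →ₗ[k] X} {u u' : P →ₗ[k] A} (h : LCol F u u') (G : B →ₗ[k] Y) :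
    LCol (TensorProduct.map F G) (sL k A B ∘ₗ u) (sL k A B ∘ₗ u') := by
  intro a t
  induction t with
  | zero => simp only [LinearMap.map_zero, LinearMap.zero_apply, mul_zero, zero_mul,
        TensorProduct.zero_tmul, TensorProduct.tmul_zero]
  | add s t hs ht => simp only [LinearMap.map_add, mul_add, hs, ht]
  | tmul x y => simp [h a x]

theorem RCol.map_left {F : A →ₗ[k] X} {u u' : P →ₗ[k] A} (h : RCol F u u') (G : B →ₗ[k] Y) :
    RCol (TensorProduct.map F G) (sL k A B ∘ₗ u) (sL k A B ∘ₗ u') := by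
  intro a t
  induction t with
  | zero => simp only [LinearMap.map_zero, LinearMap.zero_apply, mul_zero, zero_mul,
        TensorProduct.zero_tmul, TensorProduct.tmul_zero]
  | add s t hs ht => simp only [LinearMap.map_add, add_mul, hs, ht]
  | tmul x y => simp [h a x]

theorem LCol.map_right {F : A →ₗ[k] X} {u u' : P →ₗ[k] A} (h : LCol F u u') (G : B →ₗ[k] Y) :
    LCol (TensorProduct.map G F) (sR B u) (sR B u') := by
  intro a t
  induction t with
  | zero => simp only [LinearMap.map_zero, LinearMap.zero_apply, mul_zero, zero_mul,
        TensorProduct.zero_tmul, TensorProduct.tmul_zero]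
  | add s t hs ht => simp only [LinearMap.map_add, mul_add, hs, ht]
  | tmul x y => simp [h a y]

theorem RCol.map_right {F : A →ₗ[k] X} {u u' : P →ₗ[k] A} (h : RCol F u u') (G : B →ₗ[k] Y) :
    RCol (TensorProduct.map G F) (sR B u) (sR B u') := by
  intro a t
  induction t with
  | zero => simp only [LinearMap.map_zero, LinearMap.zero_apply, mul_zero, zero_mul,
        TensorProduct.zero_tmul, TensorProduct.tmul_zero]
  | add s t hs ht => simp only [LinearMap.map_add, add_mul, hs, ht]
  | tmul x y => simp [h a y]

theorem conv_sL (u v : H →ₗ[k] A) : conv Q (sL k A B ∘ₗ u) (sL k A B ∘ₗ v) = sL k A B ∘ₗ conv Q u v :=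
  (comp_conv Q _ _ _).symm

theorem conv_sR (u v : H →ₗ[k] A) : conv Q (sR B u) (sR B v) = sR B (conv Q u v) :=
  (comp_conv Q (Algebra.TensorProduct.includeRight (R := k) (A := B) (B := A)).toLinearMap u v).symm

theorem ph_sR (u v w : H →ₗ[k] A) : ph Q (sR B u) (sR B v) (sR B w) = 1 ⊗ₜ ph Q u v w :=
  (map_ph Q (Algebra.TensorProduct.includeRight (R := k) (A := B) (B := A)).toLinearMap u v w).symm

theorem phi_sR (u v w : H →ₗ[k] A) : phi Q (sR B u) (sR B v) (sR B w) = 1 ⊗ₜ phi Q u v w :=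
  (map_phi Q (Algebra.TensorProduct.includeRight (R := k) (A := B) (B := A)).toLinearMap u v w).symm

theorem ph_sL (u v w : H →ₗ[k] A) :
    ph Q (sL k A B ∘ₗ u) (sL k A B ∘ₗ v) (sL k A B ∘ₗ w) = ph Q u v w ⊗ₜ 1 :=
  (map_ph Q (sL k A B) u v w).symm

theorem phi_sL (u v w : H →ₗ[k] A) :
    phi Q (sL k A B ∘ₗ u) (sL k A B ∘ₗ v) (sL k A B ∘ₗ w) = phi Q u v w ⊗ₜ 1 :=
  (map_phi Q (sL k A B) u v w).symm

theorem triv_sL : sL k A B ∘ₗ triv Q A = triv Q (A ⊗[k] B) := by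
  ext h; simp [Algebra.TensorProduct.algebraMap_apply]

theorem triv_sR : sR B (triv Q A) = triv Q (B ⊗[k] A) := by
  ext h; simp [Algebra.algebraMap_eq_smul_one, Algebra.TensorProduct.one_def]

instance (φ : A →ₗ[k] A') (ψ : B →ₗ[k] P) [Str φ] [Str ψ] : Str (TensorProduct.map φ ψ) where
  map_one := by simp [Algebra.TensorProduct.one_def, Str.map_one]
  map_mul s t := by
    induction s with
    | zero => simp only [LinearMap.map_zero, LinearMap.zero_apply, mul_zero, zero_mul,
          TensorProduct.zero_tmul, TensorProduct.tmul_zero]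
    | add s t hs ht => simp only [LinearMap.map_add, add_mul, hs, ht]
    | tmul a b =>
      induction t with
      | zero => simp only [LinearMap.map_zero, LinearMap.zero_apply, mul_zero, zero_mul,
            TensorProduct.zero_tmul, TensorProduct.tmul_zero]
      | add s t hs ht => simp only [LinearMap.map_add, mul_add, hs, ht]
      | tmul c d => simp [Str.map_mul]

instance {P' : Type*} [Ring P'] [Algebra k P'] (χ : A →ₗ[k] A') (u : P →ₗ[k] A) (v : P' →ₗ[k] A)
    [Str χ] [Cm u v] : Cm (χ ∘ₗ u) (χ ∘ₗ v) :=
  ⟨fun a b => by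
    rw [LinearMap.comp_apply, LinearMap.comp_apply, ← Str.map_mul, Cm.comm a b, Str.map_mul]⟩

theorem m2_tensorOne (u v w z : H →ₗ[k] A) [Str z] (t : H ⊗[k] (H ⊗[k] H)) :
    m2 u (m2 v (m2 w z)) (QuasiHopfAlgebra.tensorOne k H t) = m2 u (m2 v w) t := by
  induction t using ind3 with
  | h0 => simp
  | ha s t hs ht => simp only [map_add, hs, ht]
  | h a b c => simp [QuasiHopfAlgebra.tensorOne, Str.map_one]

theorem m2_comulIdId (u v w z : H →ₗ[k] A) (t : H ⊗[k] (H ⊗[k] H)) :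
    m2 u (m2 v (m2 w z)) (Q.comulIdId t) = m2 (conv Q u v) (m2 w z) t := by
  induction t using ind3 with
  | h0 => simp
  | ha s t hs ht => simp only [map_add, hs, ht]
  | h a b c =>
    change m2 u (m2 v (m2 w z)) (TensorProduct.assoc k _ _ _ (Q.comul a ⊗ₜ (b ⊗ₜ c))) = _
    rw [m2_assoc]; rfl

end Maps

section Twist

variable {k H : Type*} [Field k] [Ring H] [Algebra k H] (Q : QuasiHopfAlgebra k H)

theorem ind22 {M1 M2 M3 M4 : Type*} [AddCommGroup M1] [Module k M1] [AddCommGroup M2] [Module k M2]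
    [AddCommGroup M3] [Module k M3] [AddCommGroup M4] [Module k M4]
    {p : (M1 ⊗[k] M2) ⊗[k] (M3 ⊗[k] M4) → Prop} (h0 : p 0)
    (ha : ∀ s t, p s → p t → p (s + t))
    (h : ∀ a b c d, p ((a ⊗ₜ b) ⊗ₜ (c ⊗ₜ d))) (t : (M1 ⊗[k] M2) ⊗[k] (M3 ⊗[k] M4)) : p t :=
  ind2 h0 ha (fun a => ind2 (by simpa using h0)
    (fun s t hs ht => by simpa [TensorProduct.tmul_add] using ha _ _ hs ht) fun c d =>
      ind2 (p := fun a => p (a ⊗ₜ (c ⊗ₜ d))) (by simpa using h0)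
    (fun s t hs ht => by simpa [TensorProduct.add_tmul] using ha _ _ hs ht)
      (fun a b => h a b c d) a) t

/-- `a ⊗ b ↦ T(b) ⊗ T(a)` -/
noncomputable def flipMap (T : H →ₗ[k] H) : H ⊗[k] H →ₗ[k] H ⊗[k] H :=
  TensorProduct.map T T ∘ₗ (TensorProduct.comm k H H).toLinearMap

@[simp] theorem flipMap_tmul (T : H →ₗ[k] H) (a b : H) : flipMap T (a ⊗ₜ b) = T b ⊗ₜ[k] T a := rfl

theorem flipMap_mul (T : H →ₗ[k] H) [Anti T] (s t : H ⊗[k] H) :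
    flipMap T (s * t) = flipMap T t * flipMap T s := by
  induction s with
  | zero => simp only [LinearMap.map_zero, LinearMap.zero_apply, mul_zero, zero_mul,
        TensorProduct.zero_tmul, TensorProduct.tmul_zero]
  | add s t hs ht => simp only [LinearMap.map_add, add_mul, mul_add, hs, ht]
  | tmul a b =>
    induction t with
    | zero => simp only [LinearMap.map_zero, LinearMap.zero_apply, mul_zero, zero_mul,
          TensorProduct.zero_tmul, TensorProduct.tmul_zero]
    | add s t hs ht => simp only [LinearMap.map_add, add_mul, mul_add, hs, ht]
    | tmul c d => simp [Anti.map_mul]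

theorem SSop_eq : Q.SSop = flipMap Q.S ∘ₗ Q.comul.toLinearMap := rfl

instance : Anti Q.SSop where
  map_one := by simp [SSop_eq, Algebra.TensorProduct.one_def]
  map_mul a b := by simp [SSop_eq, flipMap_mul]

/-- The strands of `(H ⊗ H) ⊗ (H ⊗ H)`. -/
noncomputable abbrev st11 (k H : Type*) [Field k] [Ring H] [Algebra k H] :
    H →ₗ[k] (H ⊗[k] H) ⊗[k] (H ⊗[k] H) := sL k _ _ ∘ₗ sL k H H
noncomputable abbrev st12 (k H : Type*) [Field k] [Ring H] [Algebra k H] :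
    H →ₗ[k] (H ⊗[k] H) ⊗[k] (H ⊗[k] H) := sL k _ _ ∘ₗ sR H LinearMap.id
noncomputable abbrev st21 (k H : Type*) [Field k] [Ring H] [Algebra k H] :
    H →ₗ[k] (H ⊗[k] H) ⊗[k] (H ⊗[k] H) := sR _ (sL k H H)
noncomputable abbrev st22 (k H : Type*) [Field k] [Ring H] [Algebra k H] :
    H →ₗ[k] (H ⊗[k] H) ⊗[k] (H ⊗[k] H) := sR _ (sR H LinearMap.id)

/-- `a ⊗ b ↦ S(a) α b` -/
noncomputable abbrev capS : H ⊗[k] H →ₗ[k] H := sand Q.S LinearMap.id Q.alpha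
/-- `a ⊗ b ↦ a β S(b)` -/
noncomputable abbrev cupS : H ⊗[k] H →ₗ[k] H := sand LinearMap.id Q.S Q.beta

theorem capS_lcol : LCol (capS Q) (conv Q (sL k H H) (sR H LinearMap.id)) (triv Q _) :=
  LCol.of_contr (contr_alpha Q) <| ind2 (Fac.left _ _ _).1 (Fac.left _ _ _).2 fun a b =>
    ⟨mulLeft k (Q.S a) ∘ₗ mulRight k b, fun x y => by simp [mul_assoc]⟩

theorem cupS_rcol : RCol (cupS Q) (conv Q (sL k H H) (sR H LinearMap.id)) (triv Q _) :=
  RCol.of_contr (contr_beta Q) <| ind2 (Fac.right _ _ _).1 (Fac.right _ _ _).2 fun a b =>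
    ⟨mulLeft k a ∘ₗ mulRight k (Q.S b), fun x y => by simp [mul_assoc]⟩

/-- The element `A` on four strands. -/
noncomputable def ael {A : Type*} [Ring A] [Algebra k A] (u v w z : H →ₗ[k] A) : A :=
  ph Q u v w * phi Q (conv Q u v) w z

/-- The element `C` on four strands. -/
noncomputable def cel {A : Type*} [Ring A] [Algebra k A] (u v w z : H →ₗ[k] A) : A :=
  ph Q (conv Q u v) w z * phi Q u v w

theorem gamma_eq : Q.gamma = TensorProduct.map (capS Q) (capS Q)
    (ael Q (st21 k H) (st11 k H) (st12 k H) (st22 k H)) := by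
  have : ∀ t, TensorProduct.map (capS Q) (capS Q)
      (m2 (st21 k H) (m2 (st11 k H) (m2 (st12 k H) (st22 k H))) t) =
      sw4 (fun a b c d => (Q.S b * Q.alpha * c) ⊗ₜ[k] (Q.S a * Q.alpha * d))
    (by constructor <;> intros <;> constructor <;> intros <;>
      simp [add_mul, mul_add, TensorProduct.add_tmul, TensorProduct.tmul_add,
        TensorProduct.smul_tmul']) t :=
    ind4 (by simp) (fun s t hs ht => by simp only [LinearMap.map_add, hs, ht])
      (fun a b c d => by simp [sw4_tmul])
  rw [QuasiHopfAlgebra.gamma, ← this, Str.map_mul, m2_tensorOne, m2_comulIdId]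
  rfl

theorem delta_eq : Q.delta = TensorProduct.map (cupS Q) (cupS Q)
    (cel Q (st11 k H) (st21 k H) (st22 k H) (st12 k H)) := by
  have : ∀ t, TensorProduct.map (cupS Q) (cupS Q)
      (m2 (st11 k H) (m2 (st21 k H) (m2 (st22 k H) (st12 k H))) t) =
      sw4 (fun a b c d => (a * Q.beta * Q.S d) ⊗ₜ[k] (b * Q.beta * Q.S c))
    (by constructor <;> intros <;> constructor <;> intros <;>
      simp [add_mul, mul_add, TensorProduct.add_tmul, TensorProduct.tmul_add,
        TensorProduct.smul_tmul']) t :=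
    ind4 (by simp) (fun s t hs ht => by simp only [LinearMap.map_add, hs, ht])
      (fun a b c d => by simp [sw4_tmul])
  rw [QuasiHopfAlgebra.delta, ← this, Str.map_mul, m2_tensorOne, m2_comulIdId]
  rfl

theorem map_capS_mul (p q : H ⊗[k] H) (t : (H ⊗[k] H) ⊗[k] (H ⊗[k] H)) :
    TensorProduct.map (capS Q) (capS Q)
      (t * (m2 (st21 k H) (st11 k H) p * m2 (st12 k H) (st22 k H) q)) =
    flipMap Q.S p * TensorProduct.map (capS Q) (capS Q) t * q := by
  induction t using ind22 with
  | h0 => simp only [LinearMap.map_zero, LinearMap.zero_apply, mul_zero, zero_mul,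
        TensorProduct.zero_tmul, TensorProduct.tmul_zero]
  | ha s t hs ht => simp only [LinearMap.map_add, add_mul, mul_add, hs, ht]
  | h a b c d =>
    induction p with
    | zero => simp only [LinearMap.map_zero, LinearMap.zero_apply, mul_zero, zero_mul,
          TensorProduct.zero_tmul, TensorProduct.tmul_zero]
    | add s t hs ht => simp only [LinearMap.map_add, add_mul, mul_add, hs, ht]
    | tmul x y =>
      induction q with
      | zero => simp only [LinearMap.map_zero, LinearMap.zero_apply, mul_zero, zero_mul,
            TensorProduct.zero_tmul, TensorProduct.tmul_zero]
      | add s t hs ht => simp only [LinearMap.map_add, add_mul, mul_add, hs, ht]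
      | tmul z w => simp [mul_assoc]

theorem map_cupS_mul (p q : H ⊗[k] H) (t : (H ⊗[k] H) ⊗[k] (H ⊗[k] H)) :
    TensorProduct.map (cupS Q) (cupS Q)
      (m2 (st11 k H) (st21 k H) p * m2 (st22 k H) (st12 k H) q * t) =
    p * TensorProduct.map (cupS Q) (cupS Q) t * flipMap Q.S q := by
  induction t using ind22 with
  | h0 => simp only [LinearMap.map_zero, LinearMap.zero_apply, mul_zero, zero_mul,
        TensorProduct.zero_tmul, TensorProduct.tmul_zero]
  | ha s t hs ht => simp only [LinearMap.map_add, add_mul, mul_add, hs, ht]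
  | h a b c d =>
    induction p with
    | zero => simp only [LinearMap.map_zero, LinearMap.zero_apply, mul_zero, zero_mul,
          TensorProduct.zero_tmul, TensorProduct.tmul_zero]
    | add s t hs ht => simp only [LinearMap.map_add, add_mul, mul_add, hs, ht]
    | tmul x y =>
      induction q with
      | zero => simp only [LinearMap.map_zero, LinearMap.zero_apply, mul_zero, zero_mul,
            TensorProduct.zero_tmul, TensorProduct.tmul_zero]
      | add s t hs ht => simp only [LinearMap.map_add, add_mul, mul_add, hs, ht]
      | tmul z w => simp [mul_assoc]

theorem contr_gamma : Contr Q (sand Q.SSop Q.comul.toLinearMap Q.gamma) := by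
  intro h
  set F := TensorProduct.map (capS Q) (capS Q)
  have e : ∀ t, sand Q.SSop Q.comul.toLinearMap Q.gamma t =
      F (ael Q (st21 k H) (st11 k H) (st12 k H) (st22 k H) *
        m2 (conv Q (st21 k H) (st11 k H)) (conv Q (st12 k H) (st22 k H)) t) :=
    ind2 (by simp) (fun s t hs ht => by simp only [LinearMap.map_add, mul_add, hs, ht]) fun a b => by
      rw [m2_tmul, conv, conv, LinearMap.comp_apply, LinearMap.comp_apply, map_capS_mul,
        ← gamma_eq]
      rfl
  have h1 : LCol F (conv Q (st11 k H) (st12 k H)) (triv Q _) := by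
    have := (capS_lcol Q).map_left (capS Q)
    rwa [triv_sL, ← conv_sL] at this
  have h2 : LCol F (conv Q (st21 k H) (st22 k H)) (triv Q _) := by
    have := (capS_lcol Q).map_right (capS Q)
    rwa [triv_sR, ← conv_sR] at this
  rw [e, e]
  change F (_ * conv Q _ _ h) = _
  rw [ael, mul_assoc, Ps.pass (p := phi Q _ _ _)
      (u' := conv Q (conv Q (conv Q (st21 k H) (st11 k H)) (st12 k H)) (st22 k H)), ← mul_assoc,
    Ps.pass (p := ph Q (st21 k H) (st11 k H) (st12 k H))
      (u' := conv Q (conv Q (st21 k H) (conv Q (st11 k H) (st12 k H))) (st22 k H)), mul_assoc,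
    (LCol.rfl.conv Q h1).conv Q LCol.rfl, conv_triv, h2]
  simp [Algebra.algebraMap_eq_smul_one, Str.map_one]

theorem contr_delta : Contr Q (sand Q.comul.toLinearMap Q.SSop Q.delta) := by
  intro h
  set F := TensorProduct.map (cupS Q) (cupS Q)
  have e : ∀ t, sand Q.comul.toLinearMap Q.SSop Q.delta t =
      F (m2 (conv Q (st11 k H) (st21 k H)) (conv Q (st22 k H) (st12 k H)) t *
        cel Q (st11 k H) (st21 k H) (st22 k H) (st12 k H)) :=
    ind2 (by simp) (fun s t hs ht => by simp only [LinearMap.map_add, add_mul, hs, ht]) fun a b => by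
      rw [m2_tmul, conv, conv, LinearMap.comp_apply, LinearMap.comp_apply, map_cupS_mul,
        ← delta_eq]
      rfl
  have h1 : RCol F (conv Q (st11 k H) (st12 k H)) (triv Q _) := by
    have := (cupS_rcol Q).map_left (cupS Q)
    rwa [triv_sL, ← conv_sL] at this
  have h2 : RCol F (conv Q (st21 k H) (st22 k H)) (triv Q _) := by
    have := (cupS_rcol Q).map_right (cupS Q)
    rwa [triv_sR, ← conv_sR] at this
  rw [e, e]
  change F (conv Q _ _ h * _) = _
  rw [cel, ← mul_assoc, ← Ps.pass (p := ph Q (conv Q (st11 k H) (st21 k H)) (st22 k H) (st12 k H))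
      (u := conv Q (conv Q (conv Q (st11 k H) (st21 k H)) (st22 k H)) (st12 k H)), mul_assoc,
    ← Ps.pass (p := phi Q (st11 k H) (st21 k H) (st22 k H))
      (u := conv Q (conv Q (st11 k H) (conv Q (st21 k H) (st22 k H))) (st12 k H)), ← mul_assoc,
    (RCol.rfl.conv Q h2).conv Q RCol.rfl, conv_triv, h1]
  simp [Algebra.algebraMap_eq_smul_one, Str.map_one]

theorem f_eq_mate : Q.f = mate Q Q.comul.toLinearMap Q.SSop Q.gamma := by
  rw [QuasiHopfAlgebra.f, mate]
  generalize Q.PhiInv = t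
  induction t using ind3 with
  | h0 => simp only [LinearMap.map_zero, LinearMap.zero_apply, mul_zero, zero_mul,
        TensorProduct.zero_tmul, TensorProduct.tmul_zero]
  | ha s t hs ht => simp only [LinearMap.map_add, hs, ht]
  | h a b c => simp [sw3_tmul, mul_assoc]

theorem g_eq_comate : Q.g = comate Q Q.comul.toLinearMap Q.SSop Q.delta := by
  rw [QuasiHopfAlgebra.g, comate]
  generalize Q.PhiInv = t
  induction t using ind3 with
  | h0 => simp only [LinearMap.map_zero, LinearMap.zero_apply, mul_zero, zero_mul,
        TensorProduct.zero_tmul, TensorProduct.tmul_zero]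
  | ha s t hs ht => simp only [LinearMap.map_add, hs, ht]
  | h a b c => simp [sw3_tmul, mul_assoc]

theorem SSop_mul_f (h : H) : Q.SSop h * Q.f = Q.f * Q.comul (Q.S h) := by
  rw [f_eq_mate]; exact mate_intertwine Q (contr_gamma Q) h

theorem f_mul_alpha : Q.f * Q.comul Q.alpha = Q.gamma := by
  rw [f_eq_mate]; exact mate_alpha Q (contr_gamma Q)

theorem g_mul_SSop (h : H) : Q.g * Q.SSop h = Q.comul (Q.S h) * Q.g := by
  rw [g_eq_comate]; exact comate_intertwine Q (contr_delta Q) h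

theorem beta_mul_g : Q.comul Q.beta * Q.g = Q.delta := by
  rw [g_eq_comate]; exact beta_comate Q (contr_delta Q)

end Twist

section Snake

variable {k H : Type*} [Field k] [Ring H] [Algebra k H] (Q : QuasiHopfAlgebra k H)

/-- The strands of `(H ⊗ (H ⊗ H)) ⊗ (H ⊗ (H ⊗ H))`. -/
noncomputable abbrev tl1 (k H : Type*) [Field k] [Ring H] [Algebra k H] :
    H →ₗ[k] (H ⊗[k] (H ⊗[k] H)) ⊗[k] (H ⊗[k] (H ⊗[k] H)) := sL k _ _ ∘ₗ sL k H (H ⊗[k] H)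
noncomputable abbrev tl2 (k H : Type*) [Field k] [Ring H] [Algebra k H] :
    H →ₗ[k] (H ⊗[k] (H ⊗[k] H)) ⊗[k] (H ⊗[k] (H ⊗[k] H)) := sL k _ _ ∘ₗ sR H (sL k H H)
noncomputable abbrev tl3 (k H : Type*) [Field k] [Ring H] [Algebra k H] :
    H →ₗ[k] (H ⊗[k] (H ⊗[k] H)) ⊗[k] (H ⊗[k] (H ⊗[k] H)) :=
  sL k _ _ ∘ₗ sR H (sR H LinearMap.id)
noncomputable abbrev tr1 (k H : Type*) [Field k] [Ring H] [Algebra k H] :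
    H →ₗ[k] (H ⊗[k] (H ⊗[k] H)) ⊗[k] (H ⊗[k] (H ⊗[k] H)) := sR _ (sL k H (H ⊗[k] H))
noncomputable abbrev tr2 (k H : Type*) [Field k] [Ring H] [Algebra k H] :
    H →ₗ[k] (H ⊗[k] (H ⊗[k] H)) ⊗[k] (H ⊗[k] (H ⊗[k] H)) := sR _ (sR H (sL k H H))
noncomputable abbrev tr3 (k H : Type*) [Field k] [Ring H] [Algebra k H] :
    H →ₗ[k] (H ⊗[k] (H ⊗[k] H)) ⊗[k] (H ⊗[k] (H ⊗[k] H)) := sR _ (sR H (sR H LinearMap.id))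

/-- `a ⊗ b ⊗ c ↦ S(a) α b β S(c)` -/
noncomputable def zagL : H ⊗[k] (H ⊗[k] H) →ₗ[k] H :=
  m2 (mulRight k Q.alpha ∘ₗ Q.S) (m2 (mulRight k Q.beta) Q.S)

/-- `a ⊗ b ⊗ c ↦ a β S(b) α c` -/
noncomputable def zagR : H ⊗[k] (H ⊗[k] H) →ₗ[k] H :=
  m2 (mulRight k Q.beta) (m2 (mulRight k Q.alpha ∘ₗ Q.S) LinearMap.id)

@[simp] theorem zagL_tmul (a b c : H) :
    zagL Q (a ⊗ₜ (b ⊗ₜ c)) = Q.S a * Q.alpha * (b * Q.beta * Q.S c) := rfl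
@[simp] theorem zagR_tmul (a b c : H) :
    zagR Q (a ⊗ₜ (b ⊗ₜ c)) = a * Q.beta * (Q.S b * Q.alpha * c) := rfl

theorem zagL_PhiInv : zagL Q Q.PhiInv = 1 := by
  refine Eq.trans ?_ Q.reassoc_inv_antipode
  rw [QuasiHopfAlgebra.PhiInv]
  generalize ((Q.reassoc⁻¹ : (H ⊗[k] (H ⊗[k] H))ˣ) : H ⊗[k] (H ⊗[k] H)) = t
  induction t using ind3 with
  | h0 => simp only [LinearMap.map_zero, LinearMap.zero_apply, mul_zero, zero_mul,
        TensorProduct.zero_tmul, TensorProduct.tmul_zero]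
  | ha s t hs ht => simp only [LinearMap.map_add, hs, ht]
  | h a b c => simp [sw3_tmul, mul_assoc, QuasiHopfAlgebra.S]

theorem zagR_Phi : zagR Q Q.Phi = 1 := by
  refine Eq.trans ?_ Q.reassoc_antipode
  rw [QuasiHopfAlgebra.Phi]
  generalize (Q.reassoc : H ⊗[k] (H ⊗[k] H)) = t
  induction t using ind3 with
  | h0 => simp only [LinearMap.map_zero, LinearMap.zero_apply, mul_zero, zero_mul,
        TensorProduct.zero_tmul, TensorProduct.tmul_zero]
  | ha s t hs ht => simp only [LinearMap.map_add, hs, ht]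
  | h a b c => simp [sw3_tmul, mul_assoc, QuasiHopfAlgebra.S]

theorem zagL_lcol : LCol (zagL Q) (conv Q (sL k H (H ⊗[k] H)) (sR H (sL k H H))) (triv Q _) :=
  LCol.of_contr (contr_alpha Q) <| ind3 (Fac.left _ _ _).1 (Fac.left _ _ _).2 fun a b c =>
    ⟨mulLeft k (Q.S a) ∘ₗ mulRight k (b * Q.beta * Q.S c), fun x y => by simp [mul_assoc]⟩

theorem zagL_rcol : RCol (zagL Q) (conv Q (sR H (sL k H H)) (sR H (sR H LinearMap.id)))
    (triv Q _) :=
  RCol.of_contr (contr_beta Q) <| ind3 (Fac.right _ _ _).1 (Fac.right _ _ _).2 fun a b c =>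
    ⟨mulLeft k (Q.S a * Q.alpha * b) ∘ₗ mulRight k (Q.S c), fun x y => by simp [mul_assoc]⟩

theorem zagR_rcol : RCol (zagR Q) (conv Q (sL k H (H ⊗[k] H)) (sR H (sL k H H))) (triv Q _) :=
  RCol.of_contr (contr_beta Q) <| ind3 (Fac.right _ _ _).1 (Fac.right _ _ _).2 fun a b c =>
    ⟨mulLeft k a ∘ₗ mulRight k (Q.S b * Q.alpha * c), fun x y => by simp [mul_assoc]⟩

theorem zagR_lcol : LCol (zagR Q) (conv Q (sR H (sL k H H)) (sR H (sR H LinearMap.id)))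
    (triv Q _) :=
  LCol.of_contr (contr_alpha Q) <| ind3 (Fac.left _ _ _).1 (Fac.left _ _ _).2 fun a b c =>
    ⟨mulLeft k (a * Q.beta * Q.S b) ∘ₗ mulRight k c, fun x y => by simp [mul_assoc]⟩

/-- The first two factors of a triple tensor product. -/
noncomputable abbrev emb12 (k H : Type*) [Field k] [Ring H] [Algebra k H] :
    H ⊗[k] H →ₗ[k] H ⊗[k] (H ⊗[k] H) := m2 (sL k H (H ⊗[k] H)) (sR H (sL k H H))
/-- The last two factors of a triple tensor product. -/
noncomputable abbrev emb23 (k H : Type*) [Field k] [Ring H] [Algebra k H] :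
    H ⊗[k] H →ₗ[k] H ⊗[k] (H ⊗[k] H) := m2 (sR H (sL k H H)) (sR H (sR H LinearMap.id))

theorem map_zagL (p q r : H ⊗[k] H) (s t : (H ⊗[k] H) ⊗[k] (H ⊗[k] H)) :
    TensorProduct.map (zagL Q) (zagL Q) (TensorProduct.map (emb12 k H) (emb12 k H) s *
      (m2 (tr1 k H) (tl1 k H) p * (m2 (tl2 k H) (tr2 k H) q * m2 (tr3 k H) (tl3 k H) r)) *
      TensorProduct.map (emb23 k H) (emb23 k H) t) =
    flipMap Q.S p * TensorProduct.map (capS Q) (capS Q) s * q *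
      TensorProduct.map (cupS Q) (cupS Q) t * flipMap Q.S r := by
  induction s using ind22 with
  | h0 => simp only [LinearMap.map_zero, LinearMap.zero_apply, mul_zero, zero_mul,
        TensorProduct.zero_tmul, TensorProduct.tmul_zero]
  | ha s t hs ht => simp only [LinearMap.map_add, add_mul, mul_add, hs, ht]
  | h a b c d =>
  induction t using ind22 with
  | h0 => simp only [LinearMap.map_zero, LinearMap.zero_apply, mul_zero, zero_mul,
        TensorProduct.zero_tmul, TensorProduct.tmul_zero]
  | ha s t hs ht => simp only [LinearMap.map_add, add_mul, mul_add, hs, ht]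
  | h a' b' c' d' =>
  induction p with
  | zero => simp only [LinearMap.map_zero, LinearMap.zero_apply, mul_zero, zero_mul,
        TensorProduct.zero_tmul, TensorProduct.tmul_zero]
  | add s t hs ht => simp only [LinearMap.map_add, add_mul, mul_add, hs, ht]
  | tmul x y =>
  induction q with
  | zero => simp only [LinearMap.map_zero, LinearMap.zero_apply, mul_zero, zero_mul,
        TensorProduct.zero_tmul, TensorProduct.tmul_zero]
  | add s t hs ht => simp only [LinearMap.map_add, add_mul, mul_add, hs, ht]
  | tmul z w =>
  induction r with
  | zero => simp only [LinearMap.map_zero, LinearMap.zero_apply, mul_zero, zero_mul,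
        TensorProduct.zero_tmul, TensorProduct.tmul_zero]
  | add s t hs ht => simp only [LinearMap.map_add, add_mul, mul_add, hs, ht]
  | tmul u v => simp [mul_assoc]

theorem map_zagR (p q r : H ⊗[k] H) (s t : (H ⊗[k] H) ⊗[k] (H ⊗[k] H)) :
    TensorProduct.map (zagR Q) (zagR Q) (TensorProduct.map (emb23 k H) (emb23 k H) s *
      (m2 (tl1 k H) (tr1 k H) p * (m2 (tr2 k H) (tl2 k H) q * m2 (tl3 k H) (tr3 k H) r)) *
      TensorProduct.map (emb12 k H) (emb12 k H) t) =
    p * TensorProduct.map (cupS Q) (cupS Q) t * flipMap Q.S q *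
      TensorProduct.map (capS Q) (capS Q) s * r := by
  induction s using ind22 with
  | h0 => simp only [LinearMap.map_zero, LinearMap.zero_apply, mul_zero, zero_mul,
        TensorProduct.zero_tmul, TensorProduct.tmul_zero]
  | ha s t hs ht => simp only [LinearMap.map_add, add_mul, mul_add, hs, ht]
  | h a b c d =>
  induction t using ind22 with
  | h0 => simp only [LinearMap.map_zero, LinearMap.zero_apply, mul_zero, zero_mul,
        TensorProduct.zero_tmul, TensorProduct.tmul_zero]
  | ha s t hs ht => simp only [LinearMap.map_add, add_mul, mul_add, hs, ht]
  | h a' b' c' d' =>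
  induction p with
  | zero => simp only [LinearMap.map_zero, LinearMap.zero_apply, mul_zero, zero_mul,
        TensorProduct.zero_tmul, TensorProduct.tmul_zero]
  | add s t hs ht => simp only [LinearMap.map_add, add_mul, mul_add, hs, ht]
  | tmul x y =>
  induction q with
  | zero => simp only [LinearMap.map_zero, LinearMap.zero_apply, mul_zero, zero_mul,
        TensorProduct.zero_tmul, TensorProduct.tmul_zero]
  | add s t hs ht => simp only [LinearMap.map_add, add_mul, mul_add, hs, ht]
  | tmul z w =>
  induction r with
  | zero => simp only [LinearMap.map_zero, LinearMap.zero_apply, mul_zero, zero_mul,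
        TensorProduct.zero_tmul, TensorProduct.tmul_zero]
  | add s t hs ht => simp only [LinearMap.map_add, add_mul, mul_add, hs, ht]
  | tmul u v => simp [mul_assoc]

variable {A A' : Type*} [Ring A] [Algebra k A] [Ring A'] [Algebra k A']

theorem map_ael (χ : A →ₗ[k] A') [Str χ] (u v w z : H →ₗ[k] A) :
    χ (ael Q u v w z) = ael Q (χ ∘ₗ u) (χ ∘ₗ v) (χ ∘ₗ w) (χ ∘ₗ z) := by
  rw [ael, ael, Str.map_mul, map_ph, map_phi, comp_conv]

theorem map_cel (χ : A →ₗ[k] A') [Str χ] (u v w z : H →ₗ[k] A) :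
    χ (cel Q u v w z) = cel Q (χ ∘ₗ u) (χ ∘ₗ v) (χ ∘ₗ w) (χ ∘ₗ z) := by
  rw [cel, cel, Str.map_mul, map_ph, map_phi, comp_conv]

theorem snake_left : m2 (mulRight k Q.gamma ∘ₗ Q.SSop)
    (m2 (mulRight k Q.delta ∘ₗ Q.comul.toLinearMap) Q.SSop) Q.PhiInv = 1 := by
  have hA := map_ael Q (TensorProduct.map (emb12 k H) (emb12 k H))
    (st21 k H) (st11 k H) (st12 k H) (st22 k H)
  have hC := map_cel Q (TensorProduct.map (emb23 k H) (emb23 k H))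
    (st11 k H) (st21 k H) (st22 k H) (st12 k H)
  rw [show TensorProduct.map (emb12 k H) (emb12 k H) ∘ₗ st21 k H = tr1 k H by ext; simp [Algebra.TensorProduct.one_def],
    show TensorProduct.map (emb12 k H) (emb12 k H) ∘ₗ st11 k H = tl1 k H by ext; simp [Algebra.TensorProduct.one_def],
    show TensorProduct.map (emb12 k H) (emb12 k H) ∘ₗ st12 k H = tl2 k H by ext; simp [Algebra.TensorProduct.one_def],
    show TensorProduct.map (emb12 k H) (emb12 k H) ∘ₗ st22 k H = tr2 k H by ext; simp [Algebra.TensorProduct.one_def]] at hA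
  rw [show TensorProduct.map (emb23 k H) (emb23 k H) ∘ₗ st11 k H = tl2 k H by ext; simp [Algebra.TensorProduct.one_def],
    show TensorProduct.map (emb23 k H) (emb23 k H) ∘ₗ st21 k H = tr2 k H by ext; simp [Algebra.TensorProduct.one_def],
    show TensorProduct.map (emb23 k H) (emb23 k H) ∘ₗ st22 k H = tr3 k H by ext; simp [Algebra.TensorProduct.one_def],
    show TensorProduct.map (emb23 k H) (emb23 k H) ∘ₗ st12 k H = tl3 k H by ext; simp [Algebra.TensorProduct.one_def]] at hC
  have e : ∀ t, m2 (mulRight k Q.gamma ∘ₗ Q.SSop)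
      (m2 (mulRight k Q.delta ∘ₗ Q.comul.toLinearMap) Q.SSop) t =
      TensorProduct.map (zagL Q) (zagL Q) (ael Q (tr1 k H) (tl1 k H) (tl2 k H) (tr2 k H) *
        m2 (conv Q (tr1 k H) (tl1 k H)) (m2 (conv Q (tl2 k H) (tr2 k H))
          (conv Q (tr3 k H) (tl3 k H))) t *
        cel Q (tl2 k H) (tr2 k H) (tr3 k H) (tl3 k H)) :=
    ind3 (by simp) (fun s t hs ht => by simp only [LinearMap.map_add, add_mul, mul_add, hs, ht])
      fun a b c => by
        rw [show m2 (conv Q (tr1 k H) (tl1 k H)) (m2 (conv Q (tl2 k H) (tr2 k H))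
            (conv Q (tr3 k H) (tl3 k H))) (a ⊗ₜ (b ⊗ₜ c)) = m2 (tr1 k H) (tl1 k H) (Q.comul a) *
            (m2 (tl2 k H) (tr2 k H) (Q.comul b) * m2 (tr3 k H) (tl3 k H) (Q.comul c)) from rfl,
          ← hA, ← hC, map_zagL, ← gamma_eq,
          ← delta_eq]
        simp [SSop_eq, mul_assoc]
  rw [e]
  have := zigzag_left Q (F := TensorProduct.map (zagL Q) (zagL Q)) (tr1 k H) (tl1 k H) (tl2 k H)
    (tr2 k H) (tr3 k H) (tl3 k H)
    (by simpa only [triv_sL, ← conv_sL] using (zagL_lcol Q).map_left (zagL Q))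
    (by simpa only [triv_sR, ← conv_sR] using (zagL_lcol Q).map_right (zagL Q))
    (by simpa only [triv_sL, ← conv_sL] using (zagL_rcol Q).map_left (zagL Q))
    (by simpa only [triv_sR, ← conv_sR] using (zagL_rcol Q).map_right (zagL Q))
  rw [ael, cel]
  simp only [mul_assoc]
  refine this.trans ?_
  rw [phi_sR, phi_sL, phi_std3, Algebra.TensorProduct.tmul_mul_tmul, one_mul, mul_one,
    TensorProduct.map_tmul, zagL_PhiInv, Algebra.TensorProduct.one_def]

theorem snake_right : m2 (mulRight k Q.delta ∘ₗ Q.comul.toLinearMap)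
    (m2 (mulRight k Q.gamma ∘ₗ Q.SSop) Q.comul.toLinearMap) Q.Phi = 1 := by
  have hA := map_ael Q (TensorProduct.map (emb23 k H) (emb23 k H))
    (st21 k H) (st11 k H) (st12 k H) (st22 k H)
  have hC := map_cel Q (TensorProduct.map (emb12 k H) (emb12 k H))
    (st11 k H) (st21 k H) (st22 k H) (st12 k H)
  rw [show TensorProduct.map (emb23 k H) (emb23 k H) ∘ₗ st21 k H = tr2 k H by ext; simp [Algebra.TensorProduct.one_def],
    show TensorProduct.map (emb23 k H) (emb23 k H) ∘ₗ st11 k H = tl2 k H by ext; simp [Algebra.TensorProduct.one_def],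
    show TensorProduct.map (emb23 k H) (emb23 k H) ∘ₗ st12 k H = tl3 k H by ext; simp [Algebra.TensorProduct.one_def],
    show TensorProduct.map (emb23 k H) (emb23 k H) ∘ₗ st22 k H = tr3 k H by ext; simp [Algebra.TensorProduct.one_def]] at hA
  rw [show TensorProduct.map (emb12 k H) (emb12 k H) ∘ₗ st11 k H = tl1 k H by ext; simp [Algebra.TensorProduct.one_def],
    show TensorProduct.map (emb12 k H) (emb12 k H) ∘ₗ st21 k H = tr1 k H by ext; simp [Algebra.TensorProduct.one_def],
    show TensorProduct.map (emb12 k H) (emb12 k H) ∘ₗ st22 k H = tr2 k H by ext; simp [Algebra.TensorProduct.one_def],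
    show TensorProduct.map (emb12 k H) (emb12 k H) ∘ₗ st12 k H = tl2 k H by ext; simp [Algebra.TensorProduct.one_def]] at hC
  have e : ∀ t, m2 (mulRight k Q.delta ∘ₗ Q.comul.toLinearMap)
      (m2 (mulRight k Q.gamma ∘ₗ Q.SSop) Q.comul.toLinearMap) t =
      TensorProduct.map (zagR Q) (zagR Q) (ael Q (tr2 k H) (tl2 k H) (tl3 k H) (tr3 k H) *
        m2 (conv Q (tl1 k H) (tr1 k H)) (m2 (conv Q (tr2 k H) (tl2 k H))
          (conv Q (tl3 k H) (tr3 k H))) t *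
        cel Q (tl1 k H) (tr1 k H) (tr2 k H) (tl2 k H)) :=
    ind3 (by simp) (fun s t hs ht => by simp only [LinearMap.map_add, add_mul, mul_add, hs, ht])
      fun a b c => by
        rw [show m2 (conv Q (tl1 k H) (tr1 k H)) (m2 (conv Q (tr2 k H) (tl2 k H))
            (conv Q (tl3 k H) (tr3 k H))) (a ⊗ₜ (b ⊗ₜ c)) = m2 (tl1 k H) (tr1 k H) (Q.comul a) *
            (m2 (tr2 k H) (tl2 k H) (Q.comul b) * m2 (tl3 k H) (tr3 k H) (Q.comul c)) from rfl,
          ← hA, ← hC, map_zagR, ← gamma_eq,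
          ← delta_eq]
        simp [SSop_eq, mul_assoc]
  rw [e]
  have := zigzag_right Q (F := TensorProduct.map (zagR Q) (zagR Q)) (tl1 k H) (tr1 k H) (tr2 k H)
    (tl2 k H) (tl3 k H) (tr3 k H)
    (by simpa only [triv_sR, ← conv_sR] using (zagR_rcol Q).map_right (zagR Q))
    (by simpa only [triv_sL, ← conv_sL] using (zagR_rcol Q).map_left (zagR Q))
    (by simpa only [triv_sR, ← conv_sR] using (zagR_lcol Q).map_right (zagR Q))
    (by simpa only [triv_sL, ← conv_sL] using (zagR_lcol Q).map_left (zagR Q))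
  rw [ael, cel]
  simp only [mul_assoc]
  refine this.trans ?_
  rw [ph_sR, ph_sL, ph_std3, Algebra.TensorProduct.tmul_mul_tmul, one_mul, mul_one,
    TensorProduct.map_tmul, zagR_Phi, Algebra.TensorProduct.one_def]

theorem f_mul_g : Q.f * Q.g = 1 := by
  rw [← snake_left, ← beta_mul_g]
  conv_lhs => rw [f_eq_mate, mate]
  generalize Q.PhiInv = t
  induction t using ind3 with
  | h0 => simp only [LinearMap.map_zero, LinearMap.zero_apply, mul_zero, zero_mul,
        TensorProduct.zero_tmul, TensorProduct.tmul_zero]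
  | ha s t hs ht => simp only [LinearMap.map_add, add_mul, hs, ht]
  | h a b c =>
    have := g_mul_SSop Q c
    simp only [m2_tmul, LinearMap.comp_apply, LinearMap.mulRight_apply, AlgHom.toLinearMap_apply, map_mul,
      mul_assoc, ← this]

theorem g_mul_f : Q.g * Q.f = 1 := by
  set D := Q.comul.toLinearMap
  have hT : Anti (D ∘ₗ Q.S) := inferInstance
  have hu : Contr Q (sand D (D ∘ₗ Q.S) (Q.delta * Q.f)) := by
    intro h
    have e : ∀ t, sand D (D ∘ₗ Q.S) (Q.delta * Q.f) t = sand D Q.SSop Q.delta t * Q.f :=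
      ind2 (by simp) (fun s t hs ht => by simp only [LinearMap.map_add, add_mul, hs, ht]) fun a b => by
        simp only [sand_tmul, LinearMap.comp_apply, mul_assoc, SSop_mul_f]; rfl
    rw [e, e, contr_delta, smul_mul_assoc]
  have hw : comate Q D (D ∘ₗ Q.S) (Q.delta * Q.f) = Q.g * Q.f := by
    rw [g_eq_comate, comate, comate]
    generalize Q.PhiInv = t
    induction t using ind3 with
    | h0 => simp only [LinearMap.map_zero, LinearMap.zero_apply, mul_zero, zero_mul,
          TensorProduct.zero_tmul, TensorProduct.tmul_zero]
    | ha s t hs ht => simp only [LinearMap.map_add, add_mul, hs, ht]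
    | h a b c =>
      simp only [m2_tmul, LinearMap.comp_apply, LinearMap.mulRight_apply, mul_assoc, SSop_mul_f]; rfl
  have hc : ∀ h, Q.g * Q.f * D h = D h * (Q.g * Q.f) := fun h => by
    have := comate_intertwine Q hu (Q.Sinv h)
    rw [hw] at this
    simpa using this
  have hb := beta_comate Q hu
  rw [hw] at hb
  rw [← snake_right, ← f_mul_alpha]
  have e : ∀ t, m2 (mulRight k Q.delta ∘ₗ D)
      (m2 (mulRight k (Q.f * Q.comul Q.alpha) ∘ₗ Q.SSop) D) t = Q.g * Q.f * D (zagR Q t) :=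
    ind3 (by simp) (fun s t hs ht => by simp only [LinearMap.map_add, mul_add, hs, ht]) fun a b c => by
      rw [hc]
      have hS := SSop_mul_f Q b
      calc m2 (mulRight k Q.delta ∘ₗ D) (m2 (mulRight k (Q.f * Q.comul Q.alpha) ∘ₗ Q.SSop) D)
            (a ⊗ₜ (b ⊗ₜ c)) = D a * Q.delta * (Q.SSop b * Q.f * (D Q.alpha * D c)) := by
            simp [D, mul_assoc]
        _ = D a * (Q.delta * Q.f) * D (Q.S b * Q.alpha * c) := by
            rw [hS]; simp [D, mul_assoc]
        _ = D a * D Q.beta * (Q.g * Q.f * D (Q.S b * Q.alpha * c)) := by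
            rw [← hb]; simp only [mul_assoc]
        _ = _ := by rw [hc]; simp [D, mul_assoc]
  rw [e, zagR_Phi, Str.map_one, mul_one]

end Snake

section Normalization

variable {k H : Type*} [Field k] [Ring H] [Algebra k H] (Q : QuasiHopfAlgebra k H)

/-- `ε ⊗ id` -/
noncomputable abbrev epsL : H ⊗[k] H →ₗ[k] H := m2 (triv Q H) LinearMap.id
/-- `id ⊗ ε` -/
noncomputable abbrev epsR : H ⊗[k] H →ₗ[k] H := m2 LinearMap.id (triv Q H)

theorem epsL_comul (h : H) : epsL Q (Q.comul h) = h := by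
  have := LinearMap.congr_fun (triv_conv Q (LinearMap.id : H →ₗ[k] H)) h
  exact this

theorem epsR_comul (h : H) : epsR Q (Q.comul h) = h := by
  have := LinearMap.congr_fun (conv_triv Q (LinearMap.id : H →ₗ[k] H)) h
  exact this

theorem counit_S (h : H) : Q.counit (Q.S h) = Q.counit h := by
  have h1 := congrArg Q.counit (contr_alpha Q h)
  have e : ∀ t, Q.counit (sand Q.S LinearMap.id Q.alpha t) = Q.counit (Q.S (epsR Q t)) :=
    ind2 (by simp) (fun s t hs ht => by simp only [map_add, hs, ht]) fun a b => by
      simp [Q.counit_alpha, Algebra.algebraMap_eq_smul_one, mul_comm]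
  rw [e, epsR_comul] at h1
  simpa [Q.counit_alpha] using h1

section
variable {Q} {T : H →ₗ[k] H}

theorem epsL_flipMap (hT : ∀ h, Q.counit (T h) = Q.counit h) (t : H ⊗[k] H) :
     epsL Q (flipMap T t) = T (epsR Q t) := by
  induction t with
  | zero => simp only [LinearMap.map_zero, LinearMap.zero_apply, mul_zero, zero_mul,
        TensorProduct.zero_tmul, TensorProduct.tmul_zero]
  | add s t hs ht => simp only [LinearMap.map_add, hs, ht]
  | tmul a b => simp [hT, Algebra.algebraMap_eq_smul_one]

theorem epsR_flipMap (hT : ∀ h, Q.counit (T h) = Q.counit h) (t : H ⊗[k] H) :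
     epsR Q (flipMap T t) = T (epsL Q t) := by
  induction t with
  | zero => simp only [LinearMap.map_zero, LinearMap.zero_apply, mul_zero, zero_mul,
        TensorProduct.zero_tmul, TensorProduct.tmul_zero]
  | add s t hs ht => simp only [LinearMap.map_add, hs, ht]
  | tmul a b => simp [hT, Algebra.algebraMap_eq_smul_one]
end

theorem epsL_gamma : epsL Q Q.gamma = Q.alpha := by
  set κ : (H ⊗[k] H) ⊗[k] (H ⊗[k] H) →ₗ[k] H ⊗[k] H :=
    m2 (m2 (triv Q _) (triv Q _)) LinearMap.id with hκ
  have e : ∀ t, epsL Q (TensorProduct.map (capS Q) (capS Q) t) = capS Q (κ t) :=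
    ind22 (by simp) (fun s t hs ht => by simp only [LinearMap.map_add, hs, ht]) fun a b c d => by
      simp [hκ, counit_S, Q.counit_alpha, Algebra.algebraMap_eq_smul_one, smul_smul,
        mul_comm (Q.counit _) (Q.counit _)]
  rw [gamma_eq, e, map_ael, show κ ∘ₗ st11 k H = triv Q _ by ext; simp [hκ, Algebra.TensorProduct.one_def],
    show κ ∘ₗ st12 k H = triv Q _ by ext; simp [hκ, Algebra.TensorProduct.one_def],
    show κ ∘ₗ st21 k H = sL k H H by ext; simp [hκ, Algebra.TensorProduct.one_def],
    show κ ∘ₗ st22 k H = sR H LinearMap.id by ext; simp [hκ, Algebra.TensorProduct.one_def], ael]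
  simp [Algebra.TensorProduct.one_def]

theorem epsR_gamma : epsR Q Q.gamma = Q.alpha := by
  set κ : (H ⊗[k] H) ⊗[k] (H ⊗[k] H) →ₗ[k] H ⊗[k] H :=
    m2 LinearMap.id (m2 (triv Q _) (triv Q _)) with hκ
  have e : ∀ t, epsR Q (TensorProduct.map (capS Q) (capS Q) t) = capS Q (κ t) :=
    ind22 (by simp) (fun s t hs ht => by simp only [LinearMap.map_add, hs, ht]) fun a b c d => by
      simp [hκ, counit_S, Q.counit_alpha, Algebra.algebraMap_eq_smul_one, smul_smul,
        mul_comm (Q.counit _) (Q.counit _)]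
  rw [gamma_eq, e, map_ael, show κ ∘ₗ st21 k H = triv Q _ by ext; simp [hκ, Algebra.TensorProduct.one_def],
    show κ ∘ₗ st22 k H = triv Q _ by ext; simp [hκ, Algebra.TensorProduct.one_def],
    show κ ∘ₗ st11 k H = sL k H H by ext; simp [hκ, Algebra.TensorProduct.one_def],
    show κ ∘ₗ st12 k H = sR H LinearMap.id by ext; simp [hκ, Algebra.TensorProduct.one_def], ael]
  simp [Algebra.TensorProduct.one_def]

theorem eq_one_of_intertwine {x : H} (hx : ∀ h, Q.S h * x = x * Q.S h)
    (ha : x * Q.alpha = Q.alpha) : x = 1 := by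
  have h1 := mate_of_intertwine Q (D := LinearMap.id) (T := Q.S) (f := x) hx
  have h2 := mate_of_intertwine Q (D := LinearMap.id) (T := Q.S) (f := 1) (by simp)
  simp only [LinearMap.id_apply, ha, one_mul] at h1 h2
  rw [← h1, h2]

theorem epsL_f : epsL Q Q.f = 1 := by
  refine eq_one_of_intertwine Q (fun h => ?_) ?_
  · have := congrArg (epsL Q) (SSop_mul_f Q h)
    rw [Str.map_mul, Str.map_mul, epsL_comul, SSop_eq] at this
    rwa [LinearMap.comp_apply, epsL_flipMap (counit_S Q), AlgHom.toLinearMap_apply, epsR_comul]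
      at this
  · have := congrArg (epsL Q) (f_mul_alpha Q)
    rwa [Str.map_mul, epsL_comul, epsL_gamma] at this

theorem epsR_f : epsR Q Q.f = 1 := by
  refine eq_one_of_intertwine Q (fun h => ?_) ?_
  · have := congrArg (epsR Q) (SSop_mul_f Q h)
    rw [Str.map_mul, Str.map_mul, epsR_comul, SSop_eq] at this
    rwa [LinearMap.comp_apply, epsR_flipMap (counit_S Q), AlgHom.toLinearMap_apply, epsL_comul]
      at this
  · have := congrArg (epsR Q) (f_mul_alpha Q)
    rwa [Str.map_mul, epsR_comul, epsR_gamma] at this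

end Normalization

section Hexagon

variable {k H A X : Type*} [Field k] [Ring H] [Algebra k H] [Ring A] [Algebra k A]
  [AddCommGroup X] [Module k X] (Q : QuasiHopfAlgebra k H)

attribute [local instance] Cm.symm

section
variable (a b c d e f : H →ₗ[k] A) [Str a] [Str b] [Str c] [Str d] [Str e] [Str f]
  [Cm a b] [Cm a c] [Cm a d] [Cm a e] [Cm a f] [Cm b c] [Cm b d] [Cm b e] [Cm b f]
  [Cm c d] [Cm c e] [Cm c f] [Cm d e] [Cm d f] [Cm e f]

theorem ael_mul_ael : ael Q a (conv Q b (conv Q c d)) e f * (ph Q a b (conv Q c d) *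
      (ael Q (conv Q a b) c d (conv Q e f) * ph Q d e f)) =
    ael Q b c d e * (ael Q a (conv Q b c) (conv Q d e) f * ph Q a b c) := by
  simp only [ael, mul_assoc]
  rw [← pass_phi_mul Q (u := conv Q (conv Q a b) (conv Q c d)) (v := e) (w := f)
      (ph Q a b (conv Q c d)),
    ← pass_phi_mul Q (u := conv Q (conv Q (conv Q a b) c) d) (v := e) (w := f)
      (ph Q (conv Q a b) c d), ← mul_assoc (phi Q (conv Q (conv Q (conv Q a b) c) d) e f),
    ← pentagon_phi]
  simp only [mul_assoc, phi_mul_ph, mul_one]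
  rw [← mul_assoc (ph Q a b (conv Q c d)), ← pentagon]
  simp only [mul_assoc]
  rw [← pass_ph_mul Q (u := a) (v := conv Q (conv Q b c) d) (w := e) (ph Q b c d),
    pass_phi_mul Q (u' := conv Q a (conv Q b c)) (v' := d) (w' := e) (ph Q a b c),
    pass_phi Q (u' := conv Q a (conv Q b c)) (v' := conv Q d e) (w' := f) (ph Q a b c),
    ← mul_assoc (phi Q (conv Q b c) d e), pentagon_phi_ph]
  simp only [mul_assoc]

theorem ael_collapse {F : A →ₗ[k] X} (hcd : LCol F (conv Q c d) (triv Q A)) :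
    F (ael Q a b e f * (ael Q (conv Q a b) c d (conv Q e f) * ph Q d e f)) =
    F (ael Q b c d e * (ael Q a (conv Q b c) (conv Q d e) f * ph Q a b c)) := by
  rw [← ael_mul_ael]
  have h1 : LCol F (conv Q b (conv Q c d)) b := fun h t => by
    rw [LCol.rfl.conv Q hcd, conv_triv]
  have h2 : LCol (F ∘ₗ mulLeft k (ph Q a b e)) (conv Q a (conv Q b (conv Q c d))) (conv Q a b) :=
    fun h t => by
      rw [LCol.rfl.conv Q (LCol.rfl.conv Q (hcd.past (ph Q a b e))), conv_triv]
  symm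
  calc _ = F (ph Q a b e * (phi Q (conv Q a (conv Q b (conv Q c d))) e f *
        (ph Q a b (conv Q c d) * (ael Q (conv Q a b) c d (conv Q e f) * ph Q d e f)))) := by
        rw [ael, mul_assoc, LCol.rfl.ph Q h1 LCol.rfl]
    _ = F (ph Q a b e * (phi Q (conv Q a b) e f *
        (ph Q a b (conv Q c d) * (ael Q (conv Q a b) c d (conv Q e f) * ph Q d e f)))) :=
        h2.phi Q LCol.rfl LCol.rfl _
    _ = F (ael Q a b e f * (ph Q a b (conv Q c d) *
        (ael Q (conv Q a b) c d (conv Q e f) * ph Q d e f))) := by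
        simp only [ael, mul_assoc]
    _ = F (ael Q a b e f * (ph Q a b (triv Q A) *
        (ael Q (conv Q a b) c d (conv Q e f) * ph Q d e f))) := by
        have : Ps (ael Q a b e f) (conv Q c d) (conv Q c d) := by unfold ael; infer_instance
        have : Ps (ael Q a b e f) (triv Q A) (triv Q A) := inferInstance
        exact LCol.rfl.ph Q LCol.rfl (hcd.past (ael Q a b e f)) _
    _ = _ := by rw [ph_triv_right, one_mul]
end

/-- The reversal `a ⊗ b ⊗ c ↦ T(c) ⊗ T(b) ⊗ T(a)`. -/
noncomputable def rev3 (T : H →ₗ[k] H) : H ⊗[k] (H ⊗[k] H) →ₗ[k] H ⊗[k] (H ⊗[k] H) :=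
  (TensorProduct.assoc k H H H).toLinearMap ∘ₗ TensorProduct.map (flipMap T) T ∘ₗ
    (TensorProduct.comm k H (H ⊗[k] H)).toLinearMap

@[simp] theorem rev3_tmul (T : H →ₗ[k] H) (a b c : H) :
    rev3 T (a ⊗ₜ (b ⊗ₜ c)) = T c ⊗ₜ[k] (T b ⊗ₜ[k] T a) := rfl

theorem rev3_mul (T : H →ₗ[k] H) [Anti T] (s t : H ⊗[k] (H ⊗[k] H)) :
    rev3 T (s * t) = rev3 T t * rev3 T s := by
  induction s using ind3 with
  | h0 => simp only [LinearMap.map_zero, LinearMap.zero_apply, mul_zero, zero_mul,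
        TensorProduct.zero_tmul, TensorProduct.tmul_zero]
  | ha s t hs ht => simp only [LinearMap.map_add, add_mul, mul_add, hs, ht]
  | h a b c =>
    induction t using ind3 with
    | h0 => simp only [LinearMap.map_zero, LinearMap.zero_apply, mul_zero, zero_mul,
          TensorProduct.zero_tmul, TensorProduct.tmul_zero]
    | ha s t hs ht => simp only [LinearMap.map_add, add_mul, mul_add, hs, ht]
    | h x y z => simp [Anti.map_mul]

/-- `(Δ ⊗ id)(t)` -/
noncomputable def comulId : H ⊗[k] H →ₐ[k] H ⊗[k] (H ⊗[k] H) :=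
  (Algebra.TensorProduct.assoc k k k H H H).toAlgHom.comp
    (Algebra.TensorProduct.map Q.comul (AlgHom.id k H))

/-- `t ⊗ 1` -/
noncomputable def inc12 (k H : Type*) [Field k] [Ring H] [Algebra k H] :
    H ⊗[k] H →ₐ[k] H ⊗[k] (H ⊗[k] H) :=
  (Algebra.TensorProduct.assoc k k k H H H).toAlgHom.comp Algebra.TensorProduct.includeLeft

/-- `1 ⊗ t` -/
noncomputable def inc23 (k H : Type*) [Field k] [Ring H] [Algebra k H] :
    H ⊗[k] H →ₐ[k] H ⊗[k] (H ⊗[k] H) := Algebra.TensorProduct.includeRight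

theorem inc12_mul_tmul (t p : H ⊗[k] H) (c : H) :
    inc12 k H t * TensorProduct.assoc k H H H (p ⊗ₜ c) =
      TensorProduct.assoc k H H H ((t * p) ⊗ₜ c) := by
  change Algebra.TensorProduct.assoc k k k H H H (t ⊗ₜ 1) *
    Algebra.TensorProduct.assoc k k k H H H (p ⊗ₜ c) = _
  rw [← map_mul, Algebra.TensorProduct.tmul_mul_tmul, one_mul]
  rfl

theorem assoc_tmul_mul_inc12 (t p : H ⊗[k] H) (c : H) :
    TensorProduct.assoc k H H H (p ⊗ₜ c) * inc12 k H t =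
      TensorProduct.assoc k H H H ((p * t) ⊗ₜ c) := by
  change Algebra.TensorProduct.assoc k k k H H H (p ⊗ₜ c) *
    Algebra.TensorProduct.assoc k k k H H H (t ⊗ₜ 1) = _
  rw [← map_mul, Algebra.TensorProduct.tmul_mul_tmul, mul_one]
  rfl

theorem comulId_tmul (a b : H) :
    comulId Q (a ⊗ₜ b) = TensorProduct.assoc k H H H (Q.comul a ⊗ₜ b) := rfl

theorem idComul_tmul (a b : H) : Q.idComul (a ⊗ₜ b) = a ⊗ₜ Q.comul b := rfl

theorem rev3_assoc_tmul (T : H →ₗ[k] H) (p : H ⊗[k] H) (c : H) :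
    rev3 T (TensorProduct.assoc k H H H (p ⊗ₜ c)) = T c ⊗ₜ flipMap T p := by
  induction p with
  | zero => simp only [LinearMap.map_zero, LinearEquiv.map_zero, LinearMap.zero_apply, mul_zero, zero_mul,
        TensorProduct.zero_tmul, TensorProduct.tmul_zero]
  | add s t hs ht => simp only [TensorProduct.add_tmul, TensorProduct.tmul_add, map_add, hs, ht]
  | tmul a b => simp

theorem rev3_tmul' (T : H →ₗ[k] H) (p : H ⊗[k] H) (c : H) :
    rev3 T (c ⊗ₜ p) = TensorProduct.assoc k H H H (flipMap T p ⊗ₜ T c) := rfl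

theorem Phi_mul_comulId (h : H) : Q.Phi * comulId Q (Q.comul h) = Q.idComul (Q.comul h) * Q.Phi := by
  have := Q.quasi_coassoc h
  change Q.idComul (Q.comul h) = Q.Phi * comulId Q (Q.comul h) * Q.PhiInv at this
  rw [this, mul_assoc _ Q.PhiInv, PhiInv_mul_Phi, mul_one]

/-- `T` is an anti-automorphism of `H` with inverse `T'`, and `F` is an invertible element with
inverse `G` that intertwines `Δ ∘ T` and `(T ⊗ T) ∘ Δᵒᵖ`, compatibly with the reassociator. -/
structure IsTwist (T T' : H →ₗ[k] H) (F G : H ⊗[k] H) : Prop where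
  anti : Anti T
  anti' : Anti T'
  right_inv : ∀ h, T (T' h) = h
  left_inv : ∀ h, T' (T h) = h
  counit_T : ∀ h, Q.counit (T h) = Q.counit h
  mul_inv : F * G = 1
  inv_mul : G * F = 1
  intertwine : ∀ h, flipMap T (Q.comul h) * F = F * Q.comul (T h)
  epsL_eq : epsL Q F = 1
  epsR_eq : epsR Q F = 1
  hexagon : inc23 k H F * (Q.idComul F * Q.Phi) =
    rev3 T Q.Phi * (inc12 k H F * comulId Q F)

section
variable {Q} {T T' : H →ₗ[k] H}
theorem flipMap_flipMap (h : ∀ h, T (T' h) = h) (t : H ⊗[k] H) : flipMap T (flipMap T' t) = t := by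
  induction t with
  | zero => simp only [LinearMap.map_zero, LinearMap.zero_apply, mul_zero, zero_mul,
        TensorProduct.zero_tmul, TensorProduct.tmul_zero]
  | add s t hs ht => simp only [LinearMap.map_add, hs, ht]
  | tmul a b => simp [h]

theorem rev3_rev3 (h : ∀ h, T (T' h) = h) (t : H ⊗[k] (H ⊗[k] H)) : rev3 T (rev3 T' t) = t := by
  induction t using ind3 with
  | h0 => simp only [LinearMap.map_zero, LinearMap.zero_apply, mul_zero, zero_mul,
        TensorProduct.zero_tmul, TensorProduct.tmul_zero]
  | ha s t hs ht => simp only [LinearMap.map_add, hs, ht]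
  | h a b c => simp [h]

theorem IsTwist.flip {F G : H ⊗[k] H} (h : IsTwist Q T T' F G) :
    IsTwist Q T' T (flipMap T' F) (flipMap T' G) := by
  have := h.anti
  have := h.anti'
  have hc : ∀ x, Q.counit (T' x) = Q.counit x := fun x => by rw [← h.counit_T, h.right_inv]
  have hi : ∀ x, flipMap T' (Q.comul x) * flipMap T' F = flipMap T' F * Q.comul (T' x) := fun x => by
    have := congrArg (flipMap T') (h.intertwine (T' x))
    rwa [flipMap_mul, flipMap_mul, flipMap_flipMap h.left_inv, h.right_inv, eq_comm] at this
  refine ⟨h.anti', h.anti, h.left_inv, h.right_inv, hc, ?_, ?_, hi, ?_, ?_, ?_⟩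
  · rw [← flipMap_mul, h.inv_mul]; simp [Algebra.TensorProduct.one_def, Anti.map_one]
  · rw [← flipMap_mul, h.mul_inv]; simp [Algebra.TensorProduct.one_def, Anti.map_one]
  · rw [epsL_flipMap hc, h.epsR_eq, Anti.map_one]
  · rw [epsR_flipMap hc, h.epsL_eq, Anti.map_one]
  · have h1 := congrArg (rev3 T') h.hexagon
    simp only [rev3_mul, rev3_rev3 h.left_inv] at h1
    have e1 : rev3 T' (inc23 k H F) = inc12 k H (flipMap T' F) := by
      rw [inc23, Algebra.TensorProduct.includeRight_apply, rev3_tmul', Anti.map_one]; rfl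
    have e2 : rev3 T' (inc12 k H F) = inc23 k H (flipMap T' F) := by
      refine (rev3_assoc_tmul T' F 1).trans ?_
      rw [Anti.map_one]; rfl
    have e3 : ∀ t, rev3 T' (Q.idComul t) * inc12 k H (flipMap T' F) =
        inc12 k H (flipMap T' F) * comulId Q (flipMap T' t) :=
      ind2 (by simp) (fun s t hs ht => by simp only [map_add, add_mul, mul_add, hs, ht])
        fun a b => by
          rw [idComul_tmul, rev3_tmul', assoc_tmul_mul_inc12, hi, flipMap_tmul, comulId_tmul,
            inc12_mul_tmul]
    have e4 : ∀ t, rev3 T' (comulId Q t) * inc23 k H (flipMap T' F) =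
        inc23 k H (flipMap T' F) * Q.idComul (flipMap T' t) :=
      ind2 (by simp) (fun s t hs ht => by simp only [map_add, add_mul, mul_add, hs, ht])
        fun a b => by
          rw [comulId_tmul, rev3_assoc_tmul, flipMap_tmul, idComul_tmul, inc23,
            Algebra.TensorProduct.includeRight_apply, Algebra.TensorProduct.tmul_mul_tmul,
            Algebra.TensorProduct.tmul_mul_tmul, hi, mul_one, one_mul]
    rw [e1, e2, e4, mul_assoc, e3, mul_assoc] at h1
    exact h1.symm
end

end Hexagon

section DrinfeldTwist

variable {k H : Type*} [Field k] [Ring H] [Algebra k H] (Q : QuasiHopfAlgebra k H)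

/-- `γ` as a function of the element `A`. -/
noncomputable abbrev gam : H ⊗[k] (H ⊗[k] (H ⊗[k] H)) →ₗ[k] H ⊗[k] H :=
  TensorProduct.map (capS Q) (capS Q) ∘ₗ m2 (st21 k H) (m2 (st11 k H) (m2 (st12 k H) (st22 k H)))

noncomputable def aTensor : H ⊗[k] (H ⊗[k] (H ⊗[k] H)) :=
  QuasiHopfAlgebra.tensorOne k H Q.Phi * Q.comulIdId Q.PhiInv

theorem ael_eq {A : Type*} [Ring A] [Algebra k A] (u v w z : H →ₗ[k] A)
    [Str u] [Str v] [Str w] [Str z] [Cm u v] [Cm u w] [Cm u z] [Cm v w] [Cm v z] [Cm w z] :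
    ael Q u v w z = m2 u (m2 v (m2 w z)) (aTensor Q) := by
  rw [aTensor, Str.map_mul, m2_tensorOne, m2_comulIdId]; rfl

theorem gam_aTensor : gam Q (aTensor Q) = Q.f * Q.comul Q.alpha := by
  rw [f_mul_alpha, gamma_eq, ael_eq, LinearMap.comp_apply]

theorem flipMap_gamma_comul (a d : H) :
    flipMap Q.S (Q.comul a) * Q.gamma * Q.comul d = Q.f * Q.comul (Q.S a * Q.alpha * d) := by
  change Q.SSop a * _ * _ = _
  rw [← f_mul_alpha, ← mul_assoc, SSop_mul_f]
  simp [mul_assoc]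

theorem hexagon_left (t : H ⊗[k] (H ⊗[k] (H ⊗[k] H))) (r : H ⊗[k] (H ⊗[k] H)) :
    TensorProduct.map (capS Q) (TensorProduct.map (capS Q) (capS Q))
      (((1 : H ⊗[k] H) ⊗ₜ[k] ael Q (st21 k H) (st11 k H) (st12 k H) (st22 k H)) *
        (m2 (conv Q (sR (H ⊗[k] H) (st21 k H)) (sR (H ⊗[k] H) (st11 k H)))
          (m2 (sL k (H ⊗[k] H) _ ∘ₗ sL k H H) (m2 (sL k (H ⊗[k] H) _ ∘ₗ sR H LinearMap.id)
            (conv Q (sR (H ⊗[k] H) (st12 k H)) (sR (H ⊗[k] H) (st22 k H))))) t *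
        m2 (sL k (H ⊗[k] H) _ ∘ₗ sR H LinearMap.id) (m2 (sR (H ⊗[k] H) (st12 k H))
          (sR (H ⊗[k] H) (st22 k H))) r)) =
    inc23 k H Q.f * Q.idComul (gam Q t) * r := by
  induction t using ind4 with
  | h0 => simp
  | ha s t hs ht => simp only [map_add, add_mul, mul_add, hs, ht]
  | h a b c d =>
  induction r using ind2 with
  | h0 => simp only [LinearMap.map_zero, LinearMap.zero_apply, mul_zero, zero_mul,
        TensorProduct.zero_tmul, TensorProduct.tmul_zero]
  | ha s t hs ht => simp only [LinearMap.map_add, add_mul, mul_add, hs, ht]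
  | h x y =>
  have e1 : m2 (conv Q (sR (H ⊗[k] H) (st21 k H)) (sR (H ⊗[k] H) (st11 k H)))
          (m2 (sL k (H ⊗[k] H) _ ∘ₗ sL k H H) (m2 (sL k (H ⊗[k] H) _ ∘ₗ sR H LinearMap.id)
            (conv Q (sR (H ⊗[k] H) (st12 k H)) (sR (H ⊗[k] H) (st22 k H)))))
          (a ⊗ₜ (b ⊗ₜ (c ⊗ₜ d))) =
      (b ⊗ₜ c) ⊗ₜ (m2 (st21 k H) (st11 k H) (Q.comul a) * m2 (st12 k H) (st22 k H) (Q.comul d)) := by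
    rw [conv_sR, conv_sR]; simp [conv]
  have e2 : m2 (sL k (H ⊗[k] H) _ ∘ₗ sR H LinearMap.id) (m2 (sR (H ⊗[k] H) (st12 k H))
          (sR (H ⊗[k] H) (st22 k H))) (x ⊗ₜ y) =
      (1 ⊗ₜ x) ⊗ₜ (m2 (st12 k H) (st22 k H) y) := by
    induction y with
    | zero => simp only [LinearMap.map_zero, LinearMap.zero_apply, mul_zero, zero_mul,
          TensorProduct.zero_tmul, TensorProduct.tmul_zero]
    | add s t hs ht => simp only [TensorProduct.tmul_add, map_add, hs, ht]
    | tmul y z => simp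
  rw [e1, e2, Algebra.TensorProduct.tmul_mul_tmul, Algebra.TensorProduct.tmul_mul_tmul, one_mul,
    TensorProduct.map_tmul, mul_assoc (m2 _ _ _), ← Str.map_mul, map_capS_mul, ← gamma_eq,
    ← mul_assoc, flipMap_gamma_comul]
  simp [inc23, idComul_tmul, mul_assoc]

theorem assoc_mul (s t : (H ⊗[k] H) ⊗[k] H) : TensorProduct.assoc k H H H (s * t) =
    TensorProduct.assoc k H H H s * TensorProduct.assoc k H H H t :=
  map_mul (Algebra.TensorProduct.assoc k k k H H H) s t

theorem hexagon_right (t : H ⊗[k] (H ⊗[k] (H ⊗[k] H))) (r : H ⊗[k] (H ⊗[k] H)) :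
    TensorProduct.assoc k H H H (TensorProduct.map (TensorProduct.map (capS Q) (capS Q)) (capS Q)
      ((ael Q (st21 k H) (st11 k H) (st12 k H) (st22 k H) ⊗ₜ[k] (1 : H ⊗[k] H)) *
        (m2 (sR _ (sL k H H))
          (m2 (conv Q (sL k _ (H ⊗[k] H) ∘ₗ st21 k H) (sL k _ (H ⊗[k] H) ∘ₗ st11 k H))
          (m2 (conv Q (sL k _ (H ⊗[k] H) ∘ₗ st12 k H) (sL k _ (H ⊗[k] H) ∘ₗ st22 k H))
            (sR _ (sR H LinearMap.id)))) t *
        m2 (sR _ (sL k H H)) (m2 (sL k _ (H ⊗[k] H) ∘ₗ st21 k H)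
          (sL k _ (H ⊗[k] H) ∘ₗ st11 k H)) r))) =
    rev3 Q.S r * (inc12 k H Q.f * comulId Q (gam Q t)) := by
  induction t using ind4 with
  | h0 => simp
  | ha s t hs ht => simp only [map_add, add_mul, mul_add, hs, ht]
  | h a b c d =>
  induction r using ind2 with
  | h0 => simp only [LinearMap.map_zero, LinearEquiv.map_zero, LinearMap.zero_apply, mul_zero, zero_mul,
        TensorProduct.zero_tmul, TensorProduct.tmul_zero]
  | ha s t hs ht => simp only [LinearMap.map_add, LinearEquiv.map_add, add_mul, mul_add, hs, ht]
  | h x y =>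
  have e1 : m2 (sR _ (sL k H H))
          (m2 (conv Q (sL k _ (H ⊗[k] H) ∘ₗ st21 k H) (sL k _ (H ⊗[k] H) ∘ₗ st11 k H))
          (m2 (conv Q (sL k _ (H ⊗[k] H) ∘ₗ st12 k H) (sL k _ (H ⊗[k] H) ∘ₗ st22 k H))
            (sR _ (sR H LinearMap.id)))) (a ⊗ₜ (b ⊗ₜ (c ⊗ₜ d))) =
      (m2 (st21 k H) (st11 k H) (Q.comul b) * m2 (st12 k H) (st22 k H) (Q.comul c)) ⊗ₜ
        (a ⊗ₜ d) := by
    rw [conv_sL, conv_sL]; simp [conv]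
  have e2 : m2 (sR _ (sL k H H)) (m2 (sL k _ (H ⊗[k] H) ∘ₗ st21 k H)
          (sL k _ (H ⊗[k] H) ∘ₗ st11 k H)) (x ⊗ₜ y) =
      m2 (st21 k H) (st11 k H) y ⊗ₜ (x ⊗ₜ 1) := by
    induction y with
    | zero => simp only [LinearMap.map_zero, LinearMap.zero_apply, mul_zero, zero_mul,
          TensorProduct.zero_tmul, TensorProduct.tmul_zero]
    | add s t hs ht => simp only [TensorProduct.tmul_add, TensorProduct.add_tmul, map_add, hs, ht]
    | tmul y z => simp
  have e3 : m2 (st12 k H) (st22 k H) (Q.comul c) * m2 (st21 k H) (st11 k H) y =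
      m2 (st21 k H) (st11 k H) y * m2 (st12 k H) (st22 k H) (Q.comul c) := Cm.comm _ _
  have e4 : TensorProduct.assoc k H H H ((flipMap Q.S y * (flipMap Q.S (Q.comul b) * Q.gamma *
        Q.comul c)) ⊗ₜ[k] (Q.S x * (Q.S a * Q.alpha * d))) =
      rev3 Q.S (x ⊗ₜ y) * (inc12 k H Q.f * comulId Q (gam Q (a ⊗ₜ (b ⊗ₜ (c ⊗ₜ d))))) := by
    rw [flipMap_gamma_comul]
    have : gam Q (a ⊗ₜ (b ⊗ₜ (c ⊗ₜ d))) =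
      (Q.S b * Q.alpha * c) ⊗ₜ (Q.S a * Q.alpha * d) := by simp
    rw [this, comulId_tmul, inc12_mul_tmul, rev3_tmul']
    rw [← assoc_mul, Algebra.TensorProduct.tmul_mul_tmul]
  rw [← e4, e1, e2, Algebra.TensorProduct.tmul_mul_tmul, Algebra.TensorProduct.tmul_mul_tmul,
    mul_assoc (m2 _ _ _), e3, ← mul_assoc (m2 _ _ _), ← Str.map_mul,
    TensorProduct.map_tmul, map_capS_mul, ← gamma_eq, flipMap_mul]
  simp [mul_assoc]

theorem hexagon_alpha : inc23 k H Q.f * (Q.idComul Q.f * Q.Phi) * comulId Q (Q.comul Q.alpha) =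
    rev3 Q.S Q.Phi * (inc12 k H Q.f * comulId Q Q.f) * comulId Q (Q.comul Q.alpha) := by
  have hl := hexagon_left Q (aTensor Q) Q.Phi
  have hr := hexagon_right Q (aTensor Q) Q.Phi
  rw [gam_aTensor] at hl hr
  have h1 : inc23 k H Q.f * (Q.idComul Q.f * Q.Phi) * comulId Q (Q.comul Q.alpha) =
      inc23 k H Q.f * Q.idComul (Q.f * Q.comul Q.alpha) * Q.Phi := by
    rw [map_mul]
    simp only [mul_assoc, Phi_mul_comulId]
  have h2 : rev3 Q.S Q.Phi * (inc12 k H Q.f * comulId Q Q.f) * comulId Q (Q.comul Q.alpha) =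
      rev3 Q.S Q.Phi * (inc12 k H Q.f * comulId Q (Q.f * Q.comul Q.alpha)) := by
    rw [map_mul]
    simp only [mul_assoc]
  rw [h1, h2, ← hl, ← hr, ← ael_eq, ← ael_eq]
  have hF : LCol (TensorProduct.map (capS Q) (TensorProduct.map (capS Q) (capS Q)))
      (conv Q (sL k (H ⊗[k] H) _ ∘ₗ sL k H H) (sL k (H ⊗[k] H) _ ∘ₗ sR H LinearMap.id))
      (triv Q _) := by
    simpa only [triv_sL, ← conv_sL] using (capS_lcol Q).map_left (TensorProduct.map (capS Q) (capS Q))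
  have key := ael_collapse Q (F := TensorProduct.map (capS Q) (TensorProduct.map (capS Q) (capS Q)))
    (sR (H ⊗[k] H) (st21 k H)) (sR (H ⊗[k] H) (st11 k H)) (sL k (H ⊗[k] H) _ ∘ₗ sL k H H)
    (sL k (H ⊗[k] H) _ ∘ₗ sR H LinearMap.id) (sR (H ⊗[k] H) (st12 k H)) (sR (H ⊗[k] H) (st22 k H))
    hF
  have e1 : (1 : H ⊗[k] H) ⊗ₜ[k] ael Q (st21 k H) (st11 k H) (st12 k H) (st22 k H) =
      ael Q (sR (H ⊗[k] H) (st21 k H)) (sR (H ⊗[k] H) (st11 k H)) (sR (H ⊗[k] H) (st12 k H))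
        (sR (H ⊗[k] H) (st22 k H)) :=
    map_ael Q (Algebra.TensorProduct.includeRight (R := k) (A := H ⊗[k] H)).toLinearMap _ _ _ _
  have e2 : ael Q (st21 k H) (st11 k H) (st12 k H) (st22 k H) ⊗ₜ[k] (1 : H ⊗[k] H) = _ :=
    map_ael Q (sL k _ (H ⊗[k] H)) _ _ _ _
  rw [e1, e2]
  refine key.trans ?_
  set χ : ((H ⊗[k] H) ⊗[k] (H ⊗[k] H)) ⊗[k] (H ⊗[k] H) →ₗ[k] _ :=
    (Algebra.TensorProduct.assoc k k k (H ⊗[k] H) (H ⊗[k] H) (H ⊗[k] H)).toAlgHom.toLinearMap with hχ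
  have hc : ∀ t, TensorProduct.assoc k H H H
      (TensorProduct.map (TensorProduct.map (capS Q) (capS Q)) (capS Q) t) =
      TensorProduct.map (capS Q) (TensorProduct.map (capS Q) (capS Q)) (χ t) :=
    fun t => (LinearMap.congr_fun
      (TensorProduct.map_map_comp_assoc_eq (capS Q) (capS Q) (capS Q)) t).symm
  have : Str χ := inferInstanceAs (Str (AlgHom.toLinearMap _))
  rw [hc, Str.map_mul (u := χ), Str.map_mul (u := χ), map_ael Q χ, map_ael Q χ]
  change _ = TensorProduct.map _ _ (_ * (_ * χ (ph Q _ _ _)))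
  rw [map_ph Q χ, comp_conv Q χ, comp_conv Q χ]
  have s1 : χ ∘ₗ sL k _ (H ⊗[k] H) ∘ₗ st21 k H = sR (H ⊗[k] H) (st11 k H) := by
    ext; simp [hχ, Algebra.TensorProduct.one_def]
  have s2 : χ ∘ₗ sL k _ (H ⊗[k] H) ∘ₗ st11 k H = sL k (H ⊗[k] H) _ ∘ₗ sL k H H := by
    ext; simp [hχ, Algebra.TensorProduct.one_def]
  have s3 : χ ∘ₗ sL k _ (H ⊗[k] H) ∘ₗ st12 k H = sL k (H ⊗[k] H) _ ∘ₗ sR H LinearMap.id := by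
    ext; simp [hχ, Algebra.TensorProduct.one_def]
  have s4 : χ ∘ₗ sL k _ (H ⊗[k] H) ∘ₗ st22 k H = sR (H ⊗[k] H) (st12 k H) := by
    ext; simp [hχ, Algebra.TensorProduct.one_def]
  have s5 : χ ∘ₗ sR _ (sL k H H) = sR (H ⊗[k] H) (st21 k H) := by
    ext; simp [hχ, Algebra.TensorProduct.one_def]
  have s6 : χ ∘ₗ sR _ (sR H LinearMap.id) = sR (H ⊗[k] H) (st22 k H) := by
    ext; simp [hχ, Algebra.TensorProduct.one_def]
  rw [s1, s2, s3, s4, s5, s6]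

instance {A B : Type*} [Ring A] [Algebra k A] [Ring B] [Algebra k B] (φ : H →ₗ[k] A)
    (T : A →ₗ[k] B) [Str φ] [Anti T] : Anti (T ∘ₗ φ) :=
  ⟨by simp [Str.map_one, Anti.map_one], by simp [Str.map_mul, Anti.map_mul]⟩

instance : Anti (rev3 Q.S) := ⟨by simp [Algebra.TensorProduct.one_def], rev3_mul Q.S⟩

theorem hexagon_f : inc23 k H Q.f * (Q.idComul Q.f * Q.Phi) =
    rev3 Q.S Q.Phi * (inc12 k H Q.f * comulId Q Q.f) := by
  set D : H →ₗ[k] H ⊗[k] (H ⊗[k] H) := (comulId Q).toLinearMap ∘ₗ Q.comul.toLinearMap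
  set T : H →ₗ[k] H ⊗[k] (H ⊗[k] H) := rev3 Q.S ∘ₗ D
  have hf := fun h => (SSop_mul_f Q h).symm
  have h1 := mate_of_intertwine Q (D := D) (T := T)
    (f := inc23 k H Q.f * (Q.idComul Q.f * Q.Phi)) fun h => by
      have e : ∀ t, inc23 k H Q.f * Q.idComul (flipMap Q.S t) =
          rev3 Q.S (comulId Q t) * inc23 k H Q.f :=
        ind2 (by simp) (fun s t hs ht => by simp only [map_add, add_mul, mul_add, hs, ht])
          fun a b => by
            rw [flipMap_tmul, idComul_tmul, comulId_tmul, rev3_assoc_tmul, inc23,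
              Algebra.TensorProduct.includeRight_apply, Algebra.TensorProduct.tmul_mul_tmul,
              Algebra.TensorProduct.tmul_mul_tmul, hf, mul_one, one_mul]
            rfl
      symm
      calc _ = inc23 k H Q.f * (Q.idComul Q.f * (Q.Phi * comulId Q (Q.comul (Q.S h)))) := by
            simp only [mul_assoc]; rfl
        _ = inc23 k H Q.f * (Q.idComul (Q.SSop h) * (Q.idComul Q.f * Q.Phi)) := by
            rw [Phi_mul_comulId, ← mul_assoc (Q.idComul Q.f), ← map_mul, hf, map_mul, mul_assoc]
        _ = _ := by
            rw [← mul_assoc, SSop_eq, LinearMap.comp_apply, e, mul_assoc]; rfl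
  have h2 := mate_of_intertwine Q (D := D) (T := T)
    (f := rev3 Q.S Q.Phi * (inc12 k H Q.f * comulId Q Q.f)) fun h => by
      have e : ∀ t, inc12 k H Q.f * comulId Q (flipMap Q.S t) =
          rev3 Q.S (Q.idComul t) * inc12 k H Q.f :=
        ind2 (by simp) (fun s t hs ht => by simp only [map_add, add_mul, mul_add, hs, ht])
          fun a b => by
            rw [flipMap_tmul, comulId_tmul, idComul_tmul, rev3_tmul', inc12_mul_tmul,
              assoc_tmul_mul_inc12, hf]
            rfl
      symm
      calc _ = rev3 Q.S Q.Phi * (inc12 k H Q.f * comulId Q (Q.f * Q.comul (Q.S h))) := by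
            rw [map_mul]; simp only [mul_assoc]; rfl
        _ = rev3 Q.S Q.Phi * (rev3 Q.S (Q.idComul (Q.comul h)) * (inc12 k H Q.f *
              comulId Q Q.f)) := by
            rw [hf, map_mul, ← mul_assoc (inc12 k H Q.f), SSop_eq, LinearMap.comp_apply, e,
              mul_assoc]
            rfl
        _ = _ := by
            rw [← mul_assoc, ← rev3_mul, ← Phi_mul_comulId, rev3_mul, mul_assoc]; rfl
  rw [← h1, ← h2]
  congr 1
  exact hexagon_alpha Q

theorem isTwist_f : IsTwist Q Q.S Q.Sinv Q.f Q.g where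
  anti := inferInstance
  anti' := inferInstance
  right_inv := S_Sinv Q
  left_inv := Sinv_S Q
  counit_T := counit_S Q
  mul_inv := f_mul_g Q
  inv_mul := g_mul_f Q
  intertwine := SSop_mul_f Q
  epsL_eq := epsL_f Q
  epsR_eq := epsR_f Q
  hexagon := hexagon_f Q

theorem isTwist_fOpInv : IsTwist Q Q.Sinv Q.S Q.fOpInv Q.gOpInv := (isTwist_f Q).flip

end DrinfeldTwist

section Evaluation

variable {k H A M : Type*} [Field k] [Ring H] [Algebra k H] [Ring A] [Algebra k A]
  [AddCommGroup M] [Module k M]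

/-- `a ⊗ x ↦ a ⊗ x(m)` -/
noncomputable def evAt (A : Type*) [AddCommGroup A] [Module k A] (m : M) :
    A ⊗[k] Module.End k M →ₗ[k] A ⊗[k] M := (LinearMap.applyₗ m).lTensor A

@[simp] theorem evAt_tmul {A : Type*} [AddCommGroup A] [Module k A] (m : M) (a : A)
    (x : Module.End k M) : evAt A m (a ⊗ₜ x) = a ⊗ₜ[k] x m := rfl

theorem evAt_injective {A : Type*} [AddCommGroup A] [Module k A] [Module.Finite k M]
    {X Y : A ⊗[k] Module.End k M} (h : ∀ m, evAt A m X = evAt A m Y) : X = Y := by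
  have e : ∀ (m : M) (X : A ⊗[k] Module.End k M),
      lTensorHomEquivHomLTensor k M A M X m = evAt A m X := fun m X => by
    induction X with
    | zero => simp only [LinearMap.map_zero, LinearEquiv.map_zero, LinearMap.zero_apply, mul_zero, zero_mul,
          TensorProduct.zero_tmul, TensorProduct.tmul_zero]
    | add s t hs ht => simp only [LinearMap.map_add, LinearEquiv.map_add, LinearMap.add_apply, hs, ht]
    | tmul a x => simp [lTensorHomEquivHomLTensor_apply]
  apply (lTensorHomEquivHomLTensor k M A M).injective
  ext m
  rw [e, e, h]

theorem evAt_tmul_mul (m : M) (a : A) (y : Module.End k M) (X : A ⊗[k] Module.End k M) :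
    evAt A m ((a ⊗ₜ y) * X) = TensorProduct.map (mulLeft k a) y (evAt A m X) := by
  induction X with
  | zero => simp only [LinearMap.map_zero, LinearMap.zero_apply, mul_zero, zero_mul,
        TensorProduct.zero_tmul, TensorProduct.tmul_zero]
  | add s t hs ht => simp only [LinearMap.map_add, mul_add, hs, ht]
  | tmul b x => simp

theorem evAt_mul_tmul (m : M) (a : A) (y : Module.End k M) (X : A ⊗[k] Module.End k M) :
    evAt A m (X * (a ⊗ₜ y)) = (mulRight k a).rTensor M (evAt A (y m) X) := by
  induction X with
  | zero => simp only [LinearMap.map_zero, LinearMap.zero_apply, mul_zero, zero_mul,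
        TensorProduct.zero_tmul, TensorProduct.tmul_zero]
  | add s t hs ht => simp only [LinearMap.map_add, add_mul, hs, ht]
  | tmul b x => simp

end Evaluation

section Operators

variable {k H A M : Type*} [Field k] [Ring H] [Algebra k H] [Ring A] [Algebra k A]
  [AddCommGroup M] [Module k M] [Module.Finite k M]
  (Q : QuasiHopfAlgebra k H) (D : YDData k H M)

/-- The coaction as an element of `H ⊗ End M`. -/
noncomputable def lop : H ⊗[k] Module.End k M :=
  (lTensorHomEquivHomLTensor k M H M).symm D.coact

/-- The action as a linear map. -/
noncomputable abbrev aop (D : YDData k H M) : H →ₗ[k] Module.End k M := D.act.toLinearMap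

theorem evAt_lop (m : M) : evAt H m (lop D) = D.coact m := by
  have e : ∀ (X : H ⊗[k] Module.End k M),
      lTensorHomEquivHomLTensor k M H M X m = evAt H m X := fun X => by
    induction X with
    | zero => simp only [LinearMap.map_zero, LinearEquiv.map_zero, LinearMap.zero_apply, mul_zero, zero_mul,
          TensorProduct.zero_tmul, TensorProduct.tmul_zero]
    | add s t hs ht => simp only [LinearMap.map_add, LinearEquiv.map_add, LinearMap.add_apply, hs, ht]
    | tmul a x => simp [lTensorHomEquivHomLTensor_apply]
  rw [← e, lop, LinearEquiv.apply_symm_apply]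

theorem lop_unique {X : H ⊗[k] Module.End k M} (h : ∀ m, evAt H m X = D.coact m) : X = lop D :=
  evAt_injective fun m => by rw [h, evAt_lop]

/-- The coaction placed on a strand of `H` and a strand of `End M`. -/
noncomputable def rr (n : H →ₗ[k] A) (e : Module.End k M →ₗ[k] A) : A := m2 n e (lop D)

theorem twistCoact_eq (t : H ⊗[k] H) (m : M) : D.twistCoact t m =
    evAt H m (lop D * m2 (sR H (aop D)) (sL k H _) t) := by
  induction t with
  | zero => simp only [LinearMap.map_zero, LinearMap.zero_apply, mul_zero, zero_mul,
        TensorProduct.zero_tmul, TensorProduct.tmul_zero]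
  | add s t hs ht => simp only [LinearMap.map_add, mul_add, LinearMap.add_apply, hs, ht]
  | tmul a b =>
    rw [m2_tmul, sR_apply, sL_apply, Algebra.TensorProduct.tmul_mul_tmul, one_mul, mul_one,
      evAt_mul_tmul, evAt_lop]
    rfl

theorem tensAct_evAt (t : H ⊗[k] H) (m : M) (X : H ⊗[k] Module.End k M) :
    tensAct (Algebra.lmul k H) D.act t (evAt H m X) =
    evAt H m (m2 (sL k H _) (sR H (aop D)) t * X) := by
  induction t with
  | zero => simp
  | add s t hs ht => simp only [map_add, add_mul, LinearMap.add_apply, hs, ht]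
  | tmul a b =>
    rw [m2_tmul, sR_apply, sL_apply, Algebra.TensorProduct.tmul_mul_tmul, one_mul, mul_one,
      evAt_tmul_mul]
    rfl

/-- The Yetter-Drinfeld axioms in terms of the element `lop D`. -/
structure OpYD : Prop where
  compat : ∀ h, lop D * conv Q (sR H (aop D)) (sL k H _) h =
    conv Q (sL k H _) (sR H (aop D)) h * lop D
  hex : rr D (sR H (sL k H _)) (sR H (sR H LinearMap.id)) *
      (ph Q (sL k H _) (sR H (sR H (aop D))) (sR H (sL k H _)) *
        rr D (sL k H _) (sR H (sR H LinearMap.id))) =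
    ph Q (sL k H _) (sR H (sL k H _)) (sR H (sR H (aop D))) *
      (rr D (conv Q (sL k H _) (sR H (sL k H _))) (sR H (sR H LinearMap.id)) *
        ph Q (sR H (sR H (aop D))) (sL k H _) (sR H (sL k H _)))
  counit : rr D (triv Q _) LinearMap.id = 1

/-- `a ⊗ b ⊗ x ↦ a ⊗ b ⊗ x(m)` -/
noncomputable def evAt2 (H : Type*) [Ring H] [Algebra k H] (m : M) :
    H ⊗[k] (H ⊗[k] Module.End k M) →ₗ[k] H ⊗[k] (H ⊗[k] M) := (evAt H m).lTensor H

theorem evAt2_injective {X Y : H ⊗[k] (H ⊗[k] Module.End k M)}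
    (h : ∀ m, evAt2 H m X = evAt2 H m Y) : X = Y := by
  have e : ∀ (m : M) (X : H ⊗[k] (H ⊗[k] Module.End k M)), TensorProduct.assoc k H H M
      (evAt (H ⊗[k] H) m ((TensorProduct.assoc k H H _).symm X)) = evAt2 H m X := fun m X => by
    induction X using ind3 with
    | h0 => simp only [LinearMap.map_zero, LinearEquiv.map_zero, LinearMap.zero_apply, mul_zero, zero_mul,
          TensorProduct.zero_tmul, TensorProduct.tmul_zero]
    | ha s t hs ht => simp only [LinearMap.map_add, LinearEquiv.map_add, hs, ht]
    | h a b c => simp [evAt2]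
  apply (TensorProduct.assoc k H H (Module.End k M)).symm.injective
  refine evAt_injective fun m => ?_
  apply (TensorProduct.assoc k H H M).injective
  rw [e, e, h]

theorem hex_left (m : M) (t : H ⊗[k] (H ⊗[k] H)) :
    sw3 (fun a b c => TensorProduct.map (LinearMap.mul k H a) (D.twistCoact (b ⊗ₜ c)) (D.coact m))
      (by
        constructor <;> intros <;> constructor <;> intros <;>
          simp [TensorProduct.add_tmul, TensorProduct.tmul_add, TensorProduct.map_add_left,
            TensorProduct.map_add_right, TensorProduct.map_smul_left,
            TensorProduct.map_smul_right, ← TensorProduct.smul_tmul']) t =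
    evAt2 H m (rr D (sR H (sL k H _)) (sR H (sR H LinearMap.id)) *
      (m2 (sL k H _) (m2 (sR H (sR H (aop D))) (sR H (sL k H _))) t *
        rr D (sL k H _) (sR H (sR H LinearMap.id)))) := by
  induction t using ind3 with
  | h0 => simp only [LinearMap.map_zero, LinearMap.zero_apply, mul_zero, zero_mul,
        TensorProduct.zero_tmul, TensorProduct.tmul_zero]
  | ha s t hs ht => simp only [LinearMap.map_add, add_mul, mul_add, hs, ht]
  | h a b c =>
  have e1 : rr D (sR H (sL k H _)) (sR H (sR H LinearMap.id)) = (1 : H) ⊗ₜ[k] lop D := by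
    rw [rr]
    generalize lop D = X
    induction X with
    | zero => simp only [LinearMap.map_zero, LinearMap.zero_apply, mul_zero, zero_mul,
          TensorProduct.zero_tmul, TensorProduct.tmul_zero]
    | add s t hs ht => simp only [LinearMap.map_add, TensorProduct.tmul_add, hs, ht]
    | tmul a b => simp
  rw [e1, rr, sw3_tmul, ← evAt_lop]
  have e2 : ∀ X : H ⊗[k] Module.End k M,
      TensorProduct.map (LinearMap.mul k H a) (D.twistCoact (b ⊗ₜ c)) (evAt H m X) =
      evAt2 H m (1 ⊗ₜ lop D * (m2 (sL k H _) (m2 (sR H (sR H (aop D))) (sR H (sL k H _)))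
        (a ⊗ₜ (b ⊗ₜ c)) * m2 (sL k H _) (sR H (sR H LinearMap.id)) X)) :=
    ind2 (by simp) (fun s t hs ht => by simp only [LinearMap.map_add, mul_add, hs, ht]) fun h x => by
      simp [evAt2, twistCoact_eq, evAt_mul_tmul]
  exact e2 _

theorem hex_right_inner (m : M) (t : H ⊗[k] (H ⊗[k] H)) :
    sw3 (fun a b c => TensorProduct.assoc k H H M
          (((LinearMap.mul k (H ⊗[k] H)).flip (b ⊗ₜ c) ∘ₗ Q.comul.toLinearMap).rTensor M
            (D.coact (D.act a m))))
        (by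
          constructor <;> intros <;> constructor <;> intros <;>
            simp [TensorProduct.add_tmul, TensorProduct.tmul_add, LinearMap.rTensor_add,
              LinearMap.rTensor_smul, LinearMap.add_comp, LinearMap.smul_comp,
              ← TensorProduct.smul_tmul']) t =
    evAt2 H m (rr D (conv Q (sL k H _) (sR H (sL k H _))) (sR H (sR H LinearMap.id)) *
      m2 (sR H (sR H (aop D))) (m2 (sL k H _) (sR H (sL k H _))) t) := by
  induction t using ind3 with
  | h0 => simp only [LinearMap.map_zero, LinearMap.zero_apply, mul_zero, zero_mul,
        TensorProduct.zero_tmul, TensorProduct.tmul_zero]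
  | ha s t hs ht => simp only [LinearMap.map_add, add_mul, mul_add, hs, ht]
  | h a b c =>
  rw [sw3_tmul, ← evAt_lop, rr]
  generalize lop D = X
  induction X with
  | zero => simp only [LinearMap.map_zero, LinearEquiv.map_zero, LinearMap.zero_apply, mul_zero, zero_mul,
        TensorProduct.zero_tmul, TensorProduct.tmul_zero]
  | add s t hs ht => simp only [LinearMap.map_add, LinearEquiv.map_add, add_mul, hs, ht]
  | tmul h x =>
    rw [m2_tmul, evAt_tmul, LinearMap.rTensor_tmul, LinearMap.comp_apply, conv,
      LinearMap.comp_apply]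
    generalize Q.comul.toLinearMap h = p
    induction p with
    | zero => simp only [LinearMap.map_zero, LinearEquiv.map_zero, LinearMap.zero_apply, mul_zero, zero_mul,
          TensorProduct.zero_tmul, TensorProduct.tmul_zero]
    | add s t hs ht => simp only [LinearMap.map_add, LinearEquiv.map_add, add_mul, TensorProduct.add_tmul, hs, ht]
    | tmul y z => simp [evAt2]

theorem hex_right_outer (m : M) (t : H ⊗[k] (H ⊗[k] H)) (Y : H ⊗[k] (H ⊗[k] Module.End k M)) :
    tensAct (Algebra.lmul k H) (tensAct (Algebra.lmul k H) D.act) t (evAt2 H m Y) =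
    evAt2 H m (m2 (sL k H _) (m2 (sR H (sL k H _)) (sR H (sR H (aop D)))) t * Y) := by
  induction t using ind3 with
  | h0 => simp
  | ha s t hs ht => simp only [map_add, add_mul, LinearMap.add_apply, hs, ht]
  | h a b c =>
    induction Y using ind3 with
    | h0 => simp only [LinearMap.map_zero, LinearMap.zero_apply, mul_zero, zero_mul,
          TensorProduct.zero_tmul, TensorProduct.tmul_zero]
    | ha s t hs ht => simp only [LinearMap.map_add, mul_add, hs, ht]
    | h x y z => simp [evAt2, tensAct_tmul]

theorem counit_evAt (m : M) (X : H ⊗[k] Module.End k M) :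
    TensorProduct.lid k M (Q.counit.toLinearMap.rTensor M (evAt H m X)) =
      m2 (triv Q _) LinearMap.id X m := by
  induction X with
  | zero => simp only [LinearMap.map_zero, LinearEquiv.map_zero, LinearMap.zero_apply, mul_zero, zero_mul,
        TensorProduct.zero_tmul, TensorProduct.tmul_zero]
  | add s t hs ht => simp only [LinearMap.map_add, LinearEquiv.map_add, LinearMap.add_apply, hs, ht]
  | tmul a b => simp [Algebra.algebraMap_eq_smul_one]

theorem isYD_iff : IsYD Q D ↔ OpYD Q D := by
  have hL := fun m => hex_left D m Q.Phi
  have hR := fun m => hex_right_inner Q D m Q.Phi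
  constructor
  · intro h
    refine ⟨fun x => evAt_injective fun m => ?_, evAt2_injective fun m => ?_, ?_⟩
    · have := h.compat x m
      rw [twistCoact_eq, ← evAt_lop, tensAct_evAt] at this
      exact this.symm
    · have := h.coact_coassoc m
      rw [hL, hR, hex_right_outer] at this
      exact this
    · ext m
      have := h.counit_coact m
      rw [← evAt_lop, counit_evAt] at this
      exact this
  · intro h
    refine ⟨fun m => ?_, fun m => ?_, fun x m => ?_⟩
    · rw [hL, hR, hex_right_outer]
      exact congrArg _ h.hex
    · rw [← evAt_lop, counit_evAt]
      exact LinearMap.congr_fun h.counit m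
    · rw [twistCoact_eq, ← evAt_lop, tensAct_evAt]
      exact congrArg _ (h.compat x).symm

section Generic
variable {D Q} (n n' : H →ₗ[k] A) (e : Module.End k M →ₗ[k] A) [Str n] [Str n']
  [Str e] [Cm n n'] [Cm n e] [Cm n' e]

attribute [local instance] Cm.symm

theorem map_rr {A' : Type*} [Ring A'] [Algebra k A'] (χ : A →ₗ[k] A') [Str χ] (n : H →ₗ[k] A)
    (e : Module.End k M →ₗ[k] A) : χ (rr D n e) = rr D (χ ∘ₗ n) (χ ∘ₗ e) := by
  rw [rr, rr, map_m2]

theorem OpYD.rr_compat (hD : OpYD Q D) (h : H) : rr D n e * conv Q (e ∘ₗ aop D) n h =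
    conv Q n (e ∘ₗ aop D) h * rr D n e := by
  have h1 := congrArg (m2 n e) (hD.compat h)
  rw [Str.map_mul, Str.map_mul] at h1
  have h2 := LinearMap.congr_fun (comp_conv Q (m2 n e) (sR H (aop D)) (sL k H _)) h
  have h3 := LinearMap.congr_fun (comp_conv Q (m2 n e) (sL k H _) (sR H (aop D))) h
  rw [m2_comp_sL, m2_comp_sR] at h2 h3
  simp only [LinearMap.comp_apply] at h2 h3
  rw [h2, h3] at h1
  exact h1

theorem OpYD.rr_hex (hD : OpYD Q D) : rr D n' e * (ph Q n (e ∘ₗ aop D) n' * rr D n e) =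
    ph Q n n' (e ∘ₗ aop D) * (rr D (conv Q n n') e * ph Q (e ∘ₗ aop D) n n') := by
  have h1 := congrArg (m2 n (m2 n' e)) hD.hex
  simp only [Str.map_mul (u := m2 n (m2 n' e)), map_ph Q (m2 n (m2 n' e)), map_rr (m2 n (m2 n' e)),
    comp_conv Q (m2 n (m2 n' e)), m2_comp_sL, m2_comp_sR, LinearMap.comp_id] at h1
  exact h1

theorem OpYD.rr_triv (hD : OpYD Q D) : rr D (triv Q A) e = 1 := by
  have h1 := congrArg e hD.counit
  rw [map_rr, Str.map_one, LinearMap.comp_id] at h1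
  rw [← h1]
  congr 1
  ext h
  simp [Algebra.algebraMap_eq_smul_one, Str.map_one]

theorem OpYD.ps (hD : OpYD Q D) : Ps (rr D n e) (conv Q (e ∘ₗ aop D) n) (conv Q n (e ∘ₗ aop D)) :=
  ⟨hD.rr_compat n e⟩

end Generic

end Operators

section TwistStrands

variable {k H A : Type*} [Field k] [Ring H] [Algebra k H] [Ring A] [Algebra k A]
  {Q : QuasiHopfAlgebra k H} {T T' : H →ₗ[k] H} {F G : H ⊗[k] H}

attribute [local instance] Cm.symm

theorem pass_m2 {P P' : Type*} [AddCommGroup P] [Module k P] [AddCommGroup P'] [Module k P']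
    {u u' : P →ₗ[k] A} {v v' : P' →ₗ[k] A} (p : A) [Ps p u u'] [Ps p v v'] (t : P ⊗[k] P') :
    p * m2 u v t = m2 u' v' t * p := Ps.pass t

theorem pass_m2_mul {P P' : Type*} [AddCommGroup P] [Module k P] [AddCommGroup P'] [Module k P']
    {u u' : P →ₗ[k] A} {v v' : P' →ₗ[k] A} (p : A) [Ps p u u'] [Ps p v v'] (t : P ⊗[k] P') (x : A) :
    p * (m2 u v t * x) = m2 u' v' t * (p * x) := by
  rw [← mul_assoc, pass_m2 (u' := u') (v' := v'), mul_assoc]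

section
variable {u v w : H →ₗ[k] A} [Str u] [Str v] [Str w] [Cm u v] [Cm u w]
  [Cm v w]

theorem IsTwist.F_mul_G (hT : IsTwist Q T T' F G) : m2 u v F * m2 u v G = 1 := by
  rw [← Str.map_mul, hT.mul_inv, Str.map_one]

theorem IsTwist.G_mul_F (hT : IsTwist Q T T' F G) : m2 u v G * m2 u v F = 1 := by
  rw [← Str.map_mul, hT.inv_mul, Str.map_one]

theorem IsTwist.F_mul_G_mul (hT : IsTwist Q T T' F G) (x : A) : m2 u v F * (m2 u v G * x) = x := by
  rw [← mul_assoc, hT.F_mul_G, one_mul]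

theorem IsTwist.G_mul_F_mul (hT : IsTwist Q T T' F G) (x : A) : m2 u v G * (m2 u v F * x) = x := by
  rw [← mul_assoc, hT.G_mul_F, one_mul]

theorem IsTwist.flip_mul_F (hT : IsTwist Q T T' F G) (h : H) :
    m2 u v (flipMap T (Q.comul h)) * m2 u v F = m2 u v F * conv Q u v (T h) := by
  rw [← Str.map_mul, hT.intertwine, Str.map_mul]; rfl

theorem IsTwist.G_mul_flip (hT : IsTwist Q T T' F G) (h : H) :
    m2 u v G * m2 u v (flipMap T (Q.comul h)) = conv Q u v (T h) * m2 u v G := by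
  calc _ = m2 u v G * (m2 u v (flipMap T (Q.comul h)) * m2 u v F) * m2 u v G := by
        simp only [mul_assoc, hT.F_mul_G, mul_one]
    _ = _ := by rw [hT.flip_mul_F, hT.G_mul_F_mul]

theorem IsTwist.flip_eq (hT : IsTwist Q T T' F G) (h : H) :
    m2 u v (flipMap T (Q.comul (T' h))) = m2 u v F * (conv Q u v h * m2 u v G) := by
  calc _ = m2 u v (flipMap T (Q.comul (T' h))) * m2 u v F * m2 u v G := by
        rw [mul_assoc, hT.F_mul_G, mul_one]
    _ = _ := by rw [hT.flip_mul_F, hT.right_inv, mul_assoc]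

variable (u v w)

theorem m2_inc23 (t : H ⊗[k] H) : m2 u (m2 v w) (inc23 k H t) = m2 v w t := by
  change m2 u (m2 v w) (1 ⊗ₜ t) = _
  rw [m2_tmul, Str.map_one, one_mul]

theorem m2_inc12 (t : H ⊗[k] H) : m2 u (m2 v w) (inc12 k H t) = m2 u v t := by
  refine (m2_assoc u v w (t ⊗ₜ 1)).trans ?_
  rw [m2_tmul, Str.map_one, mul_one]

theorem m2_idComul (t : H ⊗[k] H) : m2 u (m2 v w) (Q.idComul t) = m2 u (conv Q v w) t := by
  induction t with
  | zero => simp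
  | add s t hs ht => simp only [map_add, hs, ht]
  | tmul a b => rfl

theorem m2_comulId (t : H ⊗[k] H) : m2 u (m2 v w) (comulId Q t) = m2 (conv Q u v) w t := by
  induction t with
  | zero => simp
  | add s t hs ht => simp only [map_add, hs, ht]
  | tmul a b => rw [comulId_tmul]; exact m2_assoc u v w _

/-- `T(X³) ⊗ T(X²) ⊗ T(X¹)` placed on three strands. -/
noncomputable def rv (Q : QuasiHopfAlgebra k H) (T : H →ₗ[k] H) (u v w : H →ₗ[k] A) : A :=
  m2 u (m2 v w) (rev3 T Q.Phi)

theorem IsTwist.hex (hT : IsTwist Q T T' F G) :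
    m2 v w F * (m2 u (conv Q v w) F * ph Q u v w) =
      rv Q T u v w * (m2 u v F * m2 (conv Q u v) w F) := by
  have := congrArg (m2 u (m2 v w)) hT.hexagon
  simp only [Str.map_mul (u := m2 u (m2 v w)), m2_inc23, m2_inc12, m2_idComul, m2_comulId] at this
  exact this

theorem IsTwist.rv_eq (hT : IsTwist Q T T' F G) : rv Q T u v w =
    m2 v w F * (m2 u (conv Q v w) F * (ph Q u v w * (m2 (conv Q u v) w G * m2 u v G))) := by
  have := congrArg (fun x => x * (m2 (conv Q u v) w G * m2 u v G)) (hT.hex u v w)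
  simp only [mul_assoc, hT.F_mul_G_mul, hT.F_mul_G, mul_one] at this
  exact this.symm

end

section DualOperators

variable {M : Type*} [AddCommGroup M] [Module k M] [Module.Finite k M] {D : YDData k H M}

instance {P : Type*} [AddCommGroup P] [Module k P] (n : H →ₗ[k] A) (e : Module.End k M →ₗ[k] A)
    (z : P →ₗ[k] A) [Cm n z] [Cm e z] : Ps (rr D n e) z z :=
  ⟨fun a => Cm.comm (u := m2 n e) _ a⟩

variable (D) in
/-- `F · 𝓛 · G₂₁`. -/
noncomputable def kk (F G : H ⊗[k] H) (n : H →ₗ[k] A) (e : Module.End k M →ₗ[k] A) : A :=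
  m2 n (e ∘ₗ aop D) F * (rr D n e * m2 (e ∘ₗ aop D) n G)

variable (p q : H →ₗ[k] A) (e : Module.End k M →ₗ[k] A)
  [Str p] [Str q] [Str e] [Cm p q] [Cm p e] [Cm q e]

theorem kk_compat (hT : IsTwist Q T T' F G) (hD : OpYD Q D) (h : H) :
    m2 p (e ∘ₗ aop D) (flipMap T (Q.comul h)) * kk D F G p e =
    kk D F G p e * m2 (e ∘ₗ aop D) p (flipMap T (Q.comul h)) := by
  rw [kk, ← mul_assoc, hT.flip_mul_F]
  simp only [mul_assoc]
  rw [hT.G_mul_flip, ← mul_assoc (conv Q _ _ _), ← hD.rr_compat p e, mul_assoc]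

theorem kk_hex (hT : IsTwist Q T T' F G) (hD : OpYD Q D) :
    kk D F G q e * (rv Q T p (e ∘ₗ aop D) q * kk D F G p e) =
    rv Q T p q (e ∘ₗ aop D) * (m2 p q F * (kk D F G (conv Q p q) e * (m2 p q G *
      rv Q T (e ∘ₗ aop D) p q))) := by
  have := hD.ps p e
  have := hD.ps q e
  set m := e ∘ₗ aop D with hm
  rw [hT.rv_eq p m q, hT.rv_eq p q m, hT.rv_eq m p q, kk, kk, kk, ← hm]
  simp only [mul_assoc, hT.G_mul_F_mul]
  rw [pass_m2_mul (u := p) (v := conv Q m q) (u' := p) (v' := conv Q q m) (rr D q e),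
    ← pass_m2_mul (u := conv Q m p) (v := q) (u' := conv Q p m) (v' := q) (rr D p e)]
  congr 2
  simp only [← mul_assoc]
  congr 2
  rw [hm, mul_assoc, hD.rr_hex p q e, mul_assoc]

end DualOperators

section AntiMaps

variable {C P P' : Type*} [Ring C] [Algebra k C] [AddCommGroup P] [Module k P]
  [AddCommGroup P'] [Module k P'] (χ : A →ₗ[k] C) [Anti χ]

theorem anti_m2 (u : P →ₗ[k] A) (v : P' →ₗ[k] A) [Cm u v] (t : P ⊗[k] P') :
    χ (m2 u v t) = m2 (χ ∘ₗ u) (χ ∘ₗ v) t := by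
  induction t with
  | zero => simp only [LinearMap.map_zero, LinearMap.zero_apply, mul_zero, zero_mul,
        TensorProduct.zero_tmul, TensorProduct.tmul_zero]
  | add s t hs ht => simp only [LinearMap.map_add, hs, ht]
  | tmul a b =>
    rw [m2_tmul, m2_tmul, Anti.map_mul, LinearMap.comp_apply, LinearMap.comp_apply,
      ← Anti.map_mul, ← Anti.map_mul, Cm.comm (u := u) (v := v)]

theorem m2_flipMap (u v : H →ₗ[k] A) (t : H ⊗[k] H) [Cm u v] :
    m2 u v (flipMap T t) = m2 (v ∘ₗ T) (u ∘ₗ T) t := by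
  induction t with
  | zero => simp only [LinearMap.map_zero, LinearMap.zero_apply, mul_zero, zero_mul,
        TensorProduct.zero_tmul, TensorProduct.tmul_zero]
  | add s t hs ht => simp only [LinearMap.map_add, hs, ht]
  | tmul a b => simp [Cm.comm (u := u) (v := v)]

variable (u v w : H →ₗ[k] A) [Cm u v] [Cm u w] [Cm v w]

theorem anti_flip (h : H) : χ (m2 u v (flipMap T (Q.comul h))) =
    conv Q (χ ∘ₗ v ∘ₗ T) (χ ∘ₗ u ∘ₗ T) h := by
  rw [m2_flipMap, anti_m2]; rfl

theorem anti_rv : χ (rv Q T u v w) = ph Q (χ ∘ₗ w ∘ₗ T) (χ ∘ₗ v ∘ₗ T) (χ ∘ₗ u ∘ₗ T) := by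
  rw [rv, ph]
  generalize Q.Phi = t
  induction t using ind3 with
  | h0 => simp only [LinearMap.map_zero, LinearMap.zero_apply, mul_zero, zero_mul,
        TensorProduct.zero_tmul, TensorProduct.tmul_zero]
  | ha s t hs ht => simp only [LinearMap.map_add, hs, ht]
  | h a b c =>
    simp only [rev3_tmul, m2_tmul, Anti.map_mul, LinearMap.comp_apply, mul_assoc]

instance : Anti (Module.Dual.transpose (R := k) (M := P) (M' := P) : Module.End k P →ₗ[k] _) :=
  ⟨rfl, fun _ _ => rfl⟩

instance {B : Type*} [Ring B] [Algebra k B] {B' : Type*} [Ring B'] [Algebra k B']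
    (φ : A →ₗ[k] C) (ψ : B →ₗ[k] B') [Anti φ] [Anti ψ] : Anti (TensorProduct.map φ ψ) where
  map_one := by simp [Algebra.TensorProduct.one_def, Anti.map_one]
  map_mul s t := by
    induction s with
    | zero => simp only [LinearMap.map_zero, LinearMap.zero_apply, mul_zero, zero_mul,
          TensorProduct.zero_tmul, TensorProduct.tmul_zero]
    | add s t hs ht => simp only [LinearMap.map_add, add_mul, mul_add, hs, ht]
    | tmul a b =>
      induction t with
      | zero => simp only [LinearMap.map_zero, LinearMap.zero_apply, mul_zero, zero_mul,
            TensorProduct.zero_tmul, TensorProduct.tmul_zero]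
      | add s t hs ht => simp only [LinearMap.map_add, add_mul, mul_add, hs, ht]
      | tmul c d => simp [Anti.map_mul]

end AntiMaps

section DualModule

variable {M ι : Type*} [AddCommGroup M] [Module k M] [Fintype ι] (e : Module.Basis ι k M)
  (hT : IsTwist Q T T' F G) (D : YDData k H M)

/-- The dual of a Yetter-Drinfeld module with respect to a twist. -/
noncomputable def twDual (hT : IsTwist Q T T' F G) (e : Module.Basis ι k M) (D : YDData k H M) :
    YDData k H (Module.Dual k M) where
  act := dualAct T hT.anti.map_one hT.anti.map_mul D.act
  coact := dualCoact e T' (tensAct (Algebra.lmul k H) D.act F ∘ₗ D.twistCoact G)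

theorem sR_comp {P P' B : Type*} [Ring P] [Algebra k P] [Ring P'] [Algebra k P'] [Ring B]
    [Algebra k B] (s : P' →ₗ[k] A) (φ : P →ₗ[k] P') : sR B s ∘ₗ φ = sR B (s ∘ₗ φ) := rfl

theorem m2_map {P P' R R' : Type*} [AddCommGroup P] [Module k P] [AddCommGroup P'] [Module k P']
    [AddCommGroup R] [Module k R] [AddCommGroup R'] [Module k R'] (u : P →ₗ[k] A) (v : P' →ₗ[k] A)
    (φ : R →ₗ[k] P) (ψ : R' →ₗ[k] P') :
    m2 u v ∘ₗ TensorProduct.map φ ψ = m2 (u ∘ₗ φ) (v ∘ₗ ψ) := by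
  rw [m2, m2, TensorProduct.map_comp, LinearMap.comp_assoc]

variable [Module.Finite k M]

theorem rr_std : rr D (sL k H _) (sR H LinearMap.id) = lop D := by
  rw [rr]
  generalize lop D = X
  induction X with
  | zero => simp only [LinearMap.map_zero, LinearMap.zero_apply, mul_zero, zero_mul,
        TensorProduct.zero_tmul, TensorProduct.tmul_zero]
  | add s t hs ht => rw [map_add, hs, ht]
  | tmul a b => simp

theorem lop_twDual : lop (twDual hT e D) = TensorProduct.map T' Module.Dual.transpose
    (kk D F G (sL k H _) (sR H LinearMap.id)) := by
  refine (lop_unique _ fun φ => ?_).symm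
  have h1 : ∀ m, tensAct (Algebra.lmul k H) D.act F (D.twistCoact G m) =
      evAt H m (kk D F G (sL k H _) (sR H LinearMap.id)) := fun m => by
    rw [twistCoact_eq, tensAct_evAt, kk, rr_std, sR_comp, LinearMap.id_comp]
  change _ = ∑ i, T' (TensorProduct.rid k H (φ.lTensor H
    (tensAct (Algebra.lmul k H) D.act F (D.twistCoact G (e i))))) ⊗ₜ[k] e.coord i
  simp only [h1]
  generalize kk D F G (sL k H _) (sR H LinearMap.id) = Y
  induction Y with
  | zero => simp
  | add s t hs ht =>
    simp only [map_add, hs, ht, TensorProduct.add_tmul, Finset.sum_add_distrib]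
  | tmul a x =>
    simp only [evAt_tmul, LinearMap.lTensor_tmul, TensorProduct.rid_tmul, map_smul,
      TensorProduct.map_tmul, TensorProduct.smul_tmul, ← TensorProduct.tmul_sum]
    congr 1
    exact (e.sum_dual_apply_smul_coord (φ ∘ₗ x)).symm

theorem map_kk {A' : Type*} [Ring A'] [Algebra k A'] (χ : A →ₗ[k] A') [Str χ] (n : H →ₗ[k] A)
    (e : Module.End k M →ₗ[k] A) : χ (kk D F G n e) = kk D F G (χ ∘ₗ n) (χ ∘ₗ e) := by
  rw [kk, Str.map_mul, Str.map_mul, map_m2, map_rr, map_m2]; rfl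

theorem kk_eq (n : H →ₗ[k] A) (e : Module.End k M →ₗ[k] A) [Str n] [Str e] [Cm n e] :
    kk D F G n e = m2 n e (kk D F G (sL k H _) (sR H LinearMap.id)) := by
  rw [map_kk, m2_comp_sL, m2_comp_sR, LinearMap.comp_id]

variable {D} (hD : OpYD Q D)

section AntiKernel

variable {A C : Type*} [Ring A] [Algebra k A] [Ring C] [Algebra k C] (χ : A →ₗ[k] C) [Anti χ]
  {p q : H →ₗ[k] A} {x : Module.End k M →ₗ[k] A} [Str p] [Str q] [Str x] [Cm p q] [Cm p x]
  [Cm q x] {p' q' : H →ₗ[k] C} {x' : Module.End k (Module.Dual k M) →ₗ[k] C}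

theorem IsTwist.anti_comp (hT : IsTwist Q T T' F G) (hp : χ ∘ₗ p = p' ∘ₗ T') :
    χ ∘ₗ p ∘ₗ T = p' := by
  rw [← LinearMap.comp_assoc, hp]
  ext h
  simp only [LinearMap.comp_apply, hT.left_inv]

theorem anti_comp_aop (hx : χ ∘ₗ x = x' ∘ₗ Module.Dual.transpose) :
    χ ∘ₗ (x ∘ₗ aop D) ∘ₗ T = x' ∘ₗ aop (twDual hT e D) := by
  rw [← LinearMap.comp_assoc, ← LinearMap.comp_assoc, hx]
  rfl

theorem anti_kk (hp : χ ∘ₗ p = p' ∘ₗ T') (hx : χ ∘ₗ x = x' ∘ₗ Module.Dual.transpose) :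
    χ (kk D F G p x) = rr (twDual hT e D) p' x' := by
  rw [kk_eq, rr, lop_twDual, anti_m2, hp, hx, ← m2_map, LinearMap.comp_apply]

theorem anti_kk_conv [Cm q' x'] [Cm p' x'] (hp : χ ∘ₗ p = p' ∘ₗ T') (hq : χ ∘ₗ q = q' ∘ₗ T')
    (hx : χ ∘ₗ x = x' ∘ₗ Module.Dual.transpose) :
    χ (m2 p q F * (kk D F G (conv Q p q) x * m2 p q G)) = rr (twDual hT e D) (conv Q q' p') x' := by
  have hΩ : ∀ b, χ (x b) = x' (Module.Dual.transpose b) := fun b => LinearMap.congr_fun hx b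
  rw [kk_eq, rr, lop_twDual]
  generalize kk D F G (sL k H _) (sR H LinearMap.id) = Y
  induction Y with
  | zero => simp only [LinearMap.map_zero, mul_zero, zero_mul]
  | add s t hs ht => simp only [LinearMap.map_add, mul_add, add_mul, hs, ht]
  | tmul a b =>
    have : m2 p q F * (m2 (conv Q p q) x (a ⊗ₜ b) * m2 p q G) =
        m2 p q (flipMap T (Q.comul (T' a))) * x b := by
      rw [hT.flip_eq, m2_tmul, mul_assoc, mul_assoc, mul_assoc,
        Cm.comm (u := x) (v := m2 p q)]
    rw [this, Anti.map_mul, anti_flip, hT.anti_comp χ hp, hT.anti_comp χ hq,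
      TensorProduct.map_tmul, m2_tmul, Cm.comm (u := conv Q _ _), hΩ]

theorem rr_twDual_compat (hD : OpYD Q D) (hp : χ ∘ₗ p = p' ∘ₗ T')
    (hx : χ ∘ₗ x = x' ∘ₗ Module.Dual.transpose) (h : H) :
    rr (twDual hT e D) p' x' * conv Q (x' ∘ₗ aop (twDual hT e D)) p' h =
      conv Q p' (x' ∘ₗ aop (twDual hT e D)) h * rr (twDual hT e D) p' x' := by
  have h1 := congrArg χ (kk_compat p x hT hD h)
  rw [Anti.map_mul, Anti.map_mul, anti_flip, anti_flip, anti_kk e hT χ hp hx,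
    hT.anti_comp χ hp, anti_comp_aop e hT χ hx] at h1
  exact h1

theorem rr_twDual_hex [Cm q' x'] [Cm p' x'] (hD : OpYD Q D) (hp : χ ∘ₗ p = p' ∘ₗ T')
    (hq : χ ∘ₗ q = q' ∘ₗ T') (hx : χ ∘ₗ x = x' ∘ₗ Module.Dual.transpose) :
    rr (twDual hT e D) p' x' * (ph Q q' (x' ∘ₗ aop (twDual hT e D)) p' *
        rr (twDual hT e D) q' x') =
      ph Q q' p' (x' ∘ₗ aop (twDual hT e D)) * (rr (twDual hT e D) (conv Q q' p') x' *
        ph Q (x' ∘ₗ aop (twDual hT e D)) q' p') := by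
  have h1 := congrArg χ (kk_hex p q x hT hD)
  rw [show m2 p q F * (kk D F G (conv Q p q) x * (m2 p q G * rv Q T (x ∘ₗ aop D) p q)) =
    (m2 p q F * (kk D F G (conv Q p q) x * m2 p q G)) * rv Q T (x ∘ₗ aop D) p q by
      simp only [mul_assoc]] at h1
  have h2 := anti_kk_conv (D := D) e hT χ hp hq hx
  generalize m2 p q F * (kk D F G (conv Q p q) x * m2 p q G) = Z at h1 h2
  simp only [Anti.map_mul, anti_kk e hT χ hp hx, anti_kk e hT χ hq hx,
    h2, anti_rv, hT.anti_comp χ hp, hT.anti_comp χ hq,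
    anti_comp_aop e hT χ hx, mul_assoc] at h1
  exact h1

end AntiKernel

theorem twDual_compat (hD : OpYD Q D) (h : H) :
    lop (twDual hT e D) * conv Q (sR H (aop (twDual hT e D))) (sL k H _) h =
    conv Q (sL k H _) (sR H (aop (twDual hT e D))) h * lop (twDual hT e D) := by
  have := hT.anti'
  have h1 := rr_twDual_compat (A := H ⊗[k] Module.End k M)
    (C := H ⊗[k] Module.End k (Module.Dual k M)) e hT (TensorProduct.map T' Module.Dual.transpose)
    (p := sL k H (Module.End k M)) (x := sR H LinearMap.id) (p' := sL k H _)
    (x' := sR H LinearMap.id) hD (by ext h; simp [Anti.map_one]) (by ext h : 1; simp [Anti.map_one]) h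
  rw [rr_std] at h1
  exact h1

theorem twDual_hex (hD : OpYD Q D) : let V := twDual hT e D
    rr V (sR H (sL k H _)) (sR H (sR H LinearMap.id)) *
      (ph Q (sL k H _) (sR H (sR H (aop V))) (sR H (sL k H _)) *
        rr V (sL k H _) (sR H (sR H LinearMap.id))) =
    ph Q (sL k H _) (sR H (sL k H _)) (sR H (sR H (aop V))) *
      (rr V (conv Q (sL k H _) (sR H (sL k H _))) (sR H (sR H LinearMap.id)) *
        ph Q (sR H (sR H (aop V))) (sL k H _) (sR H (sL k H _))) := by
  have := hT.anti'
  exact rr_twDual_hex (A := H ⊗[k] (H ⊗[k] Module.End k M))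
    (C := H ⊗[k] (H ⊗[k] Module.End k (Module.Dual k M))) e hT
    (TensorProduct.map T' (TensorProduct.map T' Module.Dual.transpose))
    (p := sR H (sL k H (Module.End k M))) (q := sL k H _) (x := sR H (sR H LinearMap.id)) hD
    (by ext h; simp [Anti.map_one]) (by ext h; simp [Anti.map_one, Algebra.TensorProduct.one_def])
    (by ext h : 1; simp [Anti.map_one])

theorem twDual_counit (hD : OpYD Q D) : rr (twDual hT e D) (triv Q _) LinearMap.id = 1 := by
  have := hT.anti
  have := hT.anti'
  have hN := (lop_twDual e hT D).symm
  have e1 : epsR Q G = 1 := by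
    have := congrArg (epsR Q) hT.mul_inv
    rwa [Str.map_mul, hT.epsR_eq, one_mul, Str.map_one] at this
  have h1 : kk D F G (triv Q _) LinearMap.id = 1 := by
    rw [kk, hD.rr_triv LinearMap.id, one_mul]
    have e2 : m2 (triv Q _) (LinearMap.id ∘ₗ aop D) F = aop D (epsL Q F) := by
      rw [map_m2]
      congr 2
      ext h; simp
    have e3 : m2 (LinearMap.id ∘ₗ aop D) (triv Q _) G = aop D (epsR Q G) := by
      rw [map_m2]
      congr 2
      ext h; simp
    rw [e2, e3, e1, hT.epsL_eq, Str.map_one, one_mul]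
  have h2 := congrArg (Module.Dual.transpose (R := k)) h1
  rw [Anti.map_one, kk_eq] at h2
  rw [rr, ← hN, ← h2]
  generalize kk D F G (sL k H _) (sR H LinearMap.id) = Y
  induction Y with
  | zero => simp only [LinearMap.map_zero, LinearMap.zero_apply, mul_zero, zero_mul,
        TensorProduct.zero_tmul, TensorProduct.tmul_zero]
  | add s t hs ht => simp only [LinearMap.map_add, hs, ht]
  | tmul a b =>
    have hc : Q.counit (T' a) = Q.counit a := by rw [← hT.counit_T (T' a), hT.right_inv]
    simp only [TensorProduct.map_tmul, m2_tmul, triv_apply, hc, Anti.map_mul, LinearMap.id_apply]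
    rw [Algebra.algebraMap_eq_smul_one, Algebra.algebraMap_eq_smul_one, map_smul, Anti.map_one,
      smul_mul_assoc, mul_smul_comm, one_mul, mul_one]

theorem twDual_opYD (hD : OpYD Q D) : OpYD Q (twDual hT e D) :=
  ⟨twDual_compat e hT hD, twDual_hex e hT hD, twDual_counit e hT hD⟩

end DualModule

end TwistStrands

section Inverses

variable {A : Type*} [Ring A]

/-- `a` is the two-sided inverse of `r`. -/
structure Inv2 (r a : A) : Prop where
  mul : r * a = 1
  mul' : a * r = 1

theorem Inv2.symm {r a : A} (h : Inv2 r a) : Inv2 a r := ⟨h.2, h.1⟩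

theorem Inv2.unique {r a b : A} (h : Inv2 r a) (h' : Inv2 r b) : a = b :=
  left_inv_eq_right_inv h.2 h'.1

theorem Inv2.comp {r a s b : A} (h : Inv2 r a) (h' : Inv2 s b) : Inv2 (r * s) (b * a) where
  mul := by rw [mul_assoc, ← mul_assoc s, h'.1, one_mul, h.1]
  mul' := by rw [mul_assoc, ← mul_assoc a, h.2, one_mul, h'.2]

end Inverses

section ProductCoaction

variable {k H A : Type*} [Field k] [Ring H] [Algebra k H] [Ring A] [Algebra k A]
  (Q : QuasiHopfAlgebra k H)

attribute [local instance] Cm.symm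

theorem Ps.inv {P : Type*} [AddCommGroup P] [Module k P] {u u' : P →ₗ[k] A} {r a : A}
    (h : Ps r u u') (h1 : r * a = 1) (h2 : a * r = 1) : Ps a u' u := ⟨fun x => by
  calc a * u' x = a * (u' x * r) * a := by rw [mul_assoc, mul_assoc, h1, mul_one]
    _ = u x * a := by rw [← h.pass, ← mul_assoc, h2, one_mul]⟩

theorem Ps.mul {P : Type*} [AddCommGroup P] [Module k P] {u u' u'' : P →ₗ[k] A} {r s : A}
    (h : Ps r u' u'') (h' : Ps s u u') : Ps (r * s) u u'' := ⟨fun x => by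
  rw [mul_assoc, h'.pass, ← mul_assoc, h.pass, mul_assoc]⟩

/-- The coaction of a tensor product, in terms of the coactions `r` and `s` of the factors. -/
noncomputable def prR (h m n : H →ₗ[k] A) (r s : A) : A :=
  ph Q h m n * (r * (phi Q m h n * (s * ph Q m n h)))

variable (h m n l : H →ₗ[k] A) [Str h] [Str m] [Str n] [Str l] [Cm h m] [Cm h n] [Cm h l] [Cm m n]
  [Cm m l] [Cm n l] (r s t : A)

/-- Reassociating a triple tensor product preserves the coaction. -/
theorem ph_mul_prR [Ps r (conv Q m h) (conv Q h m)] [Ps r n n] [Ps r l l]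
    [Ps s (conv Q n h) (conv Q h n)] [Ps s m m] [Ps s l l]
    [Ps t (conv Q l h) (conv Q h l)] [Ps t m m] [Ps t n n] :
    ph Q m n l * prR Q h (conv Q m n) l (prR Q h m n r s) t =
      prR Q h m (conv Q n l) r (prR Q h n l s t) * ph Q m n l := by
  have e1 : ph Q m n l * (ph Q h (conv Q m n) l * (ph Q h m n * r)) =
      ph Q h m (conv Q n l) * (r * ph Q (conv Q m h) n l) := by
    rw [← mul_assoc (ph Q h (conv Q m n) l), ← mul_assoc, pentagon, mul_assoc,
      pass_ph (u' := conv Q h m) (v' := n) (w' := l) Q r]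
  have e2 : ph Q (conv Q m h) n l * (phi Q m h n * s) =
      phi Q m h (conv Q n l) * (ph Q h n l * (s * ph Q m (conv Q n h) l)) := by
    rw [← mul_assoc, pentagon_ph_phi_right, mul_assoc, mul_assoc,
      pass_ph (u' := m) (v' := conv Q h n) (w' := l) Q s]
  have e3 : ph Q m (conv Q n h) l * (ph Q m n h * (phi Q (conv Q m n) h l * t)) =
      phi Q n h l * (t * ph Q m n (conv Q l h)) := by
    rw [← mul_assoc, pentagon_ph_ph, mul_assoc, mul_assoc, ph_mul_phi_mul,
      pass_ph (u' := m) (v' := n) (w' := conv Q h l) Q t]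
  have e4 : ph Q m n (conv Q l h) * ph Q (conv Q m n) l h =
      ph Q n l h * (ph Q m (conv Q n l) h * ph Q m n l) := (pentagon Q m n l h).symm
  calc ph Q m n l * prR Q h (conv Q m n) l (prR Q h m n r s) t
      = ph Q m n l * (ph Q h (conv Q m n) l * (ph Q h m n * r)) * (phi Q m h n * s) *
        (ph Q m n h * (phi Q (conv Q m n) h l * t)) * ph Q (conv Q m n) l h := by
        simp only [prR, mul_assoc]
    _ = ph Q h m (conv Q n l) * r * (ph Q (conv Q m h) n l * (phi Q m h n * s)) *
        (ph Q m n h * (phi Q (conv Q m n) h l * t)) * ph Q (conv Q m n) l h := by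
        rw [e1]; simp only [mul_assoc]
    _ = ph Q h m (conv Q n l) * r * (phi Q m h (conv Q n l) * (ph Q h n l * s)) *
        (ph Q m (conv Q n h) l * (ph Q m n h * (phi Q (conv Q m n) h l * t))) *
        ph Q (conv Q m n) l h := by
        rw [e2]; simp only [mul_assoc]
    _ = ph Q h m (conv Q n l) * r * (phi Q m h (conv Q n l) * (ph Q h n l * s)) *
        (phi Q n h l * t) * (ph Q m n (conv Q l h) * ph Q (conv Q m n) l h) := by
        rw [e3]; simp only [mul_assoc]
    _ = _ := by rw [e4]; simp only [prR, mul_assoc]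

end ProductCoaction

section Braid

variable {k H A M N : Type*} [Field k] [Ring H] [Algebra k H] [Ring A] [Algebra k A]
  {Q : QuasiHopfAlgebra k H}
  [AddCommGroup M] [Module k M] [Module.Finite k M] [AddCommGroup N] [Module k N]
  [Module.Finite k N] {D : YDData k H M} {E : YDData k H N}

attribute [local instance] Cm.symm

variable (hD : OpYD Q D) (hE : OpYD Q E) (h : H →ₗ[k] A) (x : Module.End k M →ₗ[k] A)
  (y : Module.End k N →ₗ[k] A) [Str h] [Str x] [Str y] [Cm h x] [Cm h y] [Cm x y]

theorem pass_rr {n n' : H →ₗ[k] A} {y y' : Module.End k N →ₗ[k] A} (p : A) [Ps p n n'] [Ps p y y'] :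
    p * rr E n y = rr E n' y' * p := pass_m2 (u := n) (v := y) p _

theorem rr_swap (hD : OpYD Q D) : rr D h x * rr E (conv Q (x ∘ₗ aop D) h) y =
    rr E (conv Q h (x ∘ₗ aop D)) y * rr D h x := by
  have := hD.ps h x
  exact pass_rr (n' := conv Q h (x ∘ₗ aop D)) (y' := y) _

theorem prR_mul_rr (hE : OpYD Q E) :
    prR Q h (x ∘ₗ aop D) (y ∘ₗ aop E) (rr D h x) (rr E h y) * rr E (x ∘ₗ aop D) y =
    ph Q h (x ∘ₗ aop D) (y ∘ₗ aop E) * (rr D h x * (rr E (conv Q (x ∘ₗ aop D) h) y *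
      ph Q (y ∘ₗ aop E) (x ∘ₗ aop D) h)) := by
  rw [prR]
  simp only [mul_assoc]
  rw [hE.rr_hex (x ∘ₗ aop D) h y, phi_mul_ph_mul]

theorem rr_mul_prR (hE : OpYD Q E) :
    rr E (x ∘ₗ aop D) y * prR Q h (y ∘ₗ aop E) (x ∘ₗ aop D) (rr E h y) (rr D h x) =
    ph Q h (x ∘ₗ aop D) (y ∘ₗ aop E) * (rr E (conv Q h (x ∘ₗ aop D)) y * (rr D h x *
      ph Q (y ∘ₗ aop E) (x ∘ₗ aop D) h)) := by
  have h1 := hE.rr_hex h (x ∘ₗ aop D) y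
  calc _ = (rr E (x ∘ₗ aop D) y * (ph Q h (y ∘ₗ aop E) (x ∘ₗ aop D) * rr E h y)) *
      (phi Q (y ∘ₗ aop E) h (x ∘ₗ aop D) * (rr D h x * ph Q (y ∘ₗ aop E) (x ∘ₗ aop D) h)) := by
        simp only [prR, mul_assoc]
    _ = _ := by
        rw [h1]
        simp only [mul_assoc, ph_mul_phi_mul]

/-- The braiding is a morphism of comodules. -/
theorem rr_mul_prR_eq (hD : OpYD Q D) (hE : OpYD Q E) :
    rr E (x ∘ₗ aop D) y * prR Q h (y ∘ₗ aop E) (x ∘ₗ aop D) (rr E h y) (rr D h x) =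
    prR Q h (x ∘ₗ aop D) (y ∘ₗ aop E) (rr D h x) (rr E h y) * rr E (x ∘ₗ aop D) y := by
  rw [rr_mul_prR h x y hE, prR_mul_rr h x y hE, ← mul_assoc (rr D h x), rr_swap h x y hD,
    mul_assoc]

end Braid

section DualProduct

variable {k H A M N : Type*} [Field k] [Ring H] [Algebra k H] [Ring A] [Algebra k A]
  {Q : QuasiHopfAlgebra k H} {T T' : H →ₗ[k] H} {F G : H ⊗[k] H}
  [AddCommGroup M] [Module k M] [Module.Finite k M] [AddCommGroup N] [Module k N]
  [Module.Finite k N] {D : YDData k H M} {E : YDData k H N}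

attribute [local instance] Cm.symm

variable (hT : IsTwist Q T T' F G) (h m n : H →ₗ[k] A) (x : Module.End k M →ₗ[k] A)
  (y : Module.End k N →ₗ[k] A) [Str h] [Str x] [Str y] [Cm h x] [Cm h y] [Cm x y]
  [Str m] [Str n] [Cm h m] [Cm h n] [Cm m n]

variable (Q T) in
/-- The inverse of `rv`. -/
noncomputable def rvi (u v w : H →ₗ[k] A) : A := m2 u (m2 v w) (rev3 T Q.PhiInv)

theorem IsTwist.rv_mul_rvi (hT : IsTwist Q T T' F G) : rv Q T h m n * rvi Q T h m n = 1 := by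
  have := hT.anti
  rw [rv, rvi, ← Str.map_mul, ← rev3_mul, PhiInv_mul_Phi]
  simp [Algebra.TensorProduct.one_def, Anti.map_one, Str.map_one]

theorem IsTwist.rvi_mul_rv (hT : IsTwist Q T T' F G) : rvi Q T h m n * rv Q T h m n = 1 := by
  have := hT.anti
  rw [rv, rvi, ← Str.map_mul, ← rev3_mul, Phi_mul_PhiInv]
  simp [Algebra.TensorProduct.one_def, Anti.map_one, Str.map_one]

theorem IsTwist.rvi_eq (hT : IsTwist Q T T' F G) : rvi Q T h m n =
    m2 h m F * (m2 (conv Q h m) n F * (phi Q h m n * (m2 h (conv Q m n) G * m2 m n G))) := by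
  have h1 := hT.rv_mul_rvi h m n
  calc rvi Q T h m n = (m2 h m F * (m2 (conv Q h m) n F * (phi Q h m n *
      (m2 h (conv Q m n) G * m2 m n G))) * rv Q T h m n) * rvi Q T h m n := by
        rw [hT.rv_eq h m n]
        simp only [mul_assoc, hT.G_mul_F_mul, phi_mul_ph_mul, hT.F_mul_G_mul, hT.F_mul_G, one_mul]
    _ = _ := by rw [mul_assoc, h1, mul_one]

/-- The coaction of the tensor product of two duals, before transposition. -/
noncomputable def kk2 (Q : QuasiHopfAlgebra k H) (T : H →ₗ[k] H) (F G : H ⊗[k] H)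
    (D : YDData k H M) (E : YDData k H N) (h : H →ₗ[k] A) (x : Module.End k M →ₗ[k] A)
    (y : Module.End k N →ₗ[k] A) : A :=
  rv Q T h (y ∘ₗ aop E) (x ∘ₗ aop D) * (kk E F G h y * (rvi Q T (y ∘ₗ aop E) h (x ∘ₗ aop D) *
    (kk D F G h x * rv Q T (y ∘ₗ aop E) (x ∘ₗ aop D) h)))

theorem kk2_mul (hT : IsTwist Q T T' F G) (hD : OpYD Q D) (hE : OpYD Q E) :
    kk2 Q T F G D E h x y * m2 (y ∘ₗ aop E) (x ∘ₗ aop D) F =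
    m2 (y ∘ₗ aop E) (x ∘ₗ aop D) F * (m2 h (conv Q (y ∘ₗ aop E) (x ∘ₗ aop D)) F *
      (prR Q h (y ∘ₗ aop E) (x ∘ₗ aop D) (rr E h y) (rr D h x) *
        m2 (conv Q (y ∘ₗ aop E) (x ∘ₗ aop D)) h G)) := by
  have := hD.ps h x
  have := hE.ps h y
  set m := x ∘ₗ aop D with hm
  set n := y ∘ₗ aop E with hn
  rw [kk2, kk, kk, ← hm, ← hn, hT.rv_eq h n m, hT.rvi_eq n h m, hT.rv_eq n m h, prR]
  simp only [mul_assoc, hT.G_mul_F_mul, hT.G_mul_F, mul_one]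
  rw [← pass_m2_mul (u := conv Q n h) (v := m) (u' := conv Q h n) (v' := m) (rr E h y)]
  simp only [mul_assoc, hT.G_mul_F_mul, hT.G_mul_F, mul_one]
  rw [← pass_m2_mul (u := n) (v := conv Q m h) (u' := n) (v' := conv Q h m) (rr D h x)]
  simp only [mul_assoc, hT.G_mul_F_mul, hT.G_mul_F, mul_one]

/-- The associativity of the comparison between a product of duals and the dual of a product. -/
theorem comparison_assoc (hT : IsTwist Q T T' F G) (hD : OpYD Q D) (hE : OpYD Q E) {a b c d : A}
    (ha : Inv2 (rr D h x) a) (hb : Inv2 (rr E (conv Q h (x ∘ₗ aop D)) y) b)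
    (hc : Inv2 (rr E (x ∘ₗ aop D) y) c)
    (hd : Inv2 (prR Q h (x ∘ₗ aop D) (y ∘ₗ aop E) (rr D h x) (rr E h y)) d) :
    m2 (x ∘ₗ aop D) h F * (a * (m2 (y ∘ₗ aop E) (conv Q h (x ∘ₗ aop D)) F * b)) =
    rv Q T (y ∘ₗ aop E) (x ∘ₗ aop D) h * (m2 (y ∘ₗ aop E) (x ∘ₗ aop D) F *
      (c * (m2 (conv Q (x ∘ₗ aop D) (y ∘ₗ aop E)) h F *
        (d * ph Q h (x ∘ₗ aop D) (y ∘ₗ aop E))))) := by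
  have hm := prR_mul_rr (D := D) h x y hE
  rw [← mul_assoc (rr D h x), rr_swap h x y hD] at hm
  have p1 := (hD.ps h x).inv ha.mul ha.mul'
  have p2 := (hE.ps (x ∘ₗ aop D) y).inv hc.mul hc.mul'
  have q1 : Ps a (y ∘ₗ aop E) (y ∘ₗ aop E) :=
    Ps.inv (r := rr D h x) inferInstance ha.mul ha.mul'
  have q2 : Ps c h h := Ps.inv (r := rr E (x ∘ₗ aop D) y) inferInstance hc.mul hc.mul'
  set m := x ∘ₗ aop D
  set n := y ∘ₗ aop E
  have hph : ∀ u v w : H →ₗ[k] A, [Str u] → [Str v] → [Str w] → [Cm u v] → [Cm u w] → [Cm v w] →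
      Inv2 (ph Q u v w) (phi Q u v w) := fun u v w _ _ _ _ _ _ => ⟨by simp, by simp⟩
  have key : a * b = ph Q n m h * (c * (d * ph Q h m n)) := by
    have e1 := ((hph h m n).comp ((hb.comp ha).comp (hph n m h)))
    have e2 := hd.comp hc
    rw [hm] at e2
    have e3 := e1.unique e2
    calc a * b = ph Q n m h * (phi Q n m h * (a * b) * phi Q h m n) * ph Q h m n := by
          simp only [mul_assoc, ph_mul_phi_mul, phi_mul_ph, mul_one]
      _ = _ := by rw [e3]; simp only [mul_assoc]
  rw [pass_m2_mul (u := n) (v := conv Q h m) (u' := n) (v' := conv Q m h) a, key,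
    pass_m2_mul (u := conv Q m n) (v := h) (u' := conv Q n m) (v' := h) c]
  have e := congrArg (fun z => z * (c * (d * ph Q h m n))) (hT.hex n m h)
  simp only [mul_assoc] at e ⊢
  exact e

end DualProduct

section ProductHexagon

variable {k H A : Type*} [Field k] [Ring H] [Algebra k H] [Ring A] [Algebra k A]
  (Q : QuasiHopfAlgebra k H)

attribute [local instance] Cm.symm

variable (u v m n : H →ₗ[k] A) [Str u] [Str v] [Str m] [Str n] [Cm u v] [Cm u m] [Cm u n] [Cm v m]
  [Cm v n] [Cm m n] (r r' r'' s s' s'' : A)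

/-- The coaction of a tensor product is compatible with the reassociator. -/
theorem prR_hex [Ps r (conv Q m u) (conv Q u m)] [Ps r n n] [Ps r v v]
    [Ps r' (conv Q m v) (conv Q v m)] [Ps r' n n] [Ps r' u u]
    [Ps s (conv Q n u) (conv Q u n)] [Ps s m m] [Ps s v v]
    [Ps s' (conv Q n v) (conv Q v n)] [Ps s' m m] [Ps s' u u] (hc : s' * r = r * s')
    (hr : r' * (ph Q u m v * r) = ph Q u v m * (r'' * ph Q m u v))
    (hs : s' * (ph Q u n v * s) = ph Q u v n * (s'' * ph Q n u v)) :
    prR Q v m n r' s' * (ph Q u (conv Q m n) v * prR Q u m n r s) =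
      ph Q u v (conv Q m n) * (prR Q (conv Q u v) m n r'' s'' * ph Q (conv Q m n) u v) := by
  have e1 : ph Q m n v * (ph Q u (conv Q m n) v * ph Q u m n) =
      ph Q u m (conv Q n v) * ph Q (conv Q u m) n v := pentagon Q u m n v
  have e2 : phi Q m v n * (s' * ph Q u m (conv Q n v)) =
      ph Q u (conv Q m v) n * (ph Q u m v * (phi Q (conv Q u m) v n * s')) := by
    rw [pass_ph (u' := u) (v' := m) (w' := conv Q v n) Q s', ← mul_assoc, pentagon_phi_ph]
    simp only [mul_assoc]
  have e3 : phi Q (conv Q u m) v n * (s' * (ph Q (conv Q u m) n v * r)) =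
      r * (phi Q (conv Q m u) v n * (s' * ph Q (conv Q m u) n v)) := by
    rw [← pass_ph (u := conv Q m u) (v := n) (w := v) Q r, ← mul_assoc s', hc, mul_assoc,
      ← mul_assoc, ← pass_phi (u := conv Q m u) (v := v) (w := n) Q r, mul_assoc]
  have e4 : ph Q v m n * (ph Q u (conv Q v m) n * ph Q u v m) =
      ph Q u v (conv Q m n) * ph Q (conv Q u v) m n := pentagon Q u v m n
  have e5 : s' * (ph Q (conv Q m u) n v * phi Q m u n) =
      phi Q m u (conv Q v n) * (s' * (ph Q u n v * ph Q m (conv Q u n) v)) := by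
    rw [pentagon_ph_phi_right, ← mul_assoc,
      pass_phi (u' := m) (v' := u) (w' := conv Q v n) Q s', mul_assoc]
  have e6 : ph Q m u v * (phi Q (conv Q m u) v n * phi Q m u (conv Q v n)) =
      phi Q m (conv Q u v) n * phi Q u v n := pentagon_ph_phi_phi Q m u v n
  have e7 : phi Q u v n * (s' * (ph Q u n v * (ph Q m (conv Q u n) v * s))) =
      s'' * (ph Q n u v * ph Q m (conv Q n u) v) := by
    rw [← pass_ph (u := m) (v := conv Q n u) (w := v) Q s, ← mul_assoc (ph Q u n v),
      ← mul_assoc s', hs]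
    simp only [mul_assoc, phi_mul_ph_mul]
  have e8 : ph Q n u v * (ph Q m (conv Q n u) v * ph Q m n u) =
      ph Q m n (conv Q u v) * ph Q (conv Q m n) u v := pentagon Q m n u v
  calc prR Q v m n r' s' * (ph Q u (conv Q m n) v * prR Q u m n r s)
      = ph Q v m n * r' * phi Q m v n * s' * (ph Q m n v * (ph Q u (conv Q m n) v * ph Q u m n)) *
        r * phi Q m u n * s * ph Q m n u := by simp only [prR, mul_assoc]
    _ = ph Q v m n * r' * (phi Q m v n * (s' * ph Q u m (conv Q n v))) * ph Q (conv Q u m) n v *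
        r * phi Q m u n * s * ph Q m n u := by rw [e1]; simp only [mul_assoc]
    _ = ph Q v m n * (r' * ph Q u (conv Q m v) n) * ph Q u m v *
        (phi Q (conv Q u m) v n * (s' * (ph Q (conv Q u m) n v * r))) *
        phi Q m u n * s * ph Q m n u := by rw [e2]; simp only [mul_assoc]
    _ = ph Q v m n * ph Q u (conv Q v m) n * (r' * (ph Q u m v * r)) *
        phi Q (conv Q m u) v n * (s' * (ph Q (conv Q m u) n v * phi Q m u n)) *
        s * ph Q m n u := by
        rw [e3, pass_ph (u' := u) (v' := conv Q v m) (w' := n) Q r']; simp only [mul_assoc]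
    _ = (ph Q v m n * (ph Q u (conv Q v m) n * ph Q u v m)) * r'' *
        (ph Q m u v * (phi Q (conv Q m u) v n * phi Q m u (conv Q v n))) *
        (s' * (ph Q u n v * (ph Q m (conv Q u n) v * s))) * ph Q m n u := by
        rw [hr, e5]; simp only [mul_assoc]
    _ = ph Q u v (conv Q m n) * ph Q (conv Q u v) m n * r'' * phi Q m (conv Q u v) n *
        (phi Q u v n * (s' * (ph Q u n v * (ph Q m (conv Q u n) v * s)))) * ph Q m n u := by
        rw [e4, e6]; simp only [mul_assoc]
    _ = ph Q u v (conv Q m n) * ph Q (conv Q u v) m n * r'' * phi Q m (conv Q u v) n * s'' *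
        (ph Q n u v * (ph Q m (conv Q n u) v * ph Q m n u)) := by
        rw [e7]; simp only [mul_assoc]
    _ = _ := by rw [e8]; simp only [prR, mul_assoc]

theorem prR_compat [Ps r (conv Q m u) (conv Q u m)] [Ps r n n]
    [Ps s (conv Q n u) (conv Q u n)] [Ps s m m] (h : H) :
    prR Q u m n r s * conv Q (conv Q m n) u h = conv Q u (conv Q m n) h * prR Q u m n r s := by
  have p1 : Ps (ph Q m n u) (conv Q (conv Q m n) u) (conv Q m (conv Q n u)) := inferInstance
  have p2 : Ps s (conv Q m (conv Q n u)) (conv Q m (conv Q u n)) := inferInstance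
  have p3 : Ps (phi Q m u n) (conv Q m (conv Q u n)) (conv Q (conv Q m u) n) := inferInstance
  have p4 : Ps r (conv Q (conv Q m u) n) (conv Q (conv Q u m) n) := inferInstance
  have p5 : Ps (ph Q u m n) (conv Q (conv Q u m) n) (conv Q u (conv Q m n)) := inferInstance
  exact (p5.mul (p4.mul (p3.mul (p2.mul p1)))).pass h

end ProductHexagon

section TensorStrands

variable {k M N P : Type*} [Field k] [AddCommGroup M] [Module k M] [AddCommGroup N] [Module k N]

variable (k M N) in
/-- The strand `x ↦ x ⊗ id`. -/
noncomputable def eL : Module.End k M →ₗ[k] Module.End k (M ⊗[k] N) := LinearMap.rTensorHom N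

variable (M) in
/-- The strand `a ↦ id ⊗ s a`. -/
noncomputable def eR [AddCommGroup P] [Module k P] (s : P →ₗ[k] Module.End k N) :
    P →ₗ[k] Module.End k (M ⊗[k] N) := LinearMap.lTensorHom M ∘ₗ s

@[simp] theorem eL_tmul (x : Module.End k M) (m : M) (n : N) :
    eL k M N x (m ⊗ₜ n) = x m ⊗ₜ n := rfl

@[simp] theorem eR_tmul [AddCommGroup P] [Module k P] (s : P →ₗ[k] Module.End k N) (a : P) (m : M)
    (n : N) : eR M s a (m ⊗ₜ n) = m ⊗ₜ s a n := rfl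

theorem eR_id_comp [AddCommGroup P] [Module k P] (φ : P →ₗ[k] Module.End k N) :
    eR M LinearMap.id ∘ₗ φ = eR M φ := rfl

instance : Str (eL k M N) := ⟨by ext; rfl, fun a b => by ext; rfl⟩

instance [Ring P] [Algebra k P] (s : P →ₗ[k] Module.End k N) [Str s] : Str (eR M s) :=
  ⟨by ext; simp [Str.map_one], fun a b => by ext; simp [Str.map_mul]⟩

instance [AddCommGroup P] [Module k P] (s : P →ₗ[k] Module.End k N) : Cm (eL k M N) (eR M s) :=
  ⟨fun a b => by ext; simp⟩

instance [AddCommGroup P] [Module k P] (s : P →ₗ[k] Module.End k N) : Cm (eR M s) (eL k M N) :=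
  Cm.symm _ _

instance [AddCommGroup P] [Module k P] {P' : Type*} [AddCommGroup P'] [Module k P']
    (s : P →ₗ[k] Module.End k N) (t : P' →ₗ[k] Module.End k N) [Cm s t] : Cm (eR M s) (eR M t) :=
  ⟨fun a b => by
    ext m n
    simp only [TensorProduct.AlgebraTensorModule.curry_apply, TensorProduct.curry_apply,
      LinearMap.restrictScalars_self, LinearMap.coe_restrictScalars, Module.End.mul_apply, eR_tmul]
    rw [← Module.End.mul_apply, Cm.comm, Module.End.mul_apply]⟩

theorem tensAct_eq {A A' : Type*} [Ring A] [Algebra k A] [Ring A'] [Algebra k A']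
    (ρ : A →ₐ[k] Module.End k M) (τ : A' →ₐ[k] Module.End k N) (t : A ⊗[k] A') :
    tensAct ρ τ t = m2 (eL k M N ∘ₗ ρ.toLinearMap) (eR M τ.toLinearMap) t := by
  induction t with
  | zero => simp
  | add s t hs ht => simp only [map_add, hs, ht]
  | tmul a b => ext; rfl

end TensorStrands

section ProductModule

variable {k H A M N : Type*} [Field k] [Ring H] [Algebra k H] [Ring A] [Algebra k A]
  (Q : QuasiHopfAlgebra k H)
  [AddCommGroup M] [Module k M] [AddCommGroup N] [Module k N]
  (D : YDData k H M) (E : YDData k H N)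

theorem aop_prodYD : aop (prodYD Q D E) = conv Q (eL k M N ∘ₗ aop D) (eR M (aop E)) := by
  ext h : 1
  exact tensAct_eq D.act E.act (Q.comul h)

/-- `H ⊗ End P` acts on `H ⊗ P`. -/
noncomputable def opA (k H P : Type*) [Field k] [Ring H] [Algebra k H] [AddCommGroup P]
    [Module k P] : H ⊗[k] Module.End k P →ₐ[k] Module.End k (H ⊗[k] P) :=
  tensAct (Algebra.lmul k H) (AlgHom.id k _)

@[simp] theorem opA_tmul {P : Type*} [AddCommGroup P] [Module k P] (h h' : H) (x : Module.End k P)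
    (p : P) : opA k H P (h ⊗ₜ x) (h' ⊗ₜ p) = (h * h') ⊗ₜ x p := rfl

theorem opA_one_tmul {P : Type*} [AddCommGroup P] [Module k P] (X : H ⊗[k] Module.End k P) (p : P) :
    opA k H P X (1 ⊗ₜ p) = evAt H p X := by
  induction X with
  | zero => simp
  | add s t hs ht => simp only [map_add, LinearMap.add_apply, hs, ht]
  | tmul a b => simp

theorem opA_m2 {P : Type*} [AddCommGroup P] [Module k P] {A : Type*} [Ring A] [Algebra k A]
    (τ : A →ₐ[k] Module.End k P) (t : H ⊗[k] A) :
    tensAct (Algebra.lmul k H) τ t = opA k H P (m2 (sL k H _) (sR H τ.toLinearMap) t) := by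
  induction t with
  | zero => simp
  | add s t hs ht => simp only [map_add, hs, ht]
  | tmul a b => ext; simp [tensAct_tmul]

variable [Module.Finite k M] [Module.Finite k N]

theorem prodCoact_inner (t : H ⊗[k] (H ⊗[k] H)) (z : M ⊗[k] N) :
    TensorProduct.leftComm k M H N
      (sw3 (fun a b c => TensorProduct.map (D.act a) (E.twistCoact (b ⊗ₜ c)))
      (by
        constructor <;> intros <;> constructor <;> intros <;>
          simp [TensorProduct.add_tmul, TensorProduct.tmul_add, TensorProduct.map_add_left,
            TensorProduct.map_add_right, TensorProduct.map_smul_left,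
            TensorProduct.map_smul_right, ← TensorProduct.smul_tmul']) t z) =
    opA k H _ (rr E (sL k H _) (sR H (eR M LinearMap.id)) *
      m2 (sR H (eL k M N ∘ₗ aop D)) (m2 (sR H (eR M (aop E))) (sL k H _)) t) (1 ⊗ₜ z) := by
  induction t using ind3 with
  | h0 => simp
  | ha s t hs ht => simp only [map_add, mul_add, LinearMap.add_apply, hs, ht]
  | h a b c =>
    induction z with
    | zero => simp only [LinearMap.map_zero, LinearEquiv.map_zero, LinearMap.zero_apply, mul_zero, zero_mul,
          TensorProduct.zero_tmul, TensorProduct.tmul_zero]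
    | add s t hs ht => simp only [LinearMap.map_add, LinearEquiv.map_add, TensorProduct.tmul_add, hs, ht]
    | tmul m n =>
      rw [sw3_tmul, TensorProduct.map_tmul, twistCoact_eq, rr, map_mul (opA k H _), Module.End.mul_apply]
      simp only [m2_tmul, sR_apply, sL_apply, Algebra.TensorProduct.tmul_mul_tmul, one_mul,
        mul_one, opA_tmul, evAt_mul_tmul]
      generalize lop E = X
      induction X with
      | zero => simp
      | add s t hs ht => simp only [map_add, TensorProduct.tmul_add, LinearMap.add_apply, hs, ht]
      | tmul x y => simp

theorem prodCoact_aux (t : H ⊗[k] (H ⊗[k] H)) (z : M ⊗[k] (H ⊗[k] N)) :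
    sw3 (fun a b c => (LinearMap.mul' k H).rTensor (M ⊗[k] N) ∘ₗ
      (TensorProduct.tensorTensorTensorComm k H M H N).toLinearMap ∘ₗ
      TensorProduct.map (D.twistCoact (a ⊗ₜ b)) ((E.act c).lTensor H))
    (by
      constructor <;> intros <;> constructor <;> intros <;>
        simp [TensorProduct.add_tmul, TensorProduct.tmul_add, TensorProduct.map_add_left,
          TensorProduct.map_add_right, TensorProduct.map_smul_left, LinearMap.lTensor_add,
          LinearMap.lTensor_smul, TensorProduct.map_smul_right, LinearMap.comp_add,
          LinearMap.comp_smul, ← TensorProduct.smul_tmul']) t z =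
    opA k H _ (rr D (sL k H _) (sR H (eL k M N)) *
      m2 (sR H (eL k M N ∘ₗ aop D)) (m2 (sL k H _) (sR H (eR M (aop E)))) t)
      (TensorProduct.leftComm k M H N z) := by
  induction t using ind3 with
  | h0 => simp
  | ha s t hs ht => simp only [map_add, mul_add, LinearMap.add_apply, hs, ht]
  | h a b c =>
    induction z using ind3 with
    | h0 => simp only [LinearMap.map_zero, LinearEquiv.map_zero, LinearMap.zero_apply, mul_zero, zero_mul,
          TensorProduct.zero_tmul, TensorProduct.tmul_zero]
    | ha s t hs ht => simp only [LinearMap.map_add, LinearEquiv.map_add, hs, ht]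
    | h m h n =>
      rw [sw3_tmul, LinearMap.comp_apply, LinearMap.comp_apply, TensorProduct.map_tmul,
        twistCoact_eq, rr, map_mul (opA k H _), Module.End.mul_apply]
      simp only [m2_tmul, sR_apply, sL_apply, Algebra.TensorProduct.tmul_mul_tmul, one_mul,
        mul_one, opA_tmul, evAt_mul_tmul, TensorProduct.leftComm_tmul]
      generalize lop D = X
      induction X with
      | zero => simp
      | add s t hs ht => simp only [map_add, TensorProduct.add_tmul, LinearMap.add_apply, hs, ht]
      | tmul x y => simp [mul_assoc]

theorem lop_prodYD : lop (prodYD Q D E) = prR Q (sL k H _) (sR H (eL k M N ∘ₗ aop D))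
    (sR H (eR M (aop E))) (rr D (sL k H _) (sR H (eL k M N)))
    (rr E (sL k H _) (sR H (eR M LinearMap.id))) := by
  refine (lop_unique _ fun z => ?_).symm
  change _ = tensAct (Algebra.lmul k H) (tensAct D.act E.act) Q.Phi (prodCoactAux Q D E _)
  have e : sR H (tensAct D.act E.act).toLinearMap =
      m2 (sR H (eL k M N ∘ₗ aop D)) (sR H (eR M (aop E))) := by
    refine LinearMap.ext fun t => ?_
    rw [sR_apply, AlgHom.toLinearMap_apply, tensAct_eq, sR_m2]
    rfl
  rw [prodCoactAux, prodCoact_aux, prodCoact_inner, opA_m2, ← opA_one_tmul, prR, e]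
  simp only [map_mul, Module.End.mul_apply]
  rfl

theorem rr_prodYD (n : H →ₗ[k] A) (e : Module.End k (M ⊗[k] N) →ₗ[k] A) [Str n] [Str e] [Cm n e] :
    rr (prodYD Q D E) n e = prR Q n (e ∘ₗ eL k M N ∘ₗ aop D) (e ∘ₗ eR M (aop E))
      (rr D n (e ∘ₗ eL k M N)) (rr E n (e ∘ₗ eR M LinearMap.id)) := by
  rw [rr, lop_prodYD, prR, prR]
  simp only [Str.map_mul (u := m2 n e), map_ph Q (m2 n e), map_phi Q (m2 n e), map_rr (m2 n e),
    m2_comp_sL, m2_comp_sR]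

theorem sR_sR_aop_prodYD (B B' : Type*) [Ring B] [Algebra k B] [Ring B'] [Algebra k B'] :
    sR B (sR B' (aop (prodYD Q D E))) =
      conv Q (sR B (sR B' LinearMap.id) ∘ₗ eL k M N ∘ₗ aop D)
        (sR B (sR B' LinearMap.id) ∘ₗ eR M (aop E)) := by
  have h1 := comp_conv Q (sR B (sR B' LinearMap.id)) (eL k M N ∘ₗ aop D) (eR M (aop E))
  rw [← h1, ← aop_prodYD]
  rfl

variable {Q D E}

theorem prod_compat (hD : OpYD Q D) (hE : OpYD Q E) (h : H) :
    lop (prodYD Q D E) * conv Q (sR H (aop (prodYD Q D E))) (sL k H _) h =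
    conv Q (sL k H _) (sR H (aop (prodYD Q D E))) h * lop (prodYD Q D E) := by
  rw [lop_prodYD, aop_prodYD]
  have := hD.ps (sL k H _) (sR H (eL k M N))
  rw [sR_comp] at this
  have : Ps (rr E (sL k H _) (sR H (eR M LinearMap.id)))
      (conv Q (sR H (eR M (aop E))) (sL k H _)) (conv Q (sL k H _) (sR H (eR M (aop E)))) :=
    by simpa only [sR_comp, eR_id_comp] using hE.ps (sL k H _) (sR H (eR M LinearMap.id))
  rw [← conv_sR]
  exact prR_compat Q (sL k H _) (sR H (eL k M N ∘ₗ aop D)) (sR H (eR M (aop E))) _ _ h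

theorem rr_prodYD_hex (hD : OpYD Q D) (hE : OpYD Q E) (u v : H →ₗ[k] A)
    (e : Module.End k (M ⊗[k] N) →ₗ[k] A) [Str u] [Str v] [Str e] [Cm u v] [Cm u e] [Cm v e] :
    rr (prodYD Q D E) v e * (ph Q u (conv Q (e ∘ₗ eL k M N ∘ₗ aop D) (e ∘ₗ eR M (aop E))) v *
      rr (prodYD Q D E) u e) =
    ph Q u v (conv Q (e ∘ₗ eL k M N ∘ₗ aop D) (e ∘ₗ eR M (aop E))) *
      (rr (prodYD Q D E) (conv Q u v) e *
        ph Q (conv Q (e ∘ₗ eL k M N ∘ₗ aop D) (e ∘ₗ eR M (aop E))) u v) := by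
  have := Cm.symm u v
  have := Cm.symm u e
  have := Cm.symm v e
  have := hD.ps u (e ∘ₗ eL k M N)
  have := hD.ps v (e ∘ₗ eL k M N)
  have : Ps (rr E u (e ∘ₗ eR M LinearMap.id)) (conv Q (e ∘ₗ eR M (aop E)) u)
      (conv Q u (e ∘ₗ eR M (aop E))) := by
    simpa only [LinearMap.comp_assoc, eR_id_comp] using hE.ps u (e ∘ₗ eR M LinearMap.id)
  have : Ps (rr E v (e ∘ₗ eR M LinearMap.id)) (conv Q (e ∘ₗ eR M (aop E)) v)
      (conv Q v (e ∘ₗ eR M (aop E))) := by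
    simpa only [LinearMap.comp_assoc, eR_id_comp] using hE.ps v (e ∘ₗ eR M LinearMap.id)
  have h1 := hD.rr_hex u v (e ∘ₗ eL k M N)
  have h2 : rr E v (e ∘ₗ eR M LinearMap.id) *
      (ph Q u (e ∘ₗ eR M (aop E)) v * rr E u (e ∘ₗ eR M LinearMap.id)) =
      ph Q u v (e ∘ₗ eR M (aop E)) * (rr E (conv Q u v) (e ∘ₗ eR M LinearMap.id) *
        ph Q (e ∘ₗ eR M (aop E)) u v) := by
    simpa only [LinearMap.comp_assoc, eR_id_comp] using hE.rr_hex u v (e ∘ₗ eR M LinearMap.id)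
  have h3 : rr E v (e ∘ₗ eR M LinearMap.id) * rr D u (e ∘ₗ eL k M N) =
      rr D u (e ∘ₗ eL k M N) * rr E v (e ∘ₗ eR M LinearMap.id) :=
    Cm.comm (u := m2 v (e ∘ₗ eR M LinearMap.id)) (v := m2 u (e ∘ₗ eL k M N)) _ _
  rw [rr_prodYD, rr_prodYD, rr_prodYD]
  exact prR_hex Q u v (e ∘ₗ eL k M N ∘ₗ aop D) (e ∘ₗ eR M (aop E)) _ _ _ _ _ _ h3 h1 h2

theorem prod_opYD (hD : OpYD Q D) (hE : OpYD Q E) : OpYD Q (prodYD Q D E) := by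
  refine ⟨prod_compat hD hE, ?_, ?_⟩
  · rw [sR_sR_aop_prodYD]
    exact rr_prodYD_hex hD hE _ _ _
  · rw [rr_prodYD, hD.rr_triv (LinearMap.id ∘ₗ eL k M N),
      hE.rr_triv (LinearMap.id ∘ₗ eR M LinearMap.id), prR]
    simp

end ProductModule

section BraidingInverse

variable {k H E : Type*} [Field k] [Ring H] [Algebra k H] [Ring E] [Algebra k E]
  (Q : QuasiHopfAlgebra k H)

attribute [local instance] Cm.symm

/-- `a ⊗ b ⊗ x ↦ b S⁻¹(a c) ⊗ x` -/
noncomputable def jj (E : Type*) [Ring E] [Algebra k E] (c : H) :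
    H ⊗[k] (H ⊗[k] E) →ₗ[k] H ⊗[k] E :=
  (LinearMap.mul' k H).rTensor E ∘ₗ (TensorProduct.assoc k H H E).symm.toLinearMap ∘ₗ
    (TensorProduct.leftComm k H H E).toLinearMap ∘ₗ (Q.Sinv ∘ₗ mulRight k c).rTensor (H ⊗[k] E)

@[simp] theorem jj_tmul (c a b : H) (x : E) :
    jj Q E c (a ⊗ₜ (b ⊗ₜ x)) = (b * Q.Sinv (a * c)) ⊗ₜ x := by simp [jj]

theorem jj_mul_left (c h : H) (y : E) (t : H ⊗[k] (H ⊗[k] E)) :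
    jj Q E c (1 ⊗ₜ (h ⊗ₜ y) * t) = (h ⊗ₜ y) * jj Q E c t := by
  induction t using ind3 with
  | h0 => simp only [LinearMap.map_zero, LinearMap.zero_apply, mul_zero, zero_mul,
        TensorProduct.zero_tmul, TensorProduct.tmul_zero]
  | ha s t hs ht => simp only [LinearMap.map_add, mul_add, hs, ht]
  | h a b x => simp [mul_assoc]

theorem jj_m2_mul (c : H) (X : H ⊗[k] E) (t : H ⊗[k] (H ⊗[k] E)) :
    jj Q E c (m2 (sR H (sL k H E)) (sR H (sR H LinearMap.id)) X * t) = X * jj Q E c t := by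
  induction X with
  | zero => simp only [LinearMap.map_zero, LinearMap.zero_apply, mul_zero, zero_mul,
        TensorProduct.zero_tmul, TensorProduct.tmul_zero]
  | add s t hs ht => simp only [LinearMap.map_add, add_mul, hs, ht]
  | tmul h y => simpa using jj_mul_left Q c h y t

theorem jj_pR (m : H →ₗ[k] E) (t : H ⊗[k] (H ⊗[k] E)) :
    jj Q E 1 (t * m2 (sR H (sR H m)) (sL k H _) Q.pR) =
    jj Q E Q.beta (t * phi Q (sR H (sR H m)) (sL k H _) (sR H (sL k H _))) := by
  rw [QuasiHopfAlgebra.pR, phi]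
  generalize Q.PhiInv = p
  induction p using ind3 with
  | h0 => simp only [LinearMap.map_zero, LinearMap.zero_apply, mul_zero, zero_mul,
        TensorProduct.zero_tmul, TensorProduct.tmul_zero]
  | ha s t hs ht => simp only [LinearMap.map_add, mul_add, hs, ht]
  | h x y z =>
    rw [sw3_tmul]
    induction t using ind3 with
    | h0 => simp only [LinearMap.map_zero, LinearMap.zero_apply, mul_zero, zero_mul,
          TensorProduct.zero_tmul, TensorProduct.tmul_zero]
    | ha s t hs ht => simp only [LinearMap.map_add, add_mul, hs, ht]
    | h a b c => simp [Q.Sinv_mul, Sinv_S, mul_assoc]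

theorem jj_rcol : RCol (jj Q E Q.beta)
    (conv Q (sL k H (H ⊗[k] E)) (sR H (sL k H E))) (triv Q _) :=
  RCol.of_contr (contr_beta Q) <|
    ind3 (Fac.right _ _ _).1 (Fac.right _ _ _).2 fun a b x =>
      ⟨(TensorProduct.mk k H E).flip x ∘ₗ mulLeft k b ∘ₗ mulRight k (Q.Sinv a) ∘ₗ Q.Sinv,
        fun y z => by simp [Q.Sinv_mul, Sinv_S, mul_assoc]⟩

/-- `S(y¹) α y² X¹ β S(y³₁ X²) ⊗ y³₂ X³ = 1 ⊗ 1` -/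
theorem jj_qL_ph (m : H →ₗ[k] E) [Str m] :
    jj Q E Q.beta (m2 (sL k H _) (conv Q (sR H (sL k H _)) (sR H (sR H m))) Q.qL *
      ph Q (sL k H _) (sR H (sL k H _)) (sR H (sR H m))) = 1 := by
  set i1 : H →ₗ[k] H ⊗[k] (H ⊗[k] (H ⊗[k] H)) := sL k H _
  set i2 : H →ₗ[k] H ⊗[k] (H ⊗[k] (H ⊗[k] H)) := sR H (sL k H _)
  set i3 : H →ₗ[k] H ⊗[k] (H ⊗[k] (H ⊗[k] H)) := sR H (sR H (sL k H _))
  set i4 : H →ₗ[k] H ⊗[k] (H ⊗[k] (H ⊗[k] H)) := sR H (sR H (sR H LinearMap.id))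
  set N : H ⊗[k] (H ⊗[k] (H ⊗[k] H)) →ₗ[k] H ⊗[k] E :=
    jj Q E 1 ∘ₗ TensorProduct.map (m2 (mulRight k Q.alpha ∘ₗ Q.S) (mulRight k Q.beta))
      (m.lTensor H) ∘ₗ (TensorProduct.assoc k H H (H ⊗[k] H)).symm.toLinearMap with hN
  have hl : LCol N (conv Q i1 i2) (triv Q _) := LCol.of_contr (contr_alpha Q) <|
    ind4 (Fac.left _ _ _).1 (Fac.left _ _ _).2 fun a b c d =>
      ⟨(TensorProduct.mk k H E).flip (m d) ∘ₗ mulLeft k c ∘ₗ Q.Sinv ∘ₗ mulLeft k (Q.S a) ∘ₗ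
        mulRight k (b * Q.beta), fun x y => by simp [hN, i1, i2, S_apply_mul, mul_assoc]⟩
  have hr : RCol N (conv Q i2 i3) (triv Q _) := RCol.of_contr (contr_beta Q) <|
    ind4 (Fac.right _ _ _).1 (Fac.right _ _ _).2 fun a b c d =>
      ⟨(TensorProduct.mk k H E).flip (m d) ∘ₗ mulLeft k c ∘ₗ mulRight k (Q.Sinv (Q.S a * Q.alpha * b))
        ∘ₗ Q.Sinv, fun x y => by simp [hN, i2, i3, Q.Sinv_mul, Sinv_S, mul_assoc]⟩
  have e1 : N (phi Q i1 i2 (conv Q i3 i4) * ph Q i2 i3 i4) = 1 := by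
    have hr' := RCol.phi Q (RCol.rfl (F := N) (u := i1)) hr (RCol.rfl (u := i4))
    rw [pentagon_ph_phi_left, hl.ph Q LCol.rfl LCol.rfl, ph_triv_left, one_mul, hr',
      phi_triv_mid, mul_one, phi,
      show (1 : H ⊗[k] E) = Q.Sinv (zagL Q Q.PhiInv) ⊗ₜ 1 by
        rw [zagL_PhiInv, Q.Sinv_one, Algebra.TensorProduct.one_def]]
    generalize Q.PhiInv = t
    induction t using ind3 with
    | h0 => simp only [LinearMap.map_zero, LinearMap.zero_apply, mul_zero, zero_mul,
          TensorProduct.zero_tmul, TensorProduct.tmul_zero]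
    | ha s t hs ht => simp only [LinearMap.map_add, TensorProduct.add_tmul, hs, ht]
    | h a b c => simp [hN, i1, i2, i3, Str.map_one, Q.Sinv_mul, mul_assoc]
  rw [← e1, phi, ph, ph, QuasiHopfAlgebra.qL]
  generalize Q.PhiInv = s
  generalize Q.Phi = t
  induction t using ind3 with
  | h0 => simp only [LinearMap.map_zero, LinearMap.zero_apply, mul_zero, zero_mul,
        TensorProduct.zero_tmul, TensorProduct.tmul_zero]
  | ha s t hs ht => simp only [LinearMap.map_add, mul_add, hs, ht]
  | h a b c =>
    induction s using ind3 with
    | h0 => simp only [LinearMap.map_zero, LinearMap.zero_apply, mul_zero, zero_mul,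
          TensorProduct.zero_tmul, TensorProduct.tmul_zero]
    | ha s t hs ht => simp only [LinearMap.map_add, add_mul, hs, ht]
    | h x y z =>
      rw [sw3_tmul]
      simp only [m2_tmul, conv, LinearMap.comp_apply]
      generalize Q.comul.toLinearMap z = p
      induction p with
      | zero => simp only [LinearMap.map_zero, LinearMap.zero_apply, mul_zero, zero_mul,
            TensorProduct.zero_tmul, TensorProduct.tmul_zero]
      | add s t hs ht => simp only [LinearMap.map_add, add_mul, mul_add, hs, ht]
      | tmul p q => simp [hN, i1, i2, i3, i4, Str.map_mul, mul_assoc]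

section
variable {M : Type*} [AddCommGroup M] [Module k M] [Module.Finite k M] {D : YDData k H M}

variable (D) in
/-- A right inverse of `lop D`. -/
noncomputable def rinv : H ⊗[k] Module.End k M :=
  jj Q _ 1 (m2 (sL k H _) (conv Q (sR H (sR H (aop D))) (sR H (sL k H _))) Q.qL *
    (ph Q (sL k H _) (sR H (sR H (aop D))) (sR H (sL k H _)) *
      (rr D (sL k H _) (sR H (sR H LinearMap.id)) *
        m2 (sR H (sR H (aop D))) (sL k H _) Q.pR)))

theorem lop_mul_rinv (hD : OpYD Q D) : lop D * rinv Q D = 1 := by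
  set e : Module.End k M →ₗ[k] H ⊗[k] (H ⊗[k] Module.End k M) := sR H (sR H LinearMap.id) with he
  set u : H →ₗ[k] H ⊗[k] (H ⊗[k] Module.End k M) := sL k H _ with hu
  set v : H →ₗ[k] H ⊗[k] (H ⊗[k] Module.End k M) := sR H (sL k H _) with hv
  have hm : sR H (sR H (aop D)) = e ∘ₗ aop D := rfl
  have h1 := hD.ps v e
  have hc := jj_rcol (E := Module.End k M) Q
  rw [← hu, ← hv] at hc
  rw [rinv, ← jj_m2_mul]
  change jj Q _ 1 (rr D v e * _) = 1
  rw [hm, pass_m2_mul (u := u) (v := conv Q (e ∘ₗ aop D) v) (u' := u)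
    (v' := conv Q v (e ∘ₗ aop D)) (rr D v e), ← mul_assoc (ph Q u _ v), ← mul_assoc (rr D v e),
    hD.rr_hex u v e, ← mul_assoc, ← hm, hu, jj_pR, ← hu, ← hv]
  simp only [mul_assoc, ph_mul_phi, mul_one]
  rw [← mul_assoc, show ∀ t, jj Q _ Q.beta (t * rr D (conv Q u v) e) =
    jj Q _ Q.beta (t * rr D (triv Q _) e) from fun t => (hc.m2 RCol.rfl) _ t,
    hD.rr_triv e, mul_one]
  exact jj_qL_ph Q (aop D)

end
end BraidingInverse

section ReversedReassociator

variable {k H A : Type*} [Field k] [Ring H] [Algebra k H] [Ring A] [Algebra k A]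
  (Q : QuasiHopfAlgebra k H) (T : H →ₗ[k] H) (u v w : H →ₗ[k] A)

attribute [local instance] Cm.symm

/-- `w(X³) v(X²) u(X¹)` -/
noncomputable def hp : A := m2 w (m2 v u) (rev3 LinearMap.id Q.Phi)

/-- `w(x³) v(x²) u(x¹)` -/
noncomputable def hpi : A := m2 w (m2 v u) (rev3 LinearMap.id Q.PhiInv)

theorem rv_eq_hp : rv Q T u v w = hp Q (w ∘ₗ T) (v ∘ₗ T) (u ∘ₗ T) := by
  rw [rv, hp]
  generalize Q.Phi = t
  induction t using ind3 with
  | h0 => simp only [LinearMap.map_zero, LinearMap.zero_apply, mul_zero, zero_mul,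
        TensorProduct.zero_tmul, TensorProduct.tmul_zero]
  | ha s t hs ht => simp only [LinearMap.map_add, hs, ht]
  | h a b c => simp

theorem pass_hp {u' v' w' : H →ₗ[k] A} (p : A) [Ps p u u'] [Ps p v v'] [Ps p w w'] :
    p * hp Q u v w = hp Q u' v' w' * p := Ps.pass (u := m2 w (m2 v u)) (u' := m2 w' (m2 v' u')) _

theorem inv2_hp [Anti u] [Anti v] [Anti w] [Cm u v] [Cm u w] [Cm v w] :
    Inv2 (hp Q u v w) (hpi Q u v w) := by
  have h : ∀ s t, m2 w (m2 v u) (rev3 LinearMap.id s) * m2 w (m2 v u) (rev3 LinearMap.id t) =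
      m2 w (m2 v u) (rev3 LinearMap.id (t * s)) := fun s t => by
    induction s using ind3 with
    | h0 => simp only [LinearMap.map_zero, LinearMap.zero_apply, mul_zero, zero_mul,
          TensorProduct.zero_tmul, TensorProduct.tmul_zero]
    | ha s t hs ht => simp only [LinearMap.map_add, add_mul, mul_add, hs, ht]
    | h a b c =>
      induction t using ind3 with
      | h0 => simp only [LinearMap.map_zero, LinearMap.zero_apply, mul_zero, zero_mul,
            TensorProduct.zero_tmul, TensorProduct.tmul_zero]
      | ha s t hs ht => simp only [LinearMap.map_add, add_mul, mul_add, hs, ht]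
      | h x y z =>
        simp only [rev3_tmul, m2_tmul, LinearMap.id_apply, Algebra.TensorProduct.tmul_mul_tmul,
          Anti.map_mul]
        have e1 := Cm.comm (u := m2 v u) (v := w) (b ⊗ₜ a) z
        have e2 := Cm.comm (u := u) (v := v) a y
        simp only [m2_tmul] at e1
        calc w c * (v b * u a) * (w z * (v y * u x))
            = w c * (v b * u a * w z) * (v y * u x) := by simp only [mul_assoc]
          _ = w c * w z * (v b * (u a * v y) * u x) := by rw [e1]; simp only [mul_assoc]
          _ = _ := by rw [e2]; simp only [mul_assoc]
  have h1 : m2 w (m2 v u) (rev3 LinearMap.id 1) = 1 := by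
    simp [Algebra.TensorProduct.one_def, Anti.map_one]
  exact ⟨by rw [hp, hpi, h, PhiInv_mul_Phi, h1], by rw [hp, hpi, h, Phi_mul_PhiInv, h1]⟩

end ReversedReassociator

section Comparison

variable {k H A M N : Type*} [Field k] [Ring H] [Algebra k H] [Ring A] [Algebra k A]
  [IsDedekindFiniteMonoid A]
  {Q : QuasiHopfAlgebra k H} {T T' : H →ₗ[k] H} {F G : H ⊗[k] H}
  [AddCommGroup M] [Module k M] [Module.Finite k M] [AddCommGroup N] [Module k N]
  [Module.Finite k N] {D : YDData k H M} {E : YDData k H N}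

attribute [local instance] Cm.symm

variable (hT : IsTwist Q T T' F G) (h : H →ₗ[k] A) (x : Module.End k M →ₗ[k] A)
  (y : Module.End k N →ₗ[k] A) [Str h] [Str x] [Str y] [Cm h x] [Cm h y] [Cm x y]

variable (Q D) in
/-- The inverse of `rr D h x`. -/
noncomputable def ri (h : H →ₗ[k] A) (x : Module.End k M →ₗ[k] A) : A := m2 h x (rinv Q D)

theorem inv2_ri (hD : OpYD Q D) : Inv2 (rr D h x) (ri Q D h x) := by
  have h1 : rr D h x * ri Q D h x = 1 := by
    rw [rr, ri, ← Str.map_mul, lop_mul_rinv Q hD, Str.map_one]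
  exact ⟨h1, mul_eq_one_symm h1⟩

variable (Q F D) in
/-- The operator `F₂₁ R⁻¹` comparing a product of duals with the dual of a product. -/
noncomputable def cmp (h : H →ₗ[k] A) (x : Module.End k M →ₗ[k] A) : A :=
  m2 (x ∘ₗ aop D) h F * ri Q D h x

variable (Q D) in
/-- The inverse of `prR`. -/
noncomputable def pri (h m n : H →ₗ[k] A) (a b : A) : A :=
  phi Q m n h * (b * (ph Q m h n * (a * phi Q h m n)))

theorem inv2_pri (m n : H →ₗ[k] A) [Str m] [Str n] [Cm h m] [Cm h n] [Cm m n] {r s a b : A}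
    (hr : Inv2 r a) (hs : Inv2 s b) : Inv2 (prR Q h m n r s) (pri Q h m n a b) := by
  have hph : ∀ u v w : H →ₗ[k] A, [Str u] → [Str v] → [Str w] → [Cm u v] → [Cm u w] → [Cm v w] →
      Inv2 (ph Q u v w) (phi Q u v w) := fun u v w _ _ _ _ _ _ => ⟨by simp, by simp⟩
  have := (hph h m n).comp (hr.comp ((hph m h n).symm.comp (hs.comp (hph m n h))))
  simp only [mul_assoc] at this
  exact this

instance {P : Type*} [AddCommGroup P] [Module k P] (z : P →ₗ[k] A) [Cm h z] [Cm x z] :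
    Ps (ri Q D h x) z z := ⟨fun a => Cm.comm (u := m2 h x) _ a⟩

instance {P : Type*} [Ring P] [Algebra k P] (z : P →ₗ[k] A) [Cm h z] [Cm x z] :
    Ps (cmp Q F D h x) z z :=
  Ps.mul (u' := z) ⟨fun a => Cm.comm (u := m2 (x ∘ₗ aop D) h) _ a⟩ inferInstance

theorem cmp_assoc (hT : IsTwist Q T T' F G) (hD : OpYD Q D) (hE : OpYD Q E) :
    cmp Q F D h x * cmp Q F E (conv Q h (x ∘ₗ aop D)) y =
    rv Q T (y ∘ₗ aop E) (x ∘ₗ aop D) h * (cmp Q F E (x ∘ₗ aop D) y *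
      (m2 (conv Q (x ∘ₗ aop D) (y ∘ₗ aop E)) h F *
        (pri Q h (x ∘ₗ aop D) (y ∘ₗ aop E) (ri Q D h x) (ri Q E h y) *
          ph Q h (x ∘ₗ aop D) (y ∘ₗ aop E)))) := by
  have := comparison_assoc h x y hT hD hE (inv2_ri h x hD)
    (inv2_ri (conv Q h (x ∘ₗ aop D)) y hE) (inv2_ri (x ∘ₗ aop D) y hE)
    (inv2_pri h (x ∘ₗ aop D) (y ∘ₗ aop E) (inv2_ri h x hD) (inv2_ri h y hE))
  simp only [cmp, mul_assoc]
  exact this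

/-- The comparison operator intertwines the action on a product with the flipped product of the
actions. -/
theorem cmp_ps (hT : IsTwist Q T T' F G) (hD : OpYD Q D) :
    Ps (cmp Q F D h x) (conv Q h (x ∘ₗ aop D) ∘ₗ T)
      (m2 (x ∘ₗ aop D) h ∘ₗ flipMap T ∘ₗ Q.comul.toLinearMap) := by
  have p1 := (hD.ps h x).inv (inv2_ri h x hD).mul (inv2_ri h x hD).mul'
  refine Ps.mul (u' := conv Q (x ∘ₗ aop D) h ∘ₗ T) ⟨fun a => ?_⟩ ⟨fun a => p1.pass (T a)⟩
  exact (hT.flip_mul_F a).symm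

theorem pass_cmp {h' : H →ₗ[k] A} {x' : Module.End k M →ₗ[k] A} (p : A) [Ps p h h']
    [Ps p x x'] (h2 : Ps p (x ∘ₗ aop D) (x' ∘ₗ aop D)) :
    p * cmp Q F D h x = cmp Q F D h' x' * p := by
  rw [cmp, cmp, ri, pass_m2_mul (u' := x' ∘ₗ aop D) (v' := h'), pass_m2 (u' := h') (v' := x'),
    mul_assoc, ri]

end Comparison

section Exchange

variable {k H A M N : Type*} [Field k] [Ring H] [Algebra k H] [Ring A] [Algebra k A]
  [IsDedekindFiniteMonoid A]
  {Q : QuasiHopfAlgebra k H} {T T' : H →ₗ[k] H} {F G : H ⊗[k] H}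
  [AddCommGroup M] [Module k M] [Module.Finite k M]  {D : YDData k H M}

attribute [local instance] Cm.symm

variable (e1 e2 e3 e4 : Module.End k M →ₗ[k] A) (e34 : Module.End k (M ⊗[k] M) →ₗ[k] A)
  [Str e1] [Str e2] [Str e3] [Str e4] [Str e34] [Cm e1 e2] [Cm e1 e3] [Cm e1 e4] [Cm e2 e3]
  [Cm e2 e4] [Cm e3 e4] [Cm e1 e34] [Cm e2 e34] (τ : A) [Ps τ e1 e1] [Ps τ e4 e4]
  [Ps τ e2 e3] [Ps τ e3 e2]

variable (Q) in
/-- The middle-four exchange. -/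
noncomputable def exch (s1 s2 s3 s4 : H →ₗ[k] A) (r : A) : A :=
  phi Q s1 s2 (conv Q s3 s4) * (ph Q s2 s3 s4 * (τ * (r * (phi Q s2 s3 s4 *
    ph Q s1 s2 (conv Q s3 s4)))))

variable (Q T) in
/-- The middle-four exchange of the duals, transposed. -/
noncomputable def exchT (s1 s2 s3 s4 : H →ₗ[k] A) (r : A) : A :=
  hp Q (s1 ∘ₗ T) (s2 ∘ₗ T) (m2 s4 s3 ∘ₗ flipMap T ∘ₗ Q.comul.toLinearMap) * (rvi Q T s4 s3 s2 *
    (τ * (r * (rv Q T s4 s3 s2 *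
      hpi Q (s1 ∘ₗ T) (s2 ∘ₗ T) (m2 s4 s3 ∘ₗ flipMap T ∘ₗ Q.comul.toLinearMap)))))

theorem Inv2.pass {p p' r r' a a' : A} (h : Inv2 r a) (h' : Inv2 r' a') (e : p * r = r' * p') :
    a' * p = p' * a := by
  calc a' * p = a' * (p * r) * a := by rw [mul_assoc, mul_assoc, h.mul, mul_one]
    _ = _ := by rw [e, ← mul_assoc, h'.mul', one_mul]

/-- The braiding of two adjacent equal factors commutes with comparisons. -/
theorem cmp_braid (hT : IsTwist Q T T' F G) (hD : OpYD Q D) :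
    let s1 := e1 ∘ₗ aop D
    let s2 := e2 ∘ₗ aop D
    let s3 := e3 ∘ₗ aop D
    let s4 := e4 ∘ₗ aop D
    let W := cmp Q F D s2 e3 * (cmp Q F D (conv Q s2 s3) e4 *
      (m2 (conv Q (conv Q s2 s3) s4) s1 F * pri Q s1 (conv Q s2 s3) s4
        (pri Q s1 s2 s3 (ri Q D s1 e2) (ri Q D s1 e3)) (ri Q D s1 e4)))
    W * (τ * rr D s3 e2) = τ * (kk D F G s2 e3 * W) := by
  intro s1 s2 s3 s4 W
  have := hD.ps s3 e2
  have t1 : Ps τ s1 s1 := ⟨fun a => Ps.pass (u := e1) (u' := e1) _⟩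
  have t2 : Ps τ s2 s3 := ⟨fun a => Ps.pass (u := e2) (u' := e3) _⟩
  have t3 : Ps τ s3 s2 := ⟨fun a => Ps.pass (u := e3) (u' := e2) _⟩
  have t4 : Ps τ s4 s4 := ⟨fun a => Ps.pass (u := e4) (u' := e4) _⟩
  set c := τ * rr D s3 e2 with hc
  have c1 : Ps c s1 s1 := t1.mul inferInstance
  have c4 : Ps c s4 s4 := t4.mul inferInstance
  have c1' : Ps c e1 e1 := Ps.mul (u' := e1) inferInstance inferInstance
  have c4' : Ps c e4 e4 := Ps.mul (u' := e4) inferInstance inferInstance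
  have c23 : Ps c (conv Q s2 s3) (conv Q s2 s3) :=
    Ps.mul (u' := conv Q s3 s2) inferInstance (hD.ps s3 e2)
  have r14 : c * rr D s1 e4 = rr D s1 e4 * c := pass_rr _
  have r123 : c * prR Q s1 s2 s3 (rr D s1 e2) (rr D s1 e3) =
      prR Q s1 s2 s3 (rr D s1 e2) (rr D s1 e3) * c := by
    rw [hc, mul_assoc, rr_mul_prR_eq s1 e3 e2 hD hD, ← mul_assoc, ← mul_assoc]
    congr 1
    rw [prR, prR, pass_ph_mul Q (u' := s1) (v' := s2) (w' := s3),
      ← mul_assoc τ, pass_rr (n' := s1) (y' := e2), mul_assoc,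
      pass_phi_mul Q (u' := s2) (v' := s1) (w' := s3), ← mul_assoc τ,
      pass_rr (n' := s1) (y' := e3), mul_assoc, pass_ph Q (u' := s2) (v' := s3) (w' := s1)]
    simp only [mul_assoc]
  have i2 := inv2_ri s1 e2 hD
  have i3 := inv2_ri s1 e3 hD
  have i4 := inv2_ri s1 e4 hD
  have i23 := inv2_pri (Q := Q) s1 s2 s3 i2 i3
  have i234 := inv2_pri (Q := Q) s1 (conv Q s2 s3) s4 i23 i4
  have hP : c * prR Q s1 (conv Q s2 s3) s4 (prR Q s1 s2 s3 (rr D s1 e2) (rr D s1 e3)) (rr D s1 e4) =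
      prR Q s1 (conv Q s2 s3) s4 (prR Q s1 s2 s3 (rr D s1 e2) (rr D s1 e3)) (rr D s1 e4) * c := by
    rw [prR, pass_ph_mul Q (u' := s1) (v' := conv Q s2 s3) (w' := s4), ← mul_assoc c, r123,
      mul_assoc, pass_phi_mul Q (u' := conv Q s2 s3) (v' := s1) (w' := s4), ← mul_assoc c, r14,
      mul_assoc, pass_ph Q (u' := conv Q s2 s3) (v' := s4) (w' := s1)]
    simp only [mul_assoc]
  have hPi := i234.pass i234 hP
  have h23 : cmp Q F D s2 e3 * c = τ * (kk D F G s2 e3 * cmp Q F D s2 e3) := by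
    have j := inv2_ri s2 e3 hD
    have e : τ * ri Q D s3 e2 = ri Q D s2 e3 * τ := pass_m2 (u := s3) (v := e2) τ _
    have e' : τ * m2 s2 s3 F = m2 s3 s2 F * τ := pass_m2 (u := s2) (v := s3) τ _
    rw [cmp, kk, hc]
    simp only [mul_assoc]
    rw [← mul_assoc (ri Q D s2 e3) τ, ← e, mul_assoc, (inv2_ri s3 e2 hD).mul', mul_one,
      hT.G_mul_F_mul, j.mul, mul_one, e']
  have eF := pass_m2 (u := conv Q (conv Q s2 s3) s4) (v := s1) (u' := conv Q (conv Q s2 s3) s4)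
    (v' := s1) c F
  have eK : c * cmp Q F D (conv Q s2 s3) e4 = cmp Q F D (conv Q s2 s3) e4 * c :=
    pass_cmp (conv Q s2 s3) e4 c c4
  calc W * c = cmp Q F D s2 e3 * (cmp Q F D (conv Q s2 s3) e4 *
        (m2 (conv Q (conv Q s2 s3) s4) s1 F * (pri Q s1 (conv Q s2 s3) s4
          (pri Q s1 s2 s3 (ri Q D s1 e2) (ri Q D s1 e3)) (ri Q D s1 e4) * c))) := by
        simp only [W, mul_assoc]
    _ = (cmp Q F D s2 e3 * c) * (cmp Q F D (conv Q s2 s3) e4 *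
      (m2 (conv Q (conv Q s2 s3) s4) s1 F * pri Q s1 (conv Q s2 s3) s4
        (pri Q s1 s2 s3 (ri Q D s1 e2) (ri Q D s1 e3)) (ri Q D s1 e4))) := by
        rw [hPi, ← mul_assoc _ c, ← eF, mul_assoc c, ← mul_assoc _ c, ← eK]
        simp only [mul_assoc]
    _ = _ := by rw [h23]; simp only [W, mul_assoc]

theorem exchange (hT : IsTwist Q T T' F G) (hD : OpYD Q D)
    (h3 : e34 ∘ₗ eL k M M = e3) (h4 : e34 ∘ₗ eR M LinearMap.id = e4) :
    let s1 := e1 ∘ₗ aop D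
    let s2 := e2 ∘ₗ aop D
    let s3 := e3 ∘ₗ aop D
    let s4 := e4 ∘ₗ aop D
    let ψ := cmp Q F D s1 e2 * (cmp Q F D s3 e4 * cmp Q F (prodYD Q D D) (conv Q s1 s2) e34)
    exchT Q T τ s1 s2 s3 s4 (kk D F G s2 e3) * ψ = ψ * exch Q τ s1 s2 s3 s4 (rr D s3 e2) := by
  intro s1 s2 s3 s4 ψ
  have hDD := prod_opYD hD hD
  have hP : ∀ n : H →ₗ[k] A, [Str n] → [Cm n e3] → [Cm n e4] → [Cm n e34] →
      rr (prodYD Q D D) n e34 = prR Q n s3 s4 (rr D n e3) (rr D n e4) := by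
    intro n _ _ _ _
    rw [rr_prodYD, ← LinearMap.comp_assoc, h3, ← eR_id_comp, ← LinearMap.comp_assoc, h4]
  have hA : e34 ∘ₗ aop (prodYD Q D D) = conv Q s3 s4 := by
    rw [aop_prodYD, comp_conv, ← LinearMap.comp_assoc, h3, ← eR_id_comp, ← LinearMap.comp_assoc, h4]
  have hI : ∀ n : H →ₗ[k] A, [Str n] → [Cm n e3] → [Cm n e4] → [Cm n e34] →
      ri Q (prodYD Q D D) n e34 = pri Q n s3 s4 (ri Q D n e3) (ri Q D n e4) := by
    intro n _ _ _ _
    refine (inv2_ri n e34 hDD).unique ?_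
    rw [hP n]
    exact inv2_pri n s3 s4 (inv2_ri n e3 hD) (inv2_ri n e4 hD)
  have ca1 : cmp Q F D s1 e2 * cmp Q F (prodYD Q D D) (conv Q s1 s2) e34 =
      rv Q T (conv Q s3 s4) s2 s1 * (cmp Q F (prodYD Q D D) s2 e34 *
        (m2 (conv Q s2 (conv Q s3 s4)) s1 F *
          (pri Q s1 s2 (conv Q s3 s4) (ri Q D s1 e2)
            (pri Q s1 s3 s4 (ri Q D s1 e3) (ri Q D s1 e4)) * ph Q s1 s2 (conv Q s3 s4)))) := by
    rw [← hI s1, ← hA]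
    exact cmp_assoc s1 e2 e34 hT hD hDD
  have ca2 : cmp Q F D s2 e3 * cmp Q F D (conv Q s2 s3) e4 =
      rv Q T s4 s3 s2 * (cmp Q F D s3 e4 * (m2 (conv Q s3 s4) s2 F *
        (pri Q s2 s3 s4 (ri Q D s2 e3) (ri Q D s2 e4) * ph Q s2 s3 s4))) :=
    cmp_assoc s2 e3 e4 hT hD hD
  have cb : cmp Q F (prodYD Q D D) s2 e34 =
      m2 (conv Q s3 s4) s2 F * pri Q s2 s3 s4 (ri Q D s2 e3) (ri Q D s2 e4) := by
    rw [cmp, hI s2, hA]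
  have hrv := hT.rvi_mul_rv s4 s3 s2
  have ca3 : cmp Q F D s3 e4 * cmp Q F (prodYD Q D D) s2 e34 =
      rvi Q T s4 s3 s2 * (cmp Q F D s2 e3 * (cmp Q F D (conv Q s2 s3) e4 * phi Q s2 s3 s4)) := by
    rw [← mul_assoc (cmp Q F D s2 e3), ca2, mul_assoc, ← mul_assoc (rvi Q T s4 s3 s2), hrv, cb]
    simp only [mul_assoc, ph_mul_phi, mul_one, one_mul]
  have hanti := hT.anti
  have hPs := cmp_ps s3 e4 hT hD
  have hΘ : cmp Q F D s3 e4 * rv Q T (conv Q s3 s4) s2 s1 =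
      hp Q (s1 ∘ₗ T) (s2 ∘ₗ T) (m2 s4 s3 ∘ₗ flipMap T ∘ₗ Q.comul.toLinearMap) *
        cmp Q F D s3 e4 := by
    rw [rv_eq_hp]
    have q1 : Ps (cmp Q F D s3 e4) (s1 ∘ₗ T) (s1 ∘ₗ T) := ⟨fun a => Ps.pass (u := s1) (u' := s1) _⟩
    have q2 : Ps (cmp Q F D s3 e4) (s2 ∘ₗ T) (s2 ∘ₗ T) := ⟨fun a => Ps.pass (u := s2) (u' := s2) _⟩
    exact pass_hp ..
  have i2 := inv2_ri s1 e2 hD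
  have i3 := inv2_ri s1 e3 hD
  have i4 := inv2_ri s1 e4 hD
  have hψ : ψ = hp Q (s1 ∘ₗ T) (s2 ∘ₗ T) (m2 s4 s3 ∘ₗ flipMap T ∘ₗ Q.comul.toLinearMap) *
      (rvi Q T s4 s3 s2 * ((cmp Q F D s2 e3 * (cmp Q F D (conv Q s2 s3) e4 *
      (m2 (conv Q (conv Q s2 s3) s4) s1 F * pri Q s1 (conv Q s2 s3) s4
        (pri Q s1 s2 s3 (ri Q D s1 e2) (ri Q D s1 e3)) (ri Q D s1 e4)))) *
          (phi Q s2 s3 s4 * ph Q s1 s2 (conv Q s3 s4)))) := by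
    have a1 : cmp Q F D s1 e2 * cmp Q F D s3 e4 = cmp Q F D s3 e4 * cmp Q F D s1 e2 :=
      pass_cmp s3 e4 _ inferInstance
    have a2 : phi Q s2 s3 s4 * m2 (conv Q s2 (conv Q s3 s4)) s1 F =
      m2 (conv Q (conv Q s2 s3) s4) s1 F * phi Q s2 s3 s4 :=
      pass_m2 (u := conv Q s2 (conv Q s3 s4)) (v := s1) _ F
    have a3 : phi Q s2 s3 s4 * pri Q s1 s2 (conv Q s3 s4) (ri Q D s1 e2)
        (pri Q s1 s3 s4 (ri Q D s1 e3) (ri Q D s1 e4)) =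
        pri Q s1 (conv Q s2 s3) s4 (pri Q s1 s2 s3 (ri Q D s1 e2) (ri Q D s1 e3)) (ri Q D s1 e4) *
          phi Q s2 s3 s4 := by
      have := hD.ps s1 e2
      have := hD.ps s1 e3
      have := hD.ps s1 e4
      have h1 := ph_mul_prR Q s1 s2 s3 s4 (rr D s1 e2) (rr D s1 e3) (rr D s1 e4)
      have h2 := (inv2_pri (Q := Q) s1 (conv Q s2 s3) s4 (inv2_pri (Q := Q) s1 s2 s3 i2 i3) i4).pass
        (inv2_pri (Q := Q) s1 s2 (conv Q s3 s4) i2 (inv2_pri (Q := Q) s1 s3 s4 i3 i4)) h1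
      calc _ = phi Q s2 s3 s4 * (pri Q s1 s2 (conv Q s3 s4) (ri Q D s1 e2)
          (pri Q s1 s3 s4 (ri Q D s1 e3) (ri Q D s1 e4)) * ph Q s2 s3 s4) * phi Q s2 s3 s4 := by
            simp only [mul_assoc, ph_mul_phi, mul_one]
        _ = _ := by rw [h2, phi_mul_ph_mul]
    simp only [ψ]
    rw [← mul_assoc, a1, mul_assoc, ca1, ← mul_assoc (cmp Q F D s3 e4), hΘ, mul_assoc,
      ← mul_assoc (cmp Q F D s3 e4), ca3]
    simp only [mul_assoc]
    rw [← mul_assoc (phi Q s2 s3 s4) (m2 _ _ F), a2, mul_assoc, ← mul_assoc (phi Q s2 s3 s4) (pri ..),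
      a3, mul_assoc]
  have hb := cmp_braid e1 e2 e3 e4 τ hT hD
  have hI2 : hpi Q (s1 ∘ₗ T) (s2 ∘ₗ T) (m2 s4 s3 ∘ₗ flipMap T ∘ₗ Q.comul.toLinearMap) *
    hp Q (s1 ∘ₗ T) (s2 ∘ₗ T) (m2 s4 s3 ∘ₗ flipMap T ∘ₗ Q.comul.toLinearMap) = 1 := by
    have : Anti (flipMap T ∘ₗ Q.comul.toLinearMap) :=
      ⟨by simp [Algebra.TensorProduct.one_def, Anti.map_one], fun a b => by simp [flipMap_mul]⟩
    have : Anti (m2 s4 s3 ∘ₗ flipMap T ∘ₗ Q.comul.toLinearMap) := inferInstance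
    exact (inv2_hp (A := A) Q _ _ _).mul'
  have hrv' := hT.rv_mul_rvi s4 s3 s2
  rw [exchT, exch, hψ]
  rw [mul_assoc, mul_assoc (rvi Q T s4 s3 s2), mul_assoc τ, mul_assoc (kk ..), mul_assoc (rv ..),
    ← mul_assoc (hpi ..), hI2, one_mul, ← mul_assoc (rv ..), hrv', one_mul]
  simp only [← mul_assoc] at hb ⊢
  rw [mul_assoc _ (ph Q s1 s2 (conv Q s3 s4)) (phi ..), ph_mul_phi, mul_one,
    mul_assoc _ (phi Q s2 s3 s4) (ph Q s2 s3 s4), phi_mul_ph, mul_one]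
  simp only [mul_assoc] at hb ⊢
  have hb' := congrArg (fun z => hp Q (s1 ∘ₗ T) (s2 ∘ₗ T)
    (m2 s4 s3 ∘ₗ flipMap T ∘ₗ Q.comul.toLinearMap) * (rvi Q T s4 s3 s2 *
      (z * (phi Q s2 s3 s4 * ph Q s1 s2 (conv Q s3 s4))))) hb
  simp only [mul_assoc] at hb'
  exact hb'.symm

end Exchange

open Module (Dual)

section Adjoints

variable {k W W' W'' W₁ W₁' W₂ W₂' W₃ M M' M'' M₁ M₁' M₂ M₂' M₃ : Type*} [Field k]
  [AddCommGroup W] [Module k W] [AddCommGroup W'] [Module k W'] [AddCommGroup W''] [Module k W'']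
  [AddCommGroup M] [Module k M] [AddCommGroup M'] [Module k M'] [AddCommGroup M''] [Module k M'']
  [AddCommGroup W₁] [Module k W₁] [AddCommGroup W₁'] [Module k W₁']
  [AddCommGroup W₂] [Module k W₂] [AddCommGroup W₂'] [Module k W₂']
  [AddCommGroup W₃] [Module k W₃]
  [AddCommGroup M₁] [Module k M₁] [AddCommGroup M₁'] [Module k M₁']
  [AddCommGroup M₂] [Module k M₂] [AddCommGroup M₂'] [Module k M₂']
  [AddCommGroup M₃] [Module k M₃]

/-- The map `u` is the transpose of `g` with respect to identifications of `W` and `W'` with dual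
spaces. -/
def Adj (θ : W ≃ₗ[k] Dual k M) (θ' : W' ≃ₗ[k] Dual k M') (u : W →ₗ[k] W') (g : M' →ₗ[k] M) : Prop :=
  ∀ w m, θ' (u w) m = θ w (g m)

variable {θ : W ≃ₗ[k] Dual k M} {θ' : W' ≃ₗ[k] Dual k M'} {θ'' : W'' ≃ₗ[k] Dual k M''}

theorem Adj.comp {u : W →ₗ[k] W'} {u' : W' →ₗ[k] W''} {g : M' →ₗ[k] M} {g' : M'' →ₗ[k] M'}
    (h' : Adj θ' θ'' u' g') (h : Adj θ θ' u g) : Adj θ θ'' (u' ∘ₗ u) (g ∘ₗ g') :=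
  fun w m => by rw [LinearMap.comp_apply, h', h]; rfl

theorem Adj.id : Adj θ θ LinearMap.id LinearMap.id := fun _ _ => rfl

theorem Adj.unique {u u' : W →ₗ[k] W'} {g g' : M' →ₗ[k] M} (h : Adj θ θ' u g) (h' : Adj θ θ' u' g')
    (e : g = g') : u = u' :=
  LinearMap.ext fun w => θ'.injective (LinearMap.ext fun m => by rw [h, h', e])

theorem Adj.inv {u : W ≃ₗ[k] W'} {g : M' →ₗ[k] M} {g' : M →ₗ[k] M'} (h : Adj θ θ' u.toLinearMap g)
    (e : g ∘ₗ g' = LinearMap.id) : Adj θ' θ u.symm.toLinearMap g' := fun w m => by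
  have := h (u.symm w) (g' m)
  rw [show g (g' m) = m from LinearMap.congr_fun e m] at this
  simpa using this.symm

/-- The transpose of an endomorphism. -/
noncomputable def tr (θ : W ≃ₗ[k] Dual k M) : Module.End k M →ₗ[k] Module.End k W :=
  θ.symm.conj.toLinearMap ∘ₗ Module.Dual.transpose

theorem adj_tr (θ : W ≃ₗ[k] Dual k M) (g : Module.End k M) : Adj θ θ (tr θ g) g := fun w m => by
  simp [tr, LinearEquiv.conj_apply, Module.Dual.transpose_apply]

theorem eq_tr {u : Module.End k W} {g : Module.End k M} (h : Adj θ θ u g) : u = tr θ g :=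
  h.unique (adj_tr θ g) rfl

instance (θ : W ≃ₗ[k] Dual k M) : Anti (tr θ) where
  map_one := (eq_tr Adj.id).symm
  map_mul a b := (eq_tr ((adj_tr θ b).comp (adj_tr θ a))).symm

theorem tr_refl : tr (LinearEquiv.refl k (Dual k M)) = Module.Dual.transpose := by
  ext g : 1
  exact (eq_tr fun _ _ => rfl).symm

section Tensor

variable [Module.Finite k M] [Module.Finite k M₁] [Module.Finite k M₂] [Module.Finite k M₁']
  [Module.Finite k M₂'] [Module.Finite k M₃]

/-- The identification of a tensor product of duals with the dual of the tensor product. -/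
noncomputable def dd (θ₁ : W₁ ≃ₗ[k] Dual k M₁) (θ₂ : W₂ ≃ₗ[k] Dual k M₂) :
    W₁ ⊗[k] W₂ ≃ₗ[k] Dual k (M₁ ⊗[k] M₂) :=
  TensorProduct.congr θ₁ θ₂ ≪≫ₗ TensorProduct.dualDistribEquiv k M₁ M₂

@[simp] theorem dd_tmul (θ₁ : W₁ ≃ₗ[k] Dual k M₁) (θ₂ : W₂ ≃ₗ[k] Dual k M₂) (a : W₁) (b : W₂)
    (m : M₁) (n : M₂) : dd θ₁ θ₂ (a ⊗ₜ b) (m ⊗ₜ n) = θ₁ a m * θ₂ b n := rfl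

theorem dd_refl : (dd (LinearEquiv.refl k (Dual k M₁)) (LinearEquiv.refl k (Dual k M₂))).toLinearMap =
    TensorProduct.dualDistrib k M₁ M₂ := by
  ext; rfl

variable {θ₁ : W₁ ≃ₗ[k] Dual k M₁} {θ₂ : W₂ ≃ₗ[k] Dual k M₂} {θ₃ : W₃ ≃ₗ[k] Dual k M₃}
  {θ₁' : W₁' ≃ₗ[k] Dual k M₁'} {θ₂' : W₂' ≃ₗ[k] Dual k M₂'}

/-- A transpose on a tensor product may be tested on pure tensors. -/
theorem adj_of_tmul {u : W₁ ⊗[k] W₂ →ₗ[k] W} {g : M →ₗ[k] M₁ ⊗[k] M₂}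
    (h : ∀ a b m, θ (u (a ⊗ₜ b)) m = dd θ₁ θ₂ (a ⊗ₜ b) (g m)) : Adj (dd θ₁ θ₂) θ u g := by
  intro w m
  induction w with
  | zero => simp only [LinearMap.map_zero, LinearEquiv.map_zero, LinearMap.zero_apply, mul_zero, zero_mul,
        TensorProduct.zero_tmul, TensorProduct.tmul_zero]
  | add s t hs ht => simp only [LinearMap.map_add, LinearEquiv.map_add, LinearMap.add_apply, hs, ht]
  | tmul a b => exact h a b m

theorem Adj.map {u : W₁ →ₗ[k] W₁'} {u' : W₂ →ₗ[k] W₂'} {g : M₁' →ₗ[k] M₁} {g' : M₂' →ₗ[k] M₂}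
    (h : Adj θ₁ θ₁' u g) (h' : Adj θ₂ θ₂' u' g') :
    Adj (dd θ₁ θ₂) (dd θ₁' θ₂') (TensorProduct.map u u') (TensorProduct.map g g') := by
  refine adj_of_tmul fun a b z => ?_
  induction z with
  | zero => simp only [LinearMap.map_zero, LinearMap.zero_apply, mul_zero, zero_mul,
        TensorProduct.zero_tmul, TensorProduct.tmul_zero]
  | add s t hs ht => simp only [LinearMap.map_add, hs, ht]
  | tmul m n =>
    simp only [TensorProduct.map_tmul, dd_tmul]
    rw [h, h']

theorem Adj.lTensor {u : W₂ →ₗ[k] W₂'} {g : M₂' →ₗ[k] M₂} (h : Adj θ₂ θ₂' u g) :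
    Adj (dd θ₁ θ₂) (dd θ₁ θ₂') (u.lTensor W₁) (g.lTensor M₁) := Adj.map Adj.id h

theorem Adj.rTensor {u : W₂ →ₗ[k] W₂'} {g : M₂' →ₗ[k] M₂} (h : Adj θ₂ θ₂' u g) :
    Adj (dd θ₂ θ₁) (dd θ₂' θ₁) (u.rTensor W₁) (g.rTensor M₁) := Adj.map h Adj.id

theorem adj_assoc : Adj (dd (dd θ₁ θ₂) θ₃) (dd θ₁ (dd θ₂ θ₃))
    (TensorProduct.assoc k W₁ W₂ W₃).toLinearMap
    (TensorProduct.assoc k M₁ M₂ M₃).symm.toLinearMap := by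
  refine adj_of_tmul fun a b z => ?_
  induction a with
  | zero => simp only [LinearMap.map_zero, LinearEquiv.map_zero, LinearMap.zero_apply, mul_zero, zero_mul,
        TensorProduct.zero_tmul, TensorProduct.tmul_zero]
  | add s t hs ht => simp only [LinearMap.map_add, LinearEquiv.map_add, TensorProduct.add_tmul, LinearMap.add_apply, hs, ht]
  | tmul a a' =>
    induction z using ind3 with
    | h0 => simp only [LinearMap.map_zero, LinearMap.zero_apply, mul_zero, zero_mul,
          TensorProduct.zero_tmul, TensorProduct.tmul_zero]
    | ha s t hs ht => simp only [LinearMap.map_add, hs, ht]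
    | h x y z => simp [mul_assoc]

theorem adj_comm : Adj (dd θ₁ θ₂) (dd θ₂ θ₁) (TensorProduct.comm k W₁ W₂).toLinearMap
    (TensorProduct.comm k M₂ M₁).toLinearMap := by
  refine adj_of_tmul fun a b z => ?_
  induction z with
  | zero => simp only [LinearMap.map_zero, LinearMap.zero_apply, mul_zero, zero_mul,
        TensorProduct.zero_tmul, TensorProduct.tmul_zero]
  | add s t hs ht => simp only [LinearMap.map_add, hs, ht]
  | tmul m n => simp [mul_comm]

theorem adj_tensAct {A A' : Type*} [Ring A] [Algebra k A] [Ring A'] [Algebra k A']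
    {ρ : A →ₐ[k] Module.End k W₁} {τ : A' →ₐ[k] Module.End k W₂} {a : A →ₗ[k] Module.End k M₁}
    {b : A' →ₗ[k] Module.End k M₂} (h : ∀ x, Adj θ₁ θ₁ (ρ x) (a x)) (h' : ∀ x, Adj θ₂ θ₂ (τ x) (b x))
    (t : A ⊗[k] A') : Adj (dd θ₁ θ₂) (dd θ₁ θ₂) (tensAct ρ τ t) (m2 (eL k M₁ M₂ ∘ₗ a) (eR M₁ b) t) := by
  induction t with
  | zero => intro w m; simp
  | add s t hs ht =>
    intro w m
    have hs := hs w m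
    have ht := ht w m
    simp only [map_add, LinearMap.add_apply] at hs ht ⊢
    rw [hs, ht]
  | tmul x y =>
    have : m2 (eL k M₁ M₂ ∘ₗ a) (eR M₁ b) (x ⊗ₜ y) = TensorProduct.map (a x) (b y) := by
      ext; simp
    rw [this]
    exact (h x).map (h' y)

theorem tr_eL : tr (dd θ₁ θ₂) ∘ₗ eL k M₁ M₂ = eL k W₁ W₂ ∘ₗ tr θ₁ := by
  ext g : 1
  exact (eq_tr ((adj_tr θ₁ g).rTensor)).symm

theorem tr_eR : tr (dd θ₁ θ₂) ∘ₗ eR M₁ LinearMap.id = eR W₁ (tr θ₂) := by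
  ext g : 1
  exact (eq_tr ((adj_tr θ₂ g).lTensor)).symm

end Tensor

end Adjoints

section DualModules

variable {k H W W' M M' : Type*} [Field k] [Ring H] [Algebra k H]
  [AddCommGroup W] [Module k W] [AddCommGroup W'] [Module k W']
  [AddCommGroup M] [Module k M] [AddCommGroup M'] [Module k M']
  [Module.Finite k W] [Module.Finite k W'] [Module.Finite k M] [Module.Finite k M']

/-- The action and coaction of a dual, in terms of operators on the original space. -/
structure DualOf (T' : H →ₗ[k] H) (V : YDData k H W) (θ : W ≃ₗ[k] Dual k M)
    (a : H →ₗ[k] Module.End k M) (Y : H ⊗[k] Module.End k M) : Prop where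
  act : ∀ h, Adj θ θ (V.act h) (a h)
  coact : lop V = TensorProduct.map T' (tr θ) Y

/-- `(a ⊗ φ) ↦ φ(m) a` -/
noncomputable def tst (θ : W ≃ₗ[k] Dual k M) (m : M) : H ⊗[k] W →ₗ[k] H :=
  (TensorProduct.rid k H).toLinearMap ∘ₗ (Module.Dual.eval k M m ∘ₗ θ.toLinearMap).lTensor H

@[simp] theorem tst_tmul (θ : W ≃ₗ[k] Dual k M) (m : M) (h : H) (w : W) :
    tst θ m (h ⊗ₜ w) = θ w m • h := rfl

theorem tst_injective (θ : W ≃ₗ[k] Dual k M) {s t : H ⊗[k] W} (h : ∀ m, tst θ m s = tst θ m t) :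
    s = t := by
  set E : H ⊗[k] W ≃ₗ[k] (M →ₗ[k] H) :=
    TensorProduct.comm k H W ≪≫ₗ TensorProduct.congr θ (LinearEquiv.refl k H) ≪≫ₗ
      dualTensorHomEquiv k M H with hE
  have e : ∀ s m, E s m = tst θ m s := fun s m => by
    induction s with
    | zero => simp only [LinearMap.map_zero, LinearEquiv.map_zero, LinearMap.zero_apply, mul_zero, zero_mul,
          TensorProduct.zero_tmul, TensorProduct.tmul_zero]
    | add s t hs ht => simp only [LinearMap.map_add, LinearEquiv.map_add, LinearMap.add_apply, hs, ht]
    | tmul a w => simp [hE, dualTensorHomEquiv]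
  apply E.injective
  ext m
  rw [e, e, h]

theorem DualOf.tst_coact {T' : H →ₗ[k] H} {V : YDData k H W} {θ : W ≃ₗ[k] Dual k M}
    {a : H →ₗ[k] Module.End k M} {Y : H ⊗[k] Module.End k M} (h : DualOf T' V θ a Y) (w : W) (m : M) :
    tst θ m (V.coact w) = T' (TensorProduct.rid k H ((θ w).lTensor H (evAt H m Y))) := by
  rw [← evAt_lop, h.coact]
  clear h
  induction Y with
  | zero => simp only [LinearMap.map_zero, LinearEquiv.map_zero, LinearMap.zero_apply, mul_zero, zero_mul,
        TensorProduct.zero_tmul, TensorProduct.tmul_zero]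
  | add s t hs ht => simp only [LinearMap.map_add, LinearEquiv.map_add, hs, ht]
  | tmul x y =>
    simp only [TensorProduct.map_tmul, evAt_tmul, tst_tmul, LinearMap.lTensor_tmul,
      TensorProduct.rid_tmul, map_smul]
    rw [adj_tr]

theorem DualOf.hom {T' : H →ₗ[k] H} {V : YDData k H W} {θ : W ≃ₗ[k] Dual k M}
    {a : H →ₗ[k] Module.End k M} {Y : H ⊗[k] Module.End k M} (h : DualOf T' V θ a Y)
    {V' : YDData k H W'} {θ' : W' ≃ₗ[k] Dual k M'}
    {a' : H →ₗ[k] Module.End k M'} {Y' : H ⊗[k] Module.End k M'} (h' : DualOf T' V' θ' a' Y')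
    {u : W →ₗ[k] W'} {g : M' →ₗ[k] M} (hu : Adj θ θ' u g)
    (h1 : ∀ x, g ∘ₗ a' x = a x ∘ₗ g)
    (h2 : ∀ m, g.lTensor H (evAt H m Y') = evAt H (g m) Y) : IsYDHom V V' u where
  map_act x w := by
    exact LinearMap.congr_fun ((hu.comp (h.act x)).unique ((h'.act x).comp hu) (h1 x).symm) w
  map_coact w := by
    refine tst_injective θ' fun m => ?_
    have e : ∀ s, tst θ' m (u.lTensor H s) = tst θ (g m) s := fun s => by
      induction s with
      | zero => simp only [LinearMap.map_zero, LinearMap.zero_apply, mul_zero, zero_mul,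
            TensorProduct.zero_tmul, TensorProduct.tmul_zero]
      | add s t hs ht => simp only [LinearMap.map_add, hs, ht]
      | tmul a w => simp only [LinearMap.lTensor_tmul, tst_tmul]; rw [hu]
    rw [e, h.tst_coact, h'.tst_coact, ← h2, show θ' (u w) = θ w ∘ₗ g from LinearMap.ext (hu w),
      LinearMap.lTensor_comp]
    rfl

end DualModules

open Module (Dual)

section TransposedModules

variable {k H M N ι κ : Type*} [Field k] [Ring H] [Algebra k H]
  {Q : QuasiHopfAlgebra k H} {T T' : H →ₗ[k] H} {F G : H ⊗[k] H}
  [AddCommGroup M] [Module k M] [Module.Finite k M] [AddCommGroup N] [Module k N]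
  [Module.Finite k N] [Fintype ι] [Fintype κ]
  (hT : IsTwist Q T T' F G) (e : Module.Basis ι k M) (D : YDData k H M) (e' : Module.Basis κ k N)
  (E : YDData k H N)

attribute [local instance] Cm.symm

theorem anti_rvi {A C : Type*} [Ring A] [Algebra k A] [Ring C] [Algebra k C] (χ : A →ₗ[k] C) [Anti χ]
    (u v w : H →ₗ[k] A) [Cm u v] [Cm u w] [Cm v w] :
    χ (rvi Q T u v w) = phi Q (χ ∘ₗ w ∘ₗ T) (χ ∘ₗ v ∘ₗ T) (χ ∘ₗ u ∘ₗ T) := by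
  rw [rvi, phi]
  generalize Q.PhiInv = t
  induction t using ind3 with
  | h0 => simp only [LinearMap.map_zero, LinearMap.zero_apply, mul_zero, zero_mul,
        TensorProduct.zero_tmul, TensorProduct.tmul_zero]
  | ha s t hs ht => simp only [LinearMap.map_add, hs, ht]
  | h a b c =>
    simp only [rev3_tmul, m2_tmul, Anti.map_mul, LinearMap.comp_apply, mul_assoc]

theorem dualOf_twDual : DualOf T' (twDual hT e D) (LinearEquiv.refl k (Dual k M)) (aop D ∘ₗ T)
    (kk D F G (sL k H _) (sR H LinearMap.id)) where
  act _ _ _ := rfl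
  coact := by rw [lop_twDual, tr_refl]

set_option maxHeartbeats 800000 in
theorem map_comp_sR {C P R B' : Type*} [Ring C] [Algebra k C] [Ring P] [Algebra k P]
    [Ring R] [Algebra k R] [Ring B'] [Algebra k B'] (φ : H →ₗ[k] C) [Anti φ] (ψ : R →ₗ[k] B')
    (s : P →ₗ[k] R) : TensorProduct.map φ ψ ∘ₗ sR H s = sR C (ψ ∘ₗ s) := by
  ext h : 1
  simp only [LinearMap.comp_apply, sR_apply, TensorProduct.map_tmul, Anti.map_one]

theorem dualOf_prod : DualOf T' (prodYD Q (twDual hT e D) (twDual hT e' E))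
    (dd (LinearEquiv.refl k (Dual k M)) (LinearEquiv.refl k (Dual k N)))
    (m2 (eR M (aop E)) (eL k M N ∘ₗ aop D) ∘ₗ flipMap T ∘ₗ Q.comul.toLinearMap)
    (kk2 Q T F G D E (sL k H _) (sR H (eL k M N)) (sR H (eR M LinearMap.id))) where
  act h := by
    have := adj_tensAct (ρ := (twDual hT e D).act) (τ := (twDual hT e' E).act)
      (θ₁ := LinearEquiv.refl k (Dual k M)) (θ₂ := LinearEquiv.refl k (Dual k N))
      (a := aop D ∘ₗ T) (b := aop E ∘ₗ T) (fun _ _ _ => rfl) (fun _ _ _ => rfl) (Q.comul h)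
    rw [LinearMap.comp_apply, LinearMap.comp_apply, m2_flipMap]
    exact this
  coact := by
    have := hT.anti
    have := hT.anti'
    set θ := dd (LinearEquiv.refl k (Dual k M)) (LinearEquiv.refl k (Dual k N)) with hθ
    set Ω : H ⊗[k] Module.End k (M ⊗[k] N) →ₗ[k] _ := TensorProduct.map T' (tr θ) with hΩ
    have hp : Ω ∘ₗ sL k H _ = sL k H _ ∘ₗ T' := by
      ext h : 1
      simp only [hΩ, LinearMap.comp_apply, sL_apply, TensorProduct.map_tmul, Anti.map_one]
    have tL : tr θ ∘ₗ eL k M N = eL k _ _ ∘ₗ Module.Dual.transpose := by rw [hθ, tr_eL, tr_refl]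
    have tR : tr θ ∘ₗ eR M LinearMap.id = eR _ LinearMap.id ∘ₗ Module.Dual.transpose := by
      rw [hθ, tr_eR, tr_refl]
      rfl
    have hL : Ω ∘ₗ sR H (eL k M N) = sR H (eL k _ _) ∘ₗ Module.Dual.transpose := by
      rw [hΩ, map_comp_sR, tL]
      rfl
    have hR : Ω ∘ₗ sR H (eR M LinearMap.id) = sR H (eR _ LinearMap.id) ∘ₗ Module.Dual.transpose := by
      rw [hΩ, map_comp_sR, tR]
      rfl
    have k1 := hT.anti_comp Ω hp
    have k2 := anti_comp_aop (D := D) e hT Ω hL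
    have k3 := anti_comp_aop (D := E) e' hT Ω hR
    have r1 := anti_kk (D := D) e hT Ω hp hL
    have r2 := anti_kk (D := E) e' hT Ω hp hR
    rw [lop_prodYD, kk2]
    simp only [Anti.map_mul, anti_rv, anti_rvi, r1, r2, k1, k2, k3, prR, mul_assoc]
    rfl

theorem lop_unitYD : lop (unitYD Q) = 1 := by
  refine (lop_unique _ fun c => ?_).symm
  simp [Algebra.TensorProduct.one_def, unitYD]

theorem dualOf_unit (hT : IsTwist Q T T' F G) :
    DualOf T' (unitYD Q) (LinearMap.ringLmapEquivSelf k k k).symm (aop (unitYD Q)) 1 where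
  act h c x := by simp [unitYD]; ring
  coact := by
    have := hT.anti'
    rw [lop_unitYD, Anti.map_one]

end TransposedModules

section Naturality

variable {k H M N : Type*} [Field k] [Ring H] [Algebra k H]
  {Q : QuasiHopfAlgebra k H} {T T' : H →ₗ[k] H} {F G : H ⊗[k] H}
  [AddCommGroup M] [Module k M] [Module.Finite k M] [AddCommGroup N] [Module k N]
  [Module.Finite k N]
  {D : YDData k H M} {E : YDData k H N} {g : M →ₗ[k] N}

theorem m2_nat {X Y P P' : Type*} [AddCommGroup X] [Module k X] [AddCommGroup Y] [Module k Y]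
    [AddCommGroup P] [Module k P] [AddCommGroup P'] [Module k P'] {L : X →ₗ[k] Y}
    {u : P →ₗ[k] Module.End k X} {u' : P →ₗ[k] Module.End k Y} {v : P' →ₗ[k] Module.End k X}
    {v' : P' →ₗ[k] Module.End k Y} (hu : ∀ a, L ∘ₗ u a = u' a ∘ₗ L)
    (hv : ∀ a, L ∘ₗ v a = v' a ∘ₗ L) (t : P ⊗[k] P') : L ∘ₗ m2 u v t = m2 u' v' t ∘ₗ L := by
  induction t with
  | zero => simp
  | add s t hs ht => simp only [LinearMap.map_add, LinearMap.comp_add, LinearMap.add_comp, hs, ht]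
  | tmul a b =>
    rw [m2_tmul, m2_tmul, Module.End.mul_eq_comp, Module.End.mul_eq_comp, ← LinearMap.comp_assoc,
      hu, LinearMap.comp_assoc, hv, LinearMap.comp_assoc]

theorem mul_nat {X Y : Type*} [AddCommGroup X] [Module k X] [AddCommGroup Y] [Module k Y]
    {L : X →ₗ[k] Y} {a b : Module.End k X} {a' b' : Module.End k Y} (ha : L ∘ₗ a = a' ∘ₗ L)
    (hb : L ∘ₗ b = b' ∘ₗ L) : L ∘ₗ (a * b) = (a' * b') ∘ₗ L := by
  rw [Module.End.mul_eq_comp, Module.End.mul_eq_comp, ← LinearMap.comp_assoc, ha,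
    LinearMap.comp_assoc, hb, LinearMap.comp_assoc]

theorem inv_nat {X Y : Type*} [AddCommGroup X] [Module k X] [AddCommGroup Y] [Module k Y]
    {L : X →ₗ[k] Y} {a b : Module.End k X} {a' b' : Module.End k Y} (ha : L ∘ₗ a = a' ∘ₗ L)
    (h : Inv2 a b) (h' : Inv2 a' b') : L ∘ₗ b = b' ∘ₗ L := by
  calc L ∘ₗ b = (b' * a') ∘ₗ L ∘ₗ b := by rw [h'.mul']; rfl
    _ = b' ∘ₗ (a' ∘ₗ L) ∘ₗ b := rfl
    _ = b' ∘ₗ L ∘ₗ (a * b) := by rw [← ha]; rfl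
    _ = _ := by rw [h.mul]; rfl

theorem rr_eL_eR_apply {X : Type*} [AddCommGroup X] [Module k X] (a : H →ₗ[k] Module.End k X) (x : X)
    (m : M) : rr D (eL k X M ∘ₗ a) (eR X LinearMap.id) (x ⊗ₜ m) =
      (a.flip x).rTensor M (D.coact m) := by
  rw [rr, ← evAt_lop]
  generalize lop D = Y
  induction Y with
  | zero => simp only [LinearMap.map_zero, LinearMap.zero_apply, mul_zero, zero_mul,
        TensorProduct.zero_tmul, TensorProduct.tmul_zero]
  | add s t hs ht => simp only [LinearMap.map_add, LinearMap.add_apply, hs, ht]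
  | tmul h y => simp

theorem IsYDHom.rr_nat {X : Type*} [AddCommGroup X] [Module k X] (hg : IsYDHom D E g)
    (a : H →ₗ[k] Module.End k X) :
    g.lTensor X ∘ₗ rr D (eL k X M ∘ₗ a) (eR X LinearMap.id) =
      rr E (eL k X N ∘ₗ a) (eR X LinearMap.id) ∘ₗ g.lTensor X := by
  ext x m
  simp only [TensorProduct.AlgebraTensorModule.curry_apply, TensorProduct.curry_apply,
      LinearMap.restrictScalars_self, LinearMap.coe_restrictScalars, LinearMap.comp_apply,
      LinearMap.lTensor_tmul, rr_eL_eR_apply, hg.map_coact]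
  generalize D.coact m = s
  induction s with
  | zero => simp only [LinearMap.map_zero, LinearMap.zero_apply, mul_zero, zero_mul,
        TensorProduct.zero_tmul, TensorProduct.tmul_zero]
  | add s t hs ht => simp only [LinearMap.map_add, hs, ht]
  | tmul h y => simp

end Naturality

open Module (Dual)

section Comparison

variable {k H A M N : Type*} [Field k] [Ring H] [Algebra k H] [Ring A] [Algebra k A]
  {Q : QuasiHopfAlgebra k H} {T T' : H →ₗ[k] H} {F G : H ⊗[k] H}
  [AddCommGroup M] [Module k M] [Module.Finite k M] [AddCommGroup N] [Module k N]
  [Module.Finite k N]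
  {D : YDData k H M} {E : YDData k H N}

attribute [local instance] Cm.symm

theorem map_cmp {A' : Type*} [Ring A'] [Algebra k A'] (χ : A →ₗ[k] A') [Str χ] (h : H →ₗ[k] A)
    (x : Module.End k M →ₗ[k] A) : χ (cmp Q F D h x) = cmp Q F D (χ ∘ₗ h) (χ ∘ₗ x) := by
  rw [cmp, Str.map_mul, map_m2, ri, map_m2]; rfl

/-- The inverse of `cmp`. -/
noncomputable def cmpi (G : H ⊗[k] H) (D : YDData k H M) (h : H →ₗ[k] A)
    (x : Module.End k M →ₗ[k] A) : A := rr D h x * m2 (x ∘ₗ aop D) h G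

section
variable [IsDedekindFiniteMonoid A] (h : H →ₗ[k] A) (x : Module.End k M →ₗ[k] A)
  (y : Module.End k N →ₗ[k] A) [Str h] [Str x] [Str y] [Cm h x] [Cm h y] [Cm x y]

theorem inv2_cmp (hT : IsTwist Q T T' F G) (hD : OpYD Q D) :
    Inv2 (cmp Q F D h x) (cmpi G D h x) :=
  Inv2.comp ⟨hT.F_mul_G, hT.G_mul_F⟩ (inv2_ri h x hD).symm

end

/-- The comparison operator intertwines the coactions. -/
theorem kk2_mul_cmp (h : H →ₗ[k] A) (x : Module.End k M →ₗ[k] A)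
    (y : Module.End k N →ₗ[k] A) [Str h] [Str x] [Str y] [Cm h x] [Cm h y] [Cm x y] (hT : IsTwist Q T T' F G) (hD : OpYD Q D) (hE : OpYD Q E)
    (e : Module.End k (M ⊗[k] N) →ₗ[k] A) [Str e] [Cm h e]
    (i : Inv2 (rr E (x ∘ₗ aop D) y) (ri Q E (x ∘ₗ aop D) y)) (hx : e ∘ₗ eL k M N = x)
    (hy : e ∘ₗ eR M LinearMap.id = y) :
    kk2 Q T F G D E h x y * cmp Q F E (x ∘ₗ aop D) y =
      cmp Q F E (x ∘ₗ aop D) y * kk (prodYD Q D E) F G h e := by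
  have hP : rr (prodYD Q D E) h e =
      prR Q h (x ∘ₗ aop D) (y ∘ₗ aop E) (rr D h x) (rr E h y) := by
    rw [rr_prodYD, ← LinearMap.comp_assoc, hx, ← eR_id_comp, ← LinearMap.comp_assoc, hy]
  have hA : e ∘ₗ aop (prodYD Q D E) = conv Q (x ∘ₗ aop D) (y ∘ₗ aop E) := by
    rw [aop_prodYD, comp_conv, ← LinearMap.comp_assoc, hx, ← eR_id_comp, ← LinearMap.comp_assoc, hy]
  have p := (hE.ps (x ∘ₗ aop D) y).inv i.mul i.mul'
  have q : Ps (ri Q E (x ∘ₗ aop D) y) h h := inferInstance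
  have e1 : ri Q E (x ∘ₗ aop D) y * prR Q h (x ∘ₗ aop D) (y ∘ₗ aop E) (rr D h x) (rr E h y) =
      prR Q h (y ∘ₗ aop E) (x ∘ₗ aop D) (rr E h y) (rr D h x) * ri Q E (x ∘ₗ aop D) y := by
    calc _ = ri Q E (x ∘ₗ aop D) y * (prR Q h (x ∘ₗ aop D) (y ∘ₗ aop E) (rr D h x) (rr E h y) *
          rr E (x ∘ₗ aop D) y) * ri Q E (x ∘ₗ aop D) y := by
          simp only [mul_assoc, i.mul, mul_one]
      _ = _ := by rw [← rr_mul_prR_eq h x y hD hE, ← mul_assoc, i.mul', one_mul]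
  rw [kk, hP, hA, cmp, ← mul_assoc, kk2_mul h x y hT hD hE]
  simp only [mul_assoc]
  rw [pass_m2_mul (u := h) (v := conv Q (x ∘ₗ aop D) (y ∘ₗ aop E)) (u' := h)
    (v' := conv Q (y ∘ₗ aop E) (x ∘ₗ aop D)) (ri Q E (x ∘ₗ aop D) y), ← mul_assoc (ri ..) (prR ..),
    e1, mul_assoc, pass_m2 (u := conv Q (x ∘ₗ aop D) (y ∘ₗ aop E)) (v := h)
    (u' := conv Q (y ∘ₗ aop E) (x ∘ₗ aop D)) (v' := h) (ri Q E (x ∘ₗ aop D) y)]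

end Comparison

section ComparisonMaps

variable {k H M N X X' : Type*} [Field k] [Ring H] [Algebra k H]
  {Q : QuasiHopfAlgebra k H} {T T' : H →ₗ[k] H} {F G : H ⊗[k] H}
  [AddCommGroup M] [Module k M] [Module.Finite k M] [AddCommGroup N] [Module k N]
  [Module.Finite k N] [AddCommGroup X] [Module k X] [AddCommGroup X'] [Module k X']
  {D : YDData k H M} {E : YDData k H N} {g : M →ₗ[k] N}

attribute [local instance] Cm.symm

variable (Q F) in
/-- The comparison operator on `X ⊗ M`. -/
noncomputable def Kop (a : H →ₗ[k] Module.End k X) (D : YDData k H M) : Module.End k (X ⊗[k] M) :=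
  cmp Q F D (eL k X M ∘ₗ a) (eR X LinearMap.id)

/-- The inverse of `Kop`. -/
noncomputable def Kinv (G : H ⊗[k] H) (a : H →ₗ[k] Module.End k X) (D : YDData k H M) :
    Module.End k (X ⊗[k] M) :=
  cmpi G D (eL k X M ∘ₗ a) (eR X LinearMap.id)

theorem inv2_K [Module.Finite k X] (hT : IsTwist Q T T' F G) (hD : OpYD Q D)
    (a : H →ₗ[k] Module.End k X) [Str a] : Inv2 (Kop Q F a D) (Kinv G a D) :=
  inv2_cmp (eL k X M ∘ₗ a) (eR X LinearMap.id) hT hD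

theorem Kop_rTensor {f : X →ₗ[k] X'} {a : H →ₗ[k] Module.End k X} {a' : H →ₗ[k] Module.End k X'}
    (hf : ∀ h, f ∘ₗ a h = a' h ∘ₗ f) :
    f.rTensor M ∘ₗ Kop Q F a D = Kop Q F a' D ∘ₗ f.rTensor M := by
  have h1 : ∀ h, f.rTensor M ∘ₗ (eL k X M ∘ₗ a) h = (eL k X' M ∘ₗ a') h ∘ₗ f.rTensor M := fun h => by
    ext x m
    simpa using congrArg (· ⊗ₜ[k] m) (LinearMap.congr_fun (hf h) x)
  have h2 : ∀ y, f.rTensor M ∘ₗ eR X LinearMap.id y = eR X' LinearMap.id y ∘ₗ f.rTensor M :=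
    fun y => by ext x m; simp
  exact mul_nat (m2_nat (u := eR X LinearMap.id ∘ₗ aop D) (u' := eR X' LinearMap.id ∘ₗ aop D)
    (fun h => h2 _) h1 _) (m2_nat h1 h2 _)

theorem IsYDHom.eR_nat (hg : IsYDHom D E g) (h : H) :
    g.lTensor X ∘ₗ (eR X LinearMap.id ∘ₗ aop D) h = (eR X LinearMap.id ∘ₗ aop E) h ∘ₗ g.lTensor X := by
  ext x m
  simp [hg.map_act]

theorem eL_nat (g : M →ₗ[k] N) (x : Module.End k X) :
    g.lTensor X ∘ₗ eL k X M x = eL k X N x ∘ₗ g.lTensor X := by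
  ext; simp

theorem IsYDHom.kk_nat (hg : IsYDHom D E g) (a : H →ₗ[k] Module.End k X) :
    g.lTensor X ∘ₗ kk D F G (eL k X M ∘ₗ a) (eR X LinearMap.id) =
      kk E F G (eL k X N ∘ₗ a) (eR X LinearMap.id) ∘ₗ g.lTensor X :=
  mul_nat (m2_nat (fun h => eL_nat g (a h)) hg.eR_nat _)
    (mul_nat (hg.rr_nat a) (m2_nat hg.eR_nat (fun h => eL_nat g (a h)) _))

theorem Kop_lTensor [Module.Finite k X] (hD : OpYD Q D) (hE : OpYD Q E)
    (hg : IsYDHom D E g) (a : H →ₗ[k] Module.End k X) [Str a] :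
    g.lTensor X ∘ₗ Kop Q F a D = Kop Q F a E ∘ₗ g.lTensor X :=
  mul_nat (m2_nat hg.eR_nat (fun h => eL_nat g (a h)) _)
    (inv_nat (hg.rr_nat a) (inv2_ri (eL k X M ∘ₗ a) (eR X LinearMap.id) hD)
      (inv2_ri (eL k X N ∘ₗ a) (eR X LinearMap.id) hE))

theorem opA_sL : (opA k H M).toLinearMap ∘ₗ sL k H _ =
    eL k H M ∘ₗ (Algebra.lmul k H).toLinearMap := by
  ext h : 1
  ext x y
  simp

theorem opA_sR : (opA k H M).toLinearMap ∘ₗ sR H LinearMap.id = eR H LinearMap.id := by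
  ext h : 1
  ext x y
  simp

theorem opA_sR_apply (g : Module.End k M) : opA k H M (1 ⊗ₜ g) = g.lTensor H := by
  ext x y
  simp

theorem opA_kk (V : YDData k H M) : opA k H M (kk V F G (sL k H _) (sR H LinearMap.id)) =
    kk V F G (eL k H M ∘ₗ (Algebra.lmul k H).toLinearMap) (eR H LinearMap.id) := by
  rw [← opA_sL, ← opA_sR]
  exact map_kk (A' := Module.End k (H ⊗[k] M)) V (opA k H M).toLinearMap _ _

theorem IsYDHom.evAt_kk (hg : IsYDHom D E g) (m : M) :
    g.lTensor H (evAt H m (kk D F G (sL k H _) (sR H LinearMap.id))) =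
      evAt H (g m) (kk E F G (sL k H _) (sR H LinearMap.id)) := by
  rw [← opA_one_tmul, ← opA_one_tmul, opA_kk, opA_kk]
  exact LinearMap.congr_fun (hg.kk_nat (F := F) (G := G) (Algebra.lmul k H).toLinearMap) (1 ⊗ₜ m)

variable {ι κ : Type*} [Fintype ι] [Fintype κ]

theorem sR_id_comp {P A : Type*} [Ring P] [Algebra k P] [Ring A] [Algebra k A]
    (φ : P →ₗ[k] A) : sR H LinearMap.id ∘ₗ φ = sR H φ := rfl

theorem Inv2.map {A A' : Type*} [Ring A] [Algebra k A] [Ring A'] [Algebra k A'] (χ : A →ₗ[k] A')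
    [Str χ] {r a : A} (h : Inv2 r a) : Inv2 (χ r) (χ a) :=
  ⟨by rw [← Str.map_mul, h.mul, Str.map_one], by rw [← Str.map_mul, h.mul', Str.map_one]⟩

theorem kk2_mul_K {A : Type*} [Ring A] [Algebra k A] (h : H →ₗ[k] A)
    (e : Module.End k (M ⊗[k] N) →ₗ[k] A) [Str h] [Str e] [Cm h e]
    (hT : IsTwist Q T T' F G) (hD : OpYD Q D) (hE : OpYD Q E) :
    kk2 Q T F G D E h (e ∘ₗ eL k M N) (e ∘ₗ eR M LinearMap.id) * e (Kop Q F (aop D) E) =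
    e (Kop Q F (aop D) E) * kk (prodYD Q D E) F G h e := by
  have i := (inv2_ri (eL k M N ∘ₗ aop D) (eR M LinearMap.id) hE).map e
  rw [map_rr, ri, map_m2] at i
  have hc : Cm (e ∘ₗ eL k M N) (e ∘ₗ eR M LinearMap.id) :=
    ⟨fun a b => by
      simp only [LinearMap.comp_apply]
      rw [← Str.map_mul, ← Str.map_mul, Cm.comm (u := eL k M N) (v := eR M LinearMap.id)]⟩
  rw [Kop, map_cmp]
  exact kk2_mul_cmp h (e ∘ₗ eL k M N) (e ∘ₗ eR M LinearMap.id) hT hD hE e i rfl rfl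

theorem std_kk2_mul_K (hT : IsTwist Q T T' F G) (hD : OpYD Q D) (hE : OpYD Q E) :
    kk2 Q T F G D E (sL k H _) (sR H (eL k M N)) (sR H (eR M LinearMap.id)) *
      sR H LinearMap.id (Kop Q F (aop D) E) =
    sR H LinearMap.id (Kop Q F (aop D) E) *
      kk (prodYD Q D E) F G (sL k H _) (sR H LinearMap.id) := by
  have h := kk2_mul_K (A := H ⊗[k] Module.End k (M ⊗[k] N)) (sL k H _) (sR H LinearMap.id) hT hD hE
  rw [sR_id_comp, sR_id_comp] at h
  exact h

theorem evAt_kk2_K (hT : IsTwist Q T T' F G) (hD : OpYD Q D) (hE : OpYD Q E) (z : M ⊗[k] N) :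
    evAt H (Kop Q F (aop D) E z)
      (kk2 Q T F G D E (sL k H _) (sR H (eL k M N)) (sR H (eR M LinearMap.id))) =
    (Kop Q F (aop D) E).lTensor H
      (evAt H z (kk (prodYD Q D E) F G (sL k H _) (sR H LinearMap.id))) := by
  have h := congrArg (fun X => opA k H _ X (1 ⊗ₜ z)) (std_kk2_mul_K hT hD hE)
  simp only [map_mul, sR_apply, LinearMap.id_apply, opA_sR_apply, Module.End.mul_apply,
    LinearMap.lTensor_tmul, opA_one_tmul] at h
  exact h

theorem K_flip (hT : IsTwist Q T T' F G) (hE : OpYD Q E) (h : H) :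
    Kop Q F (aop D) E ∘ₗ aop (prodYD Q D E) (T h) =
    (m2 (eR M (aop E)) (eL k M N ∘ₗ aop D) ∘ₗ flipMap T ∘ₗ Q.comul.toLinearMap) h ∘ₗ
      Kop Q F (aop D) E := by
  rw [aop_prodYD]
  exact (cmp_ps (eL k M N ∘ₗ aop D) (eR M LinearMap.id) hT hE).pass h

end ComparisonMaps

open Module (Dual)

section AssociativeComparison

variable {k H A M N : Type*} [Field k] [Ring H] [Algebra k H] [Ring A] [Algebra k A]
  [IsDedekindFiniteMonoid A]
  {Q : QuasiHopfAlgebra k H} {T T' : H →ₗ[k] H} {F G : H ⊗[k] H}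
  [AddCommGroup M] [Module k M] [Module.Finite k M] [AddCommGroup N] [Module k N]
  [Module.Finite k N] {D : YDData k H M} {E : YDData k H N}

attribute [local instance] Cm.symm

variable (h : H →ₗ[k] A) (x : Module.End k M →ₗ[k] A)
  (y : Module.End k N →ₗ[k] A) [Str h] [Str x] [Str y] [Cm h x] [Cm h y] [Cm x y]

theorem cmp_prodYD (hD : OpYD Q D) (hE : OpYD Q E)
    (e : Module.End k (M ⊗[k] N) →ₗ[k] A) [Str e] [Cm h e]
    (hx : e ∘ₗ eL k M N = x) (hy : e ∘ₗ eR M LinearMap.id = y) :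
    cmp Q F (prodYD Q D E) h e = m2 (conv Q (x ∘ₗ aop D) (y ∘ₗ aop E)) h F *
      pri Q h (x ∘ₗ aop D) (y ∘ₗ aop E) (ri Q D h x) (ri Q E h y) := by
  have hA : e ∘ₗ aop (prodYD Q D E) = conv Q (x ∘ₗ aop D) (y ∘ₗ aop E) := by
    rw [aop_prodYD, comp_conv, ← LinearMap.comp_assoc, hx, ← eR_id_comp, ← LinearMap.comp_assoc, hy]
  have hI : ri Q (prodYD Q D E) h e =
      pri Q h (x ∘ₗ aop D) (y ∘ₗ aop E) (ri Q D h x) (ri Q E h y) := by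
    refine (inv2_ri h e (prod_opYD hD hE)).unique ?_
    rw [rr_prodYD, ← LinearMap.comp_assoc, hx, ← eR_id_comp, ← LinearMap.comp_assoc, hy]
    exact inv2_pri (Q := Q) h (x ∘ₗ aop D) (y ∘ₗ aop E) (inv2_ri h x hD) (inv2_ri h y hE)
  rw [cmp, hA, hI]

theorem cmp_assoc_prodYD (hT : IsTwist Q T T' F G) (hD : OpYD Q D) (hE : OpYD Q E)
    (e : Module.End k (M ⊗[k] N) →ₗ[k] A) [Str e] [Cm h e]
    (hx : e ∘ₗ eL k M N = x) (hy : e ∘ₗ eR M LinearMap.id = y) :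
    cmp Q F D h x * cmp Q F E (conv Q h (x ∘ₗ aop D)) y =
    rv Q T (y ∘ₗ aop E) (x ∘ₗ aop D) h * (cmp Q F E (x ∘ₗ aop D) y *
      (cmp Q F (prodYD Q D E) h e * ph Q h (x ∘ₗ aop D) (y ∘ₗ aop E))) := by
  rw [cmp_assoc h x y hT hD hE, cmp_prodYD h x y hD hE e hx hy, mul_assoc]

end AssociativeComparison

section Triple

variable {k H B : Type*} [Field k] [Ring H] [Algebra k H]
  {Q : QuasiHopfAlgebra k H} {T T' : H →ₗ[k] H} {F G : H ⊗[k] H}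
  [AddCommGroup B] [Module k B] [Module.Finite k B] {D : YDData k H B}

attribute [local instance] Cm.symm

section
variable {X Y Z P : Type*} [AddCommGroup X] [Module k X] [AddCommGroup Y] [Module k Y]
  [AddCommGroup Z] [Module k Z] [AddCommGroup P] [Module k P]

variable (k X Y Z) in
/-- Rebracketing of operators. -/
noncomputable def cj : Module.End k ((X ⊗[k] Y) ⊗[k] Z) →ₗ[k] Module.End k (X ⊗[k] (Y ⊗[k] Z)) :=
  (TensorProduct.assoc k X Y Z).conj.toLinearMap

theorem cj_comp (a : Module.End k ((X ⊗[k] Y) ⊗[k] Z)) :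
    cj k X Y Z a ∘ₗ (TensorProduct.assoc k X Y Z).toLinearMap =
      (TensorProduct.assoc k X Y Z).toLinearMap ∘ₗ a := by
  ext; simp [cj, LinearEquiv.conj_apply]

instance : Str (cj k X Y Z) :=
  ⟨LinearEquiv.conj_id _, fun a b => by ext; simp [cj, LinearEquiv.conj_apply]⟩

theorem cj_eL_eL (s : P →ₗ[k] Module.End k X) :
    cj k X Y Z ∘ₗ eL k (X ⊗[k] Y) Z ∘ₗ eL k X Y ∘ₗ s = eL k X (Y ⊗[k] Z) ∘ₗ s := by
  ext a : 1
  ext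
  simp [cj, LinearEquiv.conj_apply]

theorem cj_eL_eR (s : P →ₗ[k] Module.End k Y) :
    cj k X Y Z ∘ₗ eL k (X ⊗[k] Y) Z ∘ₗ eR X s = eR X (eL k Y Z ∘ₗ s) := by
  ext a : 1
  ext
  simp [cj, LinearEquiv.conj_apply]

theorem cj_eR (s : P →ₗ[k] Module.End k Z) :
    cj k X Y Z ∘ₗ eR (X ⊗[k] Y) s = eR X (eR Y s) := by
  ext a : 1
  ext
  simp [cj, LinearEquiv.conj_apply]

end

variable (Q D) in
/-- The reassociator acting on `B ⊗ (B ⊗ B)`. -/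
noncomputable def phiOp : Module.End k (B ⊗[k] (B ⊗[k] B)) :=
  tensAct D.act (tensAct D.act D.act) Q.Phi

variable (Q T D) in
/-- The transpose of the action of the reassociator on the triple product of the dual. -/
noncomputable def phiTr : Module.End k (B ⊗[k] (B ⊗[k] B)) :=
  m2 (eL k B _ ∘ₗ aop D ∘ₗ T) (eR B (m2 (eL k B B ∘ₗ aop D ∘ₗ T) (eR B (aop D ∘ₗ T)))) Q.Phi

theorem m2_eR {X Y P P' : Type*} [AddCommGroup X] [Module k X] [AddCommGroup Y] [Module k Y]
    [AddCommGroup P] [Module k P] [AddCommGroup P'] [Module k P'] (u : P →ₗ[k] Module.End k Y)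
    (v : P' →ₗ[k] Module.End k Y) : eR X (m2 u v) = m2 (eR X u) (eR X v) := by
  ext a b : 3
  simp [eR, Module.End.mul_eq_comp, LinearMap.lTensor_comp]

theorem phiOp_eq : phiOp Q D = ph Q (eL k B _ ∘ₗ aop D) (eR B (eL k B B ∘ₗ aop D))
    (eR B (eR B (aop D))) := by
  have : (tensAct D.act D.act).toLinearMap = m2 (eL k B B ∘ₗ aop D) (eR B (aop D)) :=
    LinearMap.ext fun t => tensAct_eq _ _ t
  rw [phiOp, tensAct_eq, this, m2_eR, ph]

theorem m2_rev3 {A : Type*} [Ring A] [Algebra k A] (u v w : H →ₗ[k] A) [Cm u v] [Cm u w] [Cm v w]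
    (t : H ⊗[k] (H ⊗[k] H)) : m2 u (m2 v w) (rev3 T t) = m2 (w ∘ₗ T) (m2 (v ∘ₗ T) (u ∘ₗ T)) t := by
  induction t using ind3 with
  | h0 => simp only [LinearMap.map_zero, LinearMap.zero_apply, mul_zero, zero_mul,
        TensorProduct.zero_tmul, TensorProduct.tmul_zero]
  | ha s t hs ht => simp only [LinearMap.map_add, hs, ht]
  | h a b c =>
    simp only [rev3_tmul, m2_tmul, LinearMap.comp_apply]
    rw [Cm.comm (u := v) (v := w), ← mul_assoc, Cm.comm (u := u) (v := w), mul_assoc,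
      Cm.comm (u := u) (v := v)]

theorem phiTr_eq : phiTr Q T D = rv Q T (eR B (eR B (aop D))) (eR B (eL k B B ∘ₗ aop D))
    (eL k B _ ∘ₗ aop D) := by
  rw [rv, m2_rev3, phiTr, m2_eR]
  rfl

theorem K_assoc (hT : IsTwist Q T T' F G) (hD : OpYD Q D) :
    (TensorProduct.assoc k B B B).toLinearMap ∘ₗ (Kop Q F (aop D) D).rTensor B ∘ₗ
      Kop Q F (aop (prodYD Q D D)) D =
    phiTr Q T D ∘ₗ (Kop Q F (aop D) D).lTensor B ∘ₗ Kop Q F (aop D) (prodYD Q D D) ∘ₗ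
      assocMap Q D.act D.act D.act := by
  have h1 := cmp_assoc_prodYD (eL k B (B ⊗[k] B) ∘ₗ aop D) (eR B (eL k B B))
    (eR B (eR B LinearMap.id)) hT hD hD (eR B LinearMap.id) rfl rfl
  have c1 : cj k B B B ((Kop Q F (aop D) D).rTensor B) =
      cmp Q F D (eL k B (B ⊗[k] B) ∘ₗ aop D) (eR B (eL k B B)) := by
    change (cj k B B B ∘ₗ eL k _ B) (Kop Q F (aop D) D) = _
    rw [Kop, map_cmp]
    simp only [LinearMap.comp_assoc, cj_eL_eL, cj_eL_eR, LinearMap.comp_id]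
  have c2 : cj k B B B (Kop Q F (aop (prodYD Q D D)) D) =
      cmp Q F D (conv Q (eL k B (B ⊗[k] B) ∘ₗ aop D) (eR B (eL k B B) ∘ₗ aop D))
        (eR B (eR B LinearMap.id)) := by
    rw [Kop, map_cmp, cj_eR, aop_prodYD, comp_conv, comp_conv, cj_eL_eR, cj_eL_eL]
    rfl
  have c3 : (Kop Q F (aop D) D).lTensor B =
      cmp Q F D (eR B (eL k B B) ∘ₗ aop D) (eR B (eR B LinearMap.id)) := by
    change eR B LinearMap.id (Kop Q F (aop D) D) = _
    rw [Kop, map_cmp]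
    rfl
  rw [← c1, ← c2, ← c3] at h1
  have h2 := congrArg (fun X => X ∘ₗ (TensorProduct.assoc k B B B).toLinearMap) h1
  change (_ * _) ∘ₗ _ = _ at h2
  rw [← Str.map_mul (u := cj k B B B), cj_comp] at h2
  refine h2.trans ?_
  rw [assocMap, phiTr_eq]
  change _ = _ ∘ₗ _ ∘ₗ _ ∘ₗ phiOp Q D ∘ₗ _
  rw [phiOp_eq]
  rfl

end Triple

open Module (Dual)

section Quadruple

variable {k H B : Type*} [Field k] [Ring H] [Algebra k H]
  {Q : QuasiHopfAlgebra k H} {T T' : H →ₗ[k] H} {F G : H ⊗[k] H}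
  [AddCommGroup B] [Module k B] {D : YDData k H B}

attribute [local instance] Cm.symm

section
variable {X Y Z : Type*} [AddCommGroup X] [Module k X] [AddCommGroup Y] [Module k Y]
  [AddCommGroup Z] [Module k Z]

theorem cj_of_comp (Y' : Module.End k (X ⊗[k] (Y ⊗[k] Z))) :
    cj k X Y Z ((TensorProduct.assoc k X Y Z).symm.toLinearMap ∘ₗ Y' ∘ₗ
      (TensorProduct.assoc k X Y Z).toLinearMap) = Y' := by
  ext; simp [cj, LinearEquiv.conj_apply]

theorem cj_injective : Function.Injective (cj k X Y Z) :=
  (TensorProduct.assoc k X Y Z).conj.injective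

theorem braiding_eq [Module.Finite k X] (D : YDData k H X) (E : YDData k H Y) : braiding D E =
    (TensorProduct.comm k X Y).toLinearMap ∘ₗ rr D (eR X (aop E)) (eL k X Y) := by
  ext x y
  simp only [TensorProduct.AlgebraTensorModule.curry_apply, TensorProduct.curry_apply,
      LinearMap.restrictScalars_self, LinearMap.coe_restrictScalars, LinearMap.comp_apply, braiding,
      LinearMap.rTensor_tmul, rr, ← evAt_lop]
  generalize lop D = L
  induction L with
  | zero => simp only [LinearMap.map_zero, LinearMap.zero_apply, mul_zero, zero_mul,
        TensorProduct.zero_tmul, TensorProduct.tmul_zero]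
  | add s t hs ht =>
    simp only [LinearMap.map_add, TensorProduct.add_tmul, LinearMap.add_apply, hs, ht]
  | tmul h a => simp

end

variable (Q D) in
/-- The middle-four exchange on `(B ⊗ B) ⊗ (B ⊗ B)`. -/
noncomputable def exOp : Module.End k ((B ⊗[k] B) ⊗[k] (B ⊗[k] B)) :=
  assocInv Q D.act D.act (prodAct Q D.act D.act) ∘ₗ
  (assocMap Q D.act D.act D.act).lTensor B ∘ₗ
  ((braiding D D).rTensor B).lTensor B ∘ₗ
  (assocInv Q D.act D.act D.act).lTensor B ∘ₗ
  assocMap Q D.act D.act (prodAct Q D.act D.act)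

variable [Module.Finite k B]

variable (Q T D) in
/-- The transpose of the middle-four exchange of the dual. -/
noncomputable def exTr (F G : H ⊗[k] H) : Module.End k ((B ⊗[k] B) ⊗[k] (B ⊗[k] B)) :=
  ((TensorProduct.assoc k B B (B ⊗[k] B)).symm.toLinearMap ∘ₗ
    m2 (eL k B _ ∘ₗ aop D ∘ₗ T) (eR B (m2 (eL k B _ ∘ₗ aop D ∘ₗ T)
      (eR B (m2 (eR B (aop D)) (eL k B B ∘ₗ aop D) ∘ₗ flipMap T ∘ₗ Q.comul.toLinearMap)))) Q.Phi) ∘ₗ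
  (m2 (eL k B _ ∘ₗ aop D ∘ₗ T) (eR B (m2 (eL k B B ∘ₗ aop D ∘ₗ T) (eR B (aop D ∘ₗ T)))) Q.PhiInv ∘ₗ
    (TensorProduct.assoc k B B B).toLinearMap).lTensor B ∘ₗ
  (((TensorProduct.comm k B B).toLinearMap ∘ₗ
    kk D F G (eL k B B ∘ₗ aop D) (eR B LinearMap.id)).rTensor B).lTensor B ∘ₗ
  ((TensorProduct.assoc k B B B).symm.toLinearMap ∘ₗ phiTr Q T D).lTensor B ∘ₗ
    m2 (eL k B _ ∘ₗ aop D ∘ₗ T) (eR B (m2 (eL k B _ ∘ₗ aop D ∘ₗ T)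
      (eR B (m2 (eR B (aop D)) (eL k B B ∘ₗ aop D) ∘ₗ flipMap T ∘ₗ Q.comul.toLinearMap)))) Q.PhiInv ∘ₗ
    (TensorProduct.assoc k B B (B ⊗[k] B)).toLinearMap

variable (k B) in
/-- The transposition of the middle factors of `B ⊗ (B ⊗ (B ⊗ B))`. -/
noncomputable def midSwap : Module.End k (B ⊗[k] (B ⊗[k] (B ⊗[k] B))) :=
  eR B LinearMap.id (cj k B B B (eL k _ B (TensorProduct.comm k B B).toLinearMap))

@[simp] theorem midSwap_tmul (a b c d : B) :
    midSwap k B (a ⊗ₜ (b ⊗ₜ (c ⊗ₜ d))) = a ⊗ₜ (c ⊗ₜ (b ⊗ₜ d)) := by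
  simp [midSwap, cj, LinearEquiv.conj_apply]

variable (k B) in
/-- The strands of `End (B ⊗ (B ⊗ (B ⊗ B)))`. -/
noncomputable abbrev t2 : Module.End k B →ₗ[k] Module.End k (B ⊗[k] (B ⊗[k] (B ⊗[k] B))) :=
  eR B (eL k B _)

variable (k B) in
noncomputable abbrev t3 : Module.End k B →ₗ[k] Module.End k (B ⊗[k] (B ⊗[k] (B ⊗[k] B))) :=
  eR B (eR B (eL k B B))

variable (k B) in
noncomputable abbrev t4 : Module.End k B →ₗ[k] Module.End k (B ⊗[k] (B ⊗[k] (B ⊗[k] B))) :=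
  eR B (eR B (eR B LinearMap.id))

theorem cj_five (P P' : Module.End k (B ⊗[k] (B ⊗[k] (B ⊗[k] B))))
    (p p' : Module.End k (B ⊗[k] (B ⊗[k] B))) (r : Module.End k (B ⊗[k] B)) :
    cj k B B (B ⊗[k] B) (((TensorProduct.assoc k B B (B ⊗[k] B)).symm.toLinearMap ∘ₗ P) ∘ₗ
      (p ∘ₗ (TensorProduct.assoc k B B B).toLinearMap).lTensor B ∘ₗ
      ((((TensorProduct.comm k B B).toLinearMap ∘ₗ r).rTensor B).lTensor B) ∘ₗ
      ((TensorProduct.assoc k B B B).symm.toLinearMap ∘ₗ p').lTensor B ∘ₗ P' ∘ₗ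
      (TensorProduct.assoc k B B (B ⊗[k] B)).toLinearMap) =
    P * (eR B LinearMap.id p * (midSwap k B * (eR B (cj k B B B ∘ₗ eL k _ B) r *
      (eR B LinearMap.id p' * P')))) := by
  have h : ((TensorProduct.comm k B B).toLinearMap ∘ₗ r).rTensor B =
      (TensorProduct.assoc k B B B).symm.toLinearMap ∘ₗ
        (cj k B B B (eL k _ B (TensorProduct.comm k B B).toLinearMap) ∘ₗ
          cj k B B B (eL k _ B r)) ∘ₗ (TensorProduct.assoc k B B B).toLinearMap := by
    change _ = _ ∘ₗ (_ * _ : Module.End k (B ⊗[k] (B ⊗[k] B))) ∘ₗ _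
    rw [← Str.map_mul, ← Str.map_mul, cj_comp, ← LinearMap.comp_assoc,
      LinearEquiv.symm_comp]
    rfl
  rw [h]
  refine Eq.trans (congrArg (cj k B B (B ⊗[k] B)) ?_) (cj_of_comp _)
  have ha : ∀ (f : Module.End k (B ⊗[k] (B ⊗[k] B))),
      (p ∘ₗ (TensorProduct.assoc k B B B).toLinearMap) ∘ₗ
      ((TensorProduct.assoc k B B B).symm.toLinearMap ∘ₗ f ∘ₗ
        (TensorProduct.assoc k B B B).toLinearMap) ∘ₗ
      ((TensorProduct.assoc k B B B).symm.toLinearMap ∘ₗ p') = p ∘ₗ f ∘ₗ p' := fun f =>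
    LinearMap.ext fun x => by simp
  have hb := congrArg (fun f => f.lTensor B) (ha
    (cj k B B B (eL k _ B (TensorProduct.comm k B B).toLinearMap) ∘ₗ cj k B B B (eL k _ B r)))
  simp only [LinearMap.lTensor_comp] at hb ⊢
  refine LinearMap.ext fun x => ?_
  have := fun y => LinearMap.congr_fun hb y
  simp only [LinearMap.comp_apply] at this ⊢
  rw [this]
  rfl

theorem tensAct_prodAct {M N N' : Type*} [AddCommGroup M] [Module k M] [AddCommGroup N]
    [Module k N] [AddCommGroup N'] [Module k N'] (ρ : H →ₐ[k] Module.End k M)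
    (σ : H →ₐ[k] Module.End k N) (τ : H →ₐ[k] Module.End k N') (t : H ⊗[k] (H ⊗[k] H)) :
    tensAct ρ (tensAct σ τ) t = m2 (eL k M _ ∘ₗ ρ.toLinearMap)
      (m2 (eR M (eL k N N' ∘ₗ σ.toLinearMap)) (eR M (eR N τ.toLinearMap))) t := by
  have : (tensAct σ τ).toLinearMap = m2 (eL k N N' ∘ₗ σ.toLinearMap) (eR N τ.toLinearMap) :=
    LinearMap.ext fun t => tensAct_eq _ _ t
  rw [tensAct_eq, this, m2_eR]

theorem eR_comp {X Y P P' : Type*} [AddCommGroup X] [Module k X] [AddCommGroup Y] [Module k Y]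
    [AddCommGroup P] [Module k P] [AddCommGroup P'] [Module k P'] (u : P →ₗ[k] Module.End k Y)
    (v : P' →ₗ[k] P) : eR X (u ∘ₗ v) = eR X u ∘ₗ v := rfl

theorem eR_conv {X Y : Type*} [AddCommGroup X] [Module k X] [AddCommGroup Y] [Module k Y]
    (u v : H →ₗ[k] Module.End k Y) : eR X (conv Q u v) = conv Q (eR X u) (eR X v) := by
  rw [conv, eR_comp, m2_eR, conv]

theorem eR_eR_aop_prodYD : eR B (eR B (aop (prodYD Q D D))) =
    conv Q (t3 k B ∘ₗ aop D) (t4 k B ∘ₗ aop D) := by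
  rw [aop_prodYD, eR_conv, eR_conv]
  rfl

theorem cj_exOp : cj k B B (B ⊗[k] B) (exOp Q D) =
    exch Q (midSwap k B) (eL k B _ ∘ₗ aop D) (t2 k B ∘ₗ aop D) (t3 k B ∘ₗ aop D)
      (t4 k B ∘ₗ aop D) (rr D (t3 k B ∘ₗ aop D) (t2 k B)) := by
  rw [exOp, braiding_eq]
  refine (cj_five _ _ _ _ _).trans ?_
  have e1 : eR B (cj k B B B ∘ₗ eL k _ B) (rr D (eR B (aop D)) (eL k B B)) =
      rr D (t3 k B ∘ₗ aop D) (t2 k B) := by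
    rw [map_rr]
    congr 1
    · change eR B ((cj k B B B ∘ₗ eL k _ B ∘ₗ eR B (aop D))) = _
      rw [cj_eL_eR]
      rfl
    · change eR B ((cj k B B B ∘ₗ eL k _ B ∘ₗ eL k B B ∘ₗ LinearMap.id)) = _
      rw [cj_eL_eL]
      rfl
  have e2 : eR B LinearMap.id (tensAct D.act (tensAct D.act D.act) Q.Phi) =
      ph Q (t2 k B ∘ₗ aop D) (t3 k B ∘ₗ aop D) (t4 k B ∘ₗ aop D) := by
    rw [tensAct_prodAct, map_m2, comp_m2]
    rfl
  have e3 : eR B LinearMap.id (tensAct D.act (tensAct D.act D.act) Q.PhiInv) =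
      phi Q (t2 k B ∘ₗ aop D) (t3 k B ∘ₗ aop D) (t4 k B ∘ₗ aop D) := by
    rw [tensAct_prodAct, map_m2, comp_m2]
    rfl
  have e4 : ∀ t, tensAct D.act (tensAct D.act (prodAct Q D.act D.act)) t =
      m2 (eL k B _ ∘ₗ aop D) (m2 (t2 k B ∘ₗ aop D)
        (conv Q (t3 k B ∘ₗ aop D) (t4 k B ∘ₗ aop D))) t := fun t => by
    rw [← eR_eR_aop_prodYD, tensAct_prodAct]
    rfl
  rw [e1, e2, e3, e4, e4]
  rfl

theorem cj_exTr : cj k B B (B ⊗[k] B) (exTr Q T D F G) =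
    exchT Q T (midSwap k B) (eL k B _ ∘ₗ aop D) (t2 k B ∘ₗ aop D) (t3 k B ∘ₗ aop D)
      (t4 k B ∘ₗ aop D) (kk D F G (t2 k B ∘ₗ aop D) (t3 k B)) := by
  refine (cj_five _ _ _ _ _).trans ?_
  have e1 : eR B (cj k B B B ∘ₗ eL k _ B) (kk D F G (eL k B B ∘ₗ aop D) (eR B LinearMap.id)) =
      kk D F G (t2 k B ∘ₗ aop D) (t3 k B) := by
    rw [map_kk]
    congr 1
    · change eR B ((cj k B B B ∘ₗ eL k _ B ∘ₗ eL k B B ∘ₗ aop D)) = _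
      rw [cj_eL_eL]
      rfl
    · change eR B ((cj k B B B ∘ₗ eL k _ B ∘ₗ eR B LinearMap.id)) = _
      rw [cj_eL_eR]
      rfl
  have e2 : eR B LinearMap.id (phiTr Q T D) =
      rv Q T (t4 k B ∘ₗ aop D) (t3 k B ∘ₗ aop D) (t2 k B ∘ₗ aop D) := by
    rw [phiTr_eq, rv, map_m2, comp_m2]
    rfl
  have e3 : eR B LinearMap.id (m2 (eL k B _ ∘ₗ aop D ∘ₗ T)
      (eR B (m2 (eL k B B ∘ₗ aop D ∘ₗ T) (eR B (aop D ∘ₗ T)))) Q.PhiInv) =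
      rvi Q T (t4 k B ∘ₗ aop D) (t3 k B ∘ₗ aop D) (t2 k B ∘ₗ aop D) := by
    rw [rvi, m2_rev3, m2_eR, map_m2, comp_m2]
    rfl
  have e4 : ∀ t, m2 (eL k B _ ∘ₗ aop D ∘ₗ T) (eR B (m2 (eL k B _ ∘ₗ aop D ∘ₗ T)
      (eR B (m2 (eR B (aop D)) (eL k B B ∘ₗ aop D) ∘ₗ flipMap T ∘ₗ Q.comul.toLinearMap)))) t =
      m2 (m2 (t4 k B ∘ₗ aop D) (t3 k B ∘ₗ aop D) ∘ₗ flipMap T ∘ₗ Q.comul.toLinearMap)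
        (m2 (t2 k B ∘ₗ aop D ∘ₗ T) (eL k B _ ∘ₗ aop D ∘ₗ T)) (rev3 LinearMap.id t) := fun t => by
    have hw : eR B (eR B (m2 (eR B (aop D)) (eL k B B ∘ₗ aop D) ∘ₗ flipMap T ∘ₗ
        Q.comul.toLinearMap)) = m2 (t4 k B ∘ₗ aop D) (t3 k B ∘ₗ aop D) ∘ₗ flipMap T ∘ₗ
          Q.comul.toLinearMap := by
      rw [eR_comp, eR_comp, m2_eR, m2_eR]
      rfl
    rw [m2_eR, hw]
    exact (m2_rev3 (T := LinearMap.id) (m2 (t4 k B ∘ₗ aop D) (t3 k B ∘ₗ aop D) ∘ₗ flipMap T ∘ₗ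
      Q.comul.toLinearMap) (t2 k B ∘ₗ aop D ∘ₗ T) (eL k B _ ∘ₗ aop D ∘ₗ T) t).symm
  rw [e1, e2, e3, e4, e4, exchT, hp, hpi]
  rfl

theorem K_exchange (hT : IsTwist Q T T' F G) (hD : OpYD Q D) :
    exTr Q T D F G ∘ₗ TensorProduct.map (Kop Q F (aop D) D) (Kop Q F (aop D) D) ∘ₗ
      Kop Q F (aop (prodYD Q D D)) (prodYD Q D D) =
    TensorProduct.map (Kop Q F (aop D) D) (Kop Q F (aop D) D) ∘ₗ
      Kop Q F (aop (prodYD Q D D)) (prodYD Q D D) ∘ₗ exOp Q D := by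
  have p1 : Ps (midSwap k B) (eL k B _) (eL k B (B ⊗[k] (B ⊗[k] B))) :=
    ⟨fun a => by ext; simp⟩
  have p2 : Ps (midSwap k B) (t2 k B) (t3 k B) := ⟨fun a => by ext; simp⟩
  have p3 : Ps (midSwap k B) (t3 k B) (t2 k B) := ⟨fun a => by ext; simp⟩
  have p4 : Ps (midSwap k B) (t4 k B) (t4 k B) := ⟨fun a => by ext; simp⟩
  have h1 := exchange (eL k B _) (t2 k B) (t3 k B) (t4 k B) (eR B (eR B LinearMap.id)) (midSwap k B)
    hT hD rfl rfl
  have c1 : cj k B B (B ⊗[k] B) (eL k _ _ (Kop Q F (aop D) D)) =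
      cmp Q F D (eL k B _ ∘ₗ aop D) (t2 k B) := by
    change (cj k B B _ ∘ₗ eL k _ _) (Kop Q F (aop D) D) = _
    rw [Kop, map_cmp]
    simp only [LinearMap.comp_assoc, cj_eL_eL, cj_eL_eR, LinearMap.comp_id]
  have c2 : cj k B B (B ⊗[k] B) (eR _ LinearMap.id (Kop Q F (aop D) D)) =
      cmp Q F D (t3 k B ∘ₗ aop D) (t4 k B) := by
    change (cj k B B _ ∘ₗ eR _ LinearMap.id) (Kop Q F (aop D) D) = _
    rw [Kop, map_cmp, cj_eR]
    rfl
  have c3 : cj k B B (B ⊗[k] B) (Kop Q F (aop (prodYD Q D D)) (prodYD Q D D)) =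
      cmp Q F (prodYD Q D D) (conv Q (eL k B _ ∘ₗ aop D) (t2 k B ∘ₗ aop D))
        (eR B (eR B LinearMap.id)) := by
    rw [Kop, map_cmp, cj_eR]
    conv_lhs => rw [aop_prodYD, comp_conv, comp_conv, cj_eL_eR, cj_eL_eL]
    rfl
  have c4 : TensorProduct.map (Kop Q F (aop D) D) (Kop Q F (aop D) D) =
      eL k _ _ (Kop Q F (aop D) D) * eR _ LinearMap.id (Kop Q F (aop D) D) := by
    ext; simp
  apply cj_injective
  change cj k B B _ (_ * (_ * _)) = cj k B B _ (_ * (_ * _))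
  simp only [Str.map_mul, c4, c1, c2, c3, cj_exOp, cj_exTr]
  simpa only [mul_assoc] using h1

end Quadruple

open Module (Dual)

section UnitObject

variable {k H A M X : Type*} [Field k] [Ring H] [Algebra k H] [Ring A] [Algebra k A]
  {Q : QuasiHopfAlgebra k H} {T T' : H →ₗ[k] H} {F G : H ⊗[k] H}
  [AddCommGroup M] [Module k M] [Module.Finite k M]
  [AddCommGroup X] [Module k X] {D : YDData k H M}

attribute [local instance] Cm.symm

theorem m2_triv_left (u : H →ₗ[k] A) [Str u] (t : H ⊗[k] H) : m2 (triv Q A) u t = u (epsL Q t) := by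
  rw [epsL, map_m2]
  congr 2
  ext h
  simp [Algebra.algebraMap_eq_smul_one, Str.map_one]

theorem m2_triv_right (u : H →ₗ[k] A) [Str u] (t : H ⊗[k] H) : m2 u (triv Q A) t = u (epsR Q t) := by
  rw [epsR, map_m2]
  congr 2
  ext h
  simp [Algebra.algebraMap_eq_smul_one, Str.map_one]

theorem comp_aop_unitYD (e : Module.End k k →ₗ[k] A) [Str e] : e ∘ₗ aop (unitYD Q) = triv Q A := by
  ext h
  have : aop (unitYD Q) h = Q.counit h • (1 : Module.End k k) := by
    ext; simp [unitYD]
  rw [LinearMap.comp_apply, this, map_smul, Str.map_one, triv_apply,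
    Algebra.algebraMap_eq_smul_one]

theorem rr_unitYD (n : H →ₗ[k] A) (e : Module.End k k →ₗ[k] A) [Str n] [Str e] :
    rr (unitYD Q) n e = 1 := by
  rw [rr, lop_unitYD, Algebra.TensorProduct.one_def, m2_tmul, Str.map_one, Str.map_one, one_mul]

theorem IsTwist.epsL_G (hT : IsTwist Q T T' F G) : epsL Q G = 1 := by
  have := congrArg (epsL Q) hT.mul_inv
  rwa [Str.map_mul, hT.epsL_eq, one_mul, Str.map_one] at this

theorem kk_unitYD (hT : IsTwist Q T T' F G) (n : H →ₗ[k] A) (e : Module.End k k →ₗ[k] A) [Str n]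
    [Str e] : kk (unitYD Q) F G n e = 1 := by
  rw [kk, comp_aop_unitYD, rr_unitYD, m2_triv_right, m2_triv_left, hT.epsR_eq, hT.epsL_G, one_mul,
    Str.map_one, one_mul]

theorem opYD_unitYD : OpYD Q (unitYD Q) := by
  have h1 : sR H (aop (unitYD Q)) = triv Q _ := by
    rw [← sR_id_comp, comp_aop_unitYD]
  have h2 : sR H (sR H (aop (unitYD Q))) = triv Q (H ⊗[k] (H ⊗[k] Module.End k k)) := by
    rw [h1, triv_sR]
  refine ⟨fun h => ?_, ?_, ?_⟩
  · rw [lop_unitYD, h1, one_mul, mul_one, conv_triv, triv_conv]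
  · rw [h2, rr_unitYD, rr_unitYD, rr_unitYD, ph_triv_mid, ph_triv_right, ph_triv_left]
  · exact rr_unitYD _ _

theorem Kop_unitYD [Module.Finite k X] (hT : IsTwist Q T T' F G) (a : H →ₗ[k] Module.End k X) [Str a] :
    Kop Q F a (unitYD Q) = LinearMap.id := by
  have h1 : ri Q (unitYD Q) (eL k X k ∘ₗ a) (eR X LinearMap.id) = 1 := by
    have := (inv2_ri (eL k X k ∘ₗ a) (eR X LinearMap.id) (opYD_unitYD (Q := Q))).mul
    rwa [rr_unitYD, one_mul] at this
  have h2 : eR X LinearMap.id ∘ₗ aop (unitYD Q) = triv Q (Module.End k (X ⊗[k] k)) :=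
    comp_aop_unitYD _
  rw [Kop, cmp, h1, h2, m2_triv_left, hT.epsL_eq, Str.map_one, one_mul]
  rfl

theorem Kop_aop_unitYD (hT : IsTwist Q T T' F G) (hD : OpYD Q D) :
    Kop Q F (aop (unitYD Q)) D = LinearMap.id := by
  have h1 : ri Q D (triv Q _) (eR k LinearMap.id) = 1 := by
    have := (inv2_ri (triv Q _) (eR k LinearMap.id) hD).mul
    rwa [hD.rr_triv (eR k LinearMap.id), one_mul] at this
  have h2 : eL k k M ∘ₗ aop (unitYD Q) = triv Q (Module.End k (k ⊗[k] M)) :=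
    comp_aop_unitYD (A := Module.End k (k ⊗[k] M)) (eL k k M)
  rw [Kop, cmp, h2, h1, m2_triv_right, hT.epsR_eq, Str.map_one, one_mul]
  rfl

end UnitObject

section TwistedDual

variable {k H B ι : Type*} [Field k] [Ring H] [Algebra k H]
  {Q : QuasiHopfAlgebra k H} {T T' : H →ₗ[k] H} {F G : H ⊗[k] H}
  [AddCommGroup B] [Module k B] [Module.Finite k B] [Fintype ι]
  (hT : IsTwist Q T T' F G) (e : Module.Basis ι k B) (D : BraidedHopfData k H B)

attribute [local instance] Cm.symm

/-- The dual of a braided Hopf algebra with respect to a twisted anti-automorphism. -/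
noncomputable def twHopf : BraidedHopfData k H (Dual k B) where
  toYDData := twDual hT e D.toYDData
  mul := (Kop Q F (aop D.toYDData) D.toYDData ∘ₗ D.comul).dualMap ∘ₗ TensorProduct.dualDistrib k B B
  one := D.counit
  comul := (dd (LinearEquiv.refl k (Dual k B)) (LinearEquiv.refl k (Dual k B))).symm.toLinearMap ∘ₗ
    (D.mul ∘ₗ Kinv G (aop D.toYDData) D.toYDData).dualMap
  counit := Module.Dual.eval k B D.one
  antipode := D.antipode.dualMap

/-- The identification of `B* ⊗ B*` with the dual of `B ⊗ B`. -/
noncomputable abbrev ddd (k B : Type*) [Field k] [AddCommGroup B] [Module k B] [Module.Finite k B] :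
    Dual k B ⊗[k] Dual k B ≃ₗ[k] Dual k (B ⊗[k] B) :=
  dd (LinearEquiv.refl k (Dual k B)) (LinearEquiv.refl k (Dual k B))

theorem adj_twHopf_mul : Adj (ddd k B) (LinearEquiv.refl k _) (twHopf hT e D).mul
    (Kop Q F (aop D.toYDData) D.toYDData ∘ₗ D.comul) := fun w _ => by
  change TensorProduct.dualDistrib k B B w _ = _
  rw [← dd_refl]
  rfl

theorem adj_twHopf_comul : Adj (LinearEquiv.refl k _) (ddd k B) (twHopf hT e D).comul
    (D.mul ∘ₗ Kinv G (aop D.toYDData) D.toYDData) := fun φ z => by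
  simp [twHopf, ddd]

theorem adj_twHopf_antipode : Adj (LinearEquiv.refl k _) (LinearEquiv.refl k _)
    (twHopf hT e D).antipode D.antipode := fun _ _ => rfl

theorem adj_toSpanSingleton (ε : Dual k B) : Adj (LinearMap.ringLmapEquivSelf k k k).symm
    (LinearEquiv.refl k _) (LinearMap.toSpanSingleton k _ ε) ε := fun c m => by
  simp [mul_comm]

theorem adj_eval (b : B) : Adj (LinearEquiv.refl k _) (LinearMap.ringLmapEquivSelf k k k).symm
    (Module.Dual.eval k B b) (LinearMap.toSpanSingleton k B b) := fun φ c => by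
  simp

theorem adj_act (V : YDData k H B) (h : H) : Adj (LinearEquiv.refl k _) (LinearEquiv.refl k _)
    ((twDual hT e V).act h) ((aop V ∘ₗ T) h) := fun _ _ => rfl

theorem adj_tensAct_twDual (V : YDData k H B) (t : H ⊗[k] H) : Adj (ddd k B) (ddd k B)
    (tensAct (twDual hT e V).act (twDual hT e V).act t)
    (m2 (eL k B B ∘ₗ aop V ∘ₗ T) (eR B (aop V ∘ₗ T)) t) :=
  adj_tensAct (adj_act hT e V) (adj_act hT e V) t

theorem adj_tensAct_tensAct (V : YDData k H B) (t : H ⊗[k] (H ⊗[k] H)) :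
    Adj (dd (LinearEquiv.refl k _) (ddd k B)) (dd (LinearEquiv.refl k _) (ddd k B))
    (tensAct (twDual hT e V).act (tensAct (twDual hT e V).act (twDual hT e V).act) t)
    (m2 (eL k B _ ∘ₗ aop V ∘ₗ T) (eR B (m2 (eL k B B ∘ₗ aop V ∘ₗ T) (eR B (aop V ∘ₗ T)))) t) :=
  adj_tensAct (adj_act hT e V) (adj_tensAct_twDual hT e V) t

theorem adj_prodAct (V : YDData k H B) (h : H) : Adj (ddd k B) (ddd k B)
    (prodAct Q (twDual hT e V).act (twDual hT e V).act h)
    ((m2 (eR B (aop V)) (eL k B B ∘ₗ aop V) ∘ₗ flipMap T ∘ₗ Q.comul.toLinearMap) h) :=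
  (dualOf_prod hT e V e V).act h

theorem adj_tensAct_prodAct (V : YDData k H B) (t : H ⊗[k] (H ⊗[k] H)) :
    Adj (dd (LinearEquiv.refl k _) (dd (LinearEquiv.refl k _) (ddd k B)))
    (dd (LinearEquiv.refl k _) (dd (LinearEquiv.refl k _) (ddd k B)))
    (tensAct (twDual hT e V).act (tensAct (twDual hT e V).act
      (prodAct Q (twDual hT e V).act (twDual hT e V).act)) t)
    (m2 (eL k B _ ∘ₗ aop V ∘ₗ T) (eR B (m2 (eL k B _ ∘ₗ aop V ∘ₗ T)
      (eR B (m2 (eR B (aop V)) (eL k B B ∘ₗ aop V) ∘ₗ flipMap T ∘ₗ Q.comul.toLinearMap)))) t) :=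
  adj_tensAct (adj_act hT e V) (adj_tensAct (adj_act hT e V) (adj_prodAct hT e V)) t

theorem adj_assoc_symm {W₁ W₂ W₃ M₁ M₂ M₃ : Type*} [AddCommGroup W₁] [Module k W₁]
    [AddCommGroup W₂] [Module k W₂] [AddCommGroup W₃] [Module k W₃] [AddCommGroup M₁] [Module k M₁]
    [AddCommGroup M₂] [Module k M₂] [AddCommGroup M₃] [Module k M₃] [Module.Finite k M₁]
    [Module.Finite k M₂] [Module.Finite k M₃] (θ₁ : W₁ ≃ₗ[k] Dual k M₁) (θ₂ : W₂ ≃ₗ[k] Dual k M₂)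
    (θ₃ : W₃ ≃ₗ[k] Dual k M₃) : Adj (dd θ₁ (dd θ₂ θ₃)) (dd (dd θ₁ θ₂) θ₃)
    (TensorProduct.assoc k W₁ W₂ W₃).symm.toLinearMap
    (TensorProduct.assoc k M₁ M₂ M₃).toLinearMap :=
  adj_assoc.inv (LinearEquiv.symm_comp _)

theorem adj_assocMap (V : YDData k H B) : Adj (dd (ddd k B) (LinearEquiv.refl k _))
    (dd (LinearEquiv.refl k _) (ddd k B))
    (assocMap Q (twDual hT e V).act (twDual hT e V).act (twDual hT e V).act)
    ((TensorProduct.assoc k B B B).symm.toLinearMap ∘ₗ phiTr Q T V) :=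
  (adj_tensAct_tensAct hT e V Q.Phi).comp adj_assoc

theorem comm_kk (V : YDData k H B) :
    (TensorProduct.comm k B B).toLinearMap ∘ₗ kk V F G (eL k B B ∘ₗ aop V) (eR B LinearMap.id) =
      kk V F G (eR B (aop V)) (eL k B B) ∘ₗ (TensorProduct.comm k B B).toLinearMap := by
  have h1 : ∀ g, (TensorProduct.comm k B B).toLinearMap ∘ₗ eL k B B g =
      eR B LinearMap.id g ∘ₗ (TensorProduct.comm k B B).toLinearMap := fun g => by ext; simp
  have h2 : ∀ g, (TensorProduct.comm k B B).toLinearMap ∘ₗ eR B LinearMap.id g =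
      eL k B B g ∘ₗ (TensorProduct.comm k B B).toLinearMap := fun g => by ext; simp
  have h3 : ∀ t, (TensorProduct.comm k B B).toLinearMap ∘ₗ m2 (eL k B B ∘ₗ aop V)
      (eR B LinearMap.id ∘ₗ aop V) t = m2 (eR B LinearMap.id ∘ₗ aop V) (eL k B B ∘ₗ aop V) t ∘ₗ
        (TensorProduct.comm k B B).toLinearMap :=
    fun t => m2_nat (fun h => h1 (aop V h)) (fun h => h2 (aop V h)) t
  have h4 : ∀ t, (TensorProduct.comm k B B).toLinearMap ∘ₗ m2 (eR B LinearMap.id ∘ₗ aop V)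
      (eL k B B ∘ₗ aop V) t = m2 (eL k B B ∘ₗ aop V) (eR B LinearMap.id ∘ₗ aop V) t ∘ₗ
        (TensorProduct.comm k B B).toLinearMap :=
    fun t => m2_nat (fun h => h2 (aop V h)) (fun h => h1 (aop V h)) t
  have h5 : (TensorProduct.comm k B B).toLinearMap ∘ₗ rr V (eL k B B ∘ₗ aop V) (eR B LinearMap.id) =
      rr V (eR B LinearMap.id ∘ₗ aop V) (eL k B B) ∘ₗ (TensorProduct.comm k B B).toLinearMap :=
    m2_nat (fun h => h1 (aop V h)) h2 _
  rw [← eR_id_comp, kk, kk]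
  exact mul_nat (h3 F) (mul_nat h5 (h4 G))

theorem adj_braiding (V : YDData k H B) : Adj (ddd k B) (ddd k B)
    (braiding (twDual hT e V) (twDual hT e V))
    ((TensorProduct.comm k B B).toLinearMap ∘ₗ
      kk V F G (eL k B B ∘ₗ aop V) (eR B LinearMap.id)) := by
  rw [braiding_eq, comm_kk]
  refine Adj.comp adj_comm ?_
  rw [kk_eq, rr, lop_twDual]
  generalize kk V F G (sL k H _) (sR H LinearMap.id) = Y
  induction Y with
  | zero => intro w m; simp
  | add s t hs ht =>
    intro w m
    have hs := hs w m
    have ht := ht w m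
    simp only [LinearMap.map_add, LinearEquiv.map_add, LinearMap.add_apply] at hs ht ⊢
    rw [hs, ht]
  | tmul h g =>
    have h1 : m2 (eR B (aop V)) (eL k B B) (h ⊗ₜ g) = TensorProduct.map g (aop V h) := by
      ext; simp
    have h2 : m2 (eR (Dual k B) (aop (twDual hT e V))) (eL k (Dual k B) (Dual k B))
        (TensorProduct.map T' Module.Dual.transpose (h ⊗ₜ g)) =
        TensorProduct.map (Module.Dual.transpose g) ((twDual hT e V).act (T' h)) := by
      ext; simp
    rw [h1, h2]
    refine Adj.map (fun _ _ => rfl) ?_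
    have := adj_act hT e V (T' h)
    rwa [LinearMap.comp_apply, hT.right_inv] at this

end TwistedDual

open Module (Dual)

theorem assocMap_assocInv {k H M N U : Type*} [Field k] [Ring H] [Algebra k H] [AddCommGroup M]
    [Module k M] [AddCommGroup N] [Module k N] [AddCommGroup U] [Module k U]
    {Q : QuasiHopfAlgebra k H} {ρ : H →ₐ[k] Module.End k M}
    {τ : H →ₐ[k] Module.End k N} {υ : H →ₐ[k] Module.End k U} (z : M ⊗[k] (N ⊗[k] U)) :
    assocMap Q ρ τ υ (assocInv Q ρ τ υ z) = z := by
  simp only [assocMap, assocInv, LinearMap.comp_apply, LinearEquiv.coe_coe,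
    LinearEquiv.apply_symm_apply]
  rw [← Module.End.mul_apply, ← map_mul, Phi_mul_PhiInv, map_one]
  rfl

section ComparisonsOfB

variable {k H B ι : Type*} [Field k] [Ring H] [Algebra k H]
  {Q : QuasiHopfAlgebra k H} {T T' : H →ₗ[k] H} {F G : H ⊗[k] H}
  [AddCommGroup B] [Module k B] [Module.Finite k B] [Fintype ι]
  (hT : IsTwist Q T T' F G) (e : Module.Basis ι k B) {D : BraidedHopfData k H B}
  (hB : IsBraidedHopf Q D)

include hB

theorem IsBraidedHopf.opYD : OpYD Q D.toYDData := (isYD_iff _ _).1 hB.isYD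

theorem comul_aop (h : H) : D.comul ∘ₗ aop D.toYDData h =
    aop (prodYD Q D.toYDData D.toYDData) h ∘ₗ D.comul :=
  LinearMap.ext fun b => hB.comul_hom.map_act h b

theorem mul_aop (h : H) : D.mul ∘ₗ aop (prodYD Q D.toYDData D.toYDData) h =
    aop D.toYDData h ∘ₗ D.mul :=
  LinearMap.ext fun b => hB.mul_hom.map_act h b

include hT

theorem K_rTensor_comul :
    D.comul.rTensor B ∘ₗ Kop Q F (aop D.toYDData) D.toYDData =
      Kop Q F (aop (prodYD Q D.toYDData D.toYDData)) D.toYDData ∘ₗ D.comul.rTensor B :=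
  Kop_rTensor (comul_aop hB)

theorem K_lTensor_comul :
    D.comul.lTensor B ∘ₗ Kop Q F (aop D.toYDData) D.toYDData =
      Kop Q F (aop D.toYDData) (prodYD Q D.toYDData D.toYDData) ∘ₗ D.comul.lTensor B :=
  Kop_lTensor hB.opYD (prod_opYD hB.opYD hB.opYD) hB.comul_hom _

theorem K_rTensor_mul :
    D.mul.rTensor B ∘ₗ Kop Q F (aop (prodYD Q D.toYDData D.toYDData)) D.toYDData =
      Kop Q F (aop D.toYDData) D.toYDData ∘ₗ D.mul.rTensor B :=
  Kop_rTensor (mul_aop hB)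

theorem K_lTensor_mul :
    D.mul.lTensor B ∘ₗ Kop Q F (aop D.toYDData) (prodYD Q D.toYDData D.toYDData) =
      Kop Q F (aop D.toYDData) D.toYDData ∘ₗ D.mul.lTensor B :=
  Kop_lTensor (prod_opYD hB.opYD hB.opYD) hB.opYD hB.mul_hom _

theorem K_map_comul :
    TensorProduct.map D.comul D.comul ∘ₗ Kop Q F (aop D.toYDData) D.toYDData =
      Kop Q F (aop (prodYD Q D.toYDData D.toYDData)) (prodYD Q D.toYDData D.toYDData) ∘ₗ
        TensorProduct.map D.comul D.comul := by
  have h : TensorProduct.map D.comul D.comul = D.comul.lTensor _ ∘ₗ D.comul.rTensor B := by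
    ext; simp
  rw [h, LinearMap.comp_assoc, K_rTensor_comul hT hB, ← LinearMap.comp_assoc,
    Kop_lTensor hB.opYD (prod_opYD hB.opYD hB.opYD) hB.comul_hom _, LinearMap.comp_assoc]

theorem K_map_mul :
    TensorProduct.map D.mul D.mul ∘ₗ Kop Q F (aop (prodYD Q D.toYDData D.toYDData))
        (prodYD Q D.toYDData D.toYDData) =
      Kop Q F (aop D.toYDData) D.toYDData ∘ₗ TensorProduct.map D.mul D.mul := by
  have h : TensorProduct.map D.mul D.mul = D.mul.rTensor B ∘ₗ D.mul.lTensor _ := by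
    ext; simp
  rw [h, LinearMap.comp_assoc, Kop_lTensor (prod_opYD hB.opYD hB.opYD) hB.opYD hB.mul_hom _,
    ← LinearMap.comp_assoc, K_rTensor_mul hT hB, LinearMap.comp_assoc]

theorem K_counit_rTensor : D.counit.rTensor B ∘ₗ Kop Q F (aop D.toYDData) D.toYDData =
    D.counit.rTensor B := by
  rw [Kop_rTensor (a' := aop (unitYD Q)) fun h => LinearMap.ext fun b => hB.counit_hom.map_act h b,
    Kop_aop_unitYD hT hB.opYD, LinearMap.id_comp]

theorem K_counit_lTensor : D.counit.lTensor B ∘ₗ Kop Q F (aop D.toYDData) D.toYDData =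
    D.counit.lTensor B := by
  rw [Kop_lTensor hB.opYD opYD_unitYD hB.counit_hom, Kop_unitYD hT, LinearMap.id_comp]

theorem K_one_left (b : B) : Kop Q F (aop D.toYDData) D.toYDData (D.one ⊗ₜ b) = D.one ⊗ₜ b := by
  have h := Kop_rTensor (F := F) (Q := Q) (D := D.toYDData) (a := aop (unitYD Q))
    (a' := aop D.toYDData) (f := LinearMap.toSpanSingleton k B D.one)
    fun h => LinearMap.ext fun b => hB.one_hom.map_act h b
  rw [Kop_aop_unitYD hT hB.opYD, LinearMap.comp_id] at h
  simpa using (LinearMap.congr_fun h (1 ⊗ₜ b)).symm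

theorem K_one_right (b : B) : Kop Q F (aop D.toYDData) D.toYDData (b ⊗ₜ D.one) = b ⊗ₜ D.one := by
  have h := Kop_lTensor (F := F) opYD_unitYD hB.opYD hB.one_hom (aop D.toYDData)
  rw [Kop_unitYD hT, LinearMap.comp_id] at h
  simpa using (LinearMap.congr_fun h (b ⊗ₜ 1)).symm

theorem K_rTensor_antipode : D.antipode.rTensor B ∘ₗ Kop Q F (aop D.toYDData) D.toYDData =
    Kop Q F (aop D.toYDData) D.toYDData ∘ₗ D.antipode.rTensor B :=
  Kop_rTensor fun h => LinearMap.ext fun b => hB.antipode_hom.map_act h b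

theorem K_lTensor_antipode : D.antipode.lTensor B ∘ₗ Kop Q F (aop D.toYDData) D.toYDData =
    Kop Q F (aop D.toYDData) D.toYDData ∘ₗ D.antipode.lTensor B :=
  Kop_lTensor hB.opYD hB.opYD hB.antipode_hom _

theorem K_Kinv (z : B ⊗[k] B) :
    Kop Q F (aop D.toYDData) D.toYDData (Kinv G (aop D.toYDData) D.toYDData z) = z :=
  LinearMap.congr_fun (inv2_K hT hB.opYD (aop D.toYDData)).mul z

theorem Kinv_K (z : B ⊗[k] B) :
    Kinv G (aop D.toYDData) D.toYDData (Kop Q F (aop D.toYDData) D.toYDData z) = z :=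
  LinearMap.congr_fun (inv2_K hT hB.opYD (aop D.toYDData)).mul' z

theorem comul_comparison_assoc :
    (Kop Q F (aop D.toYDData) D.toYDData ∘ₗ D.comul).rTensor B ∘ₗ
      (Kop Q F (aop D.toYDData) D.toYDData ∘ₗ D.comul) =
    ((TensorProduct.assoc k B B B).symm.toLinearMap ∘ₗ phiTr Q T D.toYDData) ∘ₗ
      ((Kop Q F (aop D.toYDData) D.toYDData ∘ₗ D.comul).lTensor B ∘ₗ
      (Kop Q F (aop D.toYDData) D.toYDData ∘ₗ D.comul)) := by
  have h1 : (Kop Q F (aop D.toYDData) D.toYDData ∘ₗ D.comul).rTensor B ∘ₗ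
      (Kop Q F (aop D.toYDData) D.toYDData ∘ₗ D.comul) =
      ((Kop Q F (aop D.toYDData) D.toYDData).rTensor B ∘ₗ
        Kop Q F (aop (prodYD Q D.toYDData D.toYDData)) D.toYDData) ∘ₗ
          D.comul.rTensor B ∘ₗ D.comul := by
    rw [LinearMap.rTensor_comp, LinearMap.comp_assoc, ← LinearMap.comp_assoc D.comul,
      K_rTensor_comul hT hB]
    rfl
  have h2 : (Kop Q F (aop D.toYDData) D.toYDData ∘ₗ D.comul).lTensor B ∘ₗ
      (Kop Q F (aop D.toYDData) D.toYDData ∘ₗ D.comul) =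
      ((Kop Q F (aop D.toYDData) D.toYDData).lTensor B ∘ₗ
        Kop Q F (aop D.toYDData) (prodYD Q D.toYDData D.toYDData)) ∘ₗ
          D.comul.lTensor B ∘ₗ D.comul := by
    rw [LinearMap.lTensor_comp, LinearMap.comp_assoc, ← LinearMap.comp_assoc D.comul,
      K_lTensor_comul hT hB]
    rfl
  rw [h1, h2, ← hB.coassoc]
  have h3 := K_assoc (T := T) hT hB.opYD
  refine LinearMap.ext fun b => (TensorProduct.assoc k B B B).injective ?_
  have h4 := LinearMap.congr_fun h3 (D.comul.rTensor B (D.comul b))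
  simp only [LinearMap.comp_apply, LinearEquiv.coe_coe, LinearEquiv.apply_symm_apply] at h4 ⊢
  exact h4

theorem mul_comparison_assoc :
    ((D.mul ∘ₗ Kinv G (aop D.toYDData) D.toYDData) ∘ₗ
      (D.mul ∘ₗ Kinv G (aop D.toYDData) D.toYDData).rTensor B) ∘ₗ
      ((TensorProduct.assoc k B B B).symm.toLinearMap ∘ₗ phiTr Q T D.toYDData) =
    (D.mul ∘ₗ Kinv G (aop D.toYDData) D.toYDData) ∘ₗ
      (D.mul ∘ₗ Kinv G (aop D.toYDData) D.toYDData).lTensor B := by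
  have hDD := prod_opYD hB.opYD hB.opYD
  set V := D.toYDData
  have iK := inv2_K hT hB.opYD (aop V)
  have iK3 := inv2_K hT hB.opYD (aop (prodYD Q V V))
  have iK4 := inv2_K hT hDD (aop V)
  have m3 := inv_nat (K_rTensor_mul hT hB) iK3 iK
  have m4 := inv_nat (K_lTensor_mul hT hB) iK4 iK
  have r1 : (Kinv G (aop V) V).rTensor B ∘ₗ (Kop Q F (aop V) V).rTensor B = LinearMap.id := by
    rw [← LinearMap.rTensor_comp]
    exact (congrArg (LinearMap.rTensor B) iK.mul').trans (LinearMap.rTensor_id _ _)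
  have r2 : (Kop Q F (aop V) V).lTensor B ∘ₗ (Kinv G (aop V) V).lTensor B = LinearMap.id := by
    rw [← LinearMap.lTensor_comp]
    exact (congrArg (LinearMap.lTensor B) iK.mul).trans (LinearMap.lTensor_id _ _)
  have hs : Function.Surjective (fun z => (Kop Q F (aop V) V).lTensor B
      (Kop Q F (aop V) (prodYD Q V V) (assocMap Q V.act V.act V.act z))) := fun z => by
    refine ⟨assocInv Q V.act V.act V.act (Kinv G (aop V) (prodYD Q V V)
      ((Kinv G (aop V) V).lTensor B z)), ?_⟩
    have r3 := LinearMap.congr_fun iK4.mul ((Kinv G (aop V) V).lTensor B z)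
    simp only [Module.End.mul_apply, Module.End.one_apply] at r3
    simp only [assocMap_assocInv, r3]
    exact LinearMap.congr_fun r2 z
  refine LinearMap.ext fun z => ?_
  obtain ⟨z, rfl⟩ := hs z
  have h3 := LinearMap.congr_fun (K_assoc (T := T) hT hB.opYD) z
  have a1 := LinearMap.congr_fun hB.mul_assoc z
  have r1' := LinearMap.congr_fun r1
  have r3' := LinearMap.congr_fun iK3.mul'
  have r4' := LinearMap.congr_fun iK4.mul'
  have r5 : ∀ y, (Kinv G (aop V) V).lTensor B ((Kop Q F (aop V) V).lTensor B y) = y := fun y => by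
    rw [← LinearMap.comp_apply, ← LinearMap.lTensor_comp]
    exact LinearMap.congr_fun ((congrArg (LinearMap.lTensor B) iK.mul').trans
      (LinearMap.lTensor_id _ _)) y
  have m3' := LinearMap.congr_fun m3
  have m4' := LinearMap.congr_fun m4
  simp only [LinearMap.comp_apply, Module.End.mul_apply, Module.End.one_apply, LinearMap.id_apply,
    LinearEquiv.coe_coe, LinearMap.rTensor_comp, LinearMap.lTensor_comp]
    at h3 a1 r1' r3' r4' m3' m4' ⊢
  rw [← h3, LinearEquiv.symm_apply_apply, r1', r5, ← m3', r3', ← m4', r4', a1]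

end ComparisonsOfB

open Module (Dual)

section TwistedDualHopf

variable {k H B ι : Type*} [Field k] [Ring H] [Algebra k H]
  {Q : QuasiHopfAlgebra k H} {T T' : H →ₗ[k] H} {F G : H ⊗[k] H}
  [AddCommGroup B] [Module k B] [Module.Finite k B] [Fintype ι]
  (hT : IsTwist Q T T' F G) (e : Module.Basis ι k B) {D : BraidedHopfData k H B}
  (hB : IsBraidedHopf Q D)

theorem Kinv_comp_K (hT : IsTwist Q T T' F G) (hB : IsBraidedHopf Q D) :
    Kinv G (aop D.toYDData) D.toYDData ∘ₗ Kop Q F (aop D.toYDData) D.toYDData = LinearMap.id := by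
  apply LinearMap.ext
  intro z
  rw [LinearMap.comp_apply, Kinv_K hT hB, LinearMap.id_apply]

theorem comul_mul_comparison (hT : IsTwist Q T T' F G) (hB : IsBraidedHopf Q D) :
    (Kop Q F (aop D.toYDData) D.toYDData ∘ₗ D.comul) ∘ₗ
      (D.mul ∘ₗ Kinv G (aop D.toYDData) D.toYDData) =
    (TensorProduct.map (D.mul ∘ₗ Kinv G (aop D.toYDData) D.toYDData)
      (D.mul ∘ₗ Kinv G (aop D.toYDData) D.toYDData) ∘ₗ exTr Q T D.toYDData F G) ∘ₗ
      TensorProduct.map (Kop Q F (aop D.toYDData) D.toYDData ∘ₗ D.comul)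
        (Kop Q F (aop D.toYDData) D.toYDData ∘ₗ D.comul) := by
  have h1 := fun z => LinearMap.congr_fun (K_exchange hT hB.opYD) z
  have h2 := fun z => LinearMap.congr_fun (K_map_comul hT hB) z
  have h3 := fun z => LinearMap.congr_fun (K_map_mul hT hB) z
  have h4 : ∀ z, D.comul (D.mul z) = TensorProduct.map D.mul D.mul
      (exOp Q D.toYDData (TensorProduct.map D.comul D.comul z)) :=
    fun z => LinearMap.congr_fun hB.comul_mul z
  have h5 : ∀ z, TensorProduct.map (Kinv G (aop D.toYDData) D.toYDData)
      (Kinv G (aop D.toYDData) D.toYDData) (TensorProduct.map (Kop Q F (aop D.toYDData) D.toYDData)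
      (Kop Q F (aop D.toYDData) D.toYDData) z) = z := fun z => by
    rw [← LinearMap.comp_apply, ← TensorProduct.map_comp]
    rw [Kinv_comp_K hT hB, TensorProduct.map_id, LinearMap.id_apply]
  refine LinearMap.ext fun z => ?_
  obtain ⟨z, rfl⟩ : ∃ y, Kop Q F (aop D.toYDData) D.toYDData y = z :=
    ⟨Kinv G (aop D.toYDData) D.toYDData z, K_Kinv hT hB z⟩
  simp only [LinearMap.comp_apply, TensorProduct.map_comp] at h1 h2 h3 ⊢
  rw [Kinv_K hT hB, h2, h1, h5, h3, h4]

theorem adj_exOp (V : YDData k H B) :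
    Adj (dd (ddd k B) (ddd k B)) (dd (ddd k B) (ddd k B)) (exOp Q (twDual hT e V))
      (exTr Q T V F G) := by
  have hi : ∀ t, Adj (dd (LinearEquiv.refl k _) (ddd k B)) (dd (ddd k B) (LinearEquiv.refl k _))
      ((TensorProduct.assoc k _ _ _).symm.toLinearMap ∘ₗ
        tensAct (twDual hT e V).act (tensAct (twDual hT e V).act (twDual hT e V).act) t)
      (m2 (eL k B _ ∘ₗ aop V ∘ₗ T) (eR B (m2 (eL k B B ∘ₗ aop V ∘ₗ T) (eR B (aop V ∘ₗ T)))) t ∘ₗ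
        (TensorProduct.assoc k B B B).toLinearMap) := fun t =>
    (adj_assoc_symm _ _ _).comp (adj_tensAct_tensAct hT e V t)
  have ho := (adj_assoc_symm (LinearEquiv.refl k (Dual k B)) (LinearEquiv.refl k (Dual k B))
    (ddd k B)).comp (adj_tensAct_prodAct hT e V Q.PhiInv)
  have ho' := (adj_tensAct_prodAct hT e V Q.Phi).comp (adj_assoc (θ₁ := LinearEquiv.refl k (Dual k B))
    (θ₂ := LinearEquiv.refl k (Dual k B)) (θ₃ := ddd k B))
  have h1 := ho.comp (Adj.lTensor (θ₁ := LinearEquiv.refl k (Dual k B)) (adj_assocMap hT e V))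
  have h2 := h1.comp (Adj.lTensor (θ₁ := LinearEquiv.refl k (Dual k B))
    (Adj.rTensor (θ₁ := LinearEquiv.refl k (Dual k B)) (adj_braiding hT e V)))
  have h3 := h2.comp (Adj.lTensor (θ₁ := LinearEquiv.refl k (Dual k B)) (hi Q.PhiInv))
  have h4 := h3.comp ho'
  exact h4

theorem dualDistrib_left (a b : Dual k B) (z : B ⊗[k] B) :
    TensorProduct.dualDistrib k B B (a ⊗ₜ b) z = b (TensorProduct.lid k B (a.rTensor B z)) := by
  induction z with
  | zero => simp only [LinearMap.map_zero, LinearEquiv.map_zero, LinearMap.zero_apply, mul_zero, zero_mul,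
        TensorProduct.zero_tmul, TensorProduct.tmul_zero]
  | add s t hs ht => simp only [LinearMap.map_add, LinearEquiv.map_add, hs, ht]
  | tmul x y => simp

theorem dualDistrib_right (a b : Dual k B) (z : B ⊗[k] B) :
    TensorProduct.dualDistrib k B B (a ⊗ₜ b) z = a (TensorProduct.rid k B (b.lTensor B z)) := by
  induction z with
  | zero => simp only [LinearMap.map_zero, LinearEquiv.map_zero, LinearMap.zero_apply, mul_zero, zero_mul,
        TensorProduct.zero_tmul, TensorProduct.tmul_zero]
  | add s t hs ht => simp only [LinearMap.map_add, LinearEquiv.map_add, hs, ht]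
  | tmul x y => simp [mul_comm]

theorem ddd_apply (w : Dual k B ⊗[k] Dual k B) : ddd k B w = TensorProduct.dualDistrib k B B w := by
  rw [← dd_refl]
  rfl

theorem lid_eval_rTensor (w : Dual k B ⊗[k] Dual k B) (x y : B) :
    TensorProduct.lid k _ ((Module.Dual.eval k B x).rTensor _ w) y = ddd k B w (x ⊗ₜ y) := by
  induction w with
  | zero => simp only [LinearMap.map_zero, LinearEquiv.map_zero, LinearMap.zero_apply, mul_zero, zero_mul,
        TensorProduct.zero_tmul, TensorProduct.tmul_zero]
  | add s t hs ht => simp only [LinearMap.map_add, LinearEquiv.map_add, LinearMap.add_apply, hs, ht]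
  | tmul x y => simp

theorem rid_eval_lTensor (w : Dual k B ⊗[k] Dual k B) (x y : B) :
    TensorProduct.rid k _ ((Module.Dual.eval k B y).lTensor _ w) x = ddd k B w (x ⊗ₜ y) := by
  induction w with
  | zero => simp only [LinearMap.map_zero, LinearEquiv.map_zero, LinearMap.zero_apply, mul_zero, zero_mul,
        TensorProduct.zero_tmul, TensorProduct.tmul_zero]
  | add s t hs ht => simp only [LinearMap.map_add, LinearEquiv.map_add, LinearMap.add_apply, hs, ht]
  | tmul x y => simp [mul_comm]

theorem twHopf_mul_hom (hB : IsBraidedHopf Q D) :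
    IsYDHom (prodYD Q (twHopf hT e D).toYDData (twHopf hT e D).toYDData) (twHopf hT e D).toYDData
      (twHopf hT e D).mul := by
  have h1 := dualOf_prod hT e D.toYDData e D.toYDData
  have h2 := dualOf_twDual hT e D.toYDData
  refine DualOf.hom (V := prodYD Q (twDual hT e D.toYDData) (twDual hT e D.toYDData))
    (V' := twDual hT e D.toYDData) h1 h2 (adj_twHopf_mul hT e D) (fun x => ?_) fun m => ?_
  · rw [LinearMap.comp_apply, LinearMap.comp_assoc, comul_aop hB, ← LinearMap.comp_assoc,
      K_flip hT hB.opYD, LinearMap.comp_assoc]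
  · rw [LinearMap.lTensor_comp, LinearMap.comp_apply, hB.comul_hom.evAt_kk, LinearMap.comp_apply,
      evAt_kk2_K hT hB.opYD hB.opYD]

theorem twHopf_comul_hom (hB : IsBraidedHopf Q D) :
    IsYDHom (twHopf hT e D).toYDData (prodYD Q (twHopf hT e D).toYDData (twHopf hT e D).toYDData)
      (twHopf hT e D).comul := by
  have h1 := dualOf_prod hT e D.toYDData e D.toYDData
  have h2 := dualOf_twDual hT e D.toYDData
  refine DualOf.hom (V' := prodYD Q (twDual hT e D.toYDData) (twDual hT e D.toYDData))
    (V := twDual hT e D.toYDData) h2 h1 (adj_twHopf_comul hT e D) (fun x => ?_) fun m => ?_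
  · refine LinearMap.ext fun z => ?_
    obtain ⟨z, rfl⟩ : ∃ y, Kop Q F (aop D.toYDData) D.toYDData y = z :=
    ⟨Kinv G (aop D.toYDData) D.toYDData z, K_Kinv hT hB z⟩
    have h1 := LinearMap.congr_fun (K_flip (M := B) (D := D.toYDData) hT hB.opYD x) z
    have h2 := LinearMap.congr_fun (mul_aop hB (T x)) z
    simp only [LinearMap.comp_apply] at h1 h2 ⊢
    rw [← h1, Kinv_K hT hB, Kinv_K hT hB, h2]
  · obtain ⟨z, rfl⟩ : ∃ y, Kop Q F (aop D.toYDData) D.toYDData y = m :=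
    ⟨Kinv G (aop D.toYDData) D.toYDData m, K_Kinv hT hB m⟩
    have h3 : ∀ y, (Kinv G (aop D.toYDData) D.toYDData).lTensor H
        ((Kop Q F (aop D.toYDData) D.toYDData).lTensor H y) = y := fun y => by
      rw [← LinearMap.comp_apply, ← LinearMap.lTensor_comp, Kinv_comp_K hT hB, LinearMap.lTensor_id,
        LinearMap.id_apply]
    rw [evAt_kk2_K hT hB.opYD hB.opYD, LinearMap.lTensor_comp, LinearMap.comp_apply, h3,
      LinearMap.comp_apply, Kinv_K hT hB]
    exact hB.mul_hom.evAt_kk z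

theorem aop_unitYD_T (hT : IsTwist Q T T' F G) (h : H) :
    aop (unitYD Q) (T h) = aop (unitYD Q) h := by
  ext; simp [unitYD, hT.counit_T]

theorem twHopf_mul_assoc (hB : IsBraidedHopf Q D) :
    (twHopf hT e D).mul ∘ₗ (twHopf hT e D).mul.rTensor _ =
      (twHopf hT e D).mul ∘ₗ (twHopf hT e D).mul.lTensor _ ∘ₗ
        assocMap Q (twDual hT e D.toYDData).act (twDual hT e D.toYDData).act
          (twDual hT e D.toYDData).act := by
  have h1 := (adj_twHopf_mul hT e D).comp
    (Adj.rTensor (θ₁ := LinearEquiv.refl k _) (adj_twHopf_mul hT e D))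
  have h2 := ((adj_twHopf_mul hT e D).comp
    (Adj.lTensor (θ₁ := LinearEquiv.refl k _) (adj_twHopf_mul hT e D))).comp
      (adj_assocMap hT e D.toYDData)
  exact h1.unique h2 (comul_comparison_assoc hT hB)

theorem twHopf_coassoc (hB : IsBraidedHopf Q D) :
    assocMap Q (twDual hT e D.toYDData).act (twDual hT e D.toYDData).act
      (twDual hT e D.toYDData).act ∘ₗ (twHopf hT e D).comul.rTensor _ ∘ₗ (twHopf hT e D).comul =
      (twHopf hT e D).comul.lTensor _ ∘ₗ (twHopf hT e D).comul := by
  have h1 := (adj_assocMap hT e D.toYDData).comp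
    ((Adj.rTensor (θ₁ := LinearEquiv.refl k _) (adj_twHopf_comul hT e D)).comp
      (adj_twHopf_comul hT e D))
  have h2 := (Adj.lTensor (θ₁ := LinearEquiv.refl k _) (adj_twHopf_comul hT e D)).comp
    (adj_twHopf_comul hT e D)
  exact h1.unique h2 (mul_comparison_assoc hT hB)

theorem twHopf_comul_mul (hB : IsBraidedHopf Q D) :
    (twHopf hT e D).comul ∘ₗ (twHopf hT e D).mul =
      (TensorProduct.map (twHopf hT e D).mul (twHopf hT e D).mul ∘ₗ
        exOp Q (twDual hT e D.toYDData)) ∘ₗ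
        TensorProduct.map (twHopf hT e D).comul (twHopf hT e D).comul := by
  have h1 := (adj_twHopf_comul hT e D).comp (adj_twHopf_mul hT e D)
  have h2 := (((adj_twHopf_mul hT e D).map (adj_twHopf_mul hT e D)).comp
    (adj_exOp hT e D.toYDData)).comp ((adj_twHopf_comul hT e D).map (adj_twHopf_comul hT e D))
  exact h1.unique h2 ((comul_mul_comparison hT hB).trans (by simp only [LinearMap.comp_assoc]))

theorem twHopf_isBraidedHopf (hB : IsBraidedHopf Q D) : IsBraidedHopf Q (twHopf hT e D) where
  isYD := (isYD_iff _ _).2 (twDual_opYD e hT hB.opYD)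
  mul_hom := twHopf_mul_hom hT e hB
  mul_assoc := twHopf_mul_assoc hT e hB
  one_hom := by
    refine (dualOf_unit hT).hom (dualOf_twDual hT e D.toYDData) (adj_toSpanSingleton _)
      (fun x => ?_) fun m => ?_
    · rw [← aop_unitYD_T hT]
      exact LinearMap.ext fun b => hB.counit_hom.map_act (T x) b
    · refine (hB.counit_hom.evAt_kk m).trans ?_
      rw [kk_unitYD hT]
      rfl
  one_mul φ := by
    refine LinearMap.ext fun m => ?_
    change TensorProduct.dualDistrib k B B (D.counit ⊗ₜ φ)
      (Kop Q F (aop D.toYDData) D.toYDData (D.comul m)) = φ m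
    have h := LinearMap.congr_fun (K_counit_rTensor hT hB) (D.comul m)
    rw [LinearMap.comp_apply] at h
    rw [dualDistrib_left, h, hB.counit_comul]
  mul_one φ := by
    refine LinearMap.ext fun m => ?_
    change TensorProduct.dualDistrib k B B (φ ⊗ₜ D.counit)
      (Kop Q F (aop D.toYDData) D.toYDData (D.comul m)) = φ m
    have h := LinearMap.congr_fun (K_counit_lTensor hT hB) (D.comul m)
    rw [LinearMap.comp_apply] at h
    rw [dualDistrib_right, h, hB.comul_counit]
  comul_hom := twHopf_comul_hom hT e hB
  coassoc := twHopf_coassoc hT e hB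
  counit_hom := by
    refine (dualOf_twDual hT e D.toYDData).hom (dualOf_unit hT) (adj_eval _) (fun x => ?_) fun m => ?_
    · rw [← aop_unitYD_T hT]
      exact LinearMap.ext fun b => hB.one_hom.map_act (T x) b
    · rw [← hB.one_hom.evAt_kk (F := F) (G := G), kk_unitYD hT]
  counit_comul φ := by
    refine LinearMap.ext fun m => ?_
    refine (lid_eval_rTensor _ _ _).trans ((adj_twHopf_comul hT e D φ _).trans ?_)
    have h := Kinv_K hT hB (D.one ⊗ₜ m)
    rw [K_one_left hT hB] at h
    rw [LinearMap.comp_apply, h, hB.one_mul]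
    rfl
  comul_counit φ := by
    refine LinearMap.ext fun m => ?_
    refine (rid_eval_lTensor _ _ _).trans ((adj_twHopf_comul hT e D φ _).trans ?_)
    have h := Kinv_K hT hB (m ⊗ₜ D.one)
    rw [K_one_right hT hB] at h
    rw [LinearMap.comp_apply, h, hB.mul_one]
    rfl
  comul_mul := twHopf_comul_mul hT e hB
  comul_one := by
    refine (ddd k B).injective (LinearMap.ext fun z => ?_)
    refine (adj_twHopf_comul hT e D _ _).trans ?_
    obtain ⟨z, rfl⟩ : ∃ y, Kop Q F (aop D.toYDData) D.toYDData y = z :=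
    ⟨Kinv G (aop D.toYDData) D.toYDData z, K_Kinv hT hB z⟩
    have h := LinearMap.congr_fun (K_counit_rTensor hT hB) z
    rw [LinearMap.comp_apply] at h
    rw [LinearMap.comp_apply, Kinv_K hT hB, ddd_apply, dualDistrib_left]
    change D.counit (D.mul z) = _
    refine Eq.trans ?_ (congrArg (fun t => D.counit (TensorProduct.lid k B t)) h).symm
    clear h
    induction z with
    | zero => simp only [LinearMap.map_zero, LinearEquiv.map_zero, LinearMap.zero_apply, mul_zero, zero_mul,
          TensorProduct.zero_tmul, TensorProduct.tmul_zero]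
    | add s t hs ht => simp only [LinearMap.map_add, LinearEquiv.map_add, hs, ht]
    | tmul x y => simp [hB.counit_mul]
  counit_mul a b := by
    change TensorProduct.dualDistrib k B B (a ⊗ₜ b)
      (Kop Q F (aop D.toYDData) D.toYDData (D.comul D.one)) = a D.one * b D.one
    rw [hB.comul_one, K_one_left hT hB]
    rfl
  counit_one := hB.counit_one
  antipode_hom := (dualOf_twDual hT e D.toYDData).hom (dualOf_twDual hT e D.toYDData)
    (adj_twHopf_antipode hT e D)
    (fun x => LinearMap.ext fun b => hB.antipode_hom.map_act (T x) b)
    fun m => hB.antipode_hom.evAt_kk m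
  antipode_left φ := by
    refine LinearMap.ext fun m => ?_
    have h := ((adj_twHopf_mul hT e D).comp ((adj_twHopf_antipode hT e D).rTensor.comp
      (adj_twHopf_comul hT e D))) φ m
    refine h.trans ?_
    have h1 := LinearMap.congr_fun (K_rTensor_antipode hT hB) (D.comul m)
    simp only [LinearMap.comp_apply] at h1 ⊢
    rw [h1, Kinv_K hT hB, hB.antipode_left]
    simp [twHopf, mul_comm]
  antipode_right φ := by
    refine LinearMap.ext fun m => ?_
    have h := ((adj_twHopf_mul hT e D).comp ((adj_twHopf_antipode hT e D).lTensor.comp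
      (adj_twHopf_comul hT e D))) φ m
    refine h.trans ?_
    have h1 := LinearMap.congr_fun (K_lTensor_antipode hT hB) (D.comul m)
    simp only [LinearMap.comp_apply] at h1 ⊢
    rw [h1, Kinv_K hT hB, hB.antipode_right]
    simp [twHopf, mul_comm]

end TwistedDualHopf

open Module (Dual)

section Transposes

variable {k H B ι : Type*} [Field k] [Ring H] [Algebra k H]
  {Q : QuasiHopfAlgebra k H} {T T' : H →ₗ[k] H} {F G : H ⊗[k] H}
  [AddCommGroup B] [Module k B] [Module.Finite k B] [Fintype ι]
  (hT : IsTwist Q T T' F G) (e : Module.Basis ι k B) {D : BraidedHopfData k H B}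

attribute [local instance] Cm.symm

variable (F) in
/-- The map `m ⊗ n ↦ F² · n ⊗ F¹ · m`. -/
noncomputable def flipAct (D : YDData k H B) : Module.End k (B ⊗[k] B) :=
  (TensorProduct.comm k B B).toLinearMap ∘ₗ m2 (eL k B B ∘ₗ aop D) (eR B (aop D)) F

theorem kk_mul_Kop (hT : IsTwist Q T T' F G) {V : YDData k H B} (hV : OpYD Q V) :
    kk V F G (eL k B B ∘ₗ aop V) (eR B LinearMap.id) * Kop Q F (aop V) V =
      m2 (eL k B B ∘ₗ aop V) (eR B (aop V)) F := by
  have i := inv2_ri (eL k B B ∘ₗ aop V) (eR B LinearMap.id) hV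
  rw [kk, Kop, cmp, eR_id_comp]
  calc _ = m2 (eL k B B ∘ₗ aop V) (eR B (aop V)) F * (rr V (eL k B B ∘ₗ aop V) (eR B LinearMap.id) *
        ((m2 (eR B (aop V)) (eL k B B ∘ₗ aop V) G * m2 (eR B (aop V)) (eL k B B ∘ₗ aop V) F) *
          ri Q V (eL k B B ∘ₗ aop V) (eR B LinearMap.id))) := by simp only [mul_assoc]
    _ = _ := by rw [hT.G_mul_F, one_mul, i.mul, mul_one]

theorem dualComul_eq : (ddd k B).toLinearMap ∘ₗ dualComul D e G =
    (D.mul ∘ₗ Kinv G (aop D.toYDData) D.toYDData).dualMap := by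
  refine LinearMap.ext fun φ => (e.tensorProduct e).ext fun ⟨i, j⟩ => ?_
  have h1 : Kinv G (aop D.toYDData) D.toYDData (e i ⊗ₜ e j) =
      (D.act.toLinearMap.flip (e i)).rTensor B (D.twistCoact G (e j)) := by
    rw [Kinv, cmpi]
    induction G with
    | zero => simp only [LinearMap.map_zero, LinearMap.zero_apply, mul_zero, zero_mul,
          TensorProduct.zero_tmul, TensorProduct.tmul_zero]
    | add s t hs ht => simp only [LinearMap.map_add, mul_add, LinearMap.add_apply, hs, ht]
    | tmul a b =>
      have : m2 (eR B LinearMap.id ∘ₗ aop D.toYDData) (eL k B B ∘ₗ aop D.toYDData) (a ⊗ₜ[k] b)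
          (e i ⊗ₜ e j) = D.act b (e i) ⊗ₜ D.act a (e j) := by simp
      rw [Module.End.mul_apply, this, rr_eL_eR_apply]
      simp only [YDData.twistCoact, sw2_tmul, LinearMap.comp_apply]
      generalize D.coact (D.act a (e j)) = s
      induction s with
      | zero => simp only [LinearMap.map_zero, LinearMap.zero_apply, mul_zero, zero_mul,
            TensorProduct.zero_tmul, TensorProduct.tmul_zero]
      | add s t hs ht => simp only [LinearMap.map_add, hs, ht]
      | tmul x y => simp
  rw [Module.Basis.tensorProduct_apply, LinearMap.dualMap_apply, LinearMap.comp_apply D.mul, h1,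
    LinearMap.comp_apply, LinearEquiv.coe_coe, dualComul]
  simp only [LinearMap.sum_apply, LinearMap.smulRight_apply, map_sum, map_smul,
    LinearMap.smul_apply]
  rw [Finset.sum_eq_single i, Finset.sum_eq_single j]
  · simp [ddd]
  · intro b _ hb
    simp [ddd, Finsupp.single_apply, hb, hb.symm]
  · simp
  · intro b _ hb
    simp [ddd, Finsupp.single_apply, hb, hb.symm]
  · simp

theorem twHopf_comul : (twHopf hT e D).comul = dualComul D e G := by
  refine LinearMap.ext fun φ => (ddd k B).injective ?_
  have := LinearMap.congr_fun (dualComul_eq e (D := D) (G := G)) φ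
  refine Eq.trans ?_ this.symm
  simp [twHopf, ddd]

theorem twHopf_transposes (hD : OpYD Q D.toYDData) :
    ∃ c : Dual k B ⊗[k] Dual k B ≃ₗ[k] Dual k B ⊗[k] Dual k B,
    ∃ σ : Dual k B ⊗[k] Dual k B ≃ₗ[k] Dual k (B ⊗[k] B),
      c.toLinearMap = braiding (twDual hT e D.toYDData) (twDual hT e D.toYDData) ∧
      σ.toLinearMap = ((flipAct F D.toYDData).dualMap ∘ₗ (ddd k B).toLinearMap) ∘ₗ
        c.symm.toLinearMap ∧
      (twHopf hT e D).mul = D.comul.dualMap ∘ₗ σ.toLinearMap ∧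
      (twHopf hT e D).comul = σ.symm.toLinearMap ∘ₗ D.mul.dualMap := by
  set V := D.toYDData with hV
  have iK := inv2_K hT hD (aop V)
  set κ : B ⊗[k] B ≃ₗ[k] B ⊗[k] B := LinearEquiv.ofLinearMap (Kop Q F (aop V) V) (Kinv G (aop V) V)
    iK.mul iK.mul' with hκ
  set r := kk V F G (eL k B B ∘ₗ aop V) (eR B LinearMap.id) with hr
  set s := Kop Q F (aop V) V * m2 (eL k B B ∘ₗ aop V) (eR B (aop V)) G with hs
  have rs : r * s = 1 := by
    rw [hr, hs, ← mul_assoc, kk_mul_Kop hT hD, hT.F_mul_G]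
  have sr : s * r = 1 := mul_eq_one_symm rs
  set γ : B ⊗[k] B ≃ₗ[k] B ⊗[k] B := (LinearEquiv.ofLinearMap r s rs sr) ≪≫ₗ TensorProduct.comm k B B
    with hγ
  have hc : ((ddd k B) ≪≫ₗ γ.dualMap ≪≫ₗ (ddd k B).symm).toLinearMap =
      braiding (twDual hT e V) (twDual hT e V) := by
    refine Adj.unique (θ := ddd k B) (θ' := ddd k B) (g := γ.toLinearMap) (fun w z => ?_)
      (adj_braiding hT e V) rfl
    simp
  refine ⟨(ddd k B) ≪≫ₗ γ.dualMap ≪≫ₗ (ddd k B).symm, (ddd k B) ≪≫ₗ κ.dualMap, hc, ?_, ?_, ?_⟩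
  · rw [LinearEquiv.eq_comp_toLinearMap_symm]
    refine LinearMap.ext fun w => LinearMap.ext fun z => ?_
    have := LinearMap.congr_fun (kk_mul_Kop hT hD) z
    simp only [LinearMap.comp_apply, LinearEquiv.coe_coe, LinearEquiv.trans_apply,
      LinearEquiv.apply_symm_apply, LinearEquiv.dualMap_apply, LinearMap.dualMap_apply, flipAct]
    rw [← this]
    rfl
  · refine LinearMap.ext fun w => LinearMap.ext fun z => adj_twHopf_mul hT e D w z
  · rfl

end Transposes

open Module (Dual)

section LeftComparison

variable {k H B : Type*} [Field k] [Ring H] [Algebra k H]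
  (Q : QuasiHopfAlgebra k H) [AddCommGroup B] [Module k B] [Module.Finite k B]
  (D : YDData k H B)

attribute [local instance] Cm.symm

theorem crossMap_eq (T : H →ₗ[k] H) (u v : H) : crossMap D.act D T u v =
    eR B (aop D) v * (rr D (eL k B B ∘ₗ aop D ∘ₗ T) (eR B LinearMap.id) * eR B (aop D) u) := by
  refine TensorProduct.ext' fun m n => ?_
  have h1 : eR B (aop D) u (m ⊗ₜ[k] n) = m ⊗ₜ D.act u n := rfl
  rw [Module.End.mul_apply, Module.End.mul_apply, h1, rr_eL_eR_apply]
  simp only [crossMap, LinearMap.comp_apply, LinearMap.lTensor_tmul]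
  generalize D.coact (D.act u n) = s
  induction s with
  | zero => simp only [LinearMap.map_zero, LinearMap.zero_apply, mul_zero, zero_mul,
        TensorProduct.zero_tmul, TensorProduct.tmul_zero]
  | add s t hs ht => simp only [LinearMap.map_add, TensorProduct.tmul_add, hs, ht]
  | tmul x y => simp

theorem rinv_eq : rinv Q D = jj Q _ 1
    (m2 (sL k H _) (m2 (sR H (sR H (aop D))) (sR H (sL k H _))) (Q.idComul Q.qL * Q.Phi) *
      (m2 (sL k H _) (sR H (sR H LinearMap.id)) (lop D) *
        m2 (sR H (sR H (aop D))) (sL k H _) Q.pR)) := by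
  rw [Str.map_mul (u := m2 (sL k H (H ⊗[k] Module.End k B)) (m2 (sR H (sR H (aop D)))
    (sR H (sL k H (Module.End k B))))), m2_idComul, mul_assoc]
  rfl

theorem kappaLeft_eq_Kop : kappaLeft Q D = Kop Q Q.f (aop D) D := by
  rw [Kop, cmp, ri, rinv_eq, kappaLeft]
  generalize Q.f = F
  induction F with
  | zero => simp only [LinearMap.map_zero, LinearMap.zero_apply, mul_zero, zero_mul,
        TensorProduct.zero_tmul, TensorProduct.tmul_zero]
  | add s t hs ht => simp only [LinearMap.map_add, add_mul, hs, ht]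
  | tmul f₁ f₂ =>
  rw [sw2_tmul]
  generalize Q.pR = p
  induction p with
  | zero => simp only [LinearMap.map_zero, LinearMap.zero_apply, mul_zero, zero_mul,
        TensorProduct.zero_tmul, TensorProduct.tmul_zero]
  | add s t hs ht => simp only [LinearMap.map_add, mul_add, hs, ht]
  | tmul p₁ p₂ =>
  rw [sw2_tmul]
  generalize Q.idComul Q.qL * Q.Phi = t
  induction t using ind3 with
  | h0 => simp only [LinearMap.map_zero, LinearMap.zero_apply, mul_zero, zero_mul,
        TensorProduct.zero_tmul, TensorProduct.tmul_zero]
  | ha s t hs ht => simp only [LinearMap.map_add, add_mul, mul_add, hs, ht]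
  | h a b c =>
  rw [sw3_tmul, crossMap_eq, rr]
  generalize lop D = X
  induction X with
  | zero => simp only [LinearMap.map_zero, LinearMap.zero_apply, mul_zero, zero_mul,
        TensorProduct.zero_tmul, TensorProduct.tmul_zero]
  | add s t hs ht => simp only [LinearMap.map_add, add_mul, mul_add, hs, ht]
  | tmul h y =>
  refine TensorProduct.ext' fun m n => ?_
  simp [mul_assoc]

end LeftComparison

open Module (Dual)

section Collapse

variable {k H A X : Type*} [Field k] [Ring H] [Algebra k H] [Ring A] [Algebra k A]
  [AddCommGroup X] [Module k X] {Q : QuasiHopfAlgebra k H}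

attribute [local instance] Cm.symm

theorem collapse_ael (F : A →ₗ[k] X) (a u v b w y m : H →ₗ[k] A) (p : A)
    [Str a] [Str u] [Str v] [Str y] [Str m]
    [Cm a u] [Cm a v] [Cm a b] [Cm a w] [Cm a y] [Cm a m] [Cm u v] [Cm u b] [Cm u w] [Cm u y]
    [Cm u m] [Cm v b] [Cm v w] [Cm v y] [Cm v m] [Cm m y]
    [Ps p a a] [Ps p u u] [Ps p v v] [Ps p (conv Q m y) w]
    (hb : LCol F b w) (huv : LCol F (conv Q u v) (triv Q A))
    (hvm : RCol F (conv Q v m) (triv Q A)) :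
    F (ael Q a u v b * (p * ph Q v m y)) = F (p * (ph Q a m y * phi Q u v m)) := by
  have h1 := (hb.past (ph Q a u v))
  have h2 : F (ph Q a u v * (phi Q (conv Q a u) v b * (p * ph Q v m y))) =
      F (ph Q a u v * (phi Q (conv Q a u) v w * (p * ph Q v m y))) :=
    LCol.phi Q (u := conv Q a u) (v := v) LCol.rfl LCol.rfl h1 _
  rw [ael, mul_assoc, h2,
    ← pass_phi_mul Q (u := conv Q a u) (v := v) (w := conv Q m y) (u' := conv Q a u) (v' := v) (w' := w) p,
    ← pass_ph_mul Q (u := a) (v := u) (w := v) (u' := a) (v' := u) (w' := v) p,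
    pentagon_ph_phi_left,
    pass_ph_mul Q (u := conv Q (conv Q a u) v) (v := m) (w := y) (u' := conv Q a (conv Q u v))
      (v' := m) (w' := y) (ph Q a u v),
    ← mul_assoc (ph Q a u v), pentagon_ph_phi_mid]
  have h3 : ∀ t, F (t * phi Q (conv Q a u) (conv Q v m) y) = F t := fun t => by
    rw [RCol.phi Q RCol.rfl hvm RCol.rfl, phi_triv_mid, mul_one]
  have h4 : ∀ t, F (t * ph Q a u (conv Q v m)) = F t := fun t => by
    rw [RCol.ph Q RCol.rfl RCol.rfl hvm, ph_triv_right, mul_one]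
  have h5 : LCol F (conv Q a (conv Q u v)) a := fun h t => by
    rw [LCol.rfl.conv Q huv, conv_triv]
  have h6 := h5.past p
  have h7 := huv.past (p * ph Q a m y)
  have h8 : ∀ t, F (p * (ph Q (conv Q a (conv Q u v)) m y * t)) = F (p * (ph Q a m y * t)) :=
    fun t => LCol.ph Q (v := m) (w := y) h6 LCol.rfl LCol.rfl t
  have h9 : ∀ t, F (p * (ph Q a m y * (phi Q a (conv Q u v) m * t))) =
      F (p * (ph Q a m y * t)) := fun t => by
    have := LCol.phi Q (u := a) (w := m) LCol.rfl h7 LCol.rfl t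
    simp only [LinearMap.comp_apply, LinearMap.mulLeft_apply, mul_assoc] at this
    rw [this, phi_triv_mid, one_mul]
  simp only [← mul_assoc] at h3 h4 ⊢
  rw [h3, h4]
  simp only [mul_assoc]
  rw [h8, h9]

variable {M : Type*} [AddCommGroup M] [Module k M] [Module.Finite k M] {D : YDData k H M}

theorem collapse_hex (hD : OpYD Q D) (F : A →ₗ[k] X) (a b d : H →ₗ[k] A)
    (e : Module.End k M →ₗ[k] A) [Str a] [Str b] [Str d] [Str e] [Cm a b] [Cm a d] [Cm b d]
    [Cm a e] [Cm b e] [Cm d e]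
    (hab : LCol F (conv Q a b) (triv Q A)) (hmd : LCol F (conv Q (e ∘ₗ aop D) d) (triv Q A)) :
    F (ph Q b (e ∘ₗ aop D) d * (rr D b e * phi Q (e ∘ₗ aop D) b d) *
      (ph Q a (e ∘ₗ aop D) (conv Q b d) * rr D a e)) = F (ael Q (e ∘ₗ aop D) a b d) := by
  set m := e ∘ₗ aop D with hm
  have pa := hD.ps a e
  have pb := hD.ps b e
  rw [← hm] at pa pb
  have e1 : rr D a e * phi Q (conv Q m a) b d = phi Q (conv Q a m) b d * rr D a e :=
    pass_phi Q (rr D a e)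
  have hx := hD.rr_hex a b e
  rw [← hm] at hx
  have hp := pentagon Q a b m d
  have e2 : ph Q b m d * (rr D b e * phi Q m b d) * (ph Q a m (conv Q b d) * rr D a e) =
      ph Q a b (conv Q m d) * (ph Q (conv Q a b) m d * (rr D (conv Q a b) e * ael Q m a b d)) := by
    calc _ = ph Q b m d * (rr D b e * ((phi Q m b d * ph Q a m (conv Q b d)) * rr D a e)) := by
          simp only [mul_assoc]
      _ = ph Q b m d * (rr D b e * (ph Q a (conv Q m b) d * (ph Q a m b *
            (phi Q (conv Q a m) b d * rr D a e)))) := by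
          rw [pentagon_phi_ph]; simp only [mul_assoc]
      _ = ph Q b m d * (ph Q a (conv Q b m) d * ((rr D b e * (ph Q a m b * rr D a e)) *
            phi Q (conv Q m a) b d)) := by
          rw [← e1, pass_ph_mul Q (u := a) (v := conv Q m b) (w := d) (u' := a)
            (v' := conv Q b m) (w' := d) (rr D b e)]
          simp only [mul_assoc]
      _ = (ph Q b m d * (ph Q a (conv Q b m) d * ph Q a b m)) * (rr D (conv Q a b) e *
            (ph Q m a b * phi Q (conv Q m a) b d)) := by rw [hx]; simp only [mul_assoc]
      _ = _ := by rw [hp, ael]; simp only [mul_assoc]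
  rw [e2, LCol.ph Q LCol.rfl LCol.rfl hmd, ph_triv_right, one_mul,
    LCol.ph Q hab LCol.rfl LCol.rfl, ph_triv_left, one_mul]
  have e3 : ∀ t, F (rr D (conv Q a b) e * t) = F (rr D (triv Q A) e * t) := fun t =>
    (hab.m2 LCol.rfl) _ t
  rw [e3, hD.rr_triv e, one_mul]

end Collapse

open Module (Dual)

section RightComparison

variable {k H B : Type*} [Field k] [Ring H] [Algebra k H]
  (Q : QuasiHopfAlgebra k H) [AddCommGroup B] [Module k B] [Module.Finite k B]
  (D : YDData k H B)

attribute [local instance] Cm.symm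

/-- `d ⊗ x ↦ ρ(S⁻¹(α d)) x` -/
noncomputable def pairR : H ⊗[k] Module.End k B →ₗ[k] Module.End k B :=
  m2 (aop D ∘ₗ Q.Sinv ∘ₗ mulLeft k Q.alpha) LinearMap.id

/-- `b ⊗ d ⊗ x ↦ S⁻¹(b) ⊗ ρ(S⁻¹(α d)) x` -/
noncomputable def close3 : H ⊗[k] (H ⊗[k] Module.End k B) →ₗ[k] H ⊗[k] Module.End k B :=
  TensorProduct.map Q.Sinv (pairR Q D)

/-- `(b ⊗ d ⊗ x) ⊗ v ↦ S⁻¹(b) ⊗ ρ(S⁻¹(α d)) x ρ(S⁻¹(v β))` -/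
noncomputable def close4 :
    (H ⊗[k] (H ⊗[k] Module.End k B)) ⊗[k] H →ₗ[k] H ⊗[k] Module.End k B :=
  m2 (close3 Q D) (sR H (aop D ∘ₗ Q.Sinv ∘ₗ mulRight k Q.beta))

/-- `a ⊗ b ⊗ d ⊗ x ↦ S(a) α b ⊗ ρ(S⁻¹(α d)) x` -/
noncomputable def closeA :
    H ⊗[k] (H ⊗[k] (H ⊗[k] Module.End k B)) →ₗ[k] H ⊗[k] Module.End k B :=
  TensorProduct.map (capS Q) (pairR Q D) ∘ₗ
    (TensorProduct.assoc k H H (H ⊗[k] Module.End k B)).symm.toLinearMap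

/-- `(a ⊗ b ⊗ d ⊗ x) ⊗ v ⊗ u ↦ S(a) α b ⊗ ρ(S⁻¹(α d)) x ρ(S⁻¹(α v β) u)` -/
noncomputable def closeB :
    (H ⊗[k] (H ⊗[k] (H ⊗[k] Module.End k B))) ⊗[k] (H ⊗[k] H) →ₗ[k] H ⊗[k] Module.End k B :=
  m2 (closeA Q D) (sR H (aop D ∘ₗ m2 (Q.Sinv ∘ₗ mulLeft k Q.alpha ∘ₗ mulRight k Q.beta)
    LinearMap.id))

@[simp] theorem pairR_tmul (d : H) (x : Module.End k B) :
    pairR Q D (d ⊗ₜ x) = D.act (Q.Sinv (Q.alpha * d)) * x := rfl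

@[simp] theorem close3_tmul (b : H) (t : H ⊗[k] Module.End k B) :
    close3 Q D (b ⊗ₜ t) = Q.Sinv b ⊗ₜ pairR Q D t := rfl

@[simp] theorem close4_tmul (s : H ⊗[k] (H ⊗[k] Module.End k B)) (v : H) :
    close4 Q D (s ⊗ₜ v) = close3 Q D s * (1 ⊗ₜ D.act (Q.Sinv (v * Q.beta))) := rfl

@[simp] theorem closeA_tmul (a b : H) (t : H ⊗[k] Module.End k B) :
    closeA Q D (a ⊗ₜ (b ⊗ₜ t)) = (Q.S a * Q.alpha * b) ⊗ₜ pairR Q D t := rfl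

@[simp] theorem closeB_tmul (s : H ⊗[k] (H ⊗[k] (H ⊗[k] Module.End k B))) (v u : H) :
    closeB Q D (s ⊗ₜ (v ⊗ₜ u)) =
      closeA Q D s * (1 ⊗ₜ D.act (Q.Sinv (Q.alpha * (v * Q.beta)) * u)) := by
  simp [closeB]

section
variable {Q D}

theorem ind42 {M1 M2 M3 M4 : Type*} [AddCommGroup M1] [Module k M1] [AddCommGroup M2] [Module k M2]
    [AddCommGroup M3] [Module k M3] [AddCommGroup M4] [Module k M4]
    {p : (M1 ⊗[k] (M2 ⊗[k] M3)) ⊗[k] M4 → Prop} (h0 : p 0)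
    (ha : ∀ s t, p s → p t → p (s + t))
    (h : ∀ a b c d, p ((a ⊗ₜ (b ⊗ₜ c)) ⊗ₜ d)) (t : (M1 ⊗[k] (M2 ⊗[k] M3)) ⊗[k] M4) : p t :=
  ind2 h0 ha (fun s d => by
    induction s using ind3 with
    | h0 => simpa using h0
    | ha s t hs ht => simpa [TensorProduct.add_tmul] using ha _ _ hs ht
    | h a b c => exact h a b c d) t

end

/-- strands for `close4` -/
noncomputable abbrev c4b : H →ₗ[k] (H ⊗[k] (H ⊗[k] Module.End k B)) ⊗[k] H :=
  sL k _ _ ∘ₗ sL k _ _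

noncomputable abbrev c4d : H →ₗ[k] (H ⊗[k] (H ⊗[k] Module.End k B)) ⊗[k] H :=
  sL k _ _ ∘ₗ sR H (sL k _ _)

noncomputable abbrev c4e : Module.End k B →ₗ[k] (H ⊗[k] (H ⊗[k] Module.End k B)) ⊗[k] H :=
  sL k _ _ ∘ₗ sR H (sR H LinearMap.id)

noncomputable abbrev c4v : H →ₗ[k] (H ⊗[k] (H ⊗[k] Module.End k B)) ⊗[k] H :=
  sR _ LinearMap.id

theorem close4_lcol : LCol (close4 Q D) (conv Q (c4e (H := H) (B := B) ∘ₗ aop D) c4d)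
    (triv Q _) :=
  LCol.of_contr (contr_alpha Q) <| ind42 (Fac.left _ _ _).1 (Fac.left _ _ _).2 fun b d x v =>
    ⟨TensorProduct.mk k H (Module.End k B) (Q.Sinv b) ∘ₗ mulRight k (x * D.act (Q.Sinv (v * Q.beta)))
      ∘ₗ aop D ∘ₗ mulLeft k (Q.Sinv d) ∘ₗ Q.Sinv, fun y z => by
        simp [Q.Sinv_mul, Sinv_S, mul_assoc]⟩

theorem close4_rcol : RCol (close4 Q D) (conv Q c4v (c4e (H := H) (B := B) ∘ₗ aop D))
    (triv Q _) :=
  RCol.of_contr (contr_beta Q) <| ind42 (Fac.right _ _ _).1 (Fac.right _ _ _).2 fun b d x v =>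
    ⟨TensorProduct.mk k H (Module.End k B) (Q.Sinv b) ∘ₗ mulLeft k (D.act (Q.Sinv (Q.alpha * d)) * x)
      ∘ₗ aop D ∘ₗ mulRight k (Q.Sinv v) ∘ₗ Q.Sinv, fun y z => by
        simp [Q.Sinv_mul, Sinv_S, mul_assoc]⟩

theorem close4_mul_flip (w : H ⊗[k] H) (t : (H ⊗[k] (H ⊗[k] Module.End k B)) ⊗[k] H) :
    close4 Q D t * m2 (sL k H _) (sR H (aop D)) (flipMap Q.Sinv w) =
      close4 Q D (m2 c4v c4b w * t) := by
  induction w with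
  | zero => simp only [LinearMap.map_zero, LinearMap.zero_apply, mul_zero, zero_mul,
        TensorProduct.zero_tmul, TensorProduct.tmul_zero]
  | add s t hs ht => simp only [LinearMap.map_add, add_mul, mul_add, hs, ht]
  | tmul a b =>
    induction t using ind42 with
    | h0 => simp only [LinearMap.map_zero, LinearMap.zero_apply, mul_zero, zero_mul,
          TensorProduct.zero_tmul, TensorProduct.tmul_zero]
    | ha s t hs ht => simp only [LinearMap.map_add, add_mul, mul_add, hs, ht]
    | h b d x v => simp [Q.Sinv_mul, mul_assoc]

theorem flip_mul_close4 (w : H ⊗[k] H) (t : (H ⊗[k] (H ⊗[k] Module.End k B)) ⊗[k] H) :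
    m2 (sR H (aop D)) (sL k H _) (flipMap Q.Sinv w) * close4 Q D t =
      close4 Q D (t * m2 c4b c4d w) := by
  induction w with
  | zero => simp only [LinearMap.map_zero, LinearMap.zero_apply, mul_zero, zero_mul,
        TensorProduct.zero_tmul, TensorProduct.tmul_zero]
  | add s t hs ht => simp only [LinearMap.map_add, add_mul, mul_add, hs, ht]
  | tmul a b =>
    induction t using ind42 with
    | h0 => simp only [LinearMap.map_zero, LinearMap.zero_apply, mul_zero, zero_mul,
          TensorProduct.zero_tmul, TensorProduct.tmul_zero]
    | ha s t hs ht => simp only [LinearMap.map_add, add_mul, mul_add, hs, ht]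
    | h b d x v => simp [Q.Sinv_mul, mul_assoc]

section
variable {A : Type*} [Ring A] [Algebra k A]

/-- `Φ⟨b,m,d⟩ R⟨b⟩ Φ⁻¹⟨m,b,d⟩` -/
noncomputable def pre (b d : H →ₗ[k] A) (e : Module.End k B →ₗ[k] A) : A :=
  ph Q b (e ∘ₗ aop D) d * (rr D b e * phi Q (e ∘ₗ aop D) b d)

theorem map_pre {A' : Type*} [Ring A'] [Algebra k A'] (χ : A →ₗ[k] A') [Str χ] (b d : H →ₗ[k] A)
    (e : Module.End k B →ₗ[k] A) : χ (pre Q D b d e) = pre Q D (χ ∘ₗ b) (χ ∘ₗ d) (χ ∘ₗ e) := by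
  rw [pre, Str.map_mul, Str.map_mul, map_ph, map_rr, map_phi]; rfl

variable (b d : H →ₗ[k] A) (e : Module.End k B →ₗ[k] A)

instance (z : H →ₗ[k] A) [Cm b z] [Cm d z] [Cm e z] : Ps (pre Q D b d e) z z :=
  inferInstanceAs (Ps (_ * (_ * _)) z z)

variable {Q D} in
theorem OpYD.ps_pre (hD : OpYD Q D) [Str b] [Str d] [Str e] [Cm b d] [Cm b e] [Cm d e] :
    Ps (pre Q D b d e) (conv Q (e ∘ₗ aop D) (conv Q b d)) (conv Q b (conv Q (e ∘ₗ aop D) d)) := by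
  have h1 := hD.ps b e
  have h2 : Ps (rr D b e) (conv Q (conv Q (e ∘ₗ aop D) b) d) (conv Q (conv Q b (e ∘ₗ aop D)) d) :=
    inferInstance
  refine ⟨fun y => ?_⟩
  rw [pre, mul_assoc, mul_assoc, phi_nat, ← mul_assoc (rr D b e), h2.pass, mul_assoc,
    ← mul_assoc (ph Q _ _ _), ph_nat, mul_assoc]

variable {Q D} in
theorem collapse_pass {X : Type*} [AddCommGroup X] [Module k X] {C : A →ₗ[k] X} (hD : OpYD Q D)
    (v : H →ₗ[k] A) [Str b] [Str d] [Str e] [Str v] [Cm b d] [Cm b e] [Cm d e] [Cm v b] [Cm v d]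
    [Cm v e] (hl : LCol C (conv Q (e ∘ₗ aop D) d) (triv Q _))
    (hr : RCol C (conv Q v (e ∘ₗ aop D)) (triv Q _)) (y : H) :
    C (conv Q v b y * (pre Q D b d e * ph Q v (e ∘ₗ aop D) (conv Q b d))) =
      C (pre Q D b d e * ph Q v (e ∘ₗ aop D) (conv Q b d) * conv Q b d y) := by
  have hp := hD.ps_pre b d e
  have hl' : LCol C (conv Q v (conv Q b (conv Q (e ∘ₗ aop D) d))) (conv Q v b) :=
    fun h t => by
      rw [LCol.rfl.conv Q (LCol.rfl.conv Q hl), conv_triv]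
  have hq : Ps (pre Q D b d e) (conv Q v (conv Q (e ∘ₗ aop D) (conv Q b d)))
    (conv Q v (conv Q b (conv Q (e ∘ₗ aop D) d))) := inferInstance
  rw [← hl', ← mul_assoc, ← hq.pass, mul_assoc, ← ph_nat, ← mul_assoc, (hr.conv Q RCol.rfl),
    triv_conv]

end

/-- The inverse of the braiding, with an antipode. -/
noncomputable def theta : H ⊗[k] Module.End k B :=
  close4 Q D (pre Q D c4b c4d c4e * ph Q c4v (c4e ∘ₗ aop D) (conv Q c4b c4d))

variable {Q D} in
theorem theta_mul_flip (hD : OpYD Q D) (y : H) :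
    theta Q D * m2 (sL k H _) (sR H (aop D)) (flipMap Q.Sinv (Q.comul y)) =
      m2 (sR H (aop D)) (sL k H _) (flipMap Q.Sinv (Q.comul y)) * theta Q D := by
  rw [theta, close4_mul_flip, flip_mul_close4]
  change close4 Q D (conv Q c4v c4b y * _) = close4 Q D (_ * conv Q c4b c4d y)
  exact collapse_pass (A := (H ⊗[k] (H ⊗[k] Module.End k B)) ⊗[k] H) (C := close4 Q D)
    c4b c4d c4e hD c4v (close4_lcol Q D) (close4_rcol Q D) y

end RightComparison

open Module (Dual)

section RightComparison

variable {k H B : Type*} [Field k] [Ring H] [Algebra k H]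
  (Q : QuasiHopfAlgebra k H) [AddCommGroup B] [Module k B] [Module.Finite k B]
  (D : YDData k H B)

attribute [local instance] Cm.symm

variable {Q} in
theorem eq_of_mul_alpha {A : Type*} [Ring A] [Algebra k A] (V : H →ₗ[k] A) [Str V] {W : H → A}
    {x y : A} (hx : ∀ h, x * V (Q.Sinv h) = W h * x) (hy : ∀ h, y * V (Q.Sinv h) = W h * y)
    (h : x * V (Q.Sinv Q.alpha) = y * V (Q.Sinv Q.alpha)) : x = y := by
  have key : ∀ t, x * V (Q.Sinv (zagR Q t)) = y * V (Q.Sinv (zagR Q t)) := fun t => by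
    induction t using ind3 with
    | h0 => simp only [LinearMap.map_zero, LinearMap.zero_apply, mul_zero, zero_mul,
          TensorProduct.zero_tmul, TensorProduct.tmul_zero]
    | ha s t hs ht => simp only [LinearMap.map_add, mul_add, hs, ht]
    | h a b c =>
      have e1 : ∀ z, V (Q.Sinv (zagR Q (a ⊗ₜ (b ⊗ₜ c)))) = z → z = V (Q.Sinv c) *
          (V (Q.Sinv Q.alpha) * V (Q.Sinv (a * Q.beta * Q.S b))) := by
        rintro _ rfl
        rw [zagR_tmul, ← mul_assoc, ← mul_assoc, Q.Sinv_mul _ c, Q.Sinv_mul _ Q.alpha,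
          Str.map_mul, Str.map_mul]
      rw [e1 _ rfl, ← mul_assoc, ← mul_assoc y, hx, hy, mul_assoc, mul_assoc, ← mul_assoc x, h]
      simp only [mul_assoc]
  simpa [zagR_Phi, Str.map_one] using key Q.Phi

variable (k H B) in
/-- The algebra of arguments of `closeB`. -/
abbrev ArgB : Type _ := (H ⊗[k] (H ⊗[k] (H ⊗[k] Module.End k B))) ⊗[k] (H ⊗[k] H)

variable (k H B) in
/-- The algebra of arguments of `closeA`. -/
abbrev ArgA : Type _ := H ⊗[k] (H ⊗[k] (H ⊗[k] Module.End k B))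

variable (k H B) in
noncomputable abbrev cAa : H →ₗ[k] ArgA k H B := sL k _ _

variable (k H B) in
noncomputable abbrev cAb : H →ₗ[k] ArgA k H B := sR H (sL k _ _)

variable (k H B) in
noncomputable abbrev cAd : H →ₗ[k] ArgA k H B := sR H (sR H (sL k _ _))

variable (k H B) in
noncomputable abbrev cAe : Module.End k B →ₗ[k] ArgA k H B := sR H (sR H (sR H LinearMap.id))

variable (k H B) in
noncomputable abbrev cBv : H →ₗ[k] ArgB k H B := sR _ (sL k _ _)

variable (k H B) in
noncomputable abbrev cBu : H →ₗ[k] ArgB k H B := sR _ (sR H LinearMap.id)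

theorem ind6' {M1 M2 M3 M4 M5 M6 : Type*} [AddCommGroup M1] [Module k M1] [AddCommGroup M2]
    [Module k M2] [AddCommGroup M3] [Module k M3] [AddCommGroup M4] [Module k M4]
    [AddCommGroup M5] [Module k M5] [AddCommGroup M6] [Module k M6]
    {p : (M1 ⊗[k] (M2 ⊗[k] (M3 ⊗[k] M4))) ⊗[k] (M5 ⊗[k] M6) → Prop} (h0 : p 0)
    (ha : ∀ s t, p s → p t → p (s + t))
    (h : ∀ a b c d v u, p ((a ⊗ₜ (b ⊗ₜ (c ⊗ₜ d))) ⊗ₜ (v ⊗ₜ u)))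
    (t : (M1 ⊗[k] (M2 ⊗[k] (M3 ⊗[k] M4))) ⊗[k] (M5 ⊗[k] M6)) : p t :=
  ind2 h0 ha (fun s r => by
    induction s using ind4 with
    | h0 => simpa using h0
    | ha s t hs ht => simpa [TensorProduct.add_tmul] using ha _ _ hs ht
    | h a b c d =>
      induction r with
      | zero => simpa using h0
      | add s t hs ht => simpa [TensorProduct.tmul_add] using ha _ _ hs ht
      | tmul v u => exact h a b c d v u) t

theorem closeB_lcol_uv : LCol (closeB Q D) (conv Q (cBu k H B) (cBv k H B)) (triv Q (ArgB k H B)) :=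
  LCol.of_contr (contr_alpha Q) <| ind6' (Fac.left _ _ _).1 (Fac.left _ _ _).2
    fun a b d x v u => ⟨TensorProduct.mk k H (Module.End k B) (Q.S a * Q.alpha * b) ∘ₗ
      mulLeft k (D.act (Q.Sinv (Q.alpha * d)) * x) ∘ₗ aop D ∘ₗ mulLeft k (Q.Sinv (v * Q.beta)) ∘ₗ
        mulRight k u ∘ₗ Q.Sinv, fun y z => by simp [Q.Sinv_mul, Sinv_S, mul_assoc]⟩

theorem closeB_lcol_md : LCol (closeB Q D) (conv Q ((sL k (ArgA k H B) (H ⊗[k] H) ∘ₗ (cAe k H B)) ∘ₗ aop D)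
    (sL k (ArgA k H B) (H ⊗[k] H) ∘ₗ (cAd k H B))) (triv Q (ArgB k H B)) :=
  LCol.of_contr (contr_alpha Q) <| ind6' (Fac.left _ _ _).1 (Fac.left _ _ _).2
    fun a b d x v u => ⟨TensorProduct.mk k H (Module.End k B) (Q.S a * Q.alpha * b) ∘ₗ
      mulRight k (x * D.act (Q.Sinv (Q.alpha * (v * Q.beta)) * u)) ∘ₗ aop D ∘ₗ
        mulLeft k (Q.Sinv d) ∘ₗ Q.Sinv, fun y z => by simp [Q.Sinv_mul, Sinv_S, mul_assoc]⟩

theorem closeB_rcol_vm : RCol (closeB Q D) (conv Q (cBv k H B) ((sL k (ArgA k H B) (H ⊗[k] H) ∘ₗ (cAe k H B)) ∘ₗ aop D))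
    (triv Q (ArgB k H B)) :=
  RCol.of_contr (contr_beta Q) <| ind6' (Fac.right _ _ _).1 (Fac.right _ _ _).2
    fun a b d x v u => ⟨TensorProduct.mk k H (Module.End k B) (Q.S a * Q.alpha * b) ∘ₗ
      mulLeft k (D.act (Q.Sinv (Q.alpha * d)) * x) ∘ₗ aop D ∘ₗ
        mulRight k (Q.Sinv v * (Q.Sinv Q.alpha * u)) ∘ₗ Q.Sinv, fun y z => by
          simp [Q.Sinv_mul, Sinv_S, mul_assoc]⟩

theorem closeA_lcol_ab : LCol (closeA Q D) (conv Q (cAa k H B) (cAb k H B)) (triv Q (ArgA k H B)) :=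
  LCol.of_contr (contr_alpha Q) <| ind4 (Fac.left _ _ _).1 (Fac.left _ _ _).2
    fun a b d x => ⟨(TensorProduct.mk k H (Module.End k B)).flip (D.act (Q.Sinv (Q.alpha * d)) * x)
      ∘ₗ mulLeft k (Q.S a) ∘ₗ mulRight k b, fun y z => by simp [mul_assoc]⟩

theorem closeA_lcol_md : LCol (closeA Q D) (conv Q ((cAe k H B) ∘ₗ aop D) (cAd k H B))
    (triv Q (ArgA k H B)) :=
  LCol.of_contr (contr_alpha Q) <| ind4 (Fac.left _ _ _).1 (Fac.left _ _ _).2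
    fun a b d x => ⟨TensorProduct.mk k H (Module.End k B) (Q.S a * Q.alpha * b) ∘ₗ
      mulRight k x ∘ₗ aop D ∘ₗ mulLeft k (Q.Sinv d) ∘ₗ Q.Sinv, fun y z => by
        simp [Q.Sinv_mul, Sinv_S, mul_assoc]⟩

theorem closeA_mul (s : ArgA k H B) (h : H) (x : Module.End k B) :
    closeA Q D (s * ((cAa k H B) h * (cAe k H B) x)) = (Q.S h ⊗ₜ 1) * closeA Q D s * (1 ⊗ₜ x) := by
  induction s using ind4 with
  | h0 => simp only [LinearMap.map_zero, LinearMap.zero_apply, mul_zero, zero_mul,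
        TensorProduct.zero_tmul, TensorProduct.tmul_zero]
  | ha s t hs ht => simp only [LinearMap.map_add, add_mul, mul_add, hs, ht]
  | h a b d y => simp [mul_assoc]

theorem map_S_mul (Z : H ⊗[k] Module.End k B) (h : H) (x : Module.End k B) :
    TensorProduct.map Q.S LinearMap.id (Z * (h ⊗ₜ x)) =
      (Q.S h ⊗ₜ 1) * TensorProduct.map Q.S LinearMap.id Z * (1 ⊗ₜ x) := by
  induction Z with
  | zero => simp only [LinearMap.map_zero, LinearMap.zero_apply, mul_zero, zero_mul,
        TensorProduct.zero_tmul, TensorProduct.tmul_zero]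
  | add s t hs ht => simp only [LinearMap.map_add, add_mul, mul_add, hs, ht]
  | tmul a y => simp [mul_assoc]

theorem closeA_mul_m2 {s : ArgA k H B} {Z : H ⊗[k] Module.End k B}
    (h : closeA Q D s = TensorProduct.map Q.S LinearMap.id Z) (X : H ⊗[k] Module.End k B) :
    closeA Q D (s * m2 (cAa k H B) (cAe k H B) X) = TensorProduct.map Q.S LinearMap.id (Z * X) := by
  induction X with
  | zero => simp only [LinearMap.map_zero, LinearMap.zero_apply, mul_zero, zero_mul,
        TensorProduct.zero_tmul, TensorProduct.tmul_zero]
  | add s t hs ht => simp only [LinearMap.map_add, mul_add, hs, ht]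
  | tmul a y => rw [m2_tmul, closeA_mul, map_S_mul, h]

theorem closeB_mul_phi (s : ArgA k H B) : closeB Q D (sL k (ArgA k H B) (H ⊗[k] H) s * phi Q (cBu k H B) (cBv k H B)
    ((sL k (ArgA k H B) (H ⊗[k] H) ∘ₗ (cAe k H B)) ∘ₗ aop D)) = closeA Q D s := by
  have key : ∀ t, closeB Q D (sL k (ArgA k H B) (H ⊗[k] H) s * m2 (cBu k H B) (m2 (cBv k H B)
      ((sL k (ArgA k H B) (H ⊗[k] H) ∘ₗ (cAe k H B)) ∘ₗ aop D)) t) =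
      closeA Q D s * (1 ⊗ₜ D.act (Q.Sinv (zagL Q t))) := fun t => by
    induction t using ind3 with
    | h0 => simp
    | ha s t hs ht => simp only [map_add, mul_add, TensorProduct.tmul_add, hs, ht]
    | h x y z =>
      have h1 := closeA_mul Q D s 1 (D.act z)
      simp only [sL_apply, ← Algebra.TensorProduct.one_def, one_mul, Q.S_one, sR_apply,
        LinearMap.id_apply] at h1
      simp [h1, mul_assoc, Sinv_S]
  rw [phi, key, zagL_PhiInv]
  simp [Q.Sinv_one, ← Algebra.TensorProduct.one_def]

theorem map_S_gamma : TensorProduct.map Q.S LinearMap.id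
    (m2 (sR H (aop D)) (sL k H _) (flipMap Q.Sinv Q.gamma)) =
      closeA Q D (m2 ((cAe k H B) ∘ₗ aop D) (m2 (cAa k H B) (m2 (cAb k H B) (cAd k H B))) (aTensor Q)) := by
  rw [QuasiHopfAlgebra.gamma]
  change _ = closeA Q D (m2 _ _ (QuasiHopfAlgebra.tensorOne k H Q.Phi * Q.comulIdId Q.PhiInv))
  generalize QuasiHopfAlgebra.tensorOne k H Q.Phi * Q.comulIdId Q.PhiInv = t
  induction t using ind4 with
  | h0 => simp only [LinearMap.map_zero, LinearMap.zero_apply, mul_zero, zero_mul,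
        TensorProduct.zero_tmul, TensorProduct.tmul_zero]
  | ha s t hs ht => simp only [LinearMap.map_add, hs, ht]
  | h a b c d => simp [sw4_tmul, mul_assoc, Sinv_S]

theorem map_S_close4_gamma (t : (H ⊗[k] (H ⊗[k] Module.End k B)) ⊗[k] H) :
    TensorProduct.map Q.S LinearMap.id
      (close4 Q D t * m2 (sL k H _) (sR H (aop D)) (flipMap Q.Sinv Q.gamma)) =
      closeB Q D (m2 (sL k (ArgA k H B) (H ⊗[k] H) ∘ₗ (cAa k H B)) (m2 (cBu k H B) (m2 (cBv k H B) (sL k (ArgA k H B) (H ⊗[k] H) ∘ₗ (cAb k H B)))) (aTensor Q) *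
        TensorProduct.map (sR H LinearMap.id) (sL k H H) t) := by
  rw [QuasiHopfAlgebra.gamma]
  change _ = closeB Q D (m2 _ _ (QuasiHopfAlgebra.tensorOne k H Q.Phi * Q.comulIdId Q.PhiInv) * _)
  generalize QuasiHopfAlgebra.tensorOne k H Q.Phi * Q.comulIdId Q.PhiInv = q
  induction q using ind4 with
  | h0 => simp only [LinearMap.map_zero, LinearMap.zero_apply, mul_zero, zero_mul,
        TensorProduct.zero_tmul, TensorProduct.tmul_zero]
  | ha s t hs ht => simp only [LinearMap.map_add, add_mul, mul_add, hs, ht]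
  | h a b c d =>
    rw [sw4_tmul]
    induction t using ind42 with
    | h0 => simp only [LinearMap.map_zero, LinearMap.zero_apply, mul_zero, zero_mul,
          TensorProduct.zero_tmul, TensorProduct.tmul_zero]
    | ha s t hs ht => simp only [LinearMap.map_add, add_mul, mul_add, hs, ht]
    | h p q x v => simp [mul_assoc, Sinv_S]

theorem map_S_injective {Y Z : H ⊗[k] Module.End k B}
    (h : TensorProduct.map Q.S LinearMap.id Y = TensorProduct.map Q.S LinearMap.id Z) : Y = Z := by
  have e : ∀ Y : H ⊗[k] Module.End k B,
      TensorProduct.map Q.Sinv LinearMap.id (TensorProduct.map Q.S LinearMap.id Y) = Y := fun Y => by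
    induction Y with
    | zero => simp only [LinearMap.map_zero, LinearMap.zero_apply, mul_zero, zero_mul,
          TensorProduct.zero_tmul, TensorProduct.tmul_zero]
    | add s t hs ht => simp only [LinearMap.map_add, hs, ht]
    | tmul a b => simp [Sinv_S]
  rw [← e Y, h, e]

variable {Q D} in
theorem collapse_pre {A X : Type*} [Ring A] [Algebra k A] [AddCommGroup X] [Module k X]
    (hD : OpYD Q D) (F : A →ₗ[k] X) (a u v b d : H →ₗ[k] A) (e : Module.End k B →ₗ[k] A)
    [Str a] [Str u] [Str v] [Str b] [Str d] [Str e] [Cm a u] [Cm a v] [Cm a b] [Cm a d] [Cm a e]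
    [Cm u v] [Cm u b] [Cm u d] [Cm u e] [Cm v b] [Cm v d] [Cm v e] [Cm b d] [Cm b e] [Cm d e]
    (huv : LCol F (conv Q u v) (triv Q A)) (hmd : LCol F (conv Q (e ∘ₗ aop D) d) (triv Q A))
    (hvm : RCol F (conv Q v (e ∘ₗ aop D)) (triv Q A)) :
    F (ael Q a u v b * (pre Q D b d e * ph Q v (e ∘ₗ aop D) (conv Q b d))) =
      F (pre Q D b d e * ph Q a (e ∘ₗ aop D) (conv Q b d) * phi Q u v (e ∘ₗ aop D)) := by
  have hp := hD.ps_pre b d e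
  have hb : LCol F b (conv Q b (conv Q (e ∘ₗ aop D) d)) := fun h t => by
    rw [LCol.rfl.conv Q hmd, conv_triv]
  rw [collapse_ael F a u v b _ (conv Q b d) (e ∘ₗ aop D) (pre Q D b d e) hb huv hvm, mul_assoc]

variable {Q} in
theorem map_pre_ph {A A' : Type*} [Ring A] [Algebra k A] [Ring A'] [Algebra k A']
    (χ : A →ₗ[k] A') [Str χ] (b d v : H →ₗ[k] A) (e : Module.End k B →ₗ[k] A) :
    χ (pre Q D b d e * ph Q v (e ∘ₗ aop D) (conv Q b d)) =
      pre Q D (χ ∘ₗ b) (χ ∘ₗ d) (χ ∘ₗ e) *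
        ph Q (χ ∘ₗ v) ((χ ∘ₗ e) ∘ₗ aop D) (conv Q (χ ∘ₗ b) (χ ∘ₗ d)) := by
  rw [Str.map_mul, map_pre, map_ph, comp_conv, LinearMap.comp_assoc]

variable {Q D} in
theorem closeA_pre (hD : OpYD Q D) : closeA Q D (pre Q D (cAb k H B) (cAd k H B) (cAe k H B) *
      ph Q (cAa k H B) (cAe k H B ∘ₗ aop D) (conv Q (cAb k H B) (cAd k H B))) =
    TensorProduct.map Q.S LinearMap.id
      (theta Q D * m2 (sL k H _) (sR H (aop D)) (flipMap Q.Sinv Q.gamma)) := by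
  have h1 := collapse_pre (A := ArgB k H B) hD (closeB Q D) (sL k (ArgA k H B) (H ⊗[k] H) ∘ₗ cAa k H B) (cBu k H B)
    (cBv k H B) (sL k (ArgA k H B) (H ⊗[k] H) ∘ₗ cAb k H B)
    (sL k (ArgA k H B) (H ⊗[k] H) ∘ₗ cAd k H B) (sL k (ArgA k H B) (H ⊗[k] H) ∘ₗ cAe k H B)
    (closeB_lcol_uv Q D) (closeB_lcol_md Q D) (closeB_rcol_vm Q D)
  rw [← map_pre_ph, closeB_mul_phi, ael_eq] at h1
  rw [theta, map_S_close4_gamma, ← h1, map_pre_ph]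
  rfl

variable {Q D} in
theorem theta_gamma (hD : OpYD Q D) :
    theta Q D * m2 (sL k H _) (sR H (aop D)) (flipMap Q.Sinv Q.gamma) * lop D =
      m2 (sR H (aop D)) (sL k H _) (flipMap Q.Sinv Q.gamma) := by
  apply map_S_injective Q
  rw [← closeA_mul_m2 Q D (closeA_pre hD), mul_assoc, map_S_gamma, ← ael_eq]
  exact collapse_hex (A := ArgA k H B) hD (closeA Q D) (cAa k H B) (cAb k H B) (cAd k H B) (cAe k H B)
    (closeA_lcol_ab Q D) (closeA_lcol_md Q D)

end RightComparison

open Module (Dual)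

section RightComparison

variable {k H B : Type*} [Field k] [Ring H] [Algebra k H]
  (Q : QuasiHopfAlgebra k H) [AddCommGroup B] [Module k B] [Module.Finite k B]
  (D : YDData k H B)

attribute [local instance] Cm.symm

theorem close3_mul (s : H ⊗[k] (H ⊗[k] Module.End k B)) (x : Module.End k B) :
    close3 Q D (s * (1 ⊗ₜ (1 ⊗ₜ x))) = close3 Q D s * (1 ⊗ₜ x) := by
  induction s using ind3 with
  | h0 => simp only [LinearMap.map_zero, LinearMap.zero_apply, mul_zero, zero_mul,
        TensorProduct.zero_tmul, TensorProduct.tmul_zero]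
  | ha s t hs ht => simp only [LinearMap.map_add, add_mul, hs, ht]
  | h a b c => simp [mul_assoc]

theorem theta_eq : theta Q D = close3 Q D (ph Q (sL k H _) (sR H (sR H (aop D))) (sR H (sL k H _)) *
    (rr D (sL k H _) (sR H (sR H LinearMap.id)) *
      m2 (sR H (sR H (aop D))) (m2 (sL k H (H ⊗[k] Module.End k B)) (sR H (sL k H _)))
        (Q.PhiInv * Q.idComul Q.pL))) := by
  have key : ∀ (s : H ⊗[k] (H ⊗[k] Module.End k B)) (t : H ⊗[k] (H ⊗[k] H)),
      close4 Q D (sL k _ _ s * m2 c4v (m2 (c4e ∘ₗ aop D) (conv Q c4b c4d)) t) =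
      close3 Q D (s * m2 (sR H (sR H (aop D))) (m2 (sL k H (H ⊗[k] Module.End k B))
        (sR H (sL k H _))) (Q.idComul (sw3 (fun a b c => (b * Q.Sinv (a * Q.beta)) ⊗ₜ[k] c)
    (by constructor <;> intros <;> constructor <;> intros <;>
      simp [add_mul, mul_add, TensorProduct.add_tmul, TensorProduct.tmul_add,
        TensorProduct.smul_tmul']) t))) := fun s t => by
    rw [m2_idComul]
    induction t using ind3 with
    | h0 => simp only [LinearMap.map_zero, LinearMap.zero_apply, mul_zero, zero_mul,
          TensorProduct.zero_tmul, TensorProduct.tmul_zero]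
    | ha s t hs ht => simp only [LinearMap.map_add, mul_add, hs, ht]
    | h x y z =>
      rw [sw3_tmul]
      simp only [m2_tmul, conv, LinearMap.comp_apply]
      generalize Q.comul.toLinearMap z = w
      induction w with
      | zero => simp only [LinearMap.map_zero, LinearMap.zero_apply, mul_zero, zero_mul,
            TensorProduct.zero_tmul, TensorProduct.tmul_zero]
      | add s t hs ht => simp only [LinearMap.map_add, mul_add, hs, ht]
      | tmul p q =>
        have h1 := close3_mul Q D (s * (p ⊗ₜ (q ⊗ₜ D.act y))) (D.act (Q.Sinv (x * Q.beta)))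
        simpa [mul_assoc] using h1.symm
  have hm : Str (m2 (sR H (sR H (aop D))) (m2 (sL k H (H ⊗[k] Module.End k B))
    (sR H (sL k H (Module.End k B))))) := inferInstance
  rw [hm.map_mul, QuasiHopfAlgebra.pL, theta, ph, ← map_pre, key, pre]
  simp only [mul_assoc]
  rfl

theorem kappaRight_eq : kappaRight Q D = m2 (eL k B B ∘ₗ aop D) (eR B LinearMap.id)
    (theta Q D * m2 (sL k H _) (sR H (aop D)) (flipMap Q.Sinv Q.f)) := by
  rw [kappaRight, theta_eq, ph]
  generalize Q.f = F
  induction F with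
  | zero => simp only [LinearMap.map_zero, LinearMap.zero_apply, mul_zero, zero_mul,
        TensorProduct.zero_tmul, TensorProduct.tmul_zero]
  | add s t hs ht => simp only [LinearMap.map_add, mul_add, hs, ht]
  | tmul f₁ f₂ =>
  rw [sw2_tmul, QuasiHopfAlgebra.qR]
  generalize Q.Phi = p
  induction p using ind3 with
  | h0 => simp only [LinearMap.map_zero, LinearMap.zero_apply, mul_zero, zero_mul,
        TensorProduct.zero_tmul, TensorProduct.tmul_zero]
  | ha s t hs ht => simp only [LinearMap.map_add, add_mul, hs, ht]
  | h a b c =>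
  rw [sw3_tmul, sw2_tmul]
  generalize Q.PhiInv * Q.idComul Q.pL = t
  induction t using ind3 with
  | h0 => simp only [LinearMap.map_zero, LinearMap.zero_apply, mul_zero, zero_mul,
        TensorProduct.zero_tmul, TensorProduct.tmul_zero]
  | ha s t hs ht => simp only [LinearMap.map_add, add_mul, mul_add, hs, ht]
  | h x y z =>
  rw [sw3_tmul, crossMap_eq, rr, rr]
  generalize lop D = X
  induction X with
  | zero => simp only [LinearMap.map_zero, LinearMap.zero_apply, mul_zero, zero_mul,
        TensorProduct.zero_tmul, TensorProduct.tmul_zero]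
  | add s t hs ht => simp only [LinearMap.map_add, add_mul, mul_add, hs, ht]
  | tmul h y =>
  refine TensorProduct.ext' fun m n => ?_
  simp [mul_assoc]

variable {Q D} in
theorem theta_mul_lop (hD : OpYD Q D) :
    theta Q D * m2 (sL k H _) (sR H (aop D)) Q.fOpInv * lop D =
      m2 (sR H (aop D)) (sL k H _) Q.fOpInv := by
  have hT := isTwist_fOpInv Q
  have hf : ∀ (u v : H →ₗ[k] H ⊗[k] Module.End k B) [Str u] [Str v] [Cm u v] (h : H),
      m2 u v Q.fOpInv * conv Q u v (Q.Sinv h) =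
        m2 u v (flipMap Q.Sinv (Q.comul h)) * m2 u v Q.fOpInv := fun u v _ _ _ h => by
    change m2 u v Q.fOpInv * m2 u v (Q.comul (Q.Sinv h)) = _
    rw [← Str.map_mul, ← hT.intertwine, Str.map_mul]
  have hg : ∀ (u v : H →ₗ[k] H ⊗[k] Module.End k B) [Str u] [Str v] [Cm u v],
      m2 u v Q.fOpInv * conv Q u v (Q.Sinv Q.alpha) = m2 u v (flipMap Q.Sinv Q.gamma) :=
    fun u v _ _ _ => by
      rw [hf, ← Str.map_mul]
      congr 1
      rw [← f_mul_alpha, flipMap_mul]; rfl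
  have hx : ∀ y, theta Q D * m2 (sL k H _) (sR H (aop D)) Q.fOpInv * lop D *
      conv Q (sR H (aop D)) (sL k H _) y =
      theta Q D * (m2 (sL k H _) (sR H (aop D)) Q.fOpInv * conv Q (sL k H _) (sR H (aop D)) y) *
        lop D := fun y => by
    rw [mul_assoc, hD.compat]; simp only [mul_assoc]
  refine eq_of_mul_alpha (conv Q (sR H (aop D)) (sL k H _))
    (W := fun h => m2 (sR H (aop D)) (sL k H _) (flipMap Q.Sinv (Q.comul h)))
    (fun h => ?_) (fun h => hf _ _ h) ?_
  · rw [hx, hf, ← mul_assoc, theta_mul_flip hD]; simp only [mul_assoc]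
  · rw [hx, hg, hg, theta_gamma hD]

variable {Q D} in
theorem kappaRight_eq_Kop (hD : OpYD Q D) : kappaRight Q D = Kop Q Q.fOpInv (aop D) D := by
  have i := inv2_ri (eL k B B ∘ₗ aop D) (eR B LinearMap.id) hD
  have h1 := congrArg (m2 (eL k B B ∘ₗ aop D) (eR B LinearMap.id)) (theta_mul_lop hD)
  rw [Str.map_mul] at h1
  have h2 : kappaRight Q D = m2 (eL k B B ∘ₗ aop D) (eR B LinearMap.id)
    (theta Q D * m2 (sL k H _) (sR H (aop D)) Q.fOpInv) := kappaRight_eq Q D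
  rw [← h2, map_m2, m2_comp_sL] at h1
  have h3 : m2 (eL k B B ∘ₗ aop D) (eR B LinearMap.id) ∘ₗ sR H (aop D) = eR B (aop D) :=
    m2_comp_sR _ _ _
  rw [h3] at h1
  have h4 : Kop Q Q.fOpInv (aop D) D = m2 (eR B (aop D)) (eL k B B ∘ₗ aop D) Q.fOpInv *
      ri Q D (eL k B B ∘ₗ aop D) (eR B LinearMap.id) := by
    rw [Kop, cmp, eR_id_comp]
  rw [h4, ← h1]
  change _ = kappaRight Q D * rr D _ _ * _
  rw [mul_assoc, i.mul, mul_one]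

end RightComparison

open Module (Dual)

section Gamma

variable {k H : Type*} [Field k] [Ring H] [Algebra k H] (Q : QuasiHopfAlgebra k H)

attribute [local instance] Cm.symm

theorem gamma_eq' : Q.gamma = TensorProduct.map (capS Q) (capS Q)
    (phi Q (st11 k H) (st12 k H) (st22 k H) *
      ph Q (st21 k H) (st11 k H) (conv Q (st12 k H) (st22 k H))) := by
  have hl : LCol (TensorProduct.map (capS Q) (capS Q)) (conv Q (st11 k H) (st12 k H))
      (triv Q _) := by
    have := (capS_lcol Q).map_left (B := H ⊗[k] H) (capS Q)
    rwa [← conv_sL, triv_sL] at this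
  rw [pentagon_phi_ph, LCol.ph Q LCol.rfl hl LCol.rfl, ph_triv_mid, one_mul, gamma_eq]
  rfl

end Gamma

section Coevaluation

variable {k H W Z ι : Type*} [Field k] [Ring H] [Algebra k H] (Q : QuasiHopfAlgebra k H)
  [AddCommGroup W] [Module k W] [AddCommGroup Z] [Module k Z] [Fintype ι]
  (σ : H →ₐ[k] Module.End k W) (π : H →ₐ[k] Module.End k Z) (E : Module.Basis ι k Z)

theorem lid_rTensor_coev (P : W ⊗[k] Z →ₗ[k] k) (w : W) (z : Z) :
    TensorProduct.lid k _ (P.rTensor _ (assocInv Q σ π (leftDualAct Q π) (w ⊗ₜ coev Q π E))) z =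
      P (tensAct σ π Q.pR (w ⊗ₜ z)) := by
  rw [assocInv, QuasiHopfAlgebra.pR]
  generalize Q.PhiInv = t
  induction t using ind3 with
  | h0 => simp
  | ha s t hs ht => simp only [map_add, LinearMap.add_apply, LinearMap.comp_add, hs, ht]
  | h a b c =>
    rw [sw3_tmul]
    have h2 : ∀ v, P (σ a w ⊗ₜ π (b * Q.beta) v) =
        ∑ i, E.coord i v * P (σ a w ⊗ₜ π (b * Q.beta) (E i)) := fun v => by
      conv_lhs => rw [← E.sum_repr v]
      simp only [map_sum, map_smul, TensorProduct.tmul_sum, TensorProduct.tmul_smul, smul_eq_mul]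
      rfl
    have h3 := h2 (π (Q.S c) z)
    rw [← Module.End.mul_apply, ← map_mul] at h3
    rw [tensAct_tmul, h3, coev]
    simp only [TensorProduct.tmul_sum, map_sum, LinearMap.sum_apply, LinearMap.comp_apply,
      tensAct_tmul]
    refine Finset.sum_congr rfl fun i _ => ?_
    simp only [LinearEquiv.coe_coe, TensorProduct.assoc_symm_tmul, LinearMap.rTensor_tmul,
      TensorProduct.lid_tmul, map_mul, Module.End.mul_apply, LinearMap.smul_apply, smul_eq_mul]
    rw [mul_comm]
    rfl

theorem rid_lTensor_coev (P : Z ⊗[k] W →ₗ[k] k) (w : W) (z : Z) :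
    TensorProduct.rid k _ (P.lTensor _ (assocMap Q (rightDualAct Q π) π σ (coev' Q π E ⊗ₜ w))) z =
      P (tensAct π σ Q.pL (z ⊗ₜ w)) := by
  rw [assocMap, QuasiHopfAlgebra.pL]
  generalize Q.Phi = t
  induction t using ind3 with
  | h0 => simp
  | ha s t hs ht => simp only [map_add, LinearMap.add_apply, LinearMap.add_comp, hs, ht]
  | h a b c =>
    rw [sw3_tmul]
    have h2 : ∀ v, P (π (b * Q.Sinv Q.beta) v ⊗ₜ σ c w) =
        ∑ i, E.coord i v * P (π (b * Q.Sinv Q.beta) (E i) ⊗ₜ σ c w) := fun v => by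
      conv_lhs => rw [← E.sum_repr v]
      simp only [map_sum, map_smul, TensorProduct.sum_tmul, ← TensorProduct.smul_tmul', smul_eq_mul]
      rfl
    have h3 := h2 (π (Q.Sinv a) z)
    rw [← Module.End.mul_apply, ← map_mul, mul_assoc, ← Q.Sinv_mul] at h3
    rw [tensAct_tmul, h3, coev']
    simp only [TensorProduct.sum_tmul, map_sum, LinearMap.sum_apply, LinearMap.comp_apply,
      tensAct_tmul]
    refine Finset.sum_congr rfl fun i _ => ?_
    simp only [LinearEquiv.coe_coe, TensorProduct.assoc_tmul, LinearMap.lTensor_tmul, tensAct_tmul,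
      TensorProduct.rid_tmul, map_mul, Module.End.mul_apply, LinearMap.smul_apply, smul_eq_mul]
    rw [mul_comm]
    rfl

end Coevaluation

section Functionals

variable {k H M N : Type*} [Field k] [Ring H] [Algebra k H] (Q : QuasiHopfAlgebra k H)
  [AddCommGroup M] [Module k M] [AddCommGroup N] [Module k N]
  (ρ : H →ₐ[k] Module.End k M) (τ : H →ₐ[k] Module.End k N)
  {ι κ : Type*} [Fintype ι] [Fintype κ]
  (e : Module.Basis ι k M) (e' : Module.Basis κ k N)

/-- `(n* ⊗ m*) ⊗ (m ⊗ n) ↦ ev (n* ⊗ ev (m* ⊗ m) n)`, with the associativity constraints. -/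
noncomputable def evPair : (Dual k N ⊗[k] Dual k M) ⊗[k] (M ⊗[k] N) →ₗ[k] k :=
  ev Q τ ∘ₗ
  ((TensorProduct.lid k N).toLinearMap ∘ₗ (ev Q ρ).rTensor N).lTensor (Module.Dual k N) ∘ₗ
  (assocInv Q (leftDualAct Q ρ) ρ τ).lTensor (Module.Dual k N) ∘ₗ
  assocMap Q (leftDualAct Q τ) (leftDualAct Q ρ) (prodAct Q ρ τ)

theorem phiLeft_apply (w : Dual k N ⊗[k] Dual k M) (z : M ⊗[k] N) :
    phiLeft Q ρ τ e e' w z = evPair Q ρ τ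
      (tensAct (prodAct Q (leftDualAct Q τ) (leftDualAct Q ρ)) (prodAct Q ρ τ) Q.pR (w ⊗ₜ z)) := by
  have h1 : phiLeft Q ρ τ e e' w = TensorProduct.lid k _ ((evPair Q ρ τ).rTensor _
      (assocInv Q (prodAct Q (leftDualAct Q τ) (leftDualAct Q ρ)) (prodAct Q ρ τ)
        (leftDualAct Q (prodAct Q ρ τ)) (w ⊗ₜ coev Q (prodAct Q ρ τ) (e.tensorProduct e')))) := by
    simp only [phiLeft, evPair, LinearMap.rTensor_comp, LinearMap.comp_apply]
    rfl
  rw [h1, lid_rTensor_coev]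

theorem evPair_apply (a : Dual k N) (b : Dual k M) (z : M ⊗[k] N) : evPair Q ρ τ ((a ⊗ₜ b) ⊗ₜ z) =
    TensorProduct.dualDistrib k M N (b ⊗ₜ a) (tensAct ρ τ Q.gamma z) := by
  rw [gamma_eq', evPair, assocInv, assocMap, phi, ph]
  generalize Q.PhiInv = r
  generalize Q.Phi = q
  induction q using ind3 with
  | h0 => simp
  | ha s t hs ht =>
    simp only [map_add, mul_add, LinearMap.add_apply, LinearMap.comp_add, LinearMap.add_comp] at *
    rw [hs, ht]
  | h x y v =>
  induction r using ind3 with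
  | h0 => simp
  | ha s t hs ht =>
    simp only [map_add, add_mul, LinearMap.add_apply, LinearMap.comp_add, LinearMap.add_comp,
      LinearMap.lTensor_add] at *
    rw [hs, ht]
  | h p s t =>
  simp only [LinearMap.comp_apply, LinearEquiv.coe_coe, TensorProduct.assoc_tmul, tensAct_tmul,
    m2_tmul, conv, prodAct, AlgHom.comp_apply, AlgHom.toLinearMap_apply]
  generalize Q.comul v = w
  induction w with
  | zero => simp
  | add s t hs ht =>
    simp only [map_add, mul_add, LinearMap.add_apply, TensorProduct.tmul_add] at *
    rw [hs, ht]
  | tmul c d =>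
  induction z with
  | zero => simp only [LinearMap.map_zero, LinearMap.zero_apply, mul_zero, zero_mul,
        TensorProduct.zero_tmul, TensorProduct.tmul_zero]
  | add s t hs ht => simp only [LinearMap.map_add, TensorProduct.tmul_add, hs, ht]
  | tmul m n =>
    simp [tensAct_tmul, ev, leftDualAct, dualAct, Module.Dual.transpose_apply, mul_assoc]

theorem phiLeft_tmul (a : Dual k N) (b : Dual k M) (z : M ⊗[k] N) :
    phiLeft Q ρ τ e e' (a ⊗ₜ b) z =
      TensorProduct.dualDistrib k M N (b ⊗ₜ a) (tensAct ρ τ Q.f z) := by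
  have key : ∀ (w : H ⊗[k] H) (z : M ⊗[k] N),
      evPair Q ρ τ (tensAct (leftDualAct Q τ) (leftDualAct Q ρ) w (a ⊗ₜ b) ⊗ₜ z) =
      TensorProduct.dualDistrib k M N (b ⊗ₜ a)
        (tensAct ρ τ (flipMap Q.S w) (tensAct ρ τ Q.gamma z)) := fun w z => by
    induction w with
    | zero => simp
    | add s t hs ht => simp only [map_add, LinearMap.add_apply, TensorProduct.add_tmul, hs, ht]
    | tmul c d =>
      rw [tensAct_tmul, evPair_apply]
      generalize tensAct ρ τ Q.gamma z = z'
      induction z' with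
      | zero => simp only [LinearMap.map_zero, LinearMap.zero_apply, mul_zero, zero_mul,
            TensorProduct.zero_tmul, TensorProduct.tmul_zero]
      | add s t hs ht => simp only [LinearMap.map_add, hs, ht]
      | tmul m n => simp [tensAct_tmul, leftDualAct, dualAct, Module.Dual.transpose_apply]
  rw [phiLeft_apply, QuasiHopfAlgebra.pR, QuasiHopfAlgebra.f]
  generalize Q.PhiInv = t
  induction t using ind3 with
  | h0 => simp
  | ha s t hs ht => simp only [map_add, LinearMap.add_apply, hs, ht]
  | h x y v =>
    rw [sw3_tmul, sw3_tmul, tensAct_tmul, map_mul (tensAct ρ τ), map_mul (tensAct ρ τ)]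
    exact key _ _

/-- `(m ⊗ n) ⊗ (n* ⊗ m*) ↦ ev' (m ⊗ ev' (n ⊗ n*) m*)`, with the associativity constraints. -/
noncomputable def evPair' : (M ⊗[k] N) ⊗[k] (Dual k N ⊗[k] Dual k M) →ₗ[k] k :=
  ev' Q ρ ∘ₗ
  ((TensorProduct.lid k (Dual k M)).toLinearMap ∘ₗ (ev' Q τ).rTensor (Dual k M)).lTensor M ∘ₗ
  (assocInv Q τ (rightDualAct Q τ) (rightDualAct Q ρ)).lTensor M ∘ₗ
  assocMap Q ρ τ (prodAct Q (rightDualAct Q τ) (rightDualAct Q ρ))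

theorem phiRight_apply (w : Dual k N ⊗[k] Dual k M) (z : M ⊗[k] N) :
    phiRight Q ρ τ e e' w z = evPair' Q ρ τ
      (tensAct (prodAct Q ρ τ) (prodAct Q (rightDualAct Q τ) (rightDualAct Q ρ)) Q.pL (z ⊗ₜ w)) := by
  have h1 : phiRight Q ρ τ e e' w = TensorProduct.rid k _ ((evPair' Q ρ τ).lTensor _
      (assocMap Q (rightDualAct Q (prodAct Q ρ τ)) (prodAct Q ρ τ)
        (prodAct Q (rightDualAct Q τ) (rightDualAct Q ρ))
        (coev' Q (prodAct Q ρ τ) (e.tensorProduct e') ⊗ₜ w))) := by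
    simp only [phiRight, evPair', LinearMap.lTensor_comp, LinearMap.comp_apply]
    rfl
  rw [h1, rid_lTensor_coev]

theorem evPair'_apply (a : Dual k N) (b : Dual k M) (z : M ⊗[k] N) :
    evPair' Q ρ τ (z ⊗ₜ (a ⊗ₜ b)) =
      TensorProduct.dualDistrib k M N (b ⊗ₜ a) (tensAct ρ τ (flipMap Q.Sinv Q.gamma) z) := by
  rw [gamma_eq', evPair', assocInv, assocMap, phi, ph]
  generalize Q.PhiInv = r
  generalize Q.Phi = q
  induction q using ind3 with
  | h0 => simp
  | ha s t hs ht =>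
    simp only [map_add, mul_add, LinearMap.add_apply, LinearMap.comp_add, LinearMap.add_comp] at *
    rw [hs, ht]
  | h x y v =>
  induction r using ind3 with
  | h0 => simp
  | ha s t hs ht =>
    simp only [map_add, add_mul, LinearMap.add_apply, LinearMap.comp_add, LinearMap.add_comp,
      LinearMap.lTensor_add] at *
    rw [hs, ht]
  | h p s t =>
  induction z with
  | zero => simp only [LinearMap.map_zero, LinearMap.zero_apply, mul_zero, zero_mul,
        TensorProduct.zero_tmul, TensorProduct.tmul_zero]
  | add s t hs ht => simp only [LinearMap.map_add, TensorProduct.add_tmul, hs, ht]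
  | tmul m n =>
  simp only [LinearMap.comp_apply, LinearEquiv.coe_coe, TensorProduct.assoc_tmul, tensAct_tmul,
    m2_tmul, conv, prodAct, AlgHom.comp_apply, AlgHom.toLinearMap_apply]
  generalize Q.comul v = w
  induction w with
  | zero => simp
  | add s t hs ht =>
    simp only [map_add, mul_add, LinearMap.add_apply, TensorProduct.tmul_add] at *
    rw [hs, ht]
  | tmul c d =>
    simp [tensAct_tmul, ev', rightDualAct, dualAct, Module.Dual.transpose_apply, mul_assoc, Sinv_S]
    rw [mul_comm]

theorem fOpInv_eq (t : H ⊗[k] (H ⊗[k] H)) :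
    sw3 (fun a b c => flipMap Q.Sinv (Q.comul c) * flipMap Q.Sinv Q.gamma *
      Q.comul (b * Q.Sinv (a * Q.beta)))
      (by constructor <;> intros <;> constructor <;> intros <;> simp [add_mul, mul_add]) t =
    Q.fOpInv * Q.comul (Q.Sinv (zagR Q t)) := by
  have hT := isTwist_fOpInv Q
  have hg : flipMap Q.Sinv Q.gamma = Q.fOpInv * Q.comul (Q.Sinv Q.alpha) := by
    rw [← hT.intertwine, ← f_mul_alpha, flipMap_mul]; rfl
  induction t using ind3 with
  | h0 => simp
  | ha s t hs ht => simp only [map_add, mul_add, hs, ht]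
  | h a b c =>
    rw [sw3_tmul, hg, ← mul_assoc, hT.intertwine, zagR_tmul]
    simp [mul_assoc, Sinv_S]

theorem phiRight_tmul (a : Dual k N) (b : Dual k M) (z : M ⊗[k] N) :
    phiRight Q ρ τ e e' (a ⊗ₜ b) z =
      TensorProduct.dualDistrib k M N (b ⊗ₜ a) (tensAct ρ τ Q.fOpInv z) := by
  have key : ∀ (w : H ⊗[k] H) (z : M ⊗[k] N),
      evPair' Q ρ τ (z ⊗ₜ tensAct (rightDualAct Q τ) (rightDualAct Q ρ) w (a ⊗ₜ b)) =
      TensorProduct.dualDistrib k M N (b ⊗ₜ a)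
        (tensAct ρ τ (flipMap Q.Sinv w) (tensAct ρ τ (flipMap Q.Sinv Q.gamma) z)) := fun w z => by
    induction w with
    | zero => simp
    | add s t hs ht => simp only [map_add, LinearMap.add_apply, TensorProduct.tmul_add, hs, ht]
    | tmul c d =>
      rw [tensAct_tmul, evPair'_apply]
      generalize tensAct ρ τ (flipMap Q.Sinv Q.gamma) z = z'
      induction z' with
      | zero => simp only [LinearMap.map_zero, LinearMap.zero_apply, mul_zero, zero_mul,
            TensorProduct.zero_tmul, TensorProduct.tmul_zero]
      | add s t hs ht => simp only [LinearMap.map_add, hs, ht]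
      | tmul m n => simp [tensAct_tmul, rightDualAct, dualAct, Module.Dual.transpose_apply]
  have h1 := fOpInv_eq Q Q.Phi
  rw [zagR_Phi, Q.Sinv_one, map_one, mul_one] at h1
  rw [phiRight_apply, QuasiHopfAlgebra.pL, ← h1]
  generalize Q.Phi = t
  induction t using ind3 with
  | h0 => simp
  | ha s t hs ht => simp only [map_add, LinearMap.add_apply, hs, ht]
  | h x y v =>
    rw [sw3_tmul, sw3_tmul, tensAct_tmul, map_mul (tensAct ρ τ), map_mul (tensAct ρ τ)]
    exact key _ _

end Functionals

section DualHopf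

variable {k H B ι : Type*} [Field k] [Ring H] [Algebra k H] (Q : QuasiHopfAlgebra k H)
  [AddCommGroup B] [Module k B] [Module.Finite k B] [Fintype ι] (e : Module.Basis ι k B)

theorem flipAct_dualMap (D : YDData k H B) (F : H ⊗[k] H) (a b : Dual k B) (z : B ⊗[k] B) :
    ((flipAct F D).dualMap ∘ₗ (ddd k B).toLinearMap) (a ⊗ₜ b) z =
      TensorProduct.dualDistrib k B B (b ⊗ₜ a) (tensAct D.act D.act F z) := by
  rw [LinearMap.comp_apply, LinearMap.dualMap_apply, LinearEquiv.coe_coe, ddd_apply, flipAct,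
    tensAct_eq, LinearMap.comp_apply]
  generalize m2 (eL k B B ∘ₗ aop D) (eR B (aop D)) F z = y
  induction y with
  | zero => simp only [LinearMap.map_zero, LinearMap.zero_apply, mul_zero, zero_mul,
        TensorProduct.zero_tmul, TensorProduct.tmul_zero]
  | add s t hs ht => simp only [LinearMap.map_add, hs, ht]
  | tmul m n => simp [mul_comm]

theorem phiLeft_eq (D : YDData k H B) : phiLeft Q D.act D.act e e =
    (flipAct Q.f D).dualMap ∘ₗ (ddd k B).toLinearMap :=
  TensorProduct.ext' fun a b => LinearMap.ext fun z => by
    rw [phiLeft_tmul, flipAct_dualMap]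

theorem phiRight_eq (D : YDData k H B) : phiRight Q D.act D.act e e =
    (flipAct Q.fOpInv D).dualMap ∘ₗ (ddd k B).toLinearMap :=
  TensorProduct.ext' fun a b => LinearMap.ext fun z => by
    rw [phiRight_tmul, flipAct_dualMap]

theorem leftDualHopf_eq (D : BraidedHopfData k H B) :
    leftDualHopf Q e D = twHopf (isTwist_f Q) e D := by
  have h1 := twHopf_comul (isTwist_f Q) e (D := D)
  rw [leftDualHopf, ← h1, kappaLeft_eq_Kop]
  rfl

theorem rightDualHopf_eq (D : BraidedHopfData k H B) (hD : OpYD Q D.toYDData) :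
    rightDualHopf Q e D = twHopf (isTwist_fOpInv Q) e D := by
  have h1 := twHopf_comul (isTwist_fOpInv Q) e (D := D)
  rw [rightDualHopf, ← h1, kappaRight_eq_Kop hD]
  rfl

end DualHopf

end QuasiHopf

open QuasiHopf in
theorem proposition5p1 {k H B ι : Type*} [Field k] [Ring H] [Algebra k H]
    [AddCommGroup B] [Module k B] [Fintype ι]
    (Q : QuasiHopfAlgebra k H) (D : BraidedHopfData k H B) (hD : IsBraidedHopf Q D)
    (e : Module.Basis ι k B) :
    (IsBraidedHopf Q (leftDualHopf Q e D) ∧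
      ∃ c : Module.Dual k B ⊗[k] Module.Dual k B ≃ₗ[k] Module.Dual k B ⊗[k] Module.Dual k B,
      ∃ σ : Module.Dual k B ⊗[k] Module.Dual k B ≃ₗ[k] Module.Dual k (B ⊗[k] B),
        c.toLinearMap = braiding (leftDualYD Q e D.toYDData) (leftDualYD Q e D.toYDData) ∧
        σ.toLinearMap = phiLeft Q D.act D.act e e ∘ₗ c.symm.toLinearMap ∧
        (leftDualHopf Q e D).mul = D.comul.dualMap ∘ₗ σ.toLinearMap ∧
        (leftDualHopf Q e D).comul = σ.symm.toLinearMap ∘ₗ D.mul.dualMap) ∧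
    (IsBraidedHopf Q (rightDualHopf Q e D) ∧
      ∃ c : Module.Dual k B ⊗[k] Module.Dual k B ≃ₗ[k] Module.Dual k B ⊗[k] Module.Dual k B,
      ∃ σ : Module.Dual k B ⊗[k] Module.Dual k B ≃ₗ[k] Module.Dual k (B ⊗[k] B),
        c.toLinearMap = braiding (rightDualYD Q e D.toYDData) (rightDualYD Q e D.toYDData) ∧
        σ.toLinearMap = phiRight Q D.act D.act e e ∘ₗ c.symm.toLinearMap ∧
        (rightDualHopf Q e D).mul = D.comul.dualMap ∘ₗ σ.toLinearMap ∧
        (rightDualHopf Q e D).comul = σ.symm.toLinearMap ∘ₗ D.mul.dualMap) := by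
  have := Module.Finite.of_basis e
  have hV := hD.opYD
  rw [leftDualHopf_eq, rightDualHopf_eq Q e D hV, phiLeft_eq Q e D.toYDData,
    phiRight_eq Q e D.toYDData]
  exact ⟨⟨twHopf_isBraidedHopf _ e hD, twHopf_transposes _ e hV⟩,
    twHopf_isBraidedHopf _ e hD, twHopf_transposes _ e hV⟩
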